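/- **Setting.** Let $k$ be a field and $p\in k[x]$ a polynomial with $p(0)=0$. A ($\mathbb Z$-graded) matrix factorization (MF) over a commutative ring $S$ with potential $\varphi\in S$ is a $\mathbb Z$-graded $S$-module $M$ with $d=d_++d_-$, $d_\pm$ of degree $\pm1$, $d^2=\varphi$; morphisms commute with $d$ and preserve the grading modulo $2$. For $x,y\in S$ let $\tilde Z_{x,y}$ be the MF $S\rightleftarrows S$ with $d_+=x$ (from degree $-1$ to degree $0$), $d_-=y$; Koszul MFs are tensor products of these. For an MF $M$ with $M^i=0$ for $i>0$ put $\mathcal H(M)=H^0(M,d_+)$, an MF concentrated in degree $0$, with the projection $\pi:M\to\mathcal H(M)$. A morphism $f:M\to M'$ of MFs with potential $\varphi$ is a *near-isomorphism* if for every MF $D$ on a projective $S$-module with potential $-\varphi$ the map $H^t(M\otimes D)\to H^t(M'\otimes D)$ on total homology is an isomorphism; for complexes of MFs this is required in every homological degree. **Diagrams.** An oriented tangle diagram $T$ is given by its oriented graph, with signed $4$-valent crossings and univalent end points as vertices, and possibly crossingless closed components. (Only this combinatorial structure matters; planarity is not required.) $T$ is *acyclic* if its graph has no oriented cycle and there is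 no crossingless closed component. An oriented planar arc diagram $\eta$ with $m$ holes is a set of oriented arcs pairing the marked points on the outer boundary $X_0$ and on the boundaries $X_1,\dots,X_m$ of the holes; $\eta(T_1,\dots,T_m)$ is the diagram obtained by gluing $T_i$ into the $i$-th hole. **Complexes.** Let $\tilde S_T$ be the polynomial ring over $k$ with a variable for every flag (vertex with adjacent half-edge) of the graph of $T$ and one for a mark on every crossingless closed component, and $S_T\subseteq\tilde S_T$ the subring of the variables of the end points. For an edge $e$ with variables $t_h,t_t$ at its head and tail let $L_e=\tilde Z_{x,y}$ with $x=t_h-t_t$ and $y=\frac{p(t_h)-p(t_t)}{t_h-t_t}$; for a crossingless closed component use the same formula with $t_h=t_t$. For a crossing $c$ with outgoing flags $i,j$ and incoming flags $k,\ell$, whose strands run from $k$ to $i$ and from $\ell$ to $j$, let $L'_c$ and $L''_c$ be Koszul MFs with potential $p(t_i)+p(t_j)-p(t_k)-p(t_\ell)$ on the sequences $(t_i+t_j-t_k-t_\ell,\ t_it_j-t_kt_\ell)$ and $(t_i-t_\ell,\ t_j-t_k)$, and let $L_c$ be the complex $L'_c\to L''_c$ if $c$ is positive and $L''_c\to L'_c$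 if $c$ is negative, with $L''_c$ in homological degree $0$, where the maps are morphisms of $\mathbb Z$-graded MFs which induce on $\mathcal H$ the projection, respectively multiplication by $t_i-t_k$. (Such data exist; fix any choice, the same for all crossings.) Put $\mathcal R_p(T)=\bigotimes_eL_e\otimes\bigotimes_cL_c$, a complex of MFs over $\tilde S_T$, or over $S_T$, with potential $\varphi_T=\sum_b\pm p(t_b)$ (sum over the end points), and let $\mathcal N(T)=\mathcal H(\mathcal R_p(T))$, taken componentwise, with the projection $\pi_T:\mathcal R_p(T)\to\mathcal N(T)$. The arc diagram acts on complexes $M_i$ of MFs over $k[X_i]$ with potentials $\sum\pm p(t_x)$ by $\eta(\{M_i\})=\tilde Z_\eta\otimes_{k[X_1,\dots,X_m]}(M_1\otimes_k\dots\otimes_kM_m)$, regarded over $k[X_0]$, where $\tilde Z_\eta$ is the tensor product of the factorizations $L_\alpha$ of the arcs $\alpha$, given by the same formula as for edges. If $T$ is a link diagram (no end points), then $\varphi_T=0$, and $\mathcal K_p(T)=H^t(\mathcal R_p(T))$ is the complex of $k$-vector spaces, $\mathbb Z/2$-graded in each homological degree, formed by the total homologies of the MFs in $\mathcal R_p(T)$.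 **Corollary.** Let $T=\eta(T_1,\dots,T_m)$ be a tangle diagram that is factored as the action of an arc diagram $\eta$ on acyclic tangle diagrams $T_i$. Then there is a homotopy equivalence $f:\mathcal R_p(T)\to\eta(\{\mathcal R_p(T_i)\})$ of complexes of MFs over $S_T=k[X_0]$, which commutes with the action of the variables of all flags of $T$, such that the maps $$\eta(\{\pi_{T_i}\}):\eta(\{\mathcal R_p(T_i)\})\to\eta(\{\mathcal N(T_i)\}),\qquad \eta(\{\pi_{T_i}\})\circ f:\mathcal R_p(T)\to\eta(\{\mathcal N(T_i)\})$$ are near-isomorphisms. (The homotopy equivalence is through homotopies which preserve the homological degree and commute with the differential of the complexes.) If $T$ is a link diagram, then $\eta(\{\pi_{T_i}\})\circ f$ induces an isomorphism $$\mathcal K_p(T)\cong H^t\big(\eta(\{\mathcal N(T_i)\})\big)$$ of complexes of $k$-vector spaces, which respects the homological degree and the $\mathbb Z/2$-grading. -/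

import Mathlib

universe u

namespace KhR

open TensorProduct

section Grading
variable {R M ι : Type*} [CommRing R] [AddCommGroup M] [Module R M] [DecidableEq ι]

theorem isInternal_of_comp {A : ι → Submodule R M} (hsup : ⨆ i, A i = ⊤)
    (P : M →ₗ[R] (ι →₀ M)) (hP : ∀ i, ∀ x ∈ A i, P x = Finsupp.single i x) :
    DirectSum.IsInternal A := by
  refine ⟨?_, ?_⟩
  · rw [injective_iff_map_eq_zero]
    intro v hv
    have key : ∀ w : DirectSum ι fun i => A i, ∀ i,
        P (DirectSum.coeAddMonoidHom A w) i = (w i : M) := by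
      intro w i
      induction w using DirectSum.induction_on with
      | zero => simp
      | of j x =>
        rw [DirectSum.coeAddMonoidHom_of, hP j x x.2, DirectSum.coe_of_apply,
          Finsupp.single_apply]
        split_ifs <;> simp
      | add x y hx hy => simp [hx, hy]
    ext i
    rw [← key v i, hv]; simp
  · have : Function.Surjective (DirectSum.coeLinearMap A) :=
      LinearMap.range_eq_top.1 (by rw [DirectSum.range_coeLinearMap]; exact hsup)
    exact this

/-- The decomposition of an element into its homogeneous components. -/
noncomputable def comp (A : ι → Submodule R M) (h : DirectSum.IsInternal A) :
    M →ₗ[R] (ι →₀ M) :=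
  (DirectSum.toModule R ι (ι →₀ M) fun i => Finsupp.lsingle i ∘ₗ (A i).subtype) ∘ₗ
    ((LinearEquiv.ofBijective (DirectSum.coeLinearMap A) h).symm : M →ₗ[R] _)

theorem comp_of_mem {A : ι → Submodule R M} (h : DirectSum.IsInternal A) {i : ι} {x : M}
    (hx : x ∈ A i) : comp A h x = Finsupp.single i x := by
  have : (LinearEquiv.ofBijective (DirectSum.coeLinearMap A) h).symm x =
      DirectSum.lof R ι (fun i => A i) i ⟨x, hx⟩ := by
    rw [LinearEquiv.symm_apply_eq]
    exact (DirectSum.coeLinearMap_lof A i ⟨x, hx⟩).symm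
  change DirectSum.toModule R ι (ι →₀ M) _
    ((LinearEquiv.ofBijective (DirectSum.coeLinearMap A) h).symm x) = _
  rw [this, DirectSum.toModule_lof]
  rfl

end Grading

theorem ext_homogeneous {R M N ι : Type*} [CommRing R] [AddCommGroup M] [Module R M]
    [AddCommGroup N] [Module R N] {A : ι → Submodule R M}
    (h : ⨆ i, A i = ⊤) {f g : M →ₗ[R] N} (hfg : ∀ i, ∀ x ∈ A i, f x = g x) : f = g := by
  have h' : ⨆ i, A i ≤ LinearMap.eqLocus f g := iSup_le fun i x hx => hfg i x hx
  rw [h] at h'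
  exact LinearMap.ext fun x => h' (Submodule.mem_top)

/-- A `ℤ`-graded matrix factorization over `R`: a `ℤ`-graded module with an endomorphism
`d = dp + dm`, where `dp`, `dm` have degree `1`, `-1`, such that `d ^ 2` is multiplication by
`potential`. -/
structure MF (R : Type u) [CommRing R] where
  carrier : Type u
  [addCommGroup : AddCommGroup carrier]
  [module : Module R carrier]
  gr : ℤ → Submodule R carrier
  internal : DirectSum.IsInternal gr
  potential : R
  dp : carrier →ₗ[R] carrier
  dm : carrier →ₗ[R] carrier
  dp_mem : ∀ j, ∀ x ∈ gr j, dp x ∈ gr (j + 1)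
  dm_mem : ∀ j, ∀ x ∈ gr j, dm x ∈ gr (j - 1)
  sq : (dp + dm) ∘ₗ (dp + dm) = potential • LinearMap.id

attribute [instance] MF.addCommGroup MF.module

/-- A (bounded or unbounded) complex of `ℤ`-graded matrix factorizations over `R`, all with the
same potential, written as one bigraded module: `gr (n, j)` is the part of homological degree `n`
and of degree `j` for the grading of the matrix factorizations. The total differential of the
matrix factorizations is `dp + dm`; the differential of the complex is `del`, and it is a
morphism of graded matrix factorizations. -/
structure MFComplex (R : Type u) [CommRing R] where
  carrier : Type u
  [addCommGroup : AddCommGroup carrier]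
  [module : Module R carrier]
  gr : ℤ × ℤ → Submodule R carrier
  internal : DirectSum.IsInternal gr
  potential : R
  dp : carrier →ₗ[R] carrier
  dm : carrier →ₗ[R] carrier
  del : carrier →ₗ[R] carrier
  dp_mem : ∀ i, ∀ x ∈ gr i, dp x ∈ gr (i.1, i.2 + 1)
  dm_mem : ∀ i, ∀ x ∈ gr i, dm x ∈ gr (i.1, i.2 - 1)
  del_mem : ∀ i, ∀ x ∈ gr i, del x ∈ gr (i.1 + 1, i.2)
  sq : (dp + dm) ∘ₗ (dp + dm) = potential • LinearMap.id
  del_del : del ∘ₗ del = 0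
  del_dp : del ∘ₗ dp = dp ∘ₗ del
  del_dm : del ∘ₗ dm = dm ∘ₗ del

attribute [instance] MFComplex.addCommGroup MFComplex.module

namespace MFComplex
variable {R : Type u} [CommRing R]

/-- The total differential of the underlying matrix factorization. -/
def d (M : MFComplex R) : M.carrier →ₗ[R] M.carrier := M.dp + M.dm

theorem iSup_gr (M : MFComplex R) : ⨆ i, M.gr i = ⊤ := M.internal.submodule_iSup_eq_top

/-- Multiplication by `(-1) ^ (s i)` on the part of degree `i`. -/
noncomputable def sign (M : MFComplex R) (s : ℤ × ℤ → ℤ) : M.carrier →ₗ[R] M.carrier :=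
  Finsupp.lsum R (fun i => (((s i).negOnePow : ℤˣ) : ℤ) • LinearMap.id) ∘ₗ comp M.gr M.internal

theorem sign_of_mem (M : MFComplex R) (s : ℤ × ℤ → ℤ) {i : ℤ × ℤ} {x : M.carrier}
    (hx : x ∈ M.gr i) : M.sign s x = (((s i).negOnePow : ℤˣ) : ℤ) • x := by
  rw [sign, LinearMap.comp_apply, comp_of_mem M.internal hx, Finsupp.lsum_single,
    LinearMap.smul_apply, LinearMap.id_apply]

theorem sign_mem (M : MFComplex R) (s : ℤ × ℤ → ℤ) {i : ℤ × ℤ} {x : M.carrier}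
    (hx : x ∈ M.gr i) : M.sign s x ∈ M.gr i := by
  rw [sign_of_mem M s hx]
  exact zsmul_mem hx _

/-- The sign `(-1) ^ j` for the grading of the matrix factorizations. -/
noncomputable def sgn (M : MFComplex R) : M.carrier →ₗ[R] M.carrier := M.sign Prod.snd

/-- The sign `(-1) ^ n` for the homological grading. -/
noncomputable def hsgn (M : MFComplex R) : M.carrier →ₗ[R] M.carrier := M.sign Prod.fst

theorem sign_comm (M : MFComplex R) (s t : ℤ × ℤ → ℤ) :
    M.sign s ∘ₗ M.sign t = M.sign t ∘ₗ M.sign s :=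
  ext_homogeneous M.iSup_gr fun i x hx => by
    simp only [LinearMap.comp_apply, sign_of_mem M _ hx, map_zsmul]
    rw [smul_comm]

theorem sgn_dp (M : MFComplex R) : M.sgn ∘ₗ M.dp = -(M.dp ∘ₗ M.sgn) :=
  ext_homogeneous M.iSup_gr fun i x hx => by
    simp [sgn, sign_of_mem M _ hx, sign_of_mem M _ (M.dp_mem i x hx), Int.negOnePow_succ]

theorem sgn_dm (M : MFComplex R) : M.sgn ∘ₗ M.dm = -(M.dm ∘ₗ M.sgn) :=
  ext_homogeneous M.iSup_gr fun i x hx => by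
    simp [sgn, sign_of_mem M _ hx, sign_of_mem M _ (M.dm_mem i x hx), Int.negOnePow_sub]

theorem sgn_del (M : MFComplex R) : M.sgn ∘ₗ M.del = M.del ∘ₗ M.sgn :=
  ext_homogeneous M.iSup_gr fun i x hx => by
    simp [sgn, sign_of_mem M _ hx, sign_of_mem M _ (M.del_mem i x hx)]

theorem hsgn_dp (M : MFComplex R) : M.hsgn ∘ₗ M.dp = M.dp ∘ₗ M.hsgn :=
  ext_homogeneous M.iSup_gr fun i x hx => by
    simp [hsgn, sign_of_mem M _ hx, sign_of_mem M _ (M.dp_mem i x hx)]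

theorem hsgn_dm (M : MFComplex R) : M.hsgn ∘ₗ M.dm = M.dm ∘ₗ M.hsgn :=
  ext_homogeneous M.iSup_gr fun i x hx => by
    simp [hsgn, sign_of_mem M _ hx, sign_of_mem M _ (M.dm_mem i x hx)]

theorem hsgn_del (M : MFComplex R) : M.hsgn ∘ₗ M.del = -(M.del ∘ₗ M.hsgn) :=
  ext_homogeneous M.iSup_gr fun i x hx => by
    simp [hsgn, sign_of_mem M _ hx, sign_of_mem M _ (M.del_mem i x hx), Int.negOnePow_succ]

theorem sign_sign (M : MFComplex R) (s : ℤ × ℤ → ℤ) : M.sign s ∘ₗ M.sign s = LinearMap.id :=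
  ext_homogeneous M.iSup_gr fun i x hx => by
    simp [sign_of_mem M _ hx, smul_smul]

/-- The grading of a tensor product. -/
def tensorGr (M N : MFComplex R) (i : ℤ × ℤ) : Submodule R (M.carrier ⊗[R] N.carrier) :=
  Submodule.span R {t | ∃ a b, a + b = i ∧ ∃ x ∈ M.gr a, ∃ y ∈ N.gr b, t = x ⊗ₜ[R] y}

theorem tmul_mem_tensorGr {M N : MFComplex R} {a b i : ℤ × ℤ} (h : a + b = i) {x : M.carrier}
    (hx : x ∈ M.gr a) {y : N.carrier} (hy : y ∈ N.gr b) : x ⊗ₜ[R] y ∈ tensorGr M N i :=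
  Submodule.subset_span ⟨a, b, h, x, hx, y, hy, rfl⟩

theorem tensorGr_internal (M N : MFComplex R) : DirectSum.IsInternal (tensorGr M N) := by
  refine isInternal_of_comp ?_ (Finsupp.lmapDomain _ R (fun q : (ℤ × ℤ) × (ℤ × ℤ) => q.1 + q.2) ∘ₗ
    (finsuppTensorFinsupp R R M.carrier N.carrier (ℤ × ℤ) (ℤ × ℤ)).toLinearMap ∘ₗ
    TensorProduct.map (comp M.gr M.internal) (comp N.gr N.internal)) ?_
  · rw [eq_top_iff, ← TensorProduct.span_tmul_eq_top, Submodule.span_le]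
    rintro _ ⟨x, y, rfl⟩
    have hx : x ∈ ⨆ i, M.gr i := by rw [M.iSup_gr]; trivial
    have hy : y ∈ ⨆ i, N.gr i := by rw [N.iSup_gr]; trivial
    change x ⊗ₜ[R] y ∈ ⨆ i, tensorGr M N i
    induction hx using Submodule.iSup_induction' with
    | zero => simp
    | add a b _ _ ha hb => rw [TensorProduct.add_tmul]; exact add_mem ha hb
    | mem i x hx =>
      induction hy using Submodule.iSup_induction' with
      | zero => simp
      | add a b _ _ ha hb => rw [TensorProduct.tmul_add]; exact add_mem ha hb
      | mem j y hy => exact Submodule.mem_iSup_of_mem (i + j) (tmul_mem_tensorGr rfl hx hy)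
  · intro i x hx
    induction hx using Submodule.span_induction with
    | zero => simp
    | add a b _ _ ha hb => rw [map_add, ha, hb, Finsupp.single_add]
    | smul r a _ ha => rw [map_smul, ha, Finsupp.smul_single]
    | mem x hx =>
      obtain ⟨a, b, rfl, x, hx, y, hy, rfl⟩ := hx
      simp [comp_of_mem M.internal hx, comp_of_mem N.internal hy]

theorem map_mem_tensorGr {M N M' N' : MFComplex R} {i j : ℤ × ℤ}
    (f : M.carrier ⊗[R] N.carrier →ₗ[R] M'.carrier ⊗[R] N'.carrier)
    (h : ∀ a b, a + b = i → ∀ x ∈ M.gr a, ∀ y ∈ N.gr b, f (x ⊗ₜ[R] y) ∈ tensorGr M' N' j) :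
    ∀ t ∈ tensorGr M N i, f t ∈ tensorGr M' N' j := by
  intro t ht
  have : tensorGr M N i ≤ (tensorGr M' N' j).comap f := by
    rw [tensorGr, Submodule.span_le]
    rintro _ ⟨a, b, hab, x, hx, y, hy, rfl⟩
    exact h a b hab x hx y hy
  exact this ht

/-- The tensor product over `R` of two complexes of matrix factorizations: potentials add, and
every differential is extended by the Leibniz rule with the Koszul sign of its own grading. -/
noncomputable def tensor (M N : MFComplex R) : MFComplex R where
  carrier := M.carrier ⊗[R] N.carrier
  gr := tensorGr M N
  internal := tensorGr_internal M N
  potential := M.potential + N.potential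
  dp := TensorProduct.map M.dp LinearMap.id + TensorProduct.map M.sgn N.dp
  dm := TensorProduct.map M.dm LinearMap.id + TensorProduct.map M.sgn N.dm
  del := TensorProduct.map M.del LinearMap.id + TensorProduct.map M.hsgn N.del
  dp_mem := fun i => map_mem_tensorGr _ <| by
    rintro a b rfl x hx y hy
    refine add_mem (tmul_mem_tensorGr ?_ (M.dp_mem a x hx) hy)
      (tmul_mem_tensorGr ?_ (M.sign_mem _ hx) (N.dp_mem b y hy)) <;> ext <;> simp <;> ring
  dm_mem := fun i => map_mem_tensorGr _ <| by
    rintro a b rfl x hx y hy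
    refine add_mem (tmul_mem_tensorGr ?_ (M.dm_mem a x hx) hy)
      (tmul_mem_tensorGr ?_ (M.sign_mem _ hx) (N.dm_mem b y hy)) <;> ext <;> simp <;> ring
  del_mem := fun i => map_mem_tensorGr _ <| by
    rintro a b rfl x hx y hy
    refine add_mem (tmul_mem_tensorGr ?_ (M.del_mem a x hx) hy)
      (tmul_mem_tensorGr ?_ (M.sign_mem _ hx) (N.del_mem b y hy)) <;> ext <;> simp <;> ring
  sq := by
    have e : (TensorProduct.map M.dp LinearMap.id + TensorProduct.map M.sgn N.dp) +
        (TensorProduct.map M.dm LinearMap.id + TensorProduct.map M.sgn N.dm) =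
        TensorProduct.map M.d LinearMap.id + TensorProduct.map M.sgn N.d := by
      simp only [d, TensorProduct.map_add_left, TensorProduct.map_add_right]; abel
    have hM : M.d ∘ₗ M.d = M.potential • LinearMap.id := M.sq
    have hN : N.d ∘ₗ N.d = N.potential • LinearMap.id := N.sq
    have hs : M.sgn ∘ₗ M.d = -(M.d ∘ₗ M.sgn) := by
      simp only [d, LinearMap.comp_add, LinearMap.add_comp, sgn_dp, sgn_dm]; abel
    have hss : M.sgn ∘ₗ M.sgn = LinearMap.id := M.sign_sign _
    rw [e]
    simp only [LinearMap.comp_add, LinearMap.add_comp, ← TensorProduct.map_comp, hM, hN, hs, hss,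
      LinearMap.comp_id, LinearMap.id_comp]
    refine TensorProduct.ext' fun x y => ?_
    simp [TensorProduct.neg_tmul, TensorProduct.smul_tmul', add_smul]
  del_del := by
    have hss : M.hsgn ∘ₗ M.hsgn = LinearMap.id := M.sign_sign _
    simp only [LinearMap.comp_add, LinearMap.add_comp, ← TensorProduct.map_comp, M.del_del,
      N.del_del, hsgn_del, hss, LinearMap.comp_id, LinearMap.id_comp]
    refine TensorProduct.ext' fun x y => ?_
    simp [TensorProduct.neg_tmul]
  del_dp := by
    have hc : M.hsgn ∘ₗ M.sgn = M.sgn ∘ₗ M.hsgn := M.sign_comm _ _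
    simp only [LinearMap.comp_add, LinearMap.add_comp, ← TensorProduct.map_comp, M.del_dp,
      N.del_dp, hsgn_dp, sgn_del, hc, LinearMap.comp_id, LinearMap.id_comp]
    abel
  del_dm := by
    have hc : M.hsgn ∘ₗ M.sgn = M.sgn ∘ₗ M.hsgn := M.sign_comm _ _
    simp only [LinearMap.comp_add, LinearMap.add_comp, ← TensorProduct.map_comp, M.del_dm,
      N.del_dm, hsgn_dm, sgn_del, hc, LinearMap.comp_id, LinearMap.id_comp]
    abel

/-- The unit for the tensor product: `R` in degree `(0, 0)`. -/
def unit (R : Type u) [CommRing R] : MFComplex R where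
  carrier := R
  gr i := if i = (0, 0) then ⊤ else ⊥
  internal := by
    refine isInternal_of_comp ?_ (Finsupp.lsingle (0, 0)) fun i x hx => ?_
    · exact top_le_iff.1 (le_iSup_of_le (0, 0) (by simp))
    · split_ifs at hx with h
      · simp [h]
      · simp_all
  potential := 0
  dp := 0
  dm := 0
  del := 0
  dp_mem := by simp
  dm_mem := by simp
  del_mem := by simp
  sq := by simp
  del_del := by simp
  del_dp := by simp
  del_dm := by simp

/-- The elementary Koszul matrix factorization `R ⇄ R` of the pair `(x, y)`, with potential
`x * y`. The first factor of `R × R` is in degree `0`, the second one in degree `-1`; the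
differential of degree `1` is multiplication by `x`, the one of degree `-1` multiplication
by `y`. -/
def koszul (x y : R) : MFComplex R where
  carrier := R × R
  gr i :=
    { carrier := {v | (i ≠ (0, 0) → v.1 = 0) ∧ (i ≠ (0, -1) → v.2 = 0)}
      zero_mem' := by simp
      add_mem' := by
        rintro a b ⟨h1, h2⟩ ⟨h3, h4⟩
        exact ⟨fun h => by simp [h1 h, h3 h], fun h => by simp [h2 h, h4 h]⟩
      smul_mem' := by
        rintro r a ⟨h1, h2⟩
        exact ⟨fun h => by simp [h1 h], fun h => by simp [h2 h]⟩ }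
  internal := by
    refine isInternal_of_comp ?_
      (Finsupp.lsingle (0, 0) ∘ₗ (LinearMap.inl R R R ∘ₗ LinearMap.fst R R R) +
        Finsupp.lsingle (0, -1) ∘ₗ (LinearMap.inr R R R ∘ₗ LinearMap.snd R R R)) ?_
    · refine eq_top_iff.2 fun v _ => ?_
      have : v = (v.1, 0) + (0, v.2) := by simp
      rw [this]
      refine add_mem (Submodule.mem_iSup_of_mem (0, 0) ?_) (Submodule.mem_iSup_of_mem (0, -1) ?_)
        <;> simp
    · rintro i ⟨a, b⟩ ⟨h1, h2⟩
      by_cases hi : i = (0, 0)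
      · subst hi
        have : b = 0 := h2 (by simp)
        simp [this]
      · by_cases hj : i = (0, -1)
        · subst hj
          have : a = 0 := h1 (by simp)
          simp [this]
        · have ha : a = 0 := h1 hi
          have hb : b = 0 := h2 hj
          subst ha hb
          rw [show ((0, 0) : R × R) = 0 from rfl, map_zero, Finsupp.single_zero]
  potential := x * y
  dp := LinearMap.inl R R R ∘ₗ (x • LinearMap.snd R R R)
  dm := LinearMap.inr R R R ∘ₗ (y • LinearMap.fst R R R)
  del := 0
  dp_mem := by
    rintro ⟨n, j⟩ ⟨a, b⟩ ⟨h1, h2⟩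
    refine ⟨fun h => ?_, fun _ => rfl⟩
    have : b = 0 := h2 (by rintro h'; simp only [Prod.mk.injEq] at h'; simp [h'] at h)
    simp [this]
  dm_mem := by
    rintro ⟨n, j⟩ ⟨a, b⟩ ⟨h1, h2⟩
    refine ⟨fun _ => rfl, fun h => ?_⟩
    have : a = 0 := h1 (by rintro h'; simp only [Prod.mk.injEq] at h'; simp [h'] at h)
    simp [this]
  del_mem := by simp
  sq := by
    ext <;> simp [mul_comm]
  del_del := by simp
  del_dp := by simp
  del_dm := by simp

/-- The tensor product of a finite family. -/
noncomputable def tensorFin : (m : ℕ) → (Fin m → MFComplex R) → MFComplex R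
  | 0, _ => unit R
  | m + 1, M => tensor (M 0) (tensorFin m fun i => M i.succ)

/-- The complex `M ⟶ N` with `M` in homological degree `a` and `N` in homological degree `a + 1`
(more generally the total complex, if `M` and `N` are complexes), for a morphism `f` of graded
matrix factorizations. -/
def twoTerm (a : ℤ) (M N : MFComplex R) (hpot : M.potential = N.potential)
    (f : M.carrier →ₗ[R] N.carrier) (hf : ∀ i, ∀ x ∈ M.gr i, f x ∈ N.gr i)
    (hdp : f ∘ₗ M.dp = N.dp ∘ₗ f) (hdm : f ∘ₗ M.dm = N.dm ∘ₗ f)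
    (hdel : f ∘ₗ M.del = N.del ∘ₗ f) : MFComplex R where
  carrier := M.carrier × N.carrier
  gr i := (M.gr (i.1 - a, i.2)).prod (N.gr (i.1 - (a + 1), i.2))
  internal := by
    refine isInternal_of_comp ?_
      (Finsupp.mapRange.linearMap (LinearMap.inl R M.carrier N.carrier) ∘ₗ
          Finsupp.lmapDomain _ R (fun i : ℤ × ℤ => (i.1 + a, i.2)) ∘ₗ comp M.gr M.internal ∘ₗ
          LinearMap.fst R M.carrier N.carrier +
        Finsupp.mapRange.linearMap (LinearMap.inr R M.carrier N.carrier) ∘ₗ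
          Finsupp.lmapDomain _ R (fun i : ℤ × ℤ => (i.1 + (a + 1), i.2)) ∘ₗ
          comp N.gr N.internal ∘ₗ LinearMap.snd R M.carrier N.carrier) ?_
    · refine eq_top_iff.2 fun v _ => ?_
      have hv : v = LinearMap.inl R M.carrier N.carrier v.1 + LinearMap.inr R _ _ v.2 := by simp
      have hx : v.1 ∈ ⨆ i, M.gr i := by rw [M.iSup_gr]; trivial
      have hy : v.2 ∈ ⨆ i, N.gr i := by rw [N.iSup_gr]; trivial
      rw [hv]
      refine add_mem ?_ ?_
      · refine (iSup_le fun i x hx => ?_ : (⨆ i, M.gr i) ≤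
          Submodule.comap (LinearMap.inl R M.carrier N.carrier)
            (⨆ i : ℤ × ℤ, (M.gr (i.1 - a, i.2)).prod (N.gr (i.1 - (a + 1), i.2)))) hx
        exact Submodule.mem_iSup_of_mem (i.1 + a, i.2) (by simpa using hx)
      · refine (iSup_le fun i x hx => ?_ : (⨆ i, N.gr i) ≤
          Submodule.comap (LinearMap.inr R M.carrier N.carrier)
            (⨆ i : ℤ × ℤ, (M.gr (i.1 - a, i.2)).prod (N.gr (i.1 - (a + 1), i.2)))) hy
        exact Submodule.mem_iSup_of_mem (i.1 + (a + 1), i.2) (by simpa using hx)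
    · rintro ⟨n, j⟩ ⟨x, y⟩ ⟨hx, hy⟩
      simp [comp_of_mem M.internal hx, comp_of_mem N.internal hy, ← Finsupp.single_add]
  potential := M.potential
  dp := M.dp.prodMap N.dp
  dm := M.dm.prodMap N.dm
  del := (M.del ∘ₗ LinearMap.fst R _ _).prod
    (f ∘ₗ LinearMap.fst R _ _ - N.del ∘ₗ LinearMap.snd R _ _)
  dp_mem := fun i v hv => ⟨M.dp_mem _ _ hv.1, N.dp_mem _ _ hv.2⟩
  dm_mem := fun i v hv => ⟨M.dm_mem _ _ hv.1, N.dm_mem _ _ hv.2⟩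
  del_mem := fun i v hv => by
    have h1 := M.del_mem _ _ hv.1
    have h2 := N.del_mem _ _ hv.2
    have h3 := hf _ _ hv.1
    refine ⟨?_, ?_⟩
    · have e : ((i.1 - a) + 1, i.2) = ((i.1 + 1) - a, i.2) :=
        Prod.ext (by dsimp only; ring) rfl
      exact e ▸ h1
    · have e : (i.1 - a, i.2) = ((i.1 + 1) - (a + 1), i.2) :=
        Prod.ext (by dsimp only; ring) rfl
      have e' : ((i.1 - (a + 1)) + 1, i.2) = ((i.1 + 1) - (a + 1), i.2) :=
        Prod.ext (by dsimp only; ring) rfl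
      exact sub_mem (e ▸ h3) (e' ▸ h2)
  sq := by
    have hM := fun x => LinearMap.congr_fun M.sq x
    have hN := fun x => LinearMap.congr_fun N.sq x
    refine LinearMap.ext fun v => Prod.ext ?_ ?_
    · simpa using hM v.1
    · simpa [hpot] using hN v.2
  del_del := by
    have hM := fun x => LinearMap.congr_fun M.del_del x
    have hN := fun x => LinearMap.congr_fun N.del_del x
    have h := fun x => LinearMap.congr_fun hdel x
    refine LinearMap.ext fun v => Prod.ext ?_ ?_
    · simpa using hM v.1
    · simp only [LinearMap.comp_apply] at h hN
      simp [h, hN]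
  del_dp := by
    have hM := fun x => LinearMap.congr_fun M.del_dp x
    have hN := fun x => LinearMap.congr_fun N.del_dp x
    have h := fun x => LinearMap.congr_fun hdp x
    simp only [LinearMap.comp_apply] at h hN hM
    refine LinearMap.ext fun v => Prod.ext ?_ ?_ <;> simp [h, hM, hN]
  del_dm := by
    have hM := fun x => LinearMap.congr_fun M.del_dm x
    have hN := fun x => LinearMap.congr_fun N.del_dm x
    have h := fun x => LinearMap.congr_fun hdm x
    simp only [LinearMap.comp_apply] at h hN hM
    refine LinearMap.ext fun v => Prod.ext ?_ ?_ <;> simp [h, hM, hN]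

/-- The grading of an extension of scalars. -/
def baseChangeGr (R' : Type u) [CommRing R'] [Algebra R R'] (M : MFComplex R) (i : ℤ × ℤ) :
    Submodule R' (R' ⊗[R] M.carrier) :=
  Submodule.span R' {t | ∃ x ∈ M.gr i, t = 1 ⊗ₜ[R] x}

theorem baseChangeGr_internal (R' : Type u) [CommRing R'] [Algebra R R'] (M : MFComplex R) :
    DirectSum.IsInternal (baseChangeGr R' M) := by
  refine isInternal_of_comp ?_ ((TensorProduct.finsuppRight R R' R' M.carrier
    (ℤ × ℤ)).toLinearMap ∘ₗ (comp M.gr M.internal).baseChange R') fun i x hx => ?_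
  · refine eq_top_iff.2 fun t _ => ?_
    induction t using TensorProduct.induction_on with
    | zero => exact zero_mem _
    | add a b ha hb => exact add_mem (ha trivial) (hb trivial)
    | tmul r x =>
      have hx : x ∈ ⨆ i, M.gr i := by rw [M.iSup_gr]; trivial
      have : (1 : R') ⊗ₜ[R] x ∈ ⨆ i, baseChangeGr R' M i := by
        refine (iSup_le fun i x hx => ?_ : (⨆ i, M.gr i) ≤
          ((⨆ i, baseChangeGr R' M i).restrictScalars R).comap
            (TensorProduct.mk R R' M.carrier 1)) hx
        exact Submodule.mem_iSup_of_mem i (Submodule.subset_span ⟨x, hx, rfl⟩)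
      simpa [TensorProduct.smul_tmul'] using Submodule.smul_mem _ r this
  · induction hx using Submodule.span_induction with
    | zero => simp
    | add a b _ _ ha hb => rw [map_add, ha, hb, Finsupp.single_add]
    | smul r a _ ha => rw [map_smul, ha, Finsupp.smul_single]
    | mem x hx =>
      obtain ⟨x, hx, rfl⟩ := hx
      simp [comp_of_mem M.internal hx]

theorem baseChange_mem (R' : Type u) [CommRing R'] [Algebra R R'] {M : MFComplex R}
    {i j : ℤ × ℤ} {f : M.carrier →ₗ[R] M.carrier} (hf : ∀ x ∈ M.gr i, f x ∈ M.gr j) :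
    ∀ t ∈ baseChangeGr R' M i, f.baseChange R' t ∈ baseChangeGr R' M j := by
  intro t ht
  refine (Submodule.span_le.2 ?_ : baseChangeGr R' M i ≤
    (baseChangeGr R' M j).comap (f.baseChange R')) ht
  rintro _ ⟨x, hx, rfl⟩
  exact Submodule.subset_span ⟨f x, hf x hx, by simp⟩

/-- Extension of scalars along `g`. -/
noncomputable def baseChange {R' : Type u} [CommRing R'] (g : R →+* R') (M : MFComplex R) :
    MFComplex R' :=
  letI := g.toAlgebra
  { carrier := R' ⊗[R] M.carrier
    gr := baseChangeGr R' M
    internal := baseChangeGr_internal R' M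
    potential := g M.potential
    dp := M.dp.baseChange R'
    dm := M.dm.baseChange R'
    del := M.del.baseChange R'
    dp_mem := fun i => baseChange_mem R' (M.dp_mem i)
    dm_mem := fun i => baseChange_mem R' (M.dm_mem i)
    del_mem := fun i => baseChange_mem R' (M.del_mem i)
    sq := by
      rw [← LinearMap.baseChange_add, ← LinearMap.baseChange_comp, M.sq]
      refine TensorProduct.AlgebraTensorModule.ext fun r x => ?_
      rw [LinearMap.baseChange_tmul, LinearMap.smul_apply, LinearMap.id_apply,
        TensorProduct.tmul_smul, LinearMap.smul_apply, LinearMap.id_apply,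
        ← algebraMap_smul R' M.potential]
      rfl
    del_del := by rw [← LinearMap.baseChange_comp, M.del_del, LinearMap.baseChange_zero]
    del_dp := by rw [← LinearMap.baseChange_comp, M.del_dp, LinearMap.baseChange_comp]
    del_dm := by rw [← LinearMap.baseChange_comp, M.del_dm, LinearMap.baseChange_comp] }

/-- Restriction of scalars along `g`, for a potential that comes from the smaller ring. -/
def restrict {R₀ : Type u} [CommRing R₀] (g : R₀ →+* R) (M : MFComplex R) (w : R₀)
    (hw : M.potential = g w) : MFComplex R₀ :=
  letI : Module R₀ M.carrier := Module.compHom M.carrier g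
  letI res : (M.carrier →ₗ[R] M.carrier) → (M.carrier →ₗ[R₀] M.carrier) := fun f =>
    { toFun := f, map_add' := f.map_add, map_smul' := fun r x => f.map_smul (g r) x }
  letI gr₀ : ℤ × ℤ → Submodule R₀ M.carrier := fun i =>
    { carrier := M.gr i
      zero_mem' := (M.gr i).zero_mem
      add_mem' := (M.gr i).add_mem
      smul_mem' := fun r _ hx => (M.gr i).smul_mem (g r) hx }
  { carrier := M.carrier
    gr := gr₀
    internal := M.internal
    potential := w
    dp := res M.dp
    dm := res M.dm
    del := res M.del
    dp_mem := M.dp_mem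
    dm_mem := M.dm_mem
    del_mem := M.del_mem
    sq := LinearMap.ext fun x => by
      have := LinearMap.congr_fun M.sq x
      rw [hw] at this
      exact this
    del_del := LinearMap.ext fun x => LinearMap.congr_fun M.del_del x
    del_dp := LinearMap.ext fun x => LinearMap.congr_fun M.del_dp x
    del_dm := LinearMap.ext fun x => LinearMap.congr_fun M.del_dm x }

/-- No nonzero element has positive degree for the grading of the matrix factorizations. -/
def IsNonpos (M : MFComplex R) : Prop := ∀ i : ℤ × ℤ, 0 < i.2 → M.gr i = ⊥

theorem isNonpos_unit : IsNonpos (unit R) := fun i hi => by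
  have : i ≠ (0, 0) := by rintro rfl; simp at hi
  exact if_neg this

theorem isNonpos_koszul (x y : R) : IsNonpos (koszul x y) := fun i hi => by
  refine eq_bot_iff.2 ?_
  rintro ⟨a, b⟩ ⟨h1, h2⟩
  have ha : a = 0 := h1 (by rintro rfl; simp at hi)
  have hb : b = 0 := h2 (by rintro rfl; simp at hi)
  subst ha hb
  rfl

theorem IsNonpos.tensor {M N : MFComplex R} (hM : IsNonpos M) (hN : IsNonpos N) :
    IsNonpos (tensor M N) := fun i hi => by
  refine eq_bot_iff.2 (Submodule.span_le.2 ?_)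
  rintro _ ⟨a, b, rfl, x, hx, y, hy, rfl⟩
  by_cases ha : 0 < a.2
  · rw [hM a ha, Submodule.mem_bot] at hx
    rw [hx, TensorProduct.zero_tmul]
    exact zero_mem _
  · have hb : 0 < b.2 := by simp only [Prod.snd_add] at hi; omega
    rw [hN b hb, Submodule.mem_bot] at hy
    rw [hy, TensorProduct.tmul_zero]
    exact zero_mem _

theorem IsNonpos.tensorFin : ∀ {m : ℕ} {M : Fin m → MFComplex R}, (∀ i, IsNonpos (M i)) →
    IsNonpos (tensorFin m M)
  | 0, _, _ => isNonpos_unit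
  | _ + 1, _, h => (h 0).tensor (IsNonpos.tensorFin fun i => h i.succ)

theorem IsNonpos.twoTerm {a : ℤ} {M N : MFComplex R} {hpot : M.potential = N.potential}
    {f : M.carrier →ₗ[R] N.carrier} {hf : ∀ i, ∀ x ∈ M.gr i, f x ∈ N.gr i}
    {hdp : f ∘ₗ M.dp = N.dp ∘ₗ f} {hdm : f ∘ₗ M.dm = N.dm ∘ₗ f}
    {hdel : f ∘ₗ M.del = N.del ∘ₗ f} (hM : IsNonpos M) (hN : IsNonpos N) :
    IsNonpos (twoTerm a M N hpot f hf hdp hdm hdel) := fun i hi => by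
  change (M.gr (i.1 - a, i.2)).prod (N.gr (i.1 - (a + 1), i.2)) = ⊥
  rw [hM (i.1 - a, i.2) hi, hN (i.1 - (a + 1), i.2) hi, Submodule.prod_bot]

theorem IsNonpos.baseChange {R' : Type u} [CommRing R'] (g : R →+* R') {M : MFComplex R}
    (hM : IsNonpos M) : IsNonpos (baseChange g M) := fun i hi => by
  let _ := g.toAlgebra
  refine eq_bot_iff.2 (Submodule.span_le.2 ?_)
  rintro _ ⟨x, hx, rfl⟩
  rw [hM i hi, Submodule.mem_bot] at hx
  rw [hx, TensorProduct.tmul_zero]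
  exact zero_mem _

/-- The submodule by which one divides to obtain `H^0` of `M` with the differential `dp`, when
`M` has no part of positive degree: all parts of nonzero degree and the image of `dp`. -/
def naiveSub (M : MFComplex R) : Submodule R M.carrier :=
  (⨆ i : {i : ℤ × ℤ // i.2 ≠ 0}, M.gr i) ⊔ LinearMap.range M.dp

theorem mem_naiveSub_of_ne (M : MFComplex R) {i : ℤ × ℤ} (hi : i.2 ≠ 0) {x : M.carrier}
    (hx : x ∈ M.gr i) : x ∈ M.naiveSub :=
  Submodule.mem_sup_left (Submodule.mem_iSup_of_mem (⟨i, hi⟩ : {i : ℤ × ℤ // i.2 ≠ 0}) hx)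

theorem dp_mem_naiveSub (M : MFComplex R) (x : M.carrier) : M.dp x ∈ M.naiveSub :=
  Submodule.mem_sup_right ⟨x, rfl⟩

theorem naiveSub_le (M : MFComplex R) {N : Submodule R M.carrier}
    (h : ∀ i : ℤ × ℤ, i.2 ≠ 0 → ∀ x ∈ M.gr i, x ∈ N) (h' : ∀ x, M.dp x ∈ N) :
    M.naiveSub ≤ N :=
  sup_le (iSup_le fun i x hx => h i i.2 x hx) (by rintro _ ⟨x, rfl⟩; exact h' x)

/-- The natural projection onto the naive complex. -/
def naiveMk (M : MFComplex R) : M.carrier →ₗ[R] M.carrier ⧸ M.naiveSub := M.naiveSub.mkQ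

theorem naiveMk_eq_zero (M : MFComplex R) {x : M.carrier} (h : x ∈ M.naiveSub) :
    M.naiveMk x = 0 := (Submodule.Quotient.mk_eq_zero _).2 h

/-- The grading of the naive complex. -/
noncomputable def naiveGr (M : MFComplex R) (i : ℤ × ℤ) : Submodule R (M.carrier ⧸ M.naiveSub) :=
  if i.2 = 0 then (M.gr i).map M.naiveMk else ⊥

theorem naiveGr_internal (M : MFComplex R) : DirectSum.IsInternal (naiveGr M) := by
  have hQ : M.naiveSub ≤ LinearMap.ker
      (Finsupp.mapRange.linearMap M.naiveMk ∘ₗ comp M.gr M.internal) := by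
    refine M.naiveSub_le (fun i hi x hx => ?_) fun x => ?_
    · simp [comp_of_mem M.internal hx, M.naiveMk_eq_zero (M.mem_naiveSub_of_ne hi hx)]
    · have : (Finsupp.mapRange.linearMap M.naiveMk ∘ₗ comp M.gr M.internal) ∘ₗ M.dp = 0 :=
        ext_homogeneous M.iSup_gr fun i x hx => by
          simp [comp_of_mem M.internal (M.dp_mem i x hx), M.naiveMk_eq_zero (M.dp_mem_naiveSub x)]
      exact LinearMap.congr_fun this x
  refine isInternal_of_comp ?_ (M.naiveSub.liftQ _ hQ) fun i x hx => ?_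
  · refine eq_top_iff.2 fun t _ => ?_
    obtain ⟨x, rfl⟩ := M.naiveSub.mkQ_surjective t
    have hx : x ∈ ⨆ i, M.gr i := by rw [M.iSup_gr]; trivial
    refine (iSup_le fun i x hx => ?_ : (⨆ i, M.gr i) ≤
      Submodule.comap M.naiveMk (⨆ i, naiveGr M i)) hx
    by_cases hi : i.2 = 0
    · refine Submodule.mem_iSup_of_mem i ?_
      rw [naiveGr, if_pos hi]
      exact Submodule.mem_map_of_mem hx
    · rw [Submodule.mem_comap, M.naiveMk_eq_zero (M.mem_naiveSub_of_ne hi hx)]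
      exact zero_mem _
  · rw [naiveGr] at hx
    split_ifs at hx with hi
    · obtain ⟨y, hy, rfl⟩ := hx
      change (M.naiveSub.liftQ _ hQ) (M.naiveSub.mkQ y) = _
      rw [Submodule.mkQ_apply, Submodule.liftQ_apply]
      simp [comp_of_mem M.internal hy]
    · rw [Submodule.mem_bot] at hx
      simp [hx]

/-- The naive complex: `H^0` with respect to `dp` of every matrix factorization of the complex
`M` (all of them concentrated in nonpositive degrees), as a complex of matrix factorizations
concentrated in degree `0`, with zero differentials `dp` and `dm`. -/
noncomputable def naive (M : MFComplex R) (hM : IsNonpos M) : MFComplex R where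
  carrier := M.carrier ⧸ M.naiveSub
  gr := naiveGr M
  internal := naiveGr_internal M
  potential := M.potential
  dp := 0
  dm := 0
  del := M.naiveSub.mapQ M.naiveSub M.del <| M.naiveSub_le
    (fun i hi x hx => M.mem_naiveSub_of_ne (i := (i.1 + 1, i.2)) hi (M.del_mem i x hx))
    fun x => by
      have := LinearMap.congr_fun M.del_dp x
      simp only [LinearMap.comp_apply] at this
      rw [Submodule.mem_comap, this]
      exact M.dp_mem_naiveSub _
  dp_mem := by simp
  dm_mem := by simp
  del_mem := fun i x hx => by
    rw [naiveGr] at hx ⊢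
    split_ifs at hx with hi
    · rw [if_pos hi]
      obtain ⟨y, hy, rfl⟩ := hx
      exact ⟨M.del y, M.del_mem i y hy, rfl⟩
    · rw [Submodule.mem_bot] at hx
      simp [hx]
  sq := by
    refine Submodule.linearMap_qext _ (ext_homogeneous M.iSup_gr fun i x hx => ?_)
    have h : M.naiveMk (M.potential • x) = 0 := by
      by_cases hi : i.2 = 0
      · have h0 : M.dp x = 0 := by
          have := M.dp_mem i x hx
          rwa [hM _ (by simp [hi]), Submodule.mem_bot] at this
        have h1 := LinearMap.congr_fun M.sq x
        simp only [LinearMap.comp_apply, LinearMap.add_apply, LinearMap.smul_apply,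
          LinearMap.id_apply, h0, zero_add] at h1
        rw [← h1]
        refine M.naiveMk_eq_zero (add_mem (M.dp_mem_naiveSub _) (M.mem_naiveSub_of_ne ?_
          (M.dm_mem _ _ (M.dm_mem i x hx))))
        simp [hi]
      · exact M.naiveMk_eq_zero (Submodule.smul_mem _ _ (M.mem_naiveSub_of_ne hi hx))
    simpa [naiveMk] using h.symm
  del_del := by
    refine Submodule.linearMap_qext _ (LinearMap.ext fun x => ?_)
    have := LinearMap.congr_fun M.del_del x
    simp only [LinearMap.comp_apply, LinearMap.zero_apply] at this
    simp [this]
  del_dp := by simp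
  del_dm := by simp

/-- The part of homological degree `n` and of the same parity as `j`. -/
def par (M : MFComplex R) (n j : ℤ) : Submodule R M.carrier := ⨆ l : ℤ, M.gr (n, j + 2 * l)

/-- Morphisms of complexes of matrix factorizations: they commute with both differentials,
preserve the homological degree, and preserve the other grading modulo `2`. -/
structure IsMor {M N : MFComplex R} (f : M.carrier →ₗ[R] N.carrier) : Prop where
  d_comm : f ∘ₗ M.d = N.d ∘ₗ f
  del_comm : f ∘ₗ M.del = N.del ∘ₗ f
  mem : ∀ n j, ∀ x ∈ M.gr (n, j), f x ∈ N.par n j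

theorem IsMor.sgn_comm {M N : MFComplex R} {f : M.carrier →ₗ[R] N.carrier} (hf : IsMor f) :
    f ∘ₗ M.sgn = N.sgn ∘ₗ f :=
  ext_homogeneous M.iSup_gr fun i x hx => by
    have key : ∀ y ∈ N.par i.1 i.2, N.sgn y = ((i.2.negOnePow : ℤˣ) : ℤ) • y := by
      intro y hy
      have h : N.par i.1 i.2 ≤
          LinearMap.eqLocus N.sgn (((i.2.negOnePow : ℤˣ) : ℤ) • LinearMap.id) := by
        refine iSup_le fun l y hy => ?_
        change N.sign _ y = _
        rw [sign_of_mem N _ hy, Int.negOnePow_add, Int.negOnePow_two_mul, mul_one]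
        rfl
      exact h hy
    rw [LinearMap.comp_apply, LinearMap.comp_apply, key _ (hf.mem i.1 i.2 x hx), sgn,
      sign_of_mem M _ hx, map_zsmul]

/-- `f` is a homotopy equivalence of complexes of matrix factorizations: there is a morphism `g`
in the other direction such that both composites are homotopic to the identity as morphisms of
matrix factorizations, through homotopies `h` that commute with the differential of the complex,
preserve the homological degree and are odd. -/
def IsHomotopyEquiv {M N : MFComplex R} (f : M.carrier →ₗ[R] N.carrier) : Prop :=
  IsMor f ∧ ∃ g : N.carrier →ₗ[R] M.carrier, IsMor g ∧
    (∃ h : M.carrier →ₗ[R] M.carrier, (∀ n j, ∀ x ∈ M.gr (n, j), h x ∈ M.par n (j + 1)) ∧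
      h ∘ₗ M.del = M.del ∘ₗ h ∧ g ∘ₗ f - LinearMap.id = M.d ∘ₗ h + h ∘ₗ M.d) ∧
    ∃ h : N.carrier →ₗ[R] N.carrier, (∀ n j, ∀ x ∈ N.gr (n, j), h x ∈ N.par n (j + 1)) ∧
      h ∘ₗ N.del = N.del ∘ₗ h ∧ f ∘ₗ g - LinearMap.id = N.d ∘ₗ h + h ∘ₗ N.d

end MFComplex

section Homology
variable {R : Type u} [CommRing R]

/-- The homology `ker d / im d` of an endomorphism `d` with `d ^ 2 = 0`. -/
abbrev Homology {M : Type u} [AddCommGroup M] [Module R M] (d : M →ₗ[R] M) : Type u :=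
  LinearMap.ker d ⧸ (LinearMap.range d).submoduleOf (LinearMap.ker d)

/-- The homology class of a cycle. -/
abbrev Homology.mk {M : Type u} [AddCommGroup M] [Module R M] (d : M →ₗ[R] M) :
    LinearMap.ker d →ₗ[R] Homology d :=
  ((LinearMap.range d).submoduleOf (LinearMap.ker d)).mkQ

theorem mem_ker_of_comm {M N : Type u} [AddCommGroup M] [Module R M] [AddCommGroup N] [Module R N]
    {d : M →ₗ[R] M} {d' : N →ₗ[R] N} {f : M →ₗ[R] N} (h : f ∘ₗ d = d' ∘ₗ f) :
    ∀ x ∈ LinearMap.ker d, f x ∈ LinearMap.ker d' := fun x hx => by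
  have := LinearMap.congr_fun h x
  simp only [LinearMap.comp_apply, LinearMap.mem_ker.1 hx, map_zero] at this
  exact this.symm

/-- The map induced on homology. -/
def Homology.map {M N : Type u} [AddCommGroup M] [Module R M] [AddCommGroup N] [Module R N]
    {d : M →ₗ[R] M} {d' : N →ₗ[R] N} (f : M →ₗ[R] N) (h : f ∘ₗ d = d' ∘ₗ f) :
    Homology d →ₗ[R] Homology d' :=
  Submodule.mapQ _ _ (f.restrict (mem_ker_of_comm h)) (by
    rintro ⟨x, hx⟩ ⟨y, rfl⟩
    exact ⟨f y, (LinearMap.congr_fun h y).symm⟩)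

/-- The total differential of a matrix factorization. -/
def MF.d (D : MF R) : D.carrier →ₗ[R] D.carrier := D.dp + D.dm

namespace MFComplex

/-- The total differential of the matrix factorization `M ⊗ D`. -/
noncomputable def dTensor (M : MFComplex R) (D : MF R) :
    M.carrier ⊗[R] D.carrier →ₗ[R] M.carrier ⊗[R] D.carrier :=
  TensorProduct.map M.d LinearMap.id + TensorProduct.map M.sgn D.d

theorem IsMor.dTensor_comm {M N : MFComplex R} {f : M.carrier →ₗ[R] N.carrier} (hf : IsMor f)
    (D : MF R) : f.rTensor D.carrier ∘ₗ M.dTensor D = N.dTensor D ∘ₗ f.rTensor D.carrier := by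
  simp only [dTensor, LinearMap.rTensor, LinearMap.comp_add, LinearMap.add_comp,
    ← TensorProduct.map_comp, hf.d_comm, hf.sgn_comm, LinearMap.comp_id, LinearMap.id_comp]

/-- Near-isomorphisms: morphisms `f : M → N` such that, for every graded matrix factorization `D`
on a projective module with the opposite potential, `f ⊗ 1 : M ⊗ D → N ⊗ D` induces an
isomorphism on total homology. For complexes, all homological degrees are considered at once;
since `f` and the total differentials preserve the homological degree, this means that `f` is a
near-isomorphism in every homological degree. -/
def NearIso {M N : MFComplex R} (f : M.carrier →ₗ[R] N.carrier) : Prop :=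
  ∃ hf : IsMor f, ∀ D : MF R, Module.Projective R D.carrier → D.potential = -M.potential →
    Function.Bijective (Homology.map (f.rTensor D.carrier) (hf.dTensor_comm D))

theorem del_d (M : MFComplex R) : M.del ∘ₗ M.d = M.d ∘ₗ M.del := by
  simp only [d, LinearMap.comp_add, LinearMap.add_comp, M.del_dp, M.del_dm]

/-- The total homology of the matrix factorizations of a complex with zero potential. -/
abbrev Ht (M : MFComplex R) : Type u := Homology M.d

/-- The differential which the differential of the complex induces on total homology. -/
def htDel (M : MFComplex R) : M.Ht →ₗ[R] M.Ht := Homology.map M.del M.del_d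

/-- The part of the total homology of homological degree `n` and of the parity of `j`. -/
def htGr (M : MFComplex R) (n j : ℤ) : Submodule R M.Ht :=
  ((M.par n j).submoduleOf (LinearMap.ker M.d)).map (Homology.mk M.d)

/-- Isomorphisms between the total homologies of two complexes with zero potential, as complexes
of modules: isomorphisms that commute with the induced differentials and respect the homological
degree and the parity. -/
structure HtIso (M N : MFComplex R) where
  equiv : M.Ht ≃ₗ[R] N.Ht
  del_comm : ∀ x, equiv (M.htDel x) = N.htDel (equiv x)
  map_gr : ∀ n j, (M.htGr n j).map equiv.toLinearMap = N.htGr n j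

end MFComplex
end Homology

namespace MFComplex
variable {R : Type u} [CommRing R]

/-- The tensor product of a finite family of linear maps. -/
noncomputable def tensorFinMap : (m : ℕ) → {M N : Fin m → MFComplex R} →
    (∀ i, (M i).carrier →ₗ[R] (N i).carrier) →
    ((tensorFin m M).carrier →ₗ[R] (tensorFin m N).carrier)
  | 0, _, _, _ => LinearMap.id
  | m + 1, _, _, f => TensorProduct.map (f 0) (tensorFinMap m fun i => f i.succ)

/-- Extension of scalars of a linear map. -/
noncomputable def baseChangeMap {R' : Type u} [CommRing R'] (g : R →+* R') {M N : MFComplex R}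
    (f : M.carrier →ₗ[R] N.carrier) : (M.baseChange g).carrier →ₗ[R'] (N.baseChange g).carrier :=
  letI := g.toAlgebra
  f.baseChange R'

/-- Restriction of scalars of a linear map. -/
def restrictMap {R₀ : Type u} [CommRing R₀] (g : R₀ →+* R) {M N : MFComplex R} {w : R₀}
    (hM : M.potential = g w) (hN : N.potential = g w) (f : M.carrier →ₗ[R] N.carrier) :
    (M.restrict g w hM).carrier →ₗ[R₀] (N.restrict g w hN).carrier where
  toFun := f
  map_add' := f.map_add
  map_smul' r x := f.map_smul (g r) x

theorem tensorFin_potential : ∀ (m : ℕ) (M : Fin m → MFComplex R),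
    (tensorFin m M).potential = ∑ i, (M i).potential
  | 0, _ => by simp [tensorFin, unit]
  | m + 1, M => by
    rw [Fin.sum_univ_succ, ← tensorFin_potential m fun i => M i.succ]
    rfl

end MFComplex

open MFComplex MvPolynomial

section Diagrams

/-- The boundary of a disk: `n` marked points, numbered from the distinguished one on, with a
sign: `pos b = true` (sign `+1`) if the strand of the tangle in the disk is directed towards the
boundary point `b`, and `pos b = false` (sign `-1`) if it starts at `b`. -/
structure Boundary where
  n : ℕ
  pos : Fin n → Bool

/-- The flags of the graph of a tangle diagram with `c` crossings: every crossing is adjacent to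
four half-edges, numbered `0, 1, 2, 3` (for `i, j, k, l`), and every end point to one.

At a crossing `0, 1` are the outgoing and `2, 3` the incoming half-edges; with both strands
directed upwards, `0` is top left, `1` top right, `2` bottom right and `3` bottom left, so that
the two strands of the crossing run from `2` to `0` and from `3` to `1`. -/
abbrev Flag (c n : ℕ) : Type := (Fin c × Fin 4) ⊕ Fin n

/-- Whether the edge of a flag is directed into the vertex of the flag. -/
def Boundary.inward (B : Boundary) {c : ℕ} : Flag c B.n → Bool
  | Sum.inl (_, h) => decide (2 ≤ h.val)
  | Sum.inr b => B.pos b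

/-- An oriented tangle diagram in a disk with boundary `B`, given by its oriented graph: the
vertices are the crossings, each with a sign, and the end points; every edge runs from an outgoing
flag to an incoming flag, and every flag belongs to exactly one edge. In addition there may be
closed components without crossings (`circles`). Diagrams are only recorded through these data;
the graph is not required to be planar, so that virtual diagrams are included. -/
structure TangleDiagram (B : Boundary) where
  crossings : ℕ
  positive : Fin crossings → Bool
  edges : ℕ
  tail : Fin edges ≃ {φ : Flag crossings B.n // B.inward φ = false}
  head : Fin edges ≃ {φ : Flag crossings B.n // B.inward φ = true}
  circles : ℕ

namespace TangleDiagram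
variable {B : Boundary}

/-- The vertex of a flag. -/
def vertex {c n : ℕ} : Flag c n → Fin c ⊕ Fin n := Sum.map Prod.fst id

/-- There is an edge from the vertex `v` to the vertex `w`. -/
def Adj (T : TangleDiagram B) (v w : Fin T.crossings ⊕ Fin B.n) : Prop :=
  ∃ e, vertex (T.tail e).1 = v ∧ vertex (T.head e).1 = w

/-- The graph of the diagram has no oriented cycles (and no closed components without
crossings). -/
def Acyclic (T : TangleDiagram B) : Prop :=
  (∀ v, ¬ Relation.TransGen T.Adj v v) ∧ T.circles = 0

/-- The variables: one for every flag, and one for a mark on every closed component without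
crossings. -/
abbrev Var (T : TangleDiagram B) : Type := Flag T.crossings B.n ⊕ Fin T.circles

end TangleDiagram

/-- The marked points of a disk with boundary `B₀` with holes with boundaries `B i`. -/
abbrev ArcPoint (B₀ : Boundary) {m : ℕ} (B : Fin m → Boundary) : Type :=
  Fin B₀.n ⊕ Σ i, Fin (B i).n

/-- Whether the arc at a marked point is directed towards this point. (At a hole this means that
the strand of a tangle in the hole starts at this point.) -/
def arcInward (B₀ : Boundary) {m : ℕ} (B : Fin m → Boundary) : ArcPoint B₀ B → Bool
  | Sum.inl b => B₀.pos b
  | Sum.inr b => !(B b.1).pos b.2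

/-- An oriented planar arc diagram with `m` ordered holes: every arc runs from one marked point to
another one, and every marked point is the end point of exactly one arc. As for tangle diagrams,
only these data are recorded, and planarity is not required. -/
structure ArcDiagram (B₀ : Boundary) {m : ℕ} (B : Fin m → Boundary) where
  arcs : ℕ
  tail : Fin arcs ≃ {x : ArcPoint B₀ B // arcInward B₀ B x = false}
  head : Fin arcs ≃ {x : ArcPoint B₀ B // arcInward B₀ B x = true}

section Gluing
variable {B₀ : Boundary} {m : ℕ} {B : Fin m → Boundary}

/-- The points where the pieces of the diagram glued from `T i` by an arc diagram begin and end: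
the outer boundary points and the flags of the `T i` (where the boundary points of the `i`th hole
are the end points of `T i`). -/
abbrev GluePoint (B₀ : Boundary) (T : ∀ i, TangleDiagram (B i)) : Type :=
  Fin B₀.n ⊕ Σ i, Flag (T i).crossings (B i).n

/-- The marked points of the arc diagram as points of the glued diagram. -/
def arcPoint (T : ∀ i, TangleDiagram (B i)) : ArcPoint B₀ B → GluePoint B₀ T :=
  Sum.map id fun b => ⟨b.1, Sum.inr b.2⟩

/-- The pieces of the glued diagram: the edges of the tangle diagrams `T i` and the arcs. -/
def Piece (η : ArcDiagram B₀ B) (T : ∀ i, TangleDiagram (B i)) (a b : GluePoint B₀ T) : Prop :=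
  (∃ i, ∃ e : Fin (T i).edges,
    a = Sum.inr ⟨i, ((T i).tail e).1⟩ ∧ b = Sum.inr ⟨i, ((T i).head e).1⟩) ∨
  ∃ α : Fin η.arcs, a = arcPoint T (η.tail α).1 ∧ b = arcPoint T (η.head α).1

/-- The points on closed components of the glued diagram which consist of edges of the `T i` and
arcs without any crossing. -/
abbrev ClosedPoint (η : ArcDiagram B₀ B) (T : ∀ i, TangleDiagram (B i)) : Type :=
  {a : GluePoint B₀ T // Relation.TransGen (Piece η T) a a}

/-- The flags of the glued diagram as points of the glued diagram, for a given identification of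
its crossings with those of the `T i`. -/
def gluedFlag (T : ∀ i, TangleDiagram (B i)) {c : ℕ}
    (crossing : Fin c ≃ Σ i, Fin (T i).crossings) : Flag c B₀.n → GluePoint B₀ T
  | Sum.inl (x, h) => Sum.inr ⟨(crossing x).1, Sum.inl ((crossing x).2, h)⟩
  | Sum.inr b => Sum.inl b

/-- A factorization of the tangle diagram `U` as the action of the arc diagram `η` on the tangle
diagrams `T i`: the crossings of `U` are those of the `T i`, every edge of `U` is obtained by
following edges of the `T i` and arcs of `η`, and the closed components of `U` without crossings
are those of the `T i` and the new ones which arise from the gluing. -/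
structure Factorization (η : ArcDiagram B₀ B) (T : ∀ i, TangleDiagram (B i))
    (U : TangleDiagram B₀) where
  crossing : Fin U.crossings ≃ Σ i, Fin (T i).crossings
  positive : ∀ x, U.positive x = (T (crossing x).1).positive (crossing x).2
  edge : ∀ e : Fin U.edges, Relation.TransGen (Piece η T)
    (gluedFlag T crossing (U.tail e).1) (gluedFlag T crossing (U.head e).1)
  circles : U.circles = (∑ i, (T i).circles) +
    Nat.card (Quot fun a b : ClosedPoint η T => Piece η T a.1 b.1)

/-- The flags of `U` as points of the glued diagram. -/
def Factorization.flag {η : ArcDiagram B₀ B} {T : ∀ i, TangleDiagram (B i)} {U : TangleDiagram B₀}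
    (F : Factorization η T U) : Flag U.crossings B₀.n → GluePoint B₀ T :=
  gluedFlag T F.crossing

/-- The variable of `η({KR(T i)})` that belongs to a flag of `U`. -/
def Factorization.var {η : ArcDiagram B₀ B} {T : ∀ i, TangleDiagram (B i)} {U : TangleDiagram B₀}
    (F : Factorization η T U) (φ : Flag U.crossings B₀.n) : Fin B₀.n ⊕ Σ i, (T i).Var :=
  Sum.map id (fun x => ⟨x.1, Sum.inl x.2⟩) (F.flag φ)

end Gluing
end Diagrams

section KhovanovRozansky
variable {k : Type u} [Field k]

/-- The polynomial `(p(a) - p(b)) / (a - b)`, evaluated at two elements of a `k`-algebra. -/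
noncomputable def divDiff {A : Type*} [CommRing A] [Algebra k A] (p : Polynomial k) (a b : A) : A :=
  p.sum fun n c => algebraMap k A c * ∑ i ∈ Finset.range n, a ^ i * b ^ (n - 1 - i)

theorem sub_mul_divDiff {A : Type*} [CommRing A] [Algebra k A] (p : Polynomial k) (a b : A) :
    (a - b) * divDiff p a b = Polynomial.aeval a p - Polynomial.aeval b p := by
  rw [divDiff, Polynomial.aeval_eq_sum_range' (Nat.lt_succ_self _),
    Polynomial.aeval_eq_sum_range' (Nat.lt_succ_self _), ← Finset.sum_sub_distrib,
    Polynomial.sum_over_range _ (by simp), Finset.mul_sum]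
  refine Finset.sum_congr rfl fun n _ => ?_
  rw [mul_left_comm, mul_comm (a - b), geom_sum₂_mul, Algebra.smul_def, Algebra.smul_def, mul_sub]

/-- The potential `∑ ± p(t_b)` of a boundary. -/
noncomputable def Boundary.potential (p : Polynomial k) (B : Boundary) :
    MvPolynomial (Fin B.n) k :=
  ∑ b, (if B.pos b then 1 else -1) * Polynomial.aeval (X b) p

/-- The Koszul factorization of `p(t_0) + p(t_1) - p(t_2) - p(t_3)` on the sequence
`(t_0 + t_1 - t_2 - t_3, t_0 t_1 - t_2 t_3)`, for given second entries `y`. -/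
noncomputable def wide (y : Fin 2 → MvPolynomial (Fin 4) k) : MFComplex (MvPolynomial (Fin 4) k) :=
  tensor (koszul (X 0 + X 1 - X 2 - X 3) (y 0)) (koszul (X 0 * X 1 - X 2 * X 3) (y 1))

/-- The same on the sequence `(t_0 - t_3, t_1 - t_2)`. -/
noncomputable def smooth (y : Fin 2 → MvPolynomial (Fin 4) k) :
    MFComplex (MvPolynomial (Fin 4) k) :=
  tensor (koszul (X 0 - X 3) (y 0)) (koszul (X 1 - X 2) (y 1))

/-- The generator `1` of the degree `0` part of `wide y₁`. -/
noncomputable def wideGen (y : Fin 2 → MvPolynomial (Fin 4) k) : (wide y).carrier :=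
  ((1, 0) : MvPolynomial (Fin 4) k × MvPolynomial (Fin 4) k) ⊗ₜ[MvPolynomial (Fin 4) k]
    ((1, 0) : MvPolynomial (Fin 4) k × MvPolynomial (Fin 4) k)

/-- The generator `1` of the degree `0` part of `smooth y`. -/
noncomputable def smoothGen (y : Fin 2 → MvPolynomial (Fin 4) k) : (smooth y).carrier :=
  ((1, 0) : MvPolynomial (Fin 4) k × MvPolynomial (Fin 4) k) ⊗ₜ[MvPolynomial (Fin 4) k]
    ((1, 0) : MvPolynomial (Fin 4) k × MvPolynomial (Fin 4) k)

/-- The potential of a crossing. -/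
noncomputable def crossingPotential (p : Polynomial k) : MvPolynomial (Fin 4) k :=
  Polynomial.aeval (X 0) p + Polynomial.aeval (X 1) p - Polynomial.aeval (X 2) p -
    Polynomial.aeval (X 3) p

/-- The choices which the definition of the Khovanov-Rozansky complexes of the two crossings
leaves open: Koszul factorizations with potential `p(t_0) + p(t_1) - p(t_2) - p(t_3)` on the two
sequences, and morphisms of graded matrix factorizations between them which induce on
`H^0` of the Koszul complexes the projection
`S / (t_0 + t_1 - t_2 - t_3, t_0 t_1 - t_2 t_3) → S / (t_0 - t_3, t_1 - t_2)` and
the map in the other direction that sends `1` to `t_0 - t_2`. All these quotients are generated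
by the classes of the generators `1`. -/
structure CrossingData (p : Polynomial k) where
  y₁ : Fin 2 → MvPolynomial (Fin 4) k
  y₂ : Fin 2 → MvPolynomial (Fin 4) k
  potential₁ : (wide y₁).potential = crossingPotential p
  potential₂ : (smooth y₂).potential = crossingPotential p
  pos : (wide y₁).carrier →ₗ[MvPolynomial (Fin 4) k] (smooth y₂).carrier
  pos_mem : ∀ i, ∀ x ∈ (wide y₁).gr i, pos x ∈ (smooth y₂).gr i
  pos_dp : pos ∘ₗ (wide y₁).dp = (smooth y₂).dp ∘ₗ pos
  pos_dm : pos ∘ₗ (wide y₁).dm = (smooth y₂).dm ∘ₗ pos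
  pos_gen : (smooth y₂).naiveMk (pos (wideGen y₁)) = (smooth y₂).naiveMk (smoothGen y₂)
  neg : (smooth y₂).carrier →ₗ[MvPolynomial (Fin 4) k] (wide y₁).carrier
  neg_mem : ∀ i, ∀ x ∈ (smooth y₂).gr i, neg x ∈ (wide y₁).gr i
  neg_dp : neg ∘ₗ (smooth y₂).dp = (wide y₁).dp ∘ₗ neg
  neg_dm : neg ∘ₗ (smooth y₂).dm = (wide y₁).dm ∘ₗ neg
  neg_gen : (wide y₁).naiveMk (neg (smoothGen y₂)) =
    ((X 0 - X 2 : MvPolynomial (Fin 4) k)) • (wide y₁).naiveMk (wideGen y₁)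

theorem tensor_del {R : Type u} [CommRing R] {M N : MFComplex R} (hM : M.del = 0)
    (hN : N.del = 0) : (tensor M N).del = 0 := by
  have h : (TensorProduct.map M.del LinearMap.id + TensorProduct.map M.hsgn N.del :
      M.carrier ⊗[R] N.carrier →ₗ[R] M.carrier ⊗[R] N.carrier) = 0 := by simp [hM, hN]
  exact h

theorem wide_del (y : Fin 2 → MvPolynomial (Fin 4) k) : (wide y).del = 0 :=
   tensor_del rfl rfl

theorem smooth_del (y : Fin 2 → MvPolynomial (Fin 4) k) : (smooth y).del = 0 :=
   tensor_del rfl rfl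

/-- The two-term complex of a crossing; the factorization `smooth` is in homological degree `0`. -/
noncomputable def CrossingData.crossing {p : Polynomial k} (χ : CrossingData p) :
    Bool → MFComplex (MvPolynomial (Fin 4) k)
  | true => twoTerm (-1) (wide χ.y₁) (smooth χ.y₂) (χ.potential₁.trans χ.potential₂.symm)
      χ.pos χ.pos_mem χ.pos_dp χ.pos_dm (by simp [wide_del, smooth_del])
  | false => twoTerm 0 (smooth χ.y₂) (wide χ.y₁) (χ.potential₂.trans χ.potential₁.symm)
      χ.neg χ.neg_mem χ.neg_dp χ.neg_dm (by simp [wide_del, smooth_del])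

theorem CrossingData.crossing_potential {p : Polynomial k} (χ : CrossingData p) (s : Bool) :
    (χ.crossing s).potential = crossingPotential p := by
  cases s
  · exact χ.potential₂
  · exact χ.potential₁

theorem CrossingData.crossing_nonpos {p : Polynomial k} (χ : CrossingData p) (s : Bool) :
    IsNonpos (χ.crossing s) := by
  have h1 : IsNonpos (wide χ.y₁) := (isNonpos_koszul (X 0 + X 1 - X 2 - X 3) (χ.y₁ 0)).tensor
    (isNonpos_koszul (X 0 * X 1 - X 2 * X 3) (χ.y₁ 1))
  have h2 : IsNonpos (smooth χ.y₂) :=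
    (isNonpos_koszul (X 0 - X 3) (χ.y₂ 0)).tensor (isNonpos_koszul (X 1 - X 2) (χ.y₂ 1))
  cases s
  · exact IsNonpos.twoTerm (hpot := χ.potential₂.trans χ.potential₁.symm) (hf := χ.neg_mem)
      (hdp := χ.neg_dp) (hdm := χ.neg_dm) (hdel := by simp [wide_del, smooth_del]) h2 h1
  · exact IsNonpos.twoTerm (hpot := χ.potential₁.trans χ.potential₂.symm) (hf := χ.pos_mem)
      (hdp := χ.pos_dp) (hdm := χ.pos_dm) (hdel := by simp [wide_del, smooth_del]) h1 h2

/-- Complexes of matrix factorizations over `k[Y]` with potential `∑ ± p(t_b)`, where the sum is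
over the boundary points `b` of `B`, whose variables are among those in `Y`. For `Y = Fin B.n`
these are the complexes of matrix factorizations which the canopolis assigns to the boundary `B`;
further variables only record an additional action, which may be forgotten (`overBoundary`). -/
structure BoundaryMF (p : Polynomial k) (B : Boundary) where
  Y : Type
  inc : Fin B.n → Y
  M : MFComplex (MvPolynomial Y k)
  potential_eq : M.potential = rename inc (B.potential p)

namespace BoundaryMF
variable {p : Polynomial k} {B : Boundary}

/-- The underlying complex of matrix factorizations over the polynomial ring in the variables of
the boundary points. -/
noncomputable def overBoundary (N : BoundaryMF p B) : MFComplex (MvPolynomial (Fin B.n) k) :=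
  N.M.restrict (rename N.inc : MvPolynomial (Fin B.n) k →ₐ[k] MvPolynomial N.Y k).toRingHom
    (B.potential p) N.potential_eq

/-- Multiplication by the variable `y`, which is linear over the ring of the boundary points. -/
noncomputable def mulVar (N : BoundaryMF p B) (y : N.Y) :
    N.overBoundary.carrier →ₗ[MvPolynomial (Fin B.n) k] N.overBoundary.carrier :=
  MFComplex.restrictMap _ N.potential_eq N.potential_eq
    (LinearMap.lsmul (MvPolynomial N.Y k) N.M.carrier (X y))

/-- The naive complex of `N`. -/
noncomputable abbrev naive (N : BoundaryMF p B) (hN : IsNonpos N.M) : BoundaryMF p B where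
  Y := N.Y
  inc := N.inc
  M := N.M.naive hN
  potential_eq := N.potential_eq

/-- The natural projection onto the naive complex. -/
noncomputable def proj (N : BoundaryMF p B) (hN : IsNonpos N.M) :
    N.M.carrier →ₗ[MvPolynomial N.Y k] (N.naive hN).M.carrier :=
  N.M.naiveMk

end BoundaryMF

theorem sum_head_sub_tail {A ι : Type*} [CommRing A] [Fintype ι] {q : ι → Bool} {m : ℕ}
    (tail : Fin m ≃ {i // q i = false}) (head : Fin m ≃ {i // q i = true}) (F : ι → A) :
    ∑ e, (F (head e).1 - F (tail e).1) = ∑ i, (if q i then 1 else -1) * F i := by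
  rw [Finset.sum_sub_distrib, Equiv.sum_comp head fun i => F i.1,
    Equiv.sum_comp tail fun i => F i.1,
    ← Finset.sum_subtype (Finset.univ.filter fun i => q i = true) (by simp) F,
    ← Finset.sum_subtype (Finset.univ.filter fun i => q i = false) (by simp) F,
    Finset.sum_filter, Finset.sum_filter, ← Finset.sum_sub_distrib]
  refine Finset.sum_congr rfl fun i _ => ?_
  cases q i <;> simp

namespace TangleDiagram
variable {p : Polynomial k} {B : Boundary}

/-- The factorization of an edge: it is the Koszul factorization of `t_head - t_tail` and
`(p(t_head) - p(t_tail)) / (t_head - t_tail)`. -/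
noncomputable def edgeMF (p : Polynomial k) (T : TangleDiagram B) (e : Fin T.edges) :
    MFComplex (MvPolynomial T.Var k) :=
  koszul (X (Sum.inl (T.head e).1) - X (Sum.inl (T.tail e).1))
    (divDiff p (X (Sum.inl (T.head e).1)) (X (Sum.inl (T.tail e).1)))

/-- The factorization of a closed component without crossings, on which one point is marked: as
for an edge, but with the same variable at both ends. -/
noncomputable def circleMF (p : Polynomial k) (T : TangleDiagram B) (c : Fin T.circles) :
    MFComplex (MvPolynomial T.Var k) :=
  koszul (X (Sum.inr c) - X (Sum.inr c)) (divDiff p (X (Sum.inr c)) (X (Sum.inr c)))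

/-- The complex of a crossing of `T`. -/
noncomputable def crossingMF (χ : CrossingData p) (T : TangleDiagram B) (x : Fin T.crossings) :
    MFComplex (MvPolynomial T.Var k) :=
  (χ.crossing (T.positive x)).baseChange
    (rename (fun h => Sum.inl (Sum.inl (x, h))) :
      MvPolynomial (Fin 4) k →ₐ[k] MvPolynomial T.Var k).toRingHom

/-- The Khovanov-Rozansky complex over the polynomial ring in all variables. -/
noncomputable def krComplex (χ : CrossingData p) (T : TangleDiagram B) :
    MFComplex (MvPolynomial T.Var k) :=
  tensor (tensor (tensorFin T.edges (T.edgeMF p)) (tensorFin T.circles (T.circleMF p)))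
    (tensorFin T.crossings (T.crossingMF χ))

theorem krComplex_nonpos (χ : CrossingData p) (T : TangleDiagram B) :
    IsNonpos (T.krComplex χ) :=
  ((IsNonpos.tensorFin fun _ => isNonpos_koszul _ _).tensor
    (IsNonpos.tensorFin fun _ => isNonpos_koszul _ _)).tensor
    (IsNonpos.tensorFin fun _ => (χ.crossing_nonpos _).baseChange _)

theorem krComplex_potential (χ : CrossingData p) (T : TangleDiagram B) :
    (T.krComplex χ).potential = rename (fun b => Sum.inl (Sum.inr b)) (B.potential p) := by
  have h1 : (T.krComplex χ).potential = (tensorFin T.edges (T.edgeMF p)).potential +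
    (tensorFin T.circles (T.circleMF p)).potential +
    (tensorFin T.crossings (T.crossingMF χ)).potential := rfl
  have h2 : ∀ e, (T.edgeMF p e).potential = Polynomial.aeval (X (Sum.inl (T.head e).1)) p -
      Polynomial.aeval (X (Sum.inl (T.tail e).1)) p := fun e => sub_mul_divDiff p _ _
  have h3 : ∀ c, (T.circleMF p c).potential = 0 := fun c => by simp [circleMF, koszul]
  have h4 : ∀ x, (T.crossingMF χ x).potential = rename (fun h => Sum.inl (Sum.inl (x, h)))
      (crossingPotential p) := fun x => by rw [← χ.crossing_potential (T.positive x)]; rfl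
  rw [h1, tensorFin_potential, tensorFin_potential, tensorFin_potential]
  simp only [h2, h3, h4]
  rw [sum_head_sub_tail T.tail T.head fun φ => Polynomial.aeval (X (Sum.inl φ)) p, Fintype.sum_sum_type,
    Fintype.sum_prod_type]
  have h5 : ∀ x : Fin T.crossings, (∑ h : Fin 4,
      (if B.inward (c := T.crossings) (Sum.inl (x, h)) then (1 : MvPolynomial T.Var k) else -1) *
        Polynomial.aeval (X (Sum.inl (Sum.inl (x, h)))) p) =
      -rename (fun h => Sum.inl (Sum.inl (x, h))) (crossingPotential p) := fun x => by
    simp only [crossingPotential, Fin.sum_univ_four, Boundary.inward, map_sub, map_add,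
      ← Polynomial.aeval_algHom_apply, rename_X]
    norm_num
    ring
  simp only [h5, Boundary.potential, map_sum, map_mul, ← Polynomial.aeval_algHom_apply, rename_X]
  rw [Finset.sum_neg_distrib, Finset.sum_const_zero, add_zero, neg_add_cancel_comm]
  refine Finset.sum_congr rfl fun b _ => ?_
  cases h : B.pos b <;> simp [Boundary.inward, h]

/-- The Khovanov-Rozansky complex of a tangle diagram. -/
noncomputable def kr (χ : CrossingData p) (T : TangleDiagram B) : BoundaryMF p B where
  Y := T.Var
  inc b := Sum.inl (Sum.inr b)
  M := T.krComplex χ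
  potential_eq := T.krComplex_potential χ

/-- The naive Khovanov-Rozansky complex of a tangle diagram. -/
noncomputable def naiveKR (χ : CrossingData p) (T : TangleDiagram B) : BoundaryMF p B :=
  (T.kr χ).naive (T.krComplex_nonpos χ)

end TangleDiagram

namespace ArcDiagram
variable {p : Polynomial k} {B₀ : Boundary} {m : ℕ} {B : Fin m → Boundary}

/-- The variable of a marked point of the arc diagram. -/
def var (Y : Fin m → Type) (inc : ∀ i, Fin (B i).n → Y i) :
    ArcPoint B₀ B → Fin B₀.n ⊕ Σ i, Y i :=
  Sum.map id fun b => ⟨b.1, inc b.1 b.2⟩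

/-- The factorization of an arc. -/
noncomputable def arcMF (p : Polynomial k) (η : ArcDiagram B₀ B) {Y : Fin m → Type}
    (inc : ∀ i, Fin (B i).n → Y i) (α : Fin η.arcs) :
    MFComplex (MvPolynomial (Fin B₀.n ⊕ Σ i, Y i) k) :=
  koszul (X (var Y inc (η.head α).1) - X (var Y inc (η.tail α).1))
    (divDiff p (X (var Y inc (η.head α).1)) (X (var Y inc (η.tail α).1)))

/-- The complex over the polynomial ring in all variables which the arc diagram `η` produces from
complexes `N i`: the tensor product of the Koszul factorization of the arcs with all `N i`. -/
noncomputable def actComplex (η : ArcDiagram B₀ B) (N : ∀ i, BoundaryMF p (B i)) :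
    MFComplex (MvPolynomial (Fin B₀.n ⊕ Σ i, (N i).Y) k) :=
  tensor (tensorFin η.arcs (η.arcMF p fun i => (N i).inc))
    (tensorFin m fun i => (N i).M.baseChange
      (rename (fun y => Sum.inr ⟨i, y⟩) :
        MvPolynomial (N i).Y k →ₐ[k] MvPolynomial (Fin B₀.n ⊕ Σ i, (N i).Y) k).toRingHom)

theorem actComplex_potential (η : ArcDiagram B₀ B) (N : ∀ i, BoundaryMF p (B i)) :
    (η.actComplex N).potential = rename Sum.inl (B₀.potential p) := by
  have h1 : (η.actComplex N).potential =
    (tensorFin η.arcs (η.arcMF p fun i => (N i).inc)).potential +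
    (tensorFin m fun i => (N i).M.baseChange
      (rename (fun y => Sum.inr ⟨i, y⟩) :
        MvPolynomial (N i).Y k →ₐ[k] MvPolynomial (Fin B₀.n ⊕ Σ i, (N i).Y) k).toRingHom).potential :=
    rfl
  have h2 : ∀ α, (η.arcMF p (fun i => (N i).inc) α).potential =
      Polynomial.aeval (X (var (fun i => (N i).Y) (fun i => (N i).inc) (η.head α).1)) p -
      Polynomial.aeval (X (var (fun i => (N i).Y) (fun i => (N i).inc) (η.tail α).1)) p :=
    fun α => sub_mul_divDiff p _ _
  have h3 : ∀ i, ((N i).M.baseChange (rename (fun y => Sum.inr ⟨i, y⟩) : MvPolynomial (N i).Y k →ₐ[k]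
      MvPolynomial (Fin B₀.n ⊕ Σ i, (N i).Y) k).toRingHom).potential =
      rename (fun y => Sum.inr ⟨i, y⟩) (rename (N i).inc ((B i).potential p)) := fun i => by
    rw [← (N i).potential_eq]; rfl
  rw [h1, tensorFin_potential, tensorFin_potential]
  simp only [h2, h3]
  rw [sum_head_sub_tail η.tail η.head fun x =>
    Polynomial.aeval (X (var (fun i => (N i).Y) (fun i => (N i).inc) x)) p,
    Fintype.sum_sum_type, Fintype.sum_sigma, add_assoc, ← Finset.sum_add_distrib,
    Finset.sum_eq_zero (s := Finset.univ (α := Fin m)), add_zero]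
  · simp only [Boundary.potential, map_sum, map_mul, ← Polynomial.aeval_algHom_apply, rename_X]
    refine Finset.sum_congr rfl fun b _ => ?_
    cases h : B₀.pos b <;> simp [arcInward, var, h]
  · intro i _
    simp only [Boundary.potential, map_sum, map_mul, ← Polynomial.aeval_algHom_apply, rename_X]
    rw [← Finset.sum_add_distrib]
    refine Finset.sum_eq_zero fun b _ => ?_
    cases h : (B i).pos b <;> simp [arcInward, var, h]

/-- The action of an arc diagram on complexes of matrix factorizations: the tensor product over
`k[X_1, …, X_m]` with the Koszul factorization of the arcs, as a complex over `k[X_0]`. -/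
noncomputable def act (η : ArcDiagram B₀ B) (N : ∀ i, BoundaryMF p (B i)) : BoundaryMF p B₀ where
  Y := Fin B₀.n ⊕ Σ i, (N i).Y
  inc := Sum.inl
  M := η.actComplex N
  potential_eq := η.actComplex_potential N

/-- The map `η({N i}) → η({H^0(N i)})` induced by the natural projections. -/
noncomputable def actProj (η : ArcDiagram B₀ B) (N : ∀ i, BoundaryMF p (B i))
    (hN : ∀ i, IsNonpos (N i).M) :
    (η.act N).overBoundary.carrier →ₗ[MvPolynomial (Fin B₀.n) k]
      (η.act fun i => (N i).naive (hN i)).overBoundary.carrier :=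
  MFComplex.restrictMap _ (η.act N).potential_eq (η.act fun i => (N i).naive (hN i)).potential_eq
    (TensorProduct.map LinearMap.id
      (tensorFinMap m fun i => baseChangeMap _ ((N i).proj (hN i))) :
        (η.actComplex N).carrier →ₗ[MvPolynomial (Fin B₀.n ⊕ Σ i, (N i).Y) k]
          (η.actComplex fun i => (N i).naive (hN i)).carrier)

end ArcDiagram
end KhovanovRozansky

section Existence
variable {k : Type u} [Field k]

theorem exists_wide_pow {A : Type*} [CommRing A] (a b c d : A) : ∀ n : ℕ, ∃ y z : A,
    a ^ n + b ^ n - c ^ n - d ^ n = (a + b - c - d) * y + (a * b - c * d) * z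
  | 0 => ⟨0, 0, by ring⟩
  | 1 => ⟨1, 0, by ring⟩
  | n + 2 => by
    obtain ⟨y, z, h⟩ := exists_wide_pow a b c d n
    obtain ⟨y', z', h'⟩ := exists_wide_pow a b c d (n + 1)
    refine ⟨(a + b) * y' - a * b * y + (c ^ (n + 1) + d ^ (n + 1)),
      (a + b) * z' - a * b * z - (c ^ n + d ^ n), ?_⟩
    linear_combination (a + b) * h' - a * b * h

theorem exists_wide (p : Polynomial k) : ∃ y : Fin 2 → MvPolynomial (Fin 4) k,
    (X 0 + X 1 - X 2 - X 3) * y 0 + (X 0 * X 1 - X 2 * X 3) * y 1 = crossingPotential p := by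
  suffices h : ∃ y z : MvPolynomial (Fin 4) k,
      (X 0 + X 1 - X 2 - X 3) * y + (X 0 * X 1 - X 2 * X 3) * z = crossingPotential p by
    obtain ⟨y, z, h⟩ := h
    exact ⟨![y, z], by simpa using h⟩
  induction p using Polynomial.induction_on' with
  | add p q hp hq =>
    obtain ⟨y, z, h⟩ := hp
    obtain ⟨y', z', h'⟩ := hq
    refine ⟨y + y', z + z', ?_⟩
    simp only [crossingPotential, map_add] at h h' ⊢
    linear_combination h + h'
  | monomial n c =>
    obtain ⟨y, z, h⟩ := exists_wide_pow (X 0 : MvPolynomial (Fin 4) k) (X 1) (X 2) (X 3) n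
    refine ⟨C c * y, C c * z, ?_⟩
    simp only [crossingPotential, Polynomial.aeval_monomial, MvPolynomial.algebraMap_eq]
    linear_combination -C c * h

section Matrices
variable {R : Type u} [CommRing R]

theorem koszul_sgn (x y : R) : (koszul x y).sgn =
    (LinearMap.prodMap LinearMap.id (-LinearMap.id) : R × R →ₗ[R] R × R) := by
  refine ext_homogeneous (koszul x y).iSup_gr ?_
  rintro i ⟨a, b⟩ ⟨h1, h2⟩
  have h := sign_of_mem (koszul x y) Prod.snd (i := i) (x := ((a, b) : R × R)) ⟨h1, h2⟩
  refine h.trans ?_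
  by_cases hi : i = (0, 0)
  · have hb : b = 0 := h2 (by simp [hi])
    subst hi hb
    exact (one_smul ℤ ((a, 0) : R × R)).trans
      (show ((a, 0) : R × R) = (a, -0) by rw [neg_zero])
  · have ha : a = 0 := h1 hi
    subst ha
    by_cases hj : i = (0, -1)
    · subst hj
      exact (neg_one_smul ℤ ((0, b) : R × R)).trans
        (show -((0, b) : R × R) = (0, -b) by simp)
    · have hb : b = 0 := h2 hj
      subst hb
      exact (smul_zero (A := R × R) _).trans
        (show (0 : R × R) = (0, -0) by rw [neg_zero]; rfl)

theorem ext_basis {N : Type*} [AddCommGroup N] [Module R N]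
    {f g : (R × R) ⊗[R] (R × R) →ₗ[R] N}
    (h : ∀ a b : R × R, (a = (1, 0) ∨ a = (0, 1)) → (b = (1, 0) ∨ b = (0, 1)) →
      f (a ⊗ₜ b) = g (a ⊗ₜ b)) : f = g := by
  refine TensorProduct.ext (LinearMap.prod_ext ?_ ?_) <;> refine LinearMap.ext_ring ?_ <;>
    refine LinearMap.prod_ext ?_ ?_ <;> refine LinearMap.ext_ring ?_
  all_goals simp only [LinearMap.comp_apply]
  all_goals exact h _ _ (by simp) (by simp)

/-- Elementary maps of `R × R`. -/
abbrev e₀₀ (R : Type u) [CommRing R] : R × R →ₗ[R] R × R :=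
  LinearMap.inl R R R ∘ₗ LinearMap.fst R R R
abbrev e₁₁ (R : Type u) [CommRing R] : R × R →ₗ[R] R × R :=
  LinearMap.inr R R R ∘ₗ LinearMap.snd R R R
abbrev e₀₁ (R : Type u) [CommRing R] : R × R →ₗ[R] R × R :=
  LinearMap.inl R R R ∘ₗ LinearMap.snd R R R
abbrev e₁₀ (R : Type u) [CommRing R] : R × R →ₗ[R] R × R :=
  LinearMap.inr R R R ∘ₗ LinearMap.fst R R R

/-- The map which the matrix `(1, c; 1, d)` induces on exterior algebras. -/
noncomputable def posMap (c d : R) : (R × R) ⊗[R] (R × R) →ₗ[R] (R × R) ⊗[R] (R × R) :=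
  TensorProduct.map (e₀₀ R) (e₀₀ R) + TensorProduct.map (e₁₁ R) (e₀₀ R) +
    TensorProduct.map (e₀₁ R) (e₁₀ R) + c • TensorProduct.map (e₁₀ R) (e₀₁ R) +
    d • TensorProduct.map (e₀₀ R) (e₁₁ R) + (d - c) • TensorProduct.map (e₁₁ R) (e₁₁ R)

/-- The complementary map, built from the adjugate matrix `(d, -c; -1, 1)`. -/
noncomputable def negMap (c d : R) : (R × R) ⊗[R] (R × R) →ₗ[R] (R × R) ⊗[R] (R × R) :=
  (d - c) • TensorProduct.map (e₀₀ R) (e₀₀ R) + d • TensorProduct.map (e₁₁ R) (e₀₀ R) -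
    TensorProduct.map (e₀₁ R) (e₁₀ R) - c • TensorProduct.map (e₁₀ R) (e₀₁ R) +
    TensorProduct.map (e₀₀ R) (e₁₁ R) + TensorProduct.map (e₁₁ R) (e₁₁ R)

/-- The differentials of a tensor product of two elementary Koszul factorizations. -/
noncomputable def dpMap (x y : R) : (R × R) ⊗[R] (R × R) →ₗ[R] (R × R) ⊗[R] (R × R) :=
  TensorProduct.map (LinearMap.inl R R R ∘ₗ (x • LinearMap.snd R R R)) LinearMap.id +
    TensorProduct.map (LinearMap.prodMap LinearMap.id (-LinearMap.id)) (LinearMap.inl R R R ∘ₗ (y • LinearMap.snd R R R))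

noncomputable def dmMap (x y : R) : (R × R) ⊗[R] (R × R) →ₗ[R] (R × R) ⊗[R] (R × R) :=
  TensorProduct.map (LinearMap.inr R R R ∘ₗ (x • LinearMap.fst R R R)) LinearMap.id +
    TensorProduct.map (LinearMap.prodMap LinearMap.id (-LinearMap.id)) (LinearMap.inr R R R ∘ₗ (y • LinearMap.fst R R R))

theorem tensor_koszul_dp (x y x' y' : R) :
    (tensor (koszul x y) (koszul x' y')).dp = dpMap x x' := by
  change TensorProduct.map _ _ + TensorProduct.map (koszul x y).sgn _ = _
  rw [koszul_sgn]
  rfl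

theorem tensor_koszul_dm (x y x' y' : R) :
    (tensor (koszul x y) (koszul x' y')).dm = dmMap y y' := by
  change TensorProduct.map _ _ + TensorProduct.map (koszul x y).sgn _ = _
  rw [koszul_sgn]
  rfl

theorem basis_rules (R : Type u) [CommRing R] : ∃ u w : R × R, u = (1, 0) ∧ w = (0, 1) ∧
    (e₀₀ R u = u ∧ e₀₀ R w = 0 ∧ e₁₁ R u = 0 ∧ e₁₁ R w = w ∧
      e₀₁ R u = 0 ∧ e₀₁ R w = u ∧ e₁₀ R u = w ∧ e₁₀ R w = 0) ∧
    (∀ x : R, (LinearMap.inl R R R ∘ₗ (x • LinearMap.snd R R R)) u = 0 ∧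
      (LinearMap.inl R R R ∘ₗ (x • LinearMap.snd R R R)) w = x • u ∧
      (LinearMap.inr R R R ∘ₗ (x • LinearMap.fst R R R)) u = x • w ∧
      (LinearMap.inr R R R ∘ₗ (x • LinearMap.fst R R R)) w = 0) ∧
    (LinearMap.prodMap LinearMap.id (-LinearMap.id) : R × R →ₗ[R] R × R) u = u ∧
    (LinearMap.prodMap LinearMap.id (-LinearMap.id) : R × R →ₗ[R] R × R) w = -w := by
  refine ⟨_, _, rfl, rfl, ?_, ?_, ?_, ?_⟩ <;> simp

theorem posMap_dp (a b c d : R) :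
    posMap c d ∘ₗ dpMap (a + b) (c * a + d * b) = dpMap a b ∘ₗ posMap c d := by
  obtain ⟨u, w, hu, hw, ⟨h1, h2, h3, h4, h5, h6, h7, h8⟩, h, h9, h10⟩ := basis_rules R
  refine ext_basis ?_
  rw [← hu, ← hw]
  rintro _ _ (rfl | rfl) (rfl | rfl) <;>
  simp only [posMap, dpMap, LinearMap.comp_apply (TensorProduct.map _ _ + _),
    LinearMap.comp_apply (_ + _ • TensorProduct.map _ _), LinearMap.add_apply,
    LinearMap.smul_apply, TensorProduct.map_tmul, map_add, map_smul, map_neg, (h _).1, (h _).2.1,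
    h1, h2, h3, h4, h5, h6, h7, h8, h9, h10, LinearMap.id_apply, TensorProduct.zero_tmul,
    TensorProduct.tmul_zero, TensorProduct.tmul_smul, TensorProduct.neg_tmul,
    ← TensorProduct.smul_tmul', smul_zero, map_zero] <;> module

theorem posMap_dm (y z c d : R) :
    posMap c d ∘ₗ dmMap y z = dmMap (y + c * z) (y + d * z) ∘ₗ posMap c d := by
  obtain ⟨u, w, hu, hw, ⟨h1, h2, h3, h4, h5, h6, h7, h8⟩, h, h9, h10⟩ := basis_rules R
  refine ext_basis ?_
  rw [← hu, ← hw]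
  rintro _ _ (rfl | rfl) (rfl | rfl) <;>
  simp only [posMap, dmMap, LinearMap.comp_apply (TensorProduct.map _ _ + _),
    LinearMap.comp_apply (_ + _ • TensorProduct.map _ _), LinearMap.add_apply,
    LinearMap.smul_apply, TensorProduct.map_tmul, map_add, map_smul, map_neg, (h _).2.2.1,
    (h _).2.2.2,
    h1, h2, h3, h4, h5, h6, h7, h8, h9, h10, LinearMap.id_apply, TensorProduct.zero_tmul,
    TensorProduct.tmul_zero, TensorProduct.tmul_smul, TensorProduct.neg_tmul,
    ← TensorProduct.smul_tmul', smul_zero, map_zero] <;> module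

theorem negMap_dp (a b c d : R) :
    negMap c d ∘ₗ dpMap a b = dpMap (a + b) (c * a + d * b) ∘ₗ negMap c d := by
  obtain ⟨u, w, hu, hw, ⟨h1, h2, h3, h4, h5, h6, h7, h8⟩, h, h9, h10⟩ := basis_rules R
  refine ext_basis ?_
  rw [← hu, ← hw]
  rintro _ _ (rfl | rfl) (rfl | rfl) <;>
  simp only [negMap, dpMap, LinearMap.comp_apply (TensorProduct.map _ _ + _),
    LinearMap.comp_apply (_ + TensorProduct.map _ _), LinearMap.add_apply, LinearMap.sub_apply,
    LinearMap.smul_apply, TensorProduct.map_tmul, map_add, map_sub, map_smul, map_neg, (h _).1,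
    (h _).2.1,
    h1, h2, h3, h4, h5, h6, h7, h8, h9, h10, LinearMap.id_apply, TensorProduct.zero_tmul,
    TensorProduct.tmul_zero, TensorProduct.tmul_smul, TensorProduct.neg_tmul,
    ← TensorProduct.smul_tmul', smul_zero, map_zero] <;> module

theorem negMap_dm (y z c d : R) :
    negMap c d ∘ₗ dmMap (y + c * z) (y + d * z) = dmMap y z ∘ₗ negMap c d := by
  obtain ⟨u, w, hu, hw, ⟨h1, h2, h3, h4, h5, h6, h7, h8⟩, h, h9, h10⟩ := basis_rules R
  refine ext_basis ?_
  rw [← hu, ← hw]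
  rintro _ _ (rfl | rfl) (rfl | rfl) <;>
  simp only [negMap, dmMap, LinearMap.comp_apply (TensorProduct.map _ _ + _),
    LinearMap.comp_apply (_ + TensorProduct.map _ _), LinearMap.add_apply, LinearMap.sub_apply,
    LinearMap.smul_apply, TensorProduct.map_tmul, map_add, map_sub, map_smul, map_neg,
    (h _).2.2.1, (h _).2.2.2,
    h1, h2, h3, h4, h5, h6, h7, h8, h9, h10, LinearMap.id_apply, TensorProduct.zero_tmul,
    TensorProduct.tmul_zero, TensorProduct.tmul_smul, TensorProduct.neg_tmul,
    ← TensorProduct.smul_tmul', smul_zero, map_zero] <;> module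

theorem map_mem_gr {x y x' y' z w z' w' : R} {f g : R × R →ₗ[R] R × R} (φ ψ : ℤ × ℤ → ℤ × ℤ)
    (h : ∀ a b, φ a + ψ b = a + b)
    (hf : ∀ i v, v ∈ (koszul x y).gr i → f v ∈ (koszul z w).gr (φ i))
    (hg : ∀ i v, v ∈ (koszul x' y').gr i → g v ∈ (koszul z' w').gr (ψ i)) (i : ℤ × ℤ) :
    ∀ t ∈ (tensor (koszul x y) (koszul x' y')).gr i,
      (TensorProduct.map f g : (R × R) ⊗[R] (R × R) →ₗ[R] (R × R) ⊗[R] (R × R)) t ∈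
        (tensor (koszul z w) (koszul z' w')).gr i :=
  map_mem_tensorGr (M := koszul x y) (N := koszul x' y') (M' := koszul z w) (N' := koszul z' w')
    (TensorProduct.map f g) <| by
    rintro a b rfl u hu v hv
    exact tmul_mem_tensorGr (h a b) (hf a u hu) (hg b v hv)

theorem e_mem_gr (x y z w : R) (i : ℤ × ℤ) (v : R × R) (hv : v ∈ (koszul x y).gr i) :
    (e₀₀ R v ∈ (koszul z w).gr i ∧ e₁₁ R v ∈ (koszul z w).gr i) ∧
      e₀₁ R v ∈ (koszul z w).gr (i.1, i.2 + 1) ∧ e₁₀ R v ∈ (koszul z w).gr (i.1, i.2 - 1) := by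
  obtain ⟨n, j⟩ := i
  refine ⟨⟨⟨fun h => hv.1 h, fun _ => rfl⟩, ⟨fun _ => rfl, fun h => hv.2 h⟩⟩,
    ⟨fun h => hv.2 fun h' => h ?_, fun _ => rfl⟩, ⟨fun _ => rfl, fun h => hv.1 fun h' => h ?_⟩⟩ <;>
  · simp only [Prod.mk.injEq] at h' ⊢
    omega

variable {x y x' y' z w z' w' : R}

theorem e_maps_mem (i : ℤ × ℤ) (t : (R × R) ⊗[R] (R × R))
    (ht : t ∈ (tensor (koszul x y) (koszul x' y')).gr i) :
    (TensorProduct.map (e₀₀ R) (e₀₀ R) t ∈ (tensor (koszul z w) (koszul z' w')).gr i ∧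
      TensorProduct.map (e₁₁ R) (e₀₀ R) t ∈ (tensor (koszul z w) (koszul z' w')).gr i ∧
      TensorProduct.map (e₀₁ R) (e₁₀ R) t ∈ (tensor (koszul z w) (koszul z' w')).gr i) ∧
    TensorProduct.map (e₁₀ R) (e₀₁ R) t ∈ (tensor (koszul z w) (koszul z' w')).gr i ∧
      TensorProduct.map (e₀₀ R) (e₁₁ R) t ∈ (tensor (koszul z w) (koszul z' w')).gr i ∧
      TensorProduct.map (e₁₁ R) (e₁₁ R) t ∈ (tensor (koszul z w) (koszul z' w')).gr i := by
  have h := fun x y z w i v hv => (e_mem_gr (R := R) x y z w i v hv).1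
  have h' := fun x y z w i v hv => (e_mem_gr (R := R) x y z w i v hv).2
  have e1 : ∀ a b : ℤ × ℤ, (a.1, a.2 + 1) + (b.1, b.2 - 1) = a + b := fun a b => by
    ext <;> simp
  have e2 : ∀ a b : ℤ × ℤ, (a.1, a.2 - 1) + (b.1, b.2 + 1) = a + b := fun a b => by
    ext <;> simp
  exact ⟨⟨map_mem_gr id id (fun _ _ => rfl) (fun i v hv => (h _ _ _ _ i v hv).1)
      (fun i v hv => (h _ _ _ _ i v hv).1) i t ht,
    map_mem_gr id id (fun _ _ => rfl) (fun i v hv => (h _ _ _ _ i v hv).2)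
      (fun i v hv => (h _ _ _ _ i v hv).1) i t ht,
    map_mem_gr _ _ e1 (fun i v hv => (h' _ _ _ _ i v hv).1)
      (fun i v hv => (h' _ _ _ _ i v hv).2) i t ht⟩,
    map_mem_gr _ _ e2 (fun i v hv => (h' _ _ _ _ i v hv).2)
      (fun i v hv => (h' _ _ _ _ i v hv).1) i t ht,
    map_mem_gr id id (fun _ _ => rfl) (fun i v hv => (h _ _ _ _ i v hv).1)
      (fun i v hv => (h _ _ _ _ i v hv).2) i t ht,
    map_mem_gr id id (fun _ _ => rfl) (fun i v hv => (h _ _ _ _ i v hv).2)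
      (fun i v hv => (h _ _ _ _ i v hv).2) i t ht⟩

theorem posMap_mem (c d : R) (i : ℤ × ℤ) (t : (R × R) ⊗[R] (R × R))
    (ht : t ∈ (tensor (koszul x y) (koszul x' y')).gr i) :
    posMap c d t ∈ (tensor (koszul z w) (koszul z' w')).gr i := by
  obtain ⟨⟨h1, h2, h3⟩, h4, h5, h6⟩ :=
    e_maps_mem (x := x) (y := y) (x' := x') (y' := y') (z := z) (w := w) (z' := z') (w' := w') i t ht
  exact add_mem (add_mem (add_mem (add_mem (add_mem h1 h2) h3) (Submodule.smul_mem _ _ h4))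
    (Submodule.smul_mem _ _ h5)) (Submodule.smul_mem _ _ h6)

theorem negMap_mem (c d : R) (i : ℤ × ℤ) (t : (R × R) ⊗[R] (R × R))
    (ht : t ∈ (tensor (koszul x y) (koszul x' y')).gr i) :
    negMap c d t ∈ (tensor (koszul z w) (koszul z' w')).gr i := by
  obtain ⟨⟨h1, h2, h3⟩, h4, h5, h6⟩ :=
    e_maps_mem (x := x) (y := y) (x' := x') (y' := y') (z := z) (w := w) (z' := z') (w' := w') i t ht
  exact add_mem (add_mem (sub_mem (sub_mem (add_mem (Submodule.smul_mem _ _ h1)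
    (Submodule.smul_mem _ _ h2)) h3) (Submodule.smul_mem _ _ h4)) h5) h6

theorem posMap_gen (c d : R) : posMap c d ((1, 0) ⊗ₜ (1, 0)) = (1, 0) ⊗ₜ (1, 0) := by
  obtain ⟨u, w, hu, hw, ⟨h1, h2, h3, h4, h5, h6, h7, h8⟩, h, h9, h10⟩ := basis_rules R
  rw [← hu]
  simp [posMap, h1, h3, h5, h7]

theorem negMap_gen (c d : R) :
    negMap c d ((1, 0) ⊗ₜ (1, 0)) = (d - c) • ((1, 0) ⊗ₜ[R] (1, 0)) := by
  obtain ⟨u, w, hu, hw, ⟨h1, h2, h3, h4, h5, h6, h7, h8⟩, h, h9, h10⟩ := basis_rules R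
  rw [← hu]
  simp [negMap, h1, h3, h5, h7]

end Matrices

/-- The choices in the definition of the Khovanov-Rozansky complexes can be made. -/
theorem CrossingData.exists (p : Polynomial k) : Nonempty (CrossingData p) := by
  obtain ⟨y, hy⟩ := exists_wide p
  have e1 : (X 0 + X 1 - X 2 - X 3 : MvPolynomial (Fin 4) k) = (X 0 - X 3) + (X 1 - X 2) := by ring
  have e2 : (X 0 * X 1 - X 2 * X 3 : MvPolynomial (Fin 4) k) =
      X 2 * (X 0 - X 3) + X 0 * (X 1 - X 2) := by ring
  let y₂ : Fin 2 → MvPolynomial (Fin 4) k := ![y 0 + X 2 * y 1, y 0 + X 0 * y 1]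
  have dp1 : (wide y).dp = dpMap ((X 0 - X 3) + (X 1 - X 2))
      (X 2 * (X 0 - X 3) + X 0 * (X 1 - X 2)) := by
    rw [← e1, ← e2]; exact tensor_koszul_dp _ _ _ _
  have dp2 : (smooth y₂).dp = dpMap (X 0 - X 3) (X 1 - X 2) := tensor_koszul_dp _ _ _ _
  have dm1 : (wide y).dm = dmMap (y 0) (y 1) := tensor_koszul_dm _ _ _ _
  have dm2 : (smooth y₂).dm = dmMap (y 0 + X 2 * y 1) (y 0 + X 0 * y 1) := tensor_koszul_dm _ _ _ _
  exact ⟨{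
    y₁ := y
    y₂ := y₂
    potential₁ := hy
    potential₂ := by
      rw [← hy]
      change (X 0 - X 3) * (y 0 + X 2 * y 1) + (X 1 - X 2) * (y 0 + X 0 * y 1) = _
      ring
    pos := posMap (X 2) (X 0)
    pos_mem := posMap_mem _ _
    pos_dp := by rw [dp1, dp2]; exact posMap_dp _ _ _ _
    pos_dm := by rw [dm1, dm2]; exact posMap_dm _ _ _ _
    pos_gen := congrArg (smooth y₂).naiveMk (posMap_gen (X 2) (X 0))
    neg := negMap (X 2) (X 0)
    neg_mem := negMap_mem _ _
    neg_dp := by rw [dp1, dp2]; exact negMap_dp _ _ _ _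
    neg_dm := by rw [dm1, dm2]; exact negMap_dm _ _ _ _
    neg_gen := (congrArg (wide y).naiveMk (negMap_gen (X 2) (X 0))).trans
      ((wide y).naiveMk.map_smul _ _) }⟩

end Existence

end KhR

open KhR KhR.MFComplex

-- The proof combines an elimination of variables, which compares the glued complex with that of
-- `U`, with a resolution argument, which compares the complexes of the acyclic pieces with their
-- naive complexes.
--
-- Elimination. Both complexes are tensor products of the same crossing complexes with Koszul
-- factorizations of edges. In the glued one, an edge of `U` is replaced by a chain of edges and
-- arcs, with an extra variable at every inner point. If `v` is an inner point between `a` and `b`,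
-- its variable occurs only in the two factors on `t_v - t_a` and `t_b - t_v`; all other factors are
-- extended from the ring without `t_v`. The first factor makes a mapping cone of multiplication by
-- `t_v - t_a`. Division with remainder by this element contracts the cone onto the quotient where
-- `t_v = t_a` (`HEquiv.eliminate`), and there the second factor becomes that of an edge from `a` to
-- `b` (`hEquiv_contract_edge`). On a closed chain without crossings one point is kept; what remains
-- is a loop, whose factor is that of a crossingless component. Induction on the number of inner
-- points (`hEquiv_of_contracts`, with the combinatorics in `Factorization.exists_contracts`) gives
-- the homotopy equivalence, linear over all variables that are kept.
--
-- Resolution. In an acyclic diagram the flags can be ranked so that every factor relates its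
-- outputs to inputs of smaller rank. Removing one factor therefore amounts to dividing by regular
-- elements which identify its outputs with its inputs, and the remaining factors again form an
-- acyclic system. For the factorization `smooth` the two entries are linear. For `wide` the linear
-- entry gives `t_0 = t_2 + t_3 - t_1`, after which the other one is `-(t_1 - t_2)(t_1 - t_3)`, a
-- product of two elements of the previous kind. So the homology for `dp` lives in degree `0`
-- (`resolves_of_layered`). Tangles in different holes share no variables, so this holds for the
-- tensor product of all of them. By right exactness, the tensor product of the projections is the
-- projection of this tensor product onto its `H^0` (`IsNaiveProj.tensorFin`).
--
-- Near-isomorphism. Let `X` be such a resolution, `Z` the flat factorization of the arcs and `D` a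
-- projective factorization. After tensoring with `Z` and `D`, `dp` of `X` is still exact in
-- negative degrees, and it is the part of the total differential which raises the degree in `X`;
-- the rest preserves or lowers it. Since `X` is bounded, a cycle in the kernel of the projection
-- can be removed from its top degree downwards (`exists_primitive`), so the kernel is acyclic
-- (`nearIso_of_resolves`). Homotopy equivalences are near-isomorphisms too, and near-isomorphisms
-- compose. For links, the unit factorization is an admissible `D`.

attribute [reducible] MFComplex.tensor MFComplex.unit MFComplex.koszul MFComplex.twoTerm TangleDiagram.kr
  MFComplex.naive MFComplex.restrict MFComplex.baseChange

namespace KhR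

open TensorProduct

/-! ### Homogeneous components in graded modules. -/

section Components
variable {R M ι : Type*} [CommRing R] [AddCommGroup M] [Module R M] [DecidableEq ι]
  {A : ι → Submodule R M}

theorem comp_apply_mem (h : DirectSum.IsInternal A) (i : ι) (x : M) : comp A h x i ∈ A i := by
  have hx : x ∈ ⨆ j, A j := by rw [h.submodule_iSup_eq_top]; trivial
  induction hx using Submodule.iSup_induction' with
  | zero => simp
  | add a b _ _ ha hb => rw [map_add, Finsupp.add_apply]; exact add_mem ha hb
  | mem j y hy =>
    rw [comp_of_mem h hy, Finsupp.single_apply]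
    split_ifs with e
    · exact e ▸ hy
    · exact zero_mem _

theorem lsum_comp (h : DirectSum.IsInternal A) :
    Finsupp.lsum R (fun _ : ι => (LinearMap.id : M →ₗ[R] M)) ∘ₗ comp A h = LinearMap.id :=
  ext_homogeneous h.submodule_iSup_eq_top fun i x hx => by
    simp [comp_of_mem h hx]

theorem eq_sum_comp (h : DirectSum.IsInternal A) (x : M) :
    (comp A h x).sum (fun _ y => y) = x := by
  exact LinearMap.congr_fun (lsum_comp h) x

/-- The component of `f x` in degree `φ i` is the image of the component of `x` in degree `i`;
injectivity of `φ` ensures that no other component contributes. Hence one component of `x` already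
is a preimage. -/
theorem exists_homogeneous_preimage {N : Type*} [AddCommGroup N] [Module R N]
    {B : ι → Submodule R N} (hA : DirectSum.IsInternal A) (hB : DirectSum.IsInternal B)
    (f : M →ₗ[R] N) (φ : ι → ι) (hφ : Function.Injective φ)
    (hf : ∀ i, ∀ x ∈ A i, f x ∈ B (φ i)) {i : ι} {x : M} (hx : f x ∈ B (φ i)) :
    ∃ y ∈ A i, f y = f x := by
  have key : (Finsupp.lapply (φ i) ∘ₗ comp B hB) ∘ₗ f = f ∘ₗ Finsupp.lapply i ∘ₗ comp A hA :=
    ext_homogeneous hA.submodule_iSup_eq_top fun j y hy => by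
      simp only [LinearMap.comp_apply, Finsupp.lapply_apply, comp_of_mem hA hy,
        comp_of_mem hB (hf j y hy), Finsupp.single_apply, hφ.eq_iff]
      split_ifs <;> simp
  refine ⟨comp A hA x i, comp_apply_mem hA i x, ?_⟩
  have := LinearMap.congr_fun key x
  simp only [LinearMap.comp_apply, Finsupp.lapply_apply, comp_of_mem hB hx,
    Finsupp.single_eq_same] at this
  exact this.symm

end Components

/-! ### The symmetric monoidal structure on complexes of matrix factorizations. -/

namespace MFComplex
variable {R : Type u} [CommRing R]

theorem zsmul_tmul {M N : Type*} [AddCommGroup M] [Module R M] [AddCommGroup N] [Module R N]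
    (n : ℤ) (x : M) (y : N) : (n • x) ⊗ₜ[R] y = n • (x ⊗ₜ[R] y) :=
  map_zsmul ((TensorProduct.mk R M N).flip y) n x

theorem tmul_zsmul {M N : Type*} [AddCommGroup M] [Module R M] [AddCommGroup N] [Module R N]
    (n : ℤ) (x : M) (y : N) : x ⊗ₜ[R] (n • y) = n • (x ⊗ₜ[R] y) :=
  map_zsmul (TensorProduct.mk R M N x) n y

theorem tensor_ext {M N : MFComplex R} {P : Type*} [AddCommGroup P] [Module R P]
    {f g : M.carrier ⊗[R] N.carrier →ₗ[R] P}
    (h : ∀ a b, ∀ x ∈ M.gr a, ∀ y ∈ N.gr b, f (x ⊗ₜ y) = g (x ⊗ₜ y)) : f = g := by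
  refine ext_homogeneous (tensorGr_internal M N).submodule_iSup_eq_top fun i x hx => ?_
  have : tensorGr M N i ≤ LinearMap.eqLocus f g := by
    rw [tensorGr, Submodule.span_le]
    rintro _ ⟨a, b, _, x, hx, y, hy, rfl⟩
    exact h a b x hx y hy
  exact this hx

/-- The sign `(-1) ^ n` as an integer. -/
abbrev eps (n : ℤ) : ℤ := ((n.negOnePow : ℤˣ) : ℤ)

theorem eps_mul_self (n : ℤ) : eps n * eps n = 1 := by
  rw [eps, ← Units.val_mul, Int.units_mul_self]; rfl

theorem eps_add (m n : ℤ) : eps (m + n) = eps m * eps n := by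
  rw [eps, Int.negOnePow_add]; rfl

theorem eps_one : eps 1 = -1 := by simp [eps]

theorem eps_neg (n : ℤ) : eps (-n) = eps n := by simp [eps]

theorem eps_sub (m n : ℤ) : eps (m - n) = eps m * eps n := by
  rw [sub_eq_add_neg, eps_add, eps_neg]

/-- Isomorphisms of complexes of graded matrix factorizations. -/
structure GrIso (M N : MFComplex R) where
  e : M.carrier ≃ₗ[R] N.carrier
  mem : ∀ i, ∀ x ∈ M.gr i, e x ∈ N.gr i
  dp : ∀ x, e (M.dp x) = N.dp (e x)
  dm : ∀ x, e (M.dm x) = N.dm (e x)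
  del : ∀ x, e (M.del x) = N.del (e x)
  pot : M.potential = N.potential

/-- Two complexes are isomorphic. -/
def Isom (M N : MFComplex R) : Prop := Nonempty (GrIso M N)

namespace GrIso
variable {M N P : MFComplex R}

/-- A homogeneous element has a homogeneous preimage, and by injectivity this is the only one. So
compatibility with the gradings needs to be required in one direction only. -/
theorem mem_symm (f : GrIso M N) : ∀ i, ∀ x ∈ N.gr i, f.e.symm x ∈ M.gr i := fun i x hx => by
  obtain ⟨y, hy, h⟩ := exists_homogeneous_preimage M.internal N.internal f.e.toLinearMap id
    Function.injective_id f.mem (i := i) (x := f.e.symm x) (by simpa using hx)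
  have : y = f.e.symm x := f.e.injective h
  exact this ▸ hy

/-- The identity. -/
def refl (M : MFComplex R) : GrIso M M :=
  ⟨LinearEquiv.refl R _, fun _ _ h => h, fun _ => rfl, fun _ => rfl, fun _ => rfl, rfl⟩

/-- The inverse. -/
def symm (f : GrIso M N) : GrIso N M where
  e := f.e.symm
  mem := f.mem_symm
  dp x := by rw [LinearEquiv.symm_apply_eq, f.dp, LinearEquiv.apply_symm_apply]
  dm x := by rw [LinearEquiv.symm_apply_eq, f.dm, LinearEquiv.apply_symm_apply]
  del x := by rw [LinearEquiv.symm_apply_eq, f.del, LinearEquiv.apply_symm_apply]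
  pot := f.pot.symm

/-- Composition. -/
def trans (f : GrIso M N) (g : GrIso N P) : GrIso M P where
  e := f.e.trans g.e
  mem i x hx := g.mem i _ (f.mem i x hx)
  dp x := by simp [f.dp, g.dp]
  dm x := by simp [f.dm, g.dm]
  del x := by simp [f.del, g.del]
  pot := f.pot.trans g.pot

end GrIso

theorem Isom.refl (M : MFComplex R) : Isom M M := ⟨GrIso.refl M⟩

theorem Isom.symm {M N : MFComplex R} (h : Isom M N) : Isom N M := h.map GrIso.symm

theorem Isom.trans {M N P : MFComplex R} (h : Isom M N) (h' : Isom N P) : Isom M P :=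
  let ⟨f⟩ := h
  let ⟨g⟩ := h'
  ⟨f.trans g⟩

theorem Isom.of_eq {M N : MFComplex R} (h : M = N) : Isom M N := h ▸ Isom.refl M

/-- An isomorphism out of a tensor product, checked on homogeneous elements. -/
theorem isom_of_tensor {M N P : MFComplex R} (e : M.carrier ⊗[R] N.carrier ≃ₗ[R] P.carrier)
    (hmem : ∀ a b, ∀ x ∈ M.gr a, ∀ y ∈ N.gr b, e (x ⊗ₜ y) ∈ P.gr (a + b))
    (hdp : ∀ a b, ∀ x ∈ M.gr a, ∀ y ∈ N.gr b,
      e (M.dp x ⊗ₜ y + eps a.2 • (x ⊗ₜ N.dp y)) = P.dp (e (x ⊗ₜ y)))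
    (hdm : ∀ a b, ∀ x ∈ M.gr a, ∀ y ∈ N.gr b,
      e (M.dm x ⊗ₜ y + eps a.2 • (x ⊗ₜ N.dm y)) = P.dm (e (x ⊗ₜ y)))
    (hdel : ∀ a b, ∀ x ∈ M.gr a, ∀ y ∈ N.gr b,
      e (M.del x ⊗ₜ y + eps a.1 • (x ⊗ₜ N.del y)) = P.del (e (x ⊗ₜ y)))
    (hpot : M.potential + N.potential = P.potential) : Isom (tensor M N) P := by
  refine ⟨⟨e, fun i => ?_, fun x => ?_, fun x => ?_, fun x => ?_, hpot⟩⟩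
  · intro t ht
    have : tensorGr M N i ≤ (P.gr i).comap e.toLinearMap := by
      rw [tensorGr, Submodule.span_le]
      rintro _ ⟨a, b, rfl, x, hx, y, hy, rfl⟩
      exact hmem a b x hx y hy
    exact this ht
  · have : e.toLinearMap ∘ₗ (TensorProduct.map M.dp LinearMap.id + TensorProduct.map M.sgn N.dp) =
        P.dp ∘ₗ e.toLinearMap := tensor_ext fun a b x hx y hy => by
      rw [LinearMap.comp_apply, LinearMap.comp_apply, LinearEquiv.coe_coe, ← hdp a b x hx y hy,
        LinearMap.add_apply, TensorProduct.map_tmul, TensorProduct.map_tmul, sgn,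
        sign_of_mem M _ hx, zsmul_tmul, LinearMap.id_apply]
    exact LinearMap.congr_fun this x
  · have : e.toLinearMap ∘ₗ (TensorProduct.map M.dm LinearMap.id + TensorProduct.map M.sgn N.dm) =
        P.dm ∘ₗ e.toLinearMap := tensor_ext fun a b x hx y hy => by
      rw [LinearMap.comp_apply, LinearMap.comp_apply, LinearEquiv.coe_coe, ← hdm a b x hx y hy,
        LinearMap.add_apply, TensorProduct.map_tmul, TensorProduct.map_tmul, sgn,
        sign_of_mem M _ hx, zsmul_tmul, LinearMap.id_apply]
    exact LinearMap.congr_fun this x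
  · have : e.toLinearMap ∘ₗ (TensorProduct.map M.del LinearMap.id +
        TensorProduct.map M.hsgn N.del) =
        P.del ∘ₗ e.toLinearMap := tensor_ext fun a b x hx y hy => by
      rw [LinearMap.comp_apply, LinearMap.comp_apply, LinearEquiv.coe_coe, ← hdel a b x hx y hy,
        LinearMap.add_apply, TensorProduct.map_tmul, TensorProduct.map_tmul, hsgn,
        sign_of_mem M _ hx, zsmul_tmul, LinearMap.id_apply]
    exact LinearMap.congr_fun this x

section TensorRules
variable {M N : MFComplex R} {a b : ℤ × ℤ}

theorem tensor_dp_tmul {x : M.carrier} (hx : x ∈ M.gr a) (y : N.carrier) :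
    (tensor M N).dp (x ⊗ₜ[R] y : M.carrier ⊗[R] N.carrier) =
      (M.dp x ⊗ₜ[R] y + eps a.2 • (x ⊗ₜ[R] N.dp y) : M.carrier ⊗[R] N.carrier) := by
  change (TensorProduct.map M.dp (LinearMap.id : N.carrier →ₗ[R] N.carrier) + TensorProduct.map M.sgn N.dp) (x ⊗ₜ[R] y) = _
  rw [LinearMap.add_apply, TensorProduct.map_tmul, TensorProduct.map_tmul, sgn,
        sign_of_mem M _ hx, zsmul_tmul, LinearMap.id_apply]

theorem tensor_dm_tmul {x : M.carrier} (hx : x ∈ M.gr a) (y : N.carrier) :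
    (tensor M N).dm (x ⊗ₜ[R] y : M.carrier ⊗[R] N.carrier) =
      (M.dm x ⊗ₜ[R] y + eps a.2 • (x ⊗ₜ[R] N.dm y) : M.carrier ⊗[R] N.carrier) := by
  change (TensorProduct.map M.dm (LinearMap.id : N.carrier →ₗ[R] N.carrier) + TensorProduct.map M.sgn N.dm) (x ⊗ₜ[R] y) = _
  rw [LinearMap.add_apply, TensorProduct.map_tmul, TensorProduct.map_tmul, sgn,
        sign_of_mem M _ hx, zsmul_tmul, LinearMap.id_apply]

theorem tensor_del_tmul {x : M.carrier} (hx : x ∈ M.gr a) (y : N.carrier) :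
    (tensor M N).del (x ⊗ₜ[R] y : M.carrier ⊗[R] N.carrier) =
      (M.del x ⊗ₜ[R] y + eps a.1 • (x ⊗ₜ[R] N.del y) : M.carrier ⊗[R] N.carrier) := by
  change (TensorProduct.map M.del (LinearMap.id : N.carrier →ₗ[R] N.carrier) + TensorProduct.map M.hsgn N.del) (x ⊗ₜ[R] y) = _
  rw [LinearMap.add_apply, TensorProduct.map_tmul, TensorProduct.map_tmul, hsgn,
        sign_of_mem M _ hx, zsmul_tmul, LinearMap.id_apply]

end TensorRules

theorem Isom.tensor {M M' N N' : MFComplex R} (h : Isom M M') (h' : Isom N N') :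
    Isom (tensor M N) (tensor M' N') := by
  obtain ⟨f⟩ := h
  obtain ⟨g⟩ := h'
  refine isom_of_tensor (P := MFComplex.tensor M' N') (TensorProduct.congr f.e g.e)
    (fun a b x hx y hy => tmul_mem_tensorGr rfl (f.mem a x hx) (g.mem b y hy))
    (fun a b x hx y hy => ?_) (fun a b x hx y hy => ?_) (fun a b x hx y hy => ?_)
    (by rw [f.pot, g.pot])
  · rw [map_add, map_zsmul, congr_tmul, congr_tmul, congr_tmul, f.dp, g.dp]
    exact (tensor_dp_tmul (f.mem a x hx) _).symm
  · rw [map_add, map_zsmul, congr_tmul, congr_tmul, congr_tmul, f.dm, g.dm]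
    exact (tensor_dm_tmul (f.mem a x hx) _).symm
  · rw [map_add, map_zsmul, congr_tmul, congr_tmul, congr_tmul, f.del, g.del]
    exact (tensor_del_tmul (f.mem a x hx) _).symm

theorem unit_isom_tensor (M : MFComplex R) : Isom (tensor (unit R) M) M := by
  have h0 : ∀ (a : ℤ × ℤ) (x : R), x ∈ (unit R).gr a → a ≠ 0 → x = 0 := fun a x hx ha => by
    have : (unit R).gr a = ⊥ := if_neg ha
    rw [this] at hx
    exact hx
  -- Nonzero elements of the unit have degree `0` for both gradings, so the Koszul signs are
  -- trivial.
  have h1 : ∀ (a : ℤ × ℤ) (x : R), x ∈ (unit R).gr a → ∀ i (hi : i = a.1 ∨ i = a.2)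
      (y : M.carrier), eps i • x • y = x • y := fun a x hx i hi y => by
    by_cases ha : a = 0
    · subst ha
      have : i = 0 := by simpa using hi
      subst this
      simp [eps]
    · simp [h0 a x hx ha]
  refine isom_of_tensor (M := unit R) (TensorProduct.lid R M.carrier) (fun a b x hx y hy => ?_)
    (fun a b x hx y hy => ?_) (fun a b x hx y hy => ?_) (fun a b x hx y hy => ?_) (zero_add _)
  · refine (congrArg (· ∈ M.gr (a + b)) (lid_tmul y x)).mpr ?_
    by_cases ha : a = 0
    · subst ha
      rw [zero_add]
      exact Submodule.smul_mem _ _ hy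
    · rw [h0 a x hx ha, zero_smul]
      exact zero_mem _
  · change TensorProduct.lid R M.carrier ((0 : R) ⊗ₜ y + eps a.2 • (x ⊗ₜ M.dp y)) =
      M.dp (TensorProduct.lid R M.carrier (x ⊗ₜ y))
    rw [map_add, map_zsmul, lid_tmul, lid_tmul, lid_tmul, h1 a x hx _ (Or.inr rfl), map_smul,
      zero_smul, zero_add]
  · change TensorProduct.lid R M.carrier ((0 : R) ⊗ₜ y + eps a.2 • (x ⊗ₜ M.dm y)) =
      M.dm (TensorProduct.lid R M.carrier (x ⊗ₜ y))
    rw [map_add, map_zsmul, lid_tmul, lid_tmul, lid_tmul, h1 a x hx _ (Or.inr rfl), map_smul,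
      zero_smul, zero_add]
  · change TensorProduct.lid R M.carrier ((0 : R) ⊗ₜ y + eps a.1 • (x ⊗ₜ M.del y)) =
      M.del (TensorProduct.lid R M.carrier (x ⊗ₜ y))
    rw [map_add, map_zsmul, lid_tmul, lid_tmul, lid_tmul, h1 a x hx _ (Or.inl rfl), map_smul,
      zero_smul, zero_add]

/-- The symmetry of the tensor product, with the Koszul signs of both gradings. -/
noncomputable def braid (M N : MFComplex R) :
    M.carrier ⊗[R] N.carrier →ₗ[R] N.carrier ⊗[R] M.carrier :=
  TensorProduct.lift (Finsupp.lsum R (fun i : ℤ × ℤ =>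
    ((TensorProduct.mk R N.carrier M.carrier).flip.compl₂
      (N.sign fun b => i.1 * b.1 + i.2 * b.2))) ∘ₗ comp M.gr M.internal)

theorem braid_tmul {M N : MFComplex R} {a b : ℤ × ℤ} {x : M.carrier} (hx : x ∈ M.gr a)
    {y : N.carrier} (hy : y ∈ N.gr b) :
    braid M N (x ⊗ₜ y) = eps (a.1 * b.1 + a.2 * b.2) • (y ⊗ₜ x) := by
  rw [braid, lift.tmul, LinearMap.comp_apply, comp_of_mem M.internal hx, Finsupp.lsum_single,
    LinearMap.compl₂_apply, sign_of_mem N _ hy, LinearMap.flip_apply, mk_apply, zsmul_tmul]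

theorem braid_braid (M N : MFComplex R) : braid N M ∘ₗ braid M N = LinearMap.id :=
  tensor_ext fun a b x hx y hy => by
    rw [LinearMap.comp_apply, braid_tmul hx hy, map_zsmul, braid_tmul hy hx, smul_smul,
      mul_comm b.1, mul_comm b.2, eps_mul_self, one_smul, LinearMap.id_apply]

/-- Each differential shifts one of the two gradings by one. This changes the sign of the braiding
by the parity of the other factor in the same grading, which is the Koszul sign by which the two
Leibniz rules differ. -/
theorem tensor_comm (M N : MFComplex R) : Isom (tensor M N) (tensor N M) := by
  refine isom_of_tensor (P := tensor N M) (LinearEquiv.ofLinearMap (braid M N) (braid N M)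
    (braid_braid N M) (braid_braid M N)) (fun a b x hx y hy => ?_)
    (fun a b x hx y hy => ?_) (fun a b x hx y hy => ?_) (fun a b x hx y hy => ?_)
    (add_comm _ _)
  · rw [LinearEquiv.coe_ofLinearMap, braid_tmul hx hy]
    exact zsmul_mem (tmul_mem_tensorGr (add_comm b a) hy hx) _
  · rw [LinearEquiv.coe_ofLinearMap, map_add, map_zsmul,
      braid_tmul hx hy, braid_tmul (M.dp_mem a x hx) hy, braid_tmul hx (N.dp_mem b y hy)]
    refine Eq.trans ?_ (map_zsmul (MFComplex.tensor N M).dp _ _).symm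
    rw [tensor_dp_tmul hy]
    simp only [mul_add, add_mul, one_mul, mul_one, eps_add, smul_add, smul_smul]
    rw [add_comm]
    congr 2
    rw [mul_comm (eps a.2), mul_assoc, mul_assoc, eps_mul_self, mul_one]
    rw [mul_assoc]
  · rw [LinearEquiv.coe_ofLinearMap, map_add, map_zsmul,
      braid_tmul hx hy, braid_tmul (M.dm_mem a x hx) hy, braid_tmul hx (N.dm_mem b y hy)]
    refine Eq.trans ?_ (map_zsmul (MFComplex.tensor N M).dm _ _).symm
    rw [tensor_dm_tmul hy]
    simp only [mul_sub, sub_mul, one_mul, mul_one, eps_add, eps_sub, smul_add, smul_smul]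
    rw [add_comm]
    congr 2
    rw [mul_comm (eps a.2), mul_assoc, mul_assoc, eps_mul_self, mul_one]
    rw [mul_assoc]
  · rw [LinearEquiv.coe_ofLinearMap, map_add, map_zsmul,
      braid_tmul hx hy, braid_tmul (M.del_mem a x hx) hy, braid_tmul hx (N.del_mem b y hy)]
    refine Eq.trans ?_ (map_zsmul (MFComplex.tensor N M).del _ _).symm
    rw [tensor_del_tmul hy]
    simp only [mul_add, add_mul, one_mul, mul_one, eps_add, smul_add, smul_smul]
    rw [add_comm]
    have h1 := eps_mul_self a.1
    congr 2
    · linear_combination (eps (a.1 * b.1) * eps (a.2 * b.2)) * h1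
    · ring

/-- No sign is needed in the associator: in each grading the sign of `x ⊗ y` is the product of the
signs of `x` and `y`. -/
theorem tensor_assoc (M N P : MFComplex R) :
    Isom (tensor (tensor M N) P) (tensor M (tensor N P)) := by
  have ext3 : ∀ {Q : Type u} [AddCommGroup Q] [Module R Q]
      {f g : (M.carrier ⊗[R] N.carrier) ⊗[R] P.carrier →ₗ[R] Q},
      (∀ a b c, ∀ x ∈ M.gr a, ∀ y ∈ N.gr b, ∀ z ∈ P.gr c, f (x ⊗ₜ y ⊗ₜ z) = g (x ⊗ₜ y ⊗ₜ z)) →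
      f = g := fun {Q} _ _ f g h => by
    refine TensorProduct.ext ?_
    refine tensor_ext fun a b x hx y hy => ?_
    exact ext_homogeneous P.iSup_gr fun c z hz => h a b c x hx y hy z hz
  let e := TensorProduct.assoc R M.carrier N.carrier P.carrier
  refine ⟨⟨e, fun i => ?_, fun x => ?_, fun x => ?_, fun x => ?_, add_assoc _ _ _⟩⟩
  · intro t ht
    have : tensorGr (tensor M N) P i ≤ (tensorGr M (tensor N P) i).comap e.toLinearMap := by
      rw [tensorGr, Submodule.span_le]
      rintro _ ⟨a, b, rfl, x, hx, z, hz, rfl⟩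
      have : tensorGr M N a ≤ (tensorGr M (tensor N P) (a + b)).comap (e.toLinearMap ∘ₗ
          (TensorProduct.mk R (M.carrier ⊗[R] N.carrier) P.carrier).flip z) := by
        rw [tensorGr, Submodule.span_le]
        rintro _ ⟨a, b', rfl, x, hx, y, hy, rfl⟩
        exact tmul_mem_tensorGr (add_assoc _ _ _).symm hx
          (tmul_mem_tensorGr (M := N) (N := P) rfl hy hz)
      exact this hx
    exact this ht
  · have : e.toLinearMap ∘ₗ (tensor (tensor M N) P).dp =
        (tensor M (tensor N P)).dp ∘ₗ e.toLinearMap := by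
      refine ext3 fun a b c x hx y hy z hz => ?_
      have h1 := tensor_dp_tmul (M := tensor M N) (N := P)
        (tmul_mem_tensorGr rfl hx hy) z
      have h2 := tensor_dp_tmul hx y
      have h3 := tensor_dp_tmul (N := tensor N P) hx (y ⊗ₜ[R] z : N.carrier ⊗[R] P.carrier)
      have h4 := tensor_dp_tmul hy z
      refine (congrArg e h1).trans (Eq.trans ?_ h3.symm)
      rw [h2, h4]
      rw [map_add, map_zsmul, add_tmul, zsmul_tmul, map_add, map_zsmul, Prod.snd_add, eps_add]
      simp only [e, TensorProduct.assoc_tmul, tmul_add, tmul_zsmul, smul_add, smul_smul, add_assoc]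
    exact LinearMap.congr_fun this x
  · have : e.toLinearMap ∘ₗ (tensor (tensor M N) P).dm =
        (tensor M (tensor N P)).dm ∘ₗ e.toLinearMap := by
      refine ext3 fun a b c x hx y hy z hz => ?_
      have h1 := tensor_dm_tmul (M := tensor M N) (N := P)
        (tmul_mem_tensorGr rfl hx hy) z
      have h2 := tensor_dm_tmul hx y
      have h3 := tensor_dm_tmul (N := tensor N P) hx (y ⊗ₜ[R] z : N.carrier ⊗[R] P.carrier)
      have h4 := tensor_dm_tmul hy z
      refine (congrArg e h1).trans (Eq.trans ?_ h3.symm)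
      rw [h2, h4]
      rw [map_add, map_zsmul, add_tmul, zsmul_tmul, map_add, map_zsmul, Prod.snd_add, eps_add]
      simp only [e, TensorProduct.assoc_tmul, tmul_add, tmul_zsmul, smul_add, smul_smul, add_assoc]
    exact LinearMap.congr_fun this x
  · have : e.toLinearMap ∘ₗ (tensor (tensor M N) P).del =
        (tensor M (tensor N P)).del ∘ₗ e.toLinearMap := by
      refine ext3 fun a b c x hx y hy z hz => ?_
      have h1 := tensor_del_tmul (M := tensor M N) (N := P)
        (tmul_mem_tensorGr rfl hx hy) z
      have h2 := tensor_del_tmul hx y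
      have h3 := tensor_del_tmul (N := tensor N P) hx (y ⊗ₜ[R] z : N.carrier ⊗[R] P.carrier)
      have h4 := tensor_del_tmul hy z
      refine (congrArg e h1).trans (Eq.trans ?_ h3.symm)
      rw [h2, h4]
      rw [map_add, map_zsmul, add_tmul, zsmul_tmul, map_add, map_zsmul, Prod.fst_add, eps_add]
      simp only [e, TensorProduct.assoc_tmul, tmul_add, tmul_zsmul, smul_add, smul_smul, add_assoc]
    exact LinearMap.congr_fun this x

/-- The tensor product of a list of complexes. -/
noncomputable def tensorList : List (MFComplex R) → MFComplex R
  | [] => unit R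
  | M :: l => tensor M (tensorList l)

theorem tensorFin_eq_tensorList : ∀ (m : ℕ) (M : Fin m → MFComplex R),
    tensorFin m M = tensorList (List.ofFn M)
  | 0, _ => by rw [List.ofFn_zero]; rfl
  | m + 1, M => by
    rw [List.ofFn_succ, tensorFin, tensorFin_eq_tensorList m, tensorList]

/-- Adjacent transpositions suffice, and they come from `tensor_comm` between two associators. The
complexes to be compared list their factors in different orders, and this is how the factors are
matched. -/
theorem tensorList_perm {l l' : List (MFComplex R)} (h : l.Perm l') :
    Isom (tensorList l) (tensorList l') := by
  induction h with
  | nil => exact Isom.refl _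
  | cons M _ ih => exact (Isom.refl M).tensor ih
  | swap M N l =>
    exact (tensor_assoc _ _ _).symm.trans (((tensor_comm N M).tensor (Isom.refl _)).trans
      (tensor_assoc _ _ _))
  | trans _ _ h1 h2 => exact h1.trans h2

theorem tensorList_append : ∀ l l' : List (MFComplex R),
    Isom (tensorList (l ++ l')) (tensor (tensorList l) (tensorList l'))
  | [], l' => (unit_isom_tensor (tensorList l')).symm
  | M :: l, l' => ((Isom.refl M).tensor (tensorList_append l l')).trans (tensor_assoc _ _ _).symm

theorem tensorList_forall₂ {l l' : List (MFComplex R)} (h : List.Forall₂ Isom l l') :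
    Isom (tensorList l) (tensorList l') := by
  induction h with
  | nil => exact Isom.refl _
  | cons h _ ih => exact h.tensor ih

theorem tensorList_flatten {l : List (List (MFComplex R))} :
    Isom (tensorList l.flatten) (tensorList (l.map tensorList)) := by
  induction l with
  | nil => exact Isom.refl _
  | cons a l ih =>
    rw [List.flatten_cons]
    exact (tensorList_append a l.flatten).trans ((Isom.refl _).tensor ih)

end MFComplex
end KhR

namespace KhR
open TensorProduct
namespace MFComplex
-- Extension of scalars as a monoidal operation.
section BaseChange
variable {R R' : Type u} [CommRing R] [CommRing R'] (g : R →+* R')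

/-- The element `1 ⊗ x` of an extension of scalars. -/
noncomputable def bcMk (M : MFComplex R) (x : M.carrier) : (M.baseChange g).carrier :=
  letI := g.toAlgebra
  (1 : R') ⊗ₜ[R] x

theorem bcMk_mem {M : MFComplex R} {i : ℤ × ℤ} {x : M.carrier} (hx : x ∈ M.gr i) :
    bcMk g M x ∈ (M.baseChange g).gr i :=
  Submodule.subset_span ⟨x, hx, rfl⟩

theorem bcMk_add (M : MFComplex R) (x y : M.carrier) :
    bcMk g M (x + y) = bcMk g M x + bcMk g M y :=
  let := g.toAlgebra
  tmul_add _ _ _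

theorem bcMk_zsmul (M : MFComplex R) (n : ℤ) (x : M.carrier) :
    bcMk g M (n • x) = n • bcMk g M x :=
  let := g.toAlgebra
  tmul_zsmul n (1 : R') x

theorem bcMk_smul (M : MFComplex R) (r : R) (x : M.carrier) :
    bcMk g M (r • x) = g r • bcMk g M x := by
  let := g.toAlgebra
  change (1 : R') ⊗ₜ[R] (r • x) = g r • ((1 : R') ⊗ₜ[R] x)
  rw [tmul_smul, smul_tmul', smul_tmul', smul_eq_mul, mul_one, Algebra.smul_def, mul_one]
  rfl

theorem bcMk_dp (M : MFComplex R) (x : M.carrier) :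
    (M.baseChange g).dp (bcMk g M x) = bcMk g M (M.dp x) := rfl

theorem bcMk_dm (M : MFComplex R) (x : M.carrier) :
    (M.baseChange g).dm (bcMk g M x) = bcMk g M (M.dm x) := rfl

theorem bcMk_del (M : MFComplex R) (x : M.carrier) :
    (M.baseChange g).del (bcMk g M x) = bcMk g M (M.del x) := rfl

theorem bc_ext {M : MFComplex R} {P : Type*} [AddCommGroup P] [Module R' P]
    {f h : (M.baseChange g).carrier →ₗ[R'] P}
    (hf : ∀ a, ∀ x ∈ M.gr a, f (bcMk g M x) = h (bcMk g M x)) : f = h := by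
  refine ext_homogeneous (M.baseChange g).iSup_gr fun i x hx => ?_
  have : (M.baseChange g).gr i ≤ LinearMap.eqLocus f h := by
    refine Submodule.span_le.2 ?_
    rintro _ ⟨x, hx, rfl⟩
    exact hf i x hx
  exact this hx

/-- An isomorphism out of an extension of scalars, checked on homogeneous elements. -/
theorem isom_of_bc {M : MFComplex R} {P : MFComplex R'}
    (e : (M.baseChange g).carrier ≃ₗ[R'] P.carrier)
    (hmem : ∀ a, ∀ x ∈ M.gr a, e (bcMk g M x) ∈ P.gr a)
    (hdp : ∀ a, ∀ x ∈ M.gr a, e (bcMk g M (M.dp x)) = P.dp (e (bcMk g M x)))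
    (hdm : ∀ a, ∀ x ∈ M.gr a, e (bcMk g M (M.dm x)) = P.dm (e (bcMk g M x)))
    (hdel : ∀ a, ∀ x ∈ M.gr a, e (bcMk g M (M.del x)) = P.del (e (bcMk g M x)))
    (hpot : g M.potential = P.potential) : Isom (M.baseChange g) P := by
  refine ⟨⟨e, fun i t ht => ?_, fun x => ?_, fun x => ?_, fun x => ?_, hpot⟩⟩
  · have : (M.baseChange g).gr i ≤ (P.gr i).comap e.toLinearMap := by
      refine Submodule.span_le.2 ?_
      rintro _ ⟨x, hx, rfl⟩
      exact hmem i x hx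
    exact this ht
  · exact LinearMap.congr_fun (bc_ext g (f := e.toLinearMap ∘ₗ (M.baseChange g).dp)
      (h := P.dp ∘ₗ e.toLinearMap) fun a x hx => hdp a x hx) x
  · exact LinearMap.congr_fun (bc_ext g (f := e.toLinearMap ∘ₗ (M.baseChange g).dm)
      (h := P.dm ∘ₗ e.toLinearMap) fun a x hx => hdm a x hx) x
  · exact LinearMap.congr_fun (bc_ext g (f := e.toLinearMap ∘ₗ (M.baseChange g).del)
      (h := P.del ∘ₗ e.toLinearMap) fun a x hx => hdel a x hx) x

theorem Isom.baseChange {M N : MFComplex R} (h : Isom M N) :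
    Isom (M.baseChange g) (N.baseChange g) := by
  obtain ⟨f⟩ := h
  let := g.toAlgebra
  have h1 : ∀ x, f.e.baseChange R R' M.carrier N.carrier (bcMk g M x) = bcMk g N (f.e x) :=
    fun x => rfl
  refine isom_of_bc g (P := N.baseChange g) (f.e.baseChange R R' M.carrier N.carrier)
    (fun a x hx => ?_) (fun a x hx => ?_) (fun a x hx => ?_) (fun a x hx => ?_)
    (congrArg g f.pot)
  · rw [h1]; exact bcMk_mem g (f.mem a x hx)
  · rw [h1, f.dp]; rfl
  · rw [h1, f.dm]; rfl
  · rw [h1, f.del]; rfl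

theorem baseChange_unit : Isom ((unit R).baseChange g) (unit R') := by
  let := g.toAlgebra
  let e : R' ⊗[R] R ≃ₗ[R'] R' := TensorProduct.AlgebraTensorModule.rid R R' R'
  have h1 : ∀ x : R, e (bcMk g (unit R) x) = g x := fun x => by
    change e (1 ⊗ₜ x) = _
    simp only [e, AlgebraTensorModule.rid_tmul, Algebra.smul_def, mul_one]
    rfl
  refine isom_of_bc g (P := unit R') e
    (fun a x hx => ?_) (fun a x hx => ?_) (fun a x hx => ?_) (fun a x hx => ?_)
    (map_zero g)
  · rw [h1]
    by_cases ha : a = (0, 0)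
    · have : (unit R').gr a = ⊤ := if_pos ha
      rw [this]; trivial
    · have : (unit R).gr a = ⊥ := if_neg ha
      rw [this, Submodule.mem_bot] at hx
      rw [hx]
      exact (congrArg (· ∈ (unit R').gr a) (map_zero g)).mpr (zero_mem _)
  all_goals
    change e (bcMk g (unit R) 0) = 0
    rw [h1]; exact map_zero g

theorem baseChange_koszul (x y : R) :
    Isom ((koszul x y).baseChange g) (koszul (g x) (g y)) := by
  let := g.toAlgebra
  let e : R' ⊗[R] (R × R) ≃ₗ[R'] R' × R' := (TensorProduct.prodRight R R' R' R R).trans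
    (LinearEquiv.prodCongr (AlgebraTensorModule.rid R R' R') (AlgebraTensorModule.rid R R' R'))
  have h1 : ∀ v : R × R, e (bcMk g (koszul x y) v) = (g v.1, g v.2) := fun v => by
    change e (1 ⊗ₜ v) = _
    simp only [e, LinearEquiv.trans_apply, TensorProduct.prodRight_tmul,
      LinearEquiv.prodCongr_apply, AlgebraTensorModule.rid_tmul, Algebra.smul_def, mul_one]
    rfl
  refine isom_of_bc g (P := koszul (g x) (g y)) e
    (fun a v hv => ?_) (fun a v hv => ?_) (fun a v hv => ?_) (fun a v hv => ?_)
    (map_mul g x y)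
  · rw [h1]
    exact ⟨fun h => by rw [hv.1 h, map_zero], fun h => by rw [hv.2 h, map_zero]⟩
  · rw [h1, h1]
    exact Prod.ext (map_mul g x v.2) (map_zero g)
  · rw [h1, h1]
    exact Prod.ext (map_zero g) (map_mul g y v.1)
  · rw [h1]
    exact Prod.ext (map_zero g) (map_zero g)

theorem bc_tensor_ext {M N : MFComplex R} {P : Type*} [AddCommGroup P] [Module R' P]
    {f h : ((tensor M N).baseChange g).carrier →ₗ[R'] P}
    (hf : ∀ a b, ∀ x ∈ M.gr a, ∀ y ∈ N.gr b, f (bcMk g (tensor M N) (x ⊗ₜ y)) =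
      h (bcMk g (tensor M N) (x ⊗ₜ y))) : f = h := by
  let := g.toAlgebra
  let : Module R P := Module.compHom P g
  have h1 : ∀ (f : ((tensor M N).baseChange g).carrier →ₗ[R'] P) (r : R) x,
      f (bcMk g (tensor M N) (r • x)) = r • f (bcMk g (tensor M N) x) := fun f r x => by
    rw [bcMk_smul, map_smul]; rfl
  have h2 : ∀ (f : ((tensor M N).baseChange g).carrier →ₗ[R'] P) x y,
      f (bcMk g (tensor M N) (x + y)) = f (bcMk g (tensor M N) x) + f (bcMk g (tensor M N) y) :=
    fun f x y => by rw [bcMk_add, map_add]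
  -- Once `P` is regarded as a module over `R`, restriction to the elements `1 ⊗ t` turns maps that
  -- are linear over `R'` into maps that are linear over `R`, to which `tensor_ext` applies.
  let F : (((tensor M N).baseChange g).carrier →ₗ[R'] P) → (M.carrier ⊗[R] N.carrier →ₗ[R] P) :=
    fun f => { toFun := fun x => f (bcMk g (tensor M N) x), map_add' := h2 f, map_smul' := h1 f }
  have h3 : F f = F h := tensor_ext (M := M) (N := N) hf
  exact bc_ext g fun a x _ => LinearMap.congr_fun h3 x

theorem baseChange_tensor (M N : MFComplex R) :
    Isom ((tensor M N).baseChange g) (tensor (M.baseChange g) (N.baseChange g)) := by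
  let := g.toAlgebra
  let e : R' ⊗[R] (M.carrier ⊗[R] N.carrier) ≃ₗ[R']
      (R' ⊗[R] M.carrier) ⊗[R'] (R' ⊗[R] N.carrier) :=
    AlgebraTensorModule.distribBaseChange R R' M.carrier N.carrier
  have h1 : ∀ x y, e (bcMk g (tensor M N) (x ⊗ₜ y)) = bcMk g M x ⊗ₜ[R'] bcMk g N y :=
    fun x y => rfl
  let P := tensor (M.baseChange g) (N.baseChange g)
  have key : ∀ (f h : R' ⊗[R] (M.carrier ⊗[R] N.carrier) →ₗ[R']
      (R' ⊗[R] M.carrier) ⊗[R'] (R' ⊗[R] N.carrier)),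
      (∀ a b, ∀ x ∈ M.gr a, ∀ y ∈ N.gr b, f (bcMk g (tensor M N) (x ⊗ₜ y)) =
        h (bcMk g (tensor M N) (x ⊗ₜ y))) → f = h := fun f h hf =>
    bc_tensor_ext g (M := M) (N := N) (P := (R' ⊗[R] M.carrier) ⊗[R'] (R' ⊗[R] N.carrier)) hf
  refine ⟨⟨e, fun i t ht => ?_, fun t => ?_, fun t => ?_, fun t => ?_, map_add g _ _⟩⟩
  · have h2 : (tensor M N).gr i ≤ ((P.gr i).restrictScalars R).comap
        ((e.toLinearMap.restrictScalars R) ∘ₗ TensorProduct.mk R R' _ 1) := by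
      refine Submodule.span_le.2 ?_
      rintro _ ⟨a, b, rfl, x, hx, y, hy, rfl⟩
      exact tmul_mem_tensorGr (M := M.baseChange g) (N := N.baseChange g) rfl
        (bcMk_mem g hx) (bcMk_mem g hy)
    have : ((tensor M N).baseChange g).gr i ≤ (P.gr i).comap e.toLinearMap := by
      refine Submodule.span_le.2 ?_
      rintro _ ⟨x, hx, rfl⟩
      exact h2 hx
    exact this ht
  · refine LinearMap.congr_fun (key (e.toLinearMap ∘ₗ ((tensor M N).baseChange g).dp)
      (P.dp ∘ₗ e.toLinearMap) fun a b x hx y hy => ?_) t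
    refine Eq.trans ?_ (tensor_dp_tmul (bcMk_mem g hx) (bcMk g N y)).symm
    refine (congrArg (fun z => e (bcMk g (tensor M N) z)) (tensor_dp_tmul hx y)).trans ?_
    rw [bcMk_add, bcMk_zsmul, map_add, map_zsmul, h1, h1]
    rfl
  · refine LinearMap.congr_fun (key (e.toLinearMap ∘ₗ ((tensor M N).baseChange g).dm)
      (P.dm ∘ₗ e.toLinearMap) fun a b x hx y hy => ?_) t
    refine Eq.trans ?_ (tensor_dm_tmul (bcMk_mem g hx) (bcMk g N y)).symm
    refine (congrArg (fun z => e (bcMk g (tensor M N) z)) (tensor_dm_tmul hx y)).trans ?_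
    rw [bcMk_add, bcMk_zsmul, map_add, map_zsmul, h1, h1]
    rfl
  · refine LinearMap.congr_fun (key (e.toLinearMap ∘ₗ ((tensor M N).baseChange g).del)
      (P.del ∘ₗ e.toLinearMap) fun a b x hx y hy => ?_) t
    refine Eq.trans ?_ (tensor_del_tmul (bcMk_mem g hx) (bcMk g N y)).symm
    refine (congrArg (fun z => e (bcMk g (tensor M N) z)) (tensor_del_tmul hx y)).trans ?_
    rw [bcMk_add, bcMk_zsmul, map_add, map_zsmul, h1, h1]
    rfl

theorem baseChange_tensorList : ∀ l : List (MFComplex R),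
    Isom ((tensorList l).baseChange g) (tensorList (l.map (MFComplex.baseChange g)))
  | [] => baseChange_unit g
  | M :: l => (baseChange_tensor g M (tensorList l)).trans
      ((Isom.refl _).tensor (baseChange_tensorList l))

theorem baseChange_baseChange {R'' : Type u} [CommRing R''] (g' : R' →+* R'') (M : MFComplex R) :
    Isom ((M.baseChange g).baseChange g') (M.baseChange (g'.comp g)) := by
  let i1 := g.toAlgebra
  let i2 := g'.toAlgebra
  let i3 := (g'.comp g).toAlgebra
  have : IsScalarTower R R' R'' := IsScalarTower.of_algebraMap_eq fun _ => rfl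
  let e : R'' ⊗[R'] (R' ⊗[R] M.carrier) ≃ₗ[R''] R'' ⊗[R] M.carrier :=
    AlgebraTensorModule.cancelBaseChange R R' R'' R'' M.carrier
  have h1 : ∀ x, e (bcMk g' (M.baseChange g) (bcMk g M x)) = bcMk (g'.comp g) M x := fun x => by
    change e (1 ⊗ₜ (1 ⊗ₜ x)) = 1 ⊗ₜ x
    simp [e]
  have key : ∀ (f h : R'' ⊗[R'] (R' ⊗[R] M.carrier) →ₗ[R''] R'' ⊗[R] M.carrier),
      (∀ a, ∀ x ∈ M.gr a, f (bcMk g' (M.baseChange g) (bcMk g M x)) =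
        h (bcMk g' (M.baseChange g) (bcMk g M x))) → f = h := fun f h hf => by
    refine AlgebraTensorModule.curry_injective (LinearMap.ext_ring ?_)
    refine AlgebraTensorModule.curry_injective (LinearMap.ext_ring ?_)
    exact ext_homogeneous M.iSup_gr fun a x hx => hf a x hx
  let P := M.baseChange (g'.comp g)
  refine ⟨⟨e, fun i t ht => ?_, fun t => ?_, fun t => ?_, fun t => ?_, rfl⟩⟩
  · have h2 : (M.baseChange g).gr i ≤ ((P.gr i).restrictScalars R').comap
        ((e.toLinearMap.restrictScalars R') ∘ₗ TensorProduct.mk R' R'' _ 1) := by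
      refine Submodule.span_le.2 ?_
      rintro _ ⟨x, hx, rfl⟩
      exact (congrArg (· ∈ P.gr i) (h1 x)).mpr (bcMk_mem _ hx)
    have : ((M.baseChange g).baseChange g').gr i ≤ (P.gr i).comap e.toLinearMap := by
      refine Submodule.span_le.2 ?_
      rintro _ ⟨x, hx, rfl⟩
      exact h2 hx
    exact this ht
  · refine LinearMap.congr_fun (key (e.toLinearMap ∘ₗ ((M.baseChange g).baseChange g').dp)
      (P.dp ∘ₗ e.toLinearMap) fun a x hx => ?_) t
    exact (h1 (M.dp x)).trans (congrArg P.dp (h1 x)).symm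
  · refine LinearMap.congr_fun (key (e.toLinearMap ∘ₗ ((M.baseChange g).baseChange g').dm)
      (P.dm ∘ₗ e.toLinearMap) fun a x hx => ?_) t
    exact (h1 (M.dm x)).trans (congrArg P.dm (h1 x)).symm
  · refine LinearMap.congr_fun (key (e.toLinearMap ∘ₗ ((M.baseChange g).baseChange g').del)
      (P.del ∘ₗ e.toLinearMap) fun a x hx => ?_) t
    exact (h1 (M.del x)).trans (congrArg P.del (h1 x)).symm

end BaseChange
end MFComplex
end KhR

/-! ### Tensoring with an elementary Koszul factorization as a mapping cone. -/

namespace KhR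
open TensorProduct MvPolynomial
namespace MFComplex
variable {R : Type u} [CommRing R]

/-- The tensor product of the Koszul factorization of `(x, y)` with `M`, written as `M × M`. -/
@[reducible]
def kos (x y : R) (M : MFComplex R) : MFComplex R where
  carrier := M.carrier × M.carrier
  gr i := (M.gr i).prod (M.gr (i.1, i.2 + 1))
  internal := by
    refine isInternal_of_comp ?_
      (Finsupp.mapRange.linearMap (LinearMap.inl R M.carrier M.carrier) ∘ₗ
          comp M.gr M.internal ∘ₗ LinearMap.fst R M.carrier M.carrier +
        Finsupp.mapRange.linearMap (LinearMap.inr R M.carrier M.carrier) ∘ₗ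
          Finsupp.lmapDomain _ R (fun i : ℤ × ℤ => (i.1, i.2 - 1)) ∘ₗ
          comp M.gr M.internal ∘ₗ LinearMap.snd R M.carrier M.carrier) ?_
    · refine eq_top_iff.2 fun v _ => ?_
      have hv : v = LinearMap.inl R M.carrier M.carrier v.1 + LinearMap.inr R _ _ v.2 := by simp
      have hx : v.1 ∈ ⨆ i, M.gr i := by rw [M.iSup_gr]; trivial
      have hy : v.2 ∈ ⨆ i, M.gr i := by rw [M.iSup_gr]; trivial
      rw [hv]
      refine add_mem ?_ ?_
      · refine (iSup_le fun i x hx => ?_ : (⨆ i, M.gr i) ≤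
          Submodule.comap (LinearMap.inl R M.carrier M.carrier)
            (⨆ i : ℤ × ℤ, (M.gr i).prod (M.gr (i.1, i.2 + 1)))) hx
        exact Submodule.mem_iSup_of_mem i (by simpa using hx)
      · refine (iSup_le fun i x hx => ?_ : (⨆ i, M.gr i) ≤
          Submodule.comap (LinearMap.inr R M.carrier M.carrier)
            (⨆ i : ℤ × ℤ, (M.gr i).prod (M.gr (i.1, i.2 + 1)))) hy
        exact Submodule.mem_iSup_of_mem (i.1, i.2 - 1) (by simpa using hx)
    · rintro ⟨n, j⟩ ⟨x, y⟩ ⟨hx, hy⟩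
      simp [comp_of_mem M.internal hx, comp_of_mem M.internal hy, ← Finsupp.single_add]
  potential := x * y + M.potential
  -- The second copy of `M` belongs to the generator of degree `-1`. Hence the shift in its grading
  -- and the minus signs of its `dp` and `dm`; `del` has no sign, because both generators have
  -- homological degree `0`.
  dp := (M.dp ∘ₗ LinearMap.fst R _ _ + x • LinearMap.snd R _ _).prod
    (-(M.dp ∘ₗ LinearMap.snd R _ _))
  dm := (M.dm ∘ₗ LinearMap.fst R _ _).prod
    (y • LinearMap.fst R _ _ - M.dm ∘ₗ LinearMap.snd R _ _)
  del := M.del.prodMap M.del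
  dp_mem i v hv := ⟨add_mem (M.dp_mem _ _ hv.1) (Submodule.smul_mem _ _ hv.2),
    neg_mem (M.dp_mem _ _ hv.2)⟩
  dm_mem i v hv := ⟨M.dm_mem _ _ hv.1, by
    have e : (i.1, i.2 + 1 - 1) = (i.1, i.2 - 1 + 1) := by ring_nf
    have e' : i = (i.1, i.2 - 1 + 1) := by simp
    refine sub_mem (Submodule.smul_mem _ _ ?_) ?_
    · exact e' ▸ hv.1
    · exact e ▸ M.dm_mem _ _ hv.2⟩
  del_mem i v hv := ⟨M.del_mem _ _ hv.1, M.del_mem _ _ hv.2⟩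
  sq := by
    have hM := fun x => LinearMap.congr_fun M.sq x
    simp only [LinearMap.comp_apply, LinearMap.add_apply, LinearMap.smul_apply,
      LinearMap.id_apply, map_add] at hM
    refine LinearMap.ext fun v => Prod.ext ?_ ?_
    · change (M.dp (M.dp v.1 + x • v.2 + M.dm v.1) + x • (-M.dp v.2 + (y • v.1 - M.dm v.2))) +
        M.dm (M.dp v.1 + x • v.2 + M.dm v.1) = (x * y + M.potential) • v.1
      rw [add_smul, ← hM v.1]
      simp only [map_add, map_smul]
      module
    · change -M.dp (-M.dp v.2 + (y • v.1 - M.dm v.2)) + (y • (M.dp v.1 + x • v.2 + M.dm v.1) -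
        M.dm (-M.dp v.2 + (y • v.1 - M.dm v.2))) = (x * y + M.potential) • v.2
      rw [add_smul, ← hM v.2]
      simp only [map_add, map_sub, map_neg, map_smul]
      module
  del_del := LinearMap.ext fun v => Prod.ext (LinearMap.congr_fun M.del_del v.1)
    (LinearMap.congr_fun M.del_del v.2)
  del_dp := by
    have h := fun x => LinearMap.congr_fun M.del_dp x
    simp only [LinearMap.comp_apply] at h
    refine LinearMap.ext fun v => Prod.ext ?_ ?_ <;> simp [h]
  del_dm := by
    have h := fun x => LinearMap.congr_fun M.del_dm x
    simp only [LinearMap.comp_apply] at h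
    refine LinearMap.ext fun v => Prod.ext ?_ ?_ <;> simp [h]

theorem koszul_tensor_isom (x y : R) (M : MFComplex R) :
    Isom (tensor (koszul x y) M) (kos x y M) := by
  let e : (R × R) ⊗[R] M.carrier ≃ₗ[R] M.carrier × M.carrier :=
    (TensorProduct.prodLeft R R R R M.carrier).trans
      (LinearEquiv.prodCongr (TensorProduct.lid R M.carrier) (TensorProduct.lid R M.carrier))
  have he : ∀ (v : R × R) m, e (v ⊗ₜ m) = (v.1 • m, v.2 • m) := fun ⟨a, b⟩ m => by
    simp only [e, LinearEquiv.trans_apply, TensorProduct.prodLeft_tmul,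
      LinearEquiv.prodCongr_apply, TensorProduct.lid_tmul]
  have h0 : ∀ (a : ℤ × ℤ) (v : R × R), v ∈ (koszul x y).gr a →
      (a = (0, 0) ∧ v.2 = 0) ∨ (a = (0, -1) ∧ v.1 = 0) ∨ v = 0 := by
    rintro a ⟨r, s⟩ ⟨h1, h2⟩
    by_cases ha : a = (0, 0)
    · exact Or.inl ⟨ha, h2 (by simp [ha])⟩
    · by_cases hb : a = (0, -1)
      · exact Or.inr (Or.inl ⟨hb, h1 ha⟩)
      · exact Or.inr (Or.inr (Prod.ext (h1 ha) (h2 hb)))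
  have hz : ∀ (m : M.carrier), e ((0 : R × R) ⊗ₜ m) = 0 := fun m => by
    rw [TensorProduct.zero_tmul, map_zero]
  have e1 : eps 0 = 1 := by simp [eps]
  have e2 : eps (-1) = -1 := by simp [eps]
  refine isom_of_tensor (M := koszul x y) (P := kos x y M) e ?_ ?_ ?_ ?_ rfl
  · intro a b v hv m hm
    rw [he]
    rcases h0 a v hv with ⟨rfl, h⟩ | ⟨rfl, h⟩ | rfl
    · rw [h, zero_smul]
      have : b = (0, 0) + b := (zero_add b).symm
      exact ⟨(congrArg (v.1 • m ∈ M.gr ·) this).mp (Submodule.smul_mem _ _ hm), zero_mem _⟩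
    · rw [h, zero_smul]
      refine ⟨zero_mem _, ?_⟩
      have : b = (((0, -1) + b : ℤ × ℤ).1, ((0, -1) + b : ℤ × ℤ).2 + 1) := by ext <;> simp
      exact Submodule.smul_mem _ _ (this ▸ hm)
    · exact ⟨by simp, by simp⟩
  · intro a b v hv m hm
    rw [map_add, map_zsmul, he, he, he]
    rcases h0 a v hv with ⟨rfl, h⟩ | ⟨rfl, h⟩ | rfl
    · simp [h, e1]
    · simp [h, e2, smul_smul]
    · simp
  · intro a b v hv m hm
    rw [map_add, map_zsmul, he, he, he]
    rcases h0 a v hv with ⟨rfl, h⟩ | ⟨rfl, h⟩ | rfl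
    · simp [h, e1, smul_smul]
    · simp [h, e2]
    · simp
  · intro a b v hv m hm
    rw [map_add, map_zsmul, he, he, he]
    rcases h0 a v hv with ⟨rfl, h⟩ | ⟨rfl, h⟩ | rfl
    · simp [h, e1]
    · simp [h, eps]
    · simp

end MFComplex

/-! ### The factors of a diagram, and the substitution of variables in them. -/

section Factors
variable {k : Type u} [Field k]

/-- The data of a factor of a Khovanov-Rozansky complex: an edge, given by its head and tail, or
a crossing with a sign and four flags. -/
abbrev Factor (A : Type*) := (A × A) ⊕ (Bool × (Fin 4 → A))

/-- Functoriality of `Factor`. -/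
def Factor.map {A B : Type*} (f : A → B) : Factor A → Factor B :=
  Sum.map (Prod.map f f) (Prod.map id fun v => f ∘ v)

theorem Factor.map_map {A B C : Type*} (f : A → B) (g : B → C) (F : Factor A) :
    (F.map f).map g = F.map (g ∘ f) := by
  rcases F with F | F <;> rfl

variable {p : Polynomial k} (χ : CrossingData p)

section
variable {R R' : Type u} [CommRing R] [Algebra k R] [CommRing R'] [Algebra k R']

/-- The complex of a factor, with variables in a `k`-algebra. -/
noncomputable def factorMF : Factor R → MFComplex R
  | Sum.inl e => koszul (e.1 - e.2) (divDiff p e.1 e.2)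
  | Sum.inr c => (χ.crossing c.1).baseChange (MvPolynomial.aeval (R := k) c.2).toRingHom

/-- The tensor product of the complexes of a list of factors. -/
noncomputable def factorsMF (L : List (Factor R)) : MFComplex R :=
  tensorList (L.map (factorMF χ))

theorem map_divDiff (θ : R →ₐ[k] R') (a b : R) :
    θ (divDiff p a b) = divDiff p (θ a) (θ b) := by
  simp [divDiff, Polynomial.sum, map_sum]

/-- Divided differences are natural in the algebra, and the complex of a crossing is itself extended
from the ring in four variables. Therefore renaming, identifying or replacing variables in a diagram
is always an extension of scalars. -/
theorem baseChange_factorMF (θ : R →ₐ[k] R') (F : Factor R) :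
    Isom ((factorMF χ F).baseChange θ.toRingHom) (factorMF χ (F.map θ)) := by
  rcases F with ⟨a, b⟩ | ⟨s, v⟩
  · refine (baseChange_koszul _ _ _).trans (Isom.of_eq ?_)
    change koszul (θ (a - b)) (θ (divDiff p a b)) = koszul (θ a - θ b) (divDiff p (θ a) (θ b))
    rw [map_sub, map_divDiff]
  · refine (baseChange_baseChange _ _ _).trans (Isom.of_eq ?_)
    have : θ.toRingHom.comp (MvPolynomial.aeval (R := k) v).toRingHom =
        (MvPolynomial.aeval (R := k) (θ ∘ v)).toRingHom := by
      have h : θ.comp (MvPolynomial.aeval (R := k) v) = MvPolynomial.aeval (R := k) (θ ∘ v) := by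
        ext i; simp
      rw [← h]; rfl
    change (χ.crossing s).baseChange _ = (χ.crossing s).baseChange _
    rw [this]
    rfl

theorem baseChange_factorsMF (θ : R →ₐ[k] R') (L : List (Factor R)) :
    Isom ((factorsMF χ L).baseChange θ.toRingHom) (factorsMF χ (L.map (Factor.map θ))) := by
  refine (baseChange_tensorList _ _).trans ?_
  rw [factorsMF, List.map_map, List.map_map]
  refine tensorList_forall₂ (List.forall₂_map_left_iff.2 (List.forall₂_map_right_iff.2 ?_))
  exact List.forall₂_same.2 fun F _ => baseChange_factorMF χ θ F

theorem factorsMF_perm {L L' : List (Factor R)} (h : L.Perm L') :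
    Isom (factorsMF χ L) (factorsMF χ L') := tensorList_perm (h.map _)

theorem factorsMF_append (L L' : List (Factor R)) :
    Isom (factorsMF χ (L ++ L')) (tensor (factorsMF χ L) (factorsMF χ L')) := by
  rw [factorsMF, List.map_append]
  exact tensorList_append _ _

theorem factorsMF_cons_edge (a b : R) (L : List (Factor R)) :
    Isom (factorsMF χ (Sum.inl (a, b) :: L)) (kos (a - b) (divDiff p a b) (factorsMF χ L)) :=
  koszul_tensor_isom _ _ _

end
end Factors
end KhR

namespace KhR
open TensorProduct MvPolynomial
namespace MFComplex

/-! ### Parity, and homotopy equivalences between complexes over different rings. -/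

section Parity
variable {R : Type u} [CommRing R]

theorem gr_le_par (M : MFComplex R) (n j : ℤ) : M.gr (n, j) ≤ M.par n j :=
  le_iSup_of_le 0 (by simp)

theorem par_add_two_mul (M : MFComplex R) (n j l : ℤ) : M.par n (j + 2 * l) = M.par n j := by
  refine Equiv.iSup_congr (Equiv.addLeft l) fun i => ?_
  rw [Equiv.coe_addLeft, mul_add, add_assoc]

theorem par_induction {R' : Type u} [CommRing R'] {M : MFComplex R} {N : MFComplex R'}
    (f : M.carrier →+ N.carrier) {n : ℤ} (c : ℤ)
    (hf : ∀ j, ∀ x ∈ M.gr (n, j), f x ∈ N.par n (j + c)) {j : ℤ} {x : M.carrier}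
    (hx : x ∈ M.par n j) : f x ∈ N.par n (j + c) := by
  induction hx using Submodule.iSup_induction' with
  | zero => simp
  | add a b _ _ ha hb => rw [map_add]; exact add_mem ha hb
  | mem l y hy =>
    have := hf _ y hy
    rwa [add_right_comm, par_add_two_mul] at this

theorem par_of_gr {R' : Type u} [CommRing R'] {M : MFComplex R} {N : MFComplex R'}
    (f : M.carrier →+ N.carrier) {n : ℤ}
    (hf : ∀ j, ∀ x ∈ M.gr (n, j), f x ∈ N.gr (n, j)) {j : ℤ} {x : M.carrier}
    (hx : x ∈ M.par n j) : f x ∈ N.par n j := by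
  have := par_induction f 0 (fun j x hx => by rw [add_zero]; exact gr_le_par _ _ _ (hf j x hx)) hx
  rwa [add_zero] at this

theorem d_mem_par (M : MFComplex R) {n j : ℤ} {x : M.carrier} (hx : x ∈ M.par n j) :
    M.d x ∈ M.par n (j + 1) :=
  par_induction (M := M) (N := M) M.d.toAddMonoidHom 1 (fun j x hx => add_mem
    (gr_le_par _ _ _ (M.dp_mem (n, j) x hx)) (by
      have := gr_le_par _ _ _ (M.dm_mem (n, j) x hx)
      rwa [← par_add_two_mul M n (j - 1) 1, show j - 1 + 2 * 1 = j + 1 by ring] at this)) hx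

theorem d_apply (M : MFComplex R) (x : M.carrier) : M.d x = M.dp x + M.dm x := rfl

theorem d_d (M : MFComplex R) (x : M.carrier) : M.d (M.d x) = M.potential • x :=
  LinearMap.congr_fun M.sq x

theorem del_d_apply (M : MFComplex R) (x : M.carrier) : M.del (M.d x) = M.d (M.del x) :=
  LinearMap.congr_fun M.del_d x

theorem kos_d (x y : R) (M : MFComplex R) (v : M.carrier × M.carrier) :
    (kos x y M).d v = (M.d v.1 + x • v.2, y • v.1 - M.d v.2) := by
  refine Prod.ext ?_ ?_
  · change M.dp v.1 + x • v.2 + M.dm v.1 = M.dp v.1 + M.dm v.1 + x • v.2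
    abel
  · change -M.dp v.2 + (y • v.1 - M.dm v.2) = y • v.1 - (M.dp v.2 + M.dm v.2)
    abel

end Parity

/-- A homotopy equivalence between a complex `M` of matrix factorizations over `A` and a complex
`N` over `S`, linear over `S` along a homomorphism `ι : S → A`. -/
structure HEquiv {S A : Type u} [CommRing S] [CommRing A] (ι : S →+* A) (M : MFComplex A)
    (N : MFComplex S) where
  F : M.carrier →+ N.carrier
  G : N.carrier →+ M.carrier
  h : M.carrier →+ M.carrier
  h' : N.carrier →+ N.carrier
  F_smul : ∀ (s : S) (x : M.carrier), F (ι s • x) = s • F x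
  G_smul : ∀ (s : S) (x : N.carrier), G (s • x) = ι s • G x
  h_smul : ∀ (s : S) (x : M.carrier), h (ι s • x) = ι s • h x
  h'_smul : ∀ (s : S) (x : N.carrier), h' (s • x) = s • h' x
  F_d : ∀ x, F (M.d x) = N.d (F x)
  G_d : ∀ x, G (N.d x) = M.d (G x)
  F_del : ∀ x, F (M.del x) = N.del (F x)
  G_del : ∀ x, G (N.del x) = M.del (G x)
  h_del : ∀ x, h (M.del x) = M.del (h x)
  h'_del : ∀ x, h' (N.del x) = N.del (h' x)
  F_mem : ∀ n j, ∀ x ∈ M.par n j, F x ∈ N.par n j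
  G_mem : ∀ n j, ∀ x ∈ N.par n j, G x ∈ M.par n j
  h_mem : ∀ n j, ∀ x ∈ M.par n j, h x ∈ M.par n (j + 1)
  h'_mem : ∀ n j, ∀ x ∈ N.par n j, h' x ∈ N.par n (j + 1)
  GF : ∀ x, G (F x) - x = M.d (h x) + h (M.d x)
  FG : ∀ x, F (G x) - x = N.d (h' x) + h' (N.d x)
  pot : M.potential = ι N.potential

namespace HEquiv
variable {S A B : Type u} [CommRing S] [CommRing A] [CommRing B]

/-- Composition. -/
def trans {ι : A →+* B} {κ : S →+* A} {M : MFComplex B} {N : MFComplex A} {P : MFComplex S}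
    (f : HEquiv ι M N) (g : HEquiv κ N P) : HEquiv (ι.comp κ) M P where
  F := g.F.comp f.F
  G := f.G.comp g.G
  -- The homotopy for `g` is transported through `f`, because the composite minus the identity is
  -- `f.G (g.G g.F - 1) f.F + (f.G f.F - 1)`.
  h := f.h + (f.G.comp g.h).comp f.F
  h' := g.h' + (g.F.comp f.h').comp g.G
  F_smul s x := by simp [f.F_smul, g.F_smul]
  G_smul s x := by simp [f.G_smul, g.G_smul]
  h_smul s x := by simp [f.F_smul, g.h_smul, f.G_smul, f.h_smul]
  h'_smul s x := by simp [g.G_smul, f.h'_smul, g.F_smul, g.h'_smul]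
  F_d x := by simp [f.F_d, g.F_d]
  G_d x := by simp [f.G_d, g.G_d]
  F_del x := by simp [f.F_del, g.F_del]
  G_del x := by simp [f.G_del, g.G_del]
  h_del x := by simp [f.F_del, g.h_del, f.G_del, f.h_del]
  h'_del x := by simp [g.G_del, f.h'_del, g.F_del, g.h'_del]
  F_mem n j x hx := g.F_mem n j _ (f.F_mem n j x hx)
  G_mem n j x hx := f.G_mem n j _ (g.G_mem n j x hx)
  h_mem n j x hx := add_mem (f.h_mem n j x hx)
    (f.G_mem _ _ _ (g.h_mem _ _ _ (f.F_mem n j x hx)))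
  h'_mem n j x hx := add_mem (g.h'_mem n j x hx)
    (g.F_mem _ _ _ (f.h'_mem _ _ _ (g.G_mem n j x hx)))
  GF x := by
    have h1 := congrArg f.G (g.GF (f.F x))
    have h2 := f.GF x
    simp only [map_sub, map_add, f.G_d, ← f.F_d] at h1
    simp only [AddMonoidHom.comp_apply, AddMonoidHom.add_apply, map_add]
    rw [sub_eq_iff_eq_add] at h1 h2 ⊢
    rw [h1, h2]
    abel
  FG x := by
    have h1 := congrArg g.F (f.FG (g.G x))
    have h2 := g.FG x
    simp only [map_sub, map_add, g.F_d, ← g.G_d] at h1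
    simp only [AddMonoidHom.comp_apply, AddMonoidHom.add_apply, map_add]
    rw [sub_eq_iff_eq_add] at h1 h2 ⊢
    rw [h1, h2]
    abel
  pot := by rw [f.pot, g.pot]; rfl

/-- Isomorphisms are homotopy equivalences. -/
def ofGrIso {M N : MFComplex A} (f : GrIso M N) : HEquiv (RingHom.id A) M N where
  F := f.e.toLinearMap.toAddMonoidHom
  G := f.e.symm.toLinearMap.toAddMonoidHom
  h := 0
  h' := 0
  F_smul s x := f.e.map_smul s x
  G_smul s x := f.e.symm.map_smul s x
  h_smul s x := by simp
  h'_smul s x := by simp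
  F_d x := by
    change f.e (M.dp x + M.dm x) = N.dp (f.e x) + N.dm (f.e x)
    rw [map_add, f.dp, f.dm]
  G_d x := by
    change f.symm.e (N.dp x + N.dm x) = M.dp (f.symm.e x) + M.dm (f.symm.e x)
    rw [map_add, f.symm.dp, f.symm.dm]
  F_del x := f.del x
  G_del x := f.symm.del x
  h_del x := by simp
  h'_del x := by simp
  F_mem n j x hx := par_of_gr (M := M) (N := N) f.e.toLinearMap.toAddMonoidHom
    (fun j x hx => f.mem _ x hx) hx
  G_mem n j x hx := par_of_gr (M := N) (N := M) f.e.symm.toLinearMap.toAddMonoidHom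
    (fun j x hx => f.symm.mem _ x hx) hx
  h_mem n j x hx := by simp
  h'_mem n j x hx := by simp
  GF x := by
    change f.e.symm (f.e x) - x = M.d 0 + 0
    simp
  FG x := by
    change f.e (f.e.symm x) - x = N.d 0 + 0
    simp
  pot := f.pot

/-- Removal of the Koszul factorization of `(τ, y)`: if `N` is the quotient of `M` by `τ`, and the
division by `τ` extends to a map `q` that is linear over `S`, then the tensor product of `M` with
this factorization is homotopy equivalent to `N`. -/
def eliminate {ι : S →+* A} {τ y : A} {M : MFComplex A} {N : MFComplex S}
    (r : M.carrier →+ N.carrier) (σ : N.carrier →+ M.carrier) (q : M.carrier →+ M.carrier)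
    (r_smul : ∀ (s : S) (x : M.carrier), r (ι s • x) = s • r x)
    (σ_smul : ∀ (s : S) (x : N.carrier), σ (s • x) = ι s • σ x)
    (q_smul : ∀ (s : S) (x : M.carrier), q (ι s • x) = ι s • q x) (r_d : ∀ x, r (M.d x) = N.d (r x))
    (r_del : ∀ x, r (M.del x) = N.del (r x)) (σ_del : ∀ x, σ (N.del x) = M.del (σ x))
    (q_del : ∀ x, q (M.del x) = M.del (q x)) (r_mem : ∀ i, ∀ x ∈ M.gr i, r x ∈ N.gr i)
    (σ_mem : ∀ i, ∀ x ∈ N.gr i, σ x ∈ M.gr i) (q_mem : ∀ i, ∀ x ∈ M.gr i, q x ∈ M.gr i)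
    (rσ : ∀ x, r (σ x) = x) (rτ : ∀ x, r (τ • x) = 0) (σr : ∀ x, σ (r x) + τ • q x = x)
    (qτ : ∀ x, q (τ • x) = x) (pot : τ * y + M.potential = ι N.potential) :
    HEquiv ι (kos τ y M) N := by
  -- The element `σ x` is its own remainder, so `τ • q (σ x) = 0`; applying `q` once more removes
  -- `τ`.
  have qσ : ∀ x, q (σ x) = 0 := fun x => by
    have h1 := σr (σ x)
    rw [rσ, add_eq_left] at h1
    rw [← qτ (q (σ x)), h1, map_zero]
  -- Apply `q` to `(τ * y + M.potential) • σ x`. The scalar comes from `S`, so `q` commutes with it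
  -- and the result vanishes by `qσ`; on the other hand `q` cancels `τ` in the first summand.
  have yσ : ∀ x, y • σ x = -q (M.potential • σ x) := fun x => by
    have h1 := q_smul N.potential (σ x)
    rw [← pot, qσ, smul_zero, add_smul, map_add, mul_smul, qτ] at h1
    exact eq_neg_of_add_eq_zero_left h1
  -- The section `σ` need not commute with `d`, but its defect is divisible by `τ`, so the second
  -- copy of `M` in the cone can absorb it.
  have σd : ∀ x, σ (N.d x) = M.d (σ x) - τ • q (M.d (σ x)) := fun x => by
    rw [eq_sub_iff_add_eq]
    conv_rhs => rw [← σr (M.d (σ x)), r_d, rσ]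
  -- `F` reduces the first copy modulo `τ`; `G` is the section `σ`, completed by `-q d σ` in the
  -- second copy so that it becomes a morphism; the homotopy divides the first copy by `τ` and puts
  -- the negative quotient into the second one. As `F` after `G` is the identity, the homotopy on
  -- `N` is zero.
  let F : M.carrier × M.carrier →+ N.carrier := r.comp (AddMonoidHom.fst _ _)
  let G : N.carrier →+ M.carrier × M.carrier :=
    σ.prod (-(q.comp (M.d.toAddMonoidHom.comp σ)))
  let h : M.carrier × M.carrier →+ M.carrier × M.carrier :=
    (0 : M.carrier × M.carrier →+ M.carrier).prod (-(q.comp (AddMonoidHom.fst _ _)))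
  have hG : ∀ x, G x = (σ x, -q (M.d (σ x))) := fun x => rfl
  have hh : ∀ v, h v = (0, -q v.1) := fun v => rfl
  have gr_inr : ∀ n j (x : M.carrier), x ∈ M.gr (n, j) →
      ((0, x) : M.carrier × M.carrier) ∈ (kos τ y M).gr (n, j - 1) := fun n j x hx =>
    ⟨zero_mem _, by simpa using hx⟩
  have par_inr : ∀ n j (x : M.carrier), x ∈ M.par n (j + 1) →
      ((0, x) : M.carrier × M.carrier) ∈ (kos τ y M).par n j := fun n j x hx => by
    have := par_induction (M := M) (N := kos τ y M) (AddMonoidHom.inr M.carrier M.carrier)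
      (n := n) (-1) (fun j x hx => gr_le_par _ _ _ (gr_inr n j x hx)) hx
    simpa using this
  have par_inl : ∀ n j (x : M.carrier), x ∈ M.par n j →
      ((x, 0) : M.carrier × M.carrier) ∈ (kos τ y M).par n j := fun n j x hx =>
    par_of_gr (M := M) (N := kos τ y M) (AddMonoidHom.inl M.carrier M.carrier)
      (n := n) (fun j x hx => ⟨hx, zero_mem _⟩) hx
  have par_fst : ∀ n j (v : M.carrier × M.carrier), v ∈ (kos τ y M).par n j →
      v.1 ∈ M.par n j := fun n j v hv =>
    par_of_gr (M := kos τ y M) (N := M) (AddMonoidHom.fst M.carrier M.carrier)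
      (n := n) (fun j x hx => hx.1) hv
  exact
    { F := F
      G := G
      h := h
      h' := 0
      F_smul := fun s v => r_smul s v.1
      G_smul := fun s x => by
        rw [hG, hG, σ_smul, map_smul, q_smul, ← smul_neg]; rfl
      h_smul := fun s v => by
        rw [hh, hh]
        refine Prod.ext (smul_zero _).symm ?_
        change -q (ι s • v.1) = ι s • -q v.1
        rw [q_smul, smul_neg]
      h'_smul := fun s x => by simp
      F_d := fun v => by
        rw [kos_d]
        change r (M.d v.1 + τ • v.2) = N.d (r v.1)
        rw [map_add, r_d, rτ, add_zero]
      G_d := fun x => by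
        rw [hG, hG, kos_d]
        refine Prod.ext ?_ ?_
        · change σ (N.d x) = M.d (σ x) + τ • -q (M.d (σ x))
          rw [σd, smul_neg, sub_eq_add_neg]
        · change -q (M.d (σ (N.d x))) = y • σ x - M.d (-q (M.d (σ x)))
          rw [σd, map_sub, d_d, map_smul, map_sub, qτ, yσ, map_neg]
          abel
      F_del := fun v => r_del v.1
      G_del := fun x => by
        rw [hG, hG]
        refine Prod.ext (σ_del x) ?_
        change -q (M.d (σ (N.del x))) = M.del (-q (M.d (σ x)))
        rw [σ_del, ← del_d_apply, q_del, map_neg]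
      h_del := fun v => by
        rw [hh, hh]
        refine Prod.ext (map_zero M.del).symm ?_
        change -q (M.del v.1) = M.del (-q v.1)
        rw [q_del, map_neg]
      h'_del := fun x => by simp
      F_mem := fun n j v hv => par_of_gr r (fun j x hx => r_mem _ x hx) (par_fst n j v hv)
      G_mem := fun n j x hx => by
        have h1 := par_of_gr σ (fun j x hx => σ_mem _ x hx) hx
        have h2 := neg_mem (par_of_gr q (fun j x hx => q_mem _ x hx) (d_mem_par M h1))
        have h3 := add_mem (par_inl n j _ h1) (par_inr n j _ h2)
        rw [hG]
        simpa using h3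
      h_mem := fun n j v hv => by
        refine par_inr n (j + 1) _ (neg_mem (par_of_gr q (fun j x hx => q_mem _ x hx) ?_))
        have := par_fst n j v hv
        rwa [add_assoc, show (1 + 1 : ℤ) = 2 * 1 by norm_num, par_add_two_mul]
      h'_mem := fun n j x hx => by simp
      GF := fun v => by
        have hF : F v = r v.1 := rfl
        rw [hF, hG, hh, hh, kos_d, kos_d]
        refine Prod.ext ?_ ?_
        · change σ (r v.1) - v.1 = M.d 0 + τ • -q v.1 + 0
          rw [eq_sub_of_add_eq (σr v.1), smul_neg, map_zero]
          abel
        · change -q (M.d (σ (r v.1))) - v.2 =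
            y • (0 : M.carrier) - M.d (-q v.1) + -q (M.d v.1 + τ • v.2)
          rw [eq_sub_of_add_eq (σr v.1), map_sub, map_sub, map_smul, qτ, map_add, qτ, smul_zero,
            map_neg]
          abel
      FG := fun x => by
        change r (σ x) - x = N.d 0 + 0
        simp [rσ]
      pot := pot }

end HEquiv
end MFComplex
end KhR

namespace KhR
open TensorProduct MvPolynomial
namespace MFComplex
namespace HEquiv
variable {S A : Type u} [CommRing S] [CommRing A]

/-- Removal of a Koszul factorization of `τ` from a complex which, apart from one further Koszul
factorization, is an extension of scalars along a section `ι` of the quotient map `θ` by `τ`. -/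
noncomputable def eliminateBaseChange {ι : S →+* A} (θ : A →+* S) (hθ : ∀ s, θ (ι s) = s)
    {τ y x' y' : A} (q₀ : A →+ A) (hq : ∀ s a, q₀ (ι s * a) = ι s * q₀ a) (θτ : θ τ = 0)
    (hdiv : ∀ a, ι (θ a) + τ * q₀ a = a) (qτ : ∀ a, q₀ (τ * a) = a) (N : MFComplex S)
    (pot : τ * y + x' * y' = ι (θ x' * θ y')) :
    HEquiv ι (kos τ y (kos x' y' (N.baseChange ι))) (kos (θ x') (θ y') N) := by
  letI := ι.toAlgebra
  -- Since `θ` is a retraction of `ι`, it is linear over `S`, like the division `q₀`. So reduction,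
  -- section and division can act on the first factor of `A ⊗[S] N.carrier`, where they commute with
  -- the differentials of `N`.
  let θL : A →ₗ[S] S := { θ with
    map_smul' := fun s a => by
      change θ (ι s * a) = s * θ a
      rw [map_mul, hθ] }
  let qL : A →ₗ[S] A := { q₀ with map_smul' := fun s a => hq s a }
  let ρ : A ⊗[S] N.carrier →ₗ[S] N.carrier :=
    (TensorProduct.lid S N.carrier).toLinearMap ∘ₗ θL.rTensor N.carrier
  let q : A ⊗[S] N.carrier →ₗ[S] A ⊗[S] N.carrier := qL.rTensor N.carrier
  let s : N.carrier →ₗ[S] A ⊗[S] N.carrier := TensorProduct.mk S A N.carrier 1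
  have hρ : ∀ a x, ρ (a ⊗ₜ x) = θ a • x := fun a x => by
    change TensorProduct.lid S N.carrier (θ a ⊗ₜ x) = _
    rw [TensorProduct.lid_tmul]
  have hqt : ∀ a x, q (a ⊗ₜ x) = q₀ a ⊗ₜ x := fun a x => rfl
  have hs : ∀ x, s x = 1 ⊗ₜ x := fun x => rfl
  have ind : ∀ {P : A ⊗[S] N.carrier → Prop} (_ : ∀ a x, P (a ⊗ₜ x))
      (_ : P 0) (_ : ∀ x y, P x → P y → P (x + y)) (t), P t := fun h1 h0 h2 t =>
    TensorProduct.induction_on t h0 h1 h2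
  have ρ_smul : ∀ (a : A) t, ρ (a • t) = θ a • ρ t := fun a t => by
    refine ind (P := fun t => ρ (a • t) = θ a • ρ t) (fun b x => ?_) (by simp)
      (fun x y hx hy => by rw [smul_add, map_add, hx, hy, map_add, smul_add]) t
    rw [smul_tmul', smul_eq_mul, hρ, hρ, map_mul, mul_smul]
  have ρ_map : ∀ (f : N.carrier →ₗ[S] N.carrier) t, ρ (f.baseChange A t) = f (ρ t) := fun f t => by
    refine ind (P := fun t => ρ (f.baseChange A t) = f (ρ t)) (fun b x => ?_) (by simp)
      (fun x y hx hy => by rw [map_add, map_add, hx, hy, map_add, map_add]) t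
    rw [LinearMap.baseChange_tmul, hρ, hρ, map_smul]
  have q_map : ∀ (f : N.carrier →ₗ[S] N.carrier) t, q (f.baseChange A t) = f.baseChange A (q t) :=
    fun f t => by
    refine ind (P := fun t => q (f.baseChange A t) = f.baseChange A (q t)) (fun b x => ?_) (by simp)
      (fun x y hx hy => by rw [map_add, map_add, hx, hy, map_add, map_add]) t
    rw [LinearMap.baseChange_tmul, hqt, hqt, LinearMap.baseChange_tmul]
  have ρs : ∀ x, ρ (s x) = x := fun x => by
    rw [hs, hρ, map_one, one_smul]
  have ρτ : ∀ t, ρ (τ • t) = 0 := fun t => by rw [ρ_smul, θτ, zero_smul]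
  have sρ : ∀ t, s (ρ t) + τ • q t = t := fun t => by
    refine ind (P := fun t => s (ρ t) + τ • q t = t) (fun b x => ?_) (by simp)
      (fun x y hx hy => ?_) t
    · rw [hρ, hqt, hs, smul_tmul', tmul_smul, smul_tmul', ← TensorProduct.add_tmul]
      congr 1
      change ι (θ b) * 1 + τ * q₀ b = b
      rw [mul_one, hdiv]
    · rw [map_add, map_add, map_add, smul_add, add_add_add_comm, hx, hy]
  have q_τ : ∀ t, q (τ • t) = t := fun t => by
    refine ind (P := fun t => q (τ • t) = t) (fun b x => ?_) (by simp)
      (fun x y hx hy => by rw [smul_add, map_add, hx, hy]) t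
    rw [smul_tmul', hqt, smul_eq_mul, qτ]
  have q_smul : ∀ (c : S) t, q (ι c • t) = ι c • q t := fun c t => by
    refine ind (P := fun t => q (ι c • t) = ι c • q t) (fun b x => ?_) (by simp)
      (fun x y hx hy => by rw [smul_add, map_add, hx, hy, map_add, smul_add]) t
    rw [smul_tmul', hqt, smul_eq_mul, hq, hqt, smul_tmul', smul_eq_mul]
  have s_smul : ∀ (c : S) x, s (c • x) = ι c • s x := fun c x => bcMk_smul ι N c x
  have ρ_mem : ∀ i, ∀ t ∈ (N.baseChange ι).gr i, ρ t ∈ N.gr i := fun i t ht => by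
    refine Submodule.closure_induction (p := fun t _ => ρ t ∈ N.gr i) (by simp)
      (fun x y _ _ hx hy => by rw [map_add]; exact add_mem hx hy) ?_ ht
    rintro a _ ⟨x, hx, rfl⟩
    rw [ρ_smul]
    exact Submodule.smul_mem _ _ (by rwa [hρ, map_one, one_smul])
  have q_mem : ∀ i, ∀ t ∈ (N.baseChange ι).gr i, q t ∈ (N.baseChange ι).gr i := fun i t ht => by
    -- The division is not linear over `A`, so the induction has to run over sums of multiples `a •
    -- (1 ⊗ x)` of the generators.
    refine Submodule.closure_induction (p := fun t _ => q t ∈ (N.baseChange ι).gr i) (by simp)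
      (fun x y _ _ hx hy => by rw [map_add]; exact add_mem hx hy) ?_ ht
    rintro a _ ⟨x, hx, rfl⟩
    have h1 : a • ((1 : A) ⊗ₜ[S] x) = a ⊗ₜ[S] x := by
      rw [smul_tmul', smul_eq_mul, mul_one]
    have h2 : q₀ a ⊗ₜ[S] x = q₀ a • ((1 : A) ⊗ₜ[S] x) := by
      rw [smul_tmul', smul_eq_mul, mul_one]
    rw [h1, hqt, h2]
    exact Submodule.smul_mem _ _ (bcMk_mem ι hx)
  have ρ_d : ∀ t, ρ ((N.baseChange ι).d t) = N.d (ρ t) := fun t => by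
    rw [d_apply, map_add]
    exact congrArg₂ (· + ·) (ρ_map N.dp t) (ρ_map N.dm t)
  -- The entries `x'` and `y'` may involve the variable to be removed, so division and section need
  -- not commute with `d` of the inner cone. `eliminate` asks this of the reduction only, which
  -- turns the entries into `θ x'` and `θ y'`.
  refine eliminate (ι := ι) (τ := τ) (y := y) (M := kos x' y' (N.baseChange ι))
    (N := kos (θ x') (θ y') N)
    (ρ.toAddMonoidHom.prodMap ρ.toAddMonoidHom) (s.toAddMonoidHom.prodMap s.toAddMonoidHom)
    (q.toAddMonoidHom.prodMap q.toAddMonoidHom)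
    (fun c v => ?_) (fun c v => Prod.ext (s_smul c v.1) (s_smul c v.2))
    (fun c v => Prod.ext (q_smul c v.1) (q_smul c v.2)) (fun v => ?_)
    (fun v => Prod.ext (ρ_map N.del v.1) (ρ_map N.del v.2))
    (fun v => Prod.ext (bcMk_del ι N v.1).symm (bcMk_del ι N v.2).symm)
    (fun v => Prod.ext (q_map N.del v.1) (q_map N.del v.2))
    (fun i v hv => ⟨ρ_mem _ _ hv.1, ρ_mem _ _ hv.2⟩)
    (fun i v hv => ⟨bcMk_mem ι hv.1, bcMk_mem ι hv.2⟩)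
    (fun i v hv => ⟨q_mem _ _ hv.1, q_mem _ _ hv.2⟩)
    (fun v => Prod.ext (ρs v.1) (ρs v.2)) (fun v => Prod.ext (ρτ v.1) (ρτ v.2))
    (fun v => Prod.ext (sρ v.1) (sρ v.2)) (fun v => Prod.ext (q_τ v.1) (q_τ v.2)) ?_
  · refine Prod.ext ?_ ?_
    · change ρ (ι c • v.1) = c • ρ v.1
      rw [ρ_smul, hθ]
    · change ρ (ι c • v.2) = c • ρ v.2
      rw [ρ_smul, hθ]
  · rw [kos_d, kos_d]
    refine Prod.ext ?_ ?_
    · change ρ ((N.baseChange ι).d v.1 + x' • v.2) = N.d (ρ v.1) + θ x' • ρ v.2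
      rw [map_add, ρ_d, ρ_smul]
    · change ρ (y' • v.1 - (N.baseChange ι).d v.2) = θ y' • ρ v.1 - N.d (ρ v.2)
      rw [map_sub, ρ_d, ρ_smul]
  · change τ * y + (x' * y' + ι N.potential) = ι (θ x' * θ y' + N.potential)
    rw [map_add, ← pot, add_assoc]

end HEquiv
end MFComplex

/-! ### Polynomial division by the difference of a variable and an expression without it. -/

section Substitution
variable {k : Type u} [Field k] {V : Type} [DecidableEq V] (v : V)

/-- Substitution of `c` for the variable `v`. -/
noncomputable def substVar (c : MvPolynomial {x // x ≠ v} k) :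
    MvPolynomial V k →ₐ[k] MvPolynomial {x // x ≠ v} k :=
  aeval fun x => if h : x = v then c else X ⟨x, h⟩

/-- Inclusion of the polynomials without the variable `v`. -/
noncomputable def inclVar : MvPolynomial {x // x ≠ v} k →ₐ[k] MvPolynomial V k :=
  rename Subtype.val

variable {v} (c : MvPolynomial {x // x ≠ v} k)

theorem substVar_X_self : substVar v c (X v) = c := by simp [substVar]

theorem substVar_X {x : V} (h : x ≠ v) : substVar v c (X x) = X ⟨x, h⟩ := by simp [substVar, h]

theorem substVar_inclVar (f : MvPolynomial {x // x ≠ v} k) : substVar v c (inclVar v f) = f := by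
  have : (substVar v c).comp (inclVar v) = AlgHom.id k _ := by
    ext ⟨x, hx⟩
    simp [inclVar, substVar, hx]
  exact DFunLike.congr_fun this f

/-- Substituting `c + 1` for the variable turns the difference into `1`. -/
theorem X_sub_inclVar_ne_zero : (X v : MvPolynomial V k) - inclVar v c ≠ 0 := fun h => by
  have h1 := congrArg (substVar v (c + 1)) h
  rw [map_sub, substVar_X_self, substVar_inclVar, map_zero, add_sub_cancel_left] at h1
  exact one_ne_zero h1

/-- Modulo `v - c`, substitution followed by inclusion agrees with the identity on every variable,
hence on every polynomial. -/
theorem exists_substVar_add (f : MvPolynomial V k) :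
    ∃ g, inclVar v (substVar v c f) + (X v - inclVar v c) * g = f := by
  let I : Ideal (MvPolynomial V k) := Ideal.span {X v - inclVar v c}
  have h : (Ideal.Quotient.mkₐ k I).comp ((inclVar v).comp (substVar v c)) =
      Ideal.Quotient.mkₐ k I := by
    ext x
    by_cases hx : x = v
    · subst hx
      simp only [AlgHom.comp_apply, substVar_X_self, Ideal.Quotient.mkₐ_eq_mk]
      exact (Ideal.Quotient.eq.2 (Ideal.mem_span_singleton_self _)).symm
    · simp [substVar_X c hx, inclVar]
  have h1 := DFunLike.congr_fun h f
  simp only [AlgHom.comp_apply, Ideal.Quotient.mkₐ_eq_mk] at h1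
  obtain ⟨g, hg⟩ := Ideal.mem_span_singleton.1 (Ideal.Quotient.eq.1 h1.symm)
  exact ⟨g, by rw [← hg]; ring⟩

/-- The quotient of the division by `v - c`, as a function. -/
noncomputable def divVarFun (f : MvPolynomial V k) : MvPolynomial V k :=
  (exists_substVar_add c f).choose

theorem divVarFun_spec (f : MvPolynomial V k) :
    inclVar v (substVar v c f) + (X v - inclVar v c) * divVarFun c f = f :=
  (exists_substVar_add c f).choose_spec

/-- The quotient of the division by `v - c`. -/
noncomputable def divVar : MvPolynomial V k →+ MvPolynomial V k where
  toFun := divVarFun c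
  -- The chosen quotients are unique, because `v - c` is nonzero in a domain; this makes an
  -- arbitrary choice additive.
  map_zero' := mul_left_cancel₀ (X_sub_inclVar_ne_zero c) (by
    have := divVarFun_spec c (0 : MvPolynomial V k)
    rw [map_zero, map_zero, zero_add] at this
    rw [this, mul_zero])
  map_add' f g := mul_left_cancel₀ (X_sub_inclVar_ne_zero c) (by
    have h1 := divVarFun_spec c f
    have h2 := divVarFun_spec c g
    have h3 := divVarFun_spec c (f + g)
    rw [map_add, map_add] at h3
    linear_combination h3 - h1 - h2)

theorem divVar_spec (f : MvPolynomial V k) :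
    inclVar v (substVar v c f) + (X v - inclVar v c) * divVar c f = f :=
  divVarFun_spec c f

theorem divVar_mul (f : MvPolynomial V k) : divVar c ((X v - inclVar v c) * f) = f :=
  mul_left_cancel₀ (X_sub_inclVar_ne_zero c) (by
    have h := divVar_spec c ((X v - inclVar v c) * f)
    rwa [map_mul, map_sub, substVar_X_self, substVar_inclVar, sub_self, zero_mul, map_zero,
      zero_add] at h)

theorem divVar_inclVar_mul (g : MvPolynomial {x // x ≠ v} k) (f : MvPolynomial V k) :
    divVar c (inclVar v g * f) = inclVar v g * divVar c f :=
  mul_left_cancel₀ (X_sub_inclVar_ne_zero c) (by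
    have h := divVar_spec c (inclVar v g * f)
    have h' := divVar_spec c f
    rw [map_mul, substVar_inclVar, map_mul] at h
    linear_combination h - inclVar v g * h')

end Substitution
end KhR

namespace KhR
open TensorProduct MvPolynomial

/-- A complex is homotopy equivalent to its extension of scalars along an isomorphism. -/
noncomputable def MFComplex.HEquiv.ofBaseChange {S A : Type u} [CommRing S] [CommRing A]
    {ι : S →+* A} (θ : A →+* S) (hθ : ∀ s, θ (ι s) = s) (hι : ∀ a, ι (θ a) = a)
    (N : MFComplex S) : HEquiv ι (N.baseChange ι) N := by
  letI := ι.toAlgebra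
  let θL : A →ₗ[S] S := { θ with
    map_smul' := fun s a => by
      change θ (ι s * a) = s * θ a
      rw [map_mul, hθ] }
  let ρ : A ⊗[S] N.carrier →ₗ[S] N.carrier :=
    (TensorProduct.lid S N.carrier).toLinearMap ∘ₗ θL.rTensor N.carrier
  let s : N.carrier →ₗ[S] A ⊗[S] N.carrier := TensorProduct.mk S A N.carrier 1
  have hρ : ∀ a x, ρ (a ⊗ₜ x) = θ a • x := fun a x => by
    change TensorProduct.lid S N.carrier (θ a ⊗ₜ x) = _
    rw [TensorProduct.lid_tmul]
  have hs : ∀ x, s x = 1 ⊗ₜ x := fun x => rfl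
  have ρs : ∀ x, ρ (s x) = x := fun x => by
    rw [hs, hρ, map_one, one_smul]
  have sρ : ∀ t, s (ρ t) = t := fun t => by
    induction t using TensorProduct.induction_on with
    | zero => simp
    | add x y hx hy => rw [map_add, map_add, hx, hy]
    | tmul b x =>
      rw [hρ, hs, tmul_smul, smul_tmul']
      congr 1
      change ι (θ b) * 1 = b
      rw [mul_one, hι]
  have s_smul : ∀ (c : S) x, s (c • x) = ι c • s x := fun c x => bcMk_smul ι N c x
  have of_s : ∀ {P : A ⊗[S] N.carrier → Prop} (_ : ∀ x, P (s x)) t, P t := fun h t => by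
    rw [← sρ t]; exact h _
  have s_d : ∀ x, s (N.d x) = (N.baseChange ι).d (s x) := fun x => by
    rw [d_apply, d_apply, map_add]
    exact congrArg₂ (· + ·) (bcMk_dp ι N x) (bcMk_dm ι N x)
  have s_del : ∀ x, s (N.del x) = (N.baseChange ι).del (s x) := fun x => bcMk_del ι N x
  have ρ_mem : ∀ i, ∀ t ∈ (N.baseChange ι).gr i, ρ t ∈ N.gr i := fun i t ht => by
    refine Submodule.closure_induction (p := fun t _ => ρ t ∈ N.gr i) (by simp)
      (fun x y _ _ hx hy => by rw [map_add]; exact add_mem hx hy) ?_ ht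
    rintro a _ ⟨x, hx, rfl⟩
    rw [smul_tmul', hρ]
    exact Submodule.smul_mem _ _ hx
  exact
    { F := ρ.toAddMonoidHom
      G := s.toAddMonoidHom
      h := 0
      h' := 0
      F_smul := fun c => of_s fun x => by
        change ρ (ι c • s x) = c • ρ (s x)
        rw [← s_smul, ρs, ρs]
      G_smul := s_smul
      h_smul := fun s x => by simp
      h'_smul := fun s x => by simp
      F_d := of_s fun x => by
        change ρ ((N.baseChange ι).d (s x)) = N.d (ρ (s x))
        rw [← s_d, ρs, ρs]
      G_d := s_d
      F_del := of_s fun x => by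
        change ρ ((N.baseChange ι).del (s x)) = N.del (ρ (s x))
        rw [← s_del, ρs, ρs]
      G_del := s_del
      h_del := fun x => by simp
      h'_del := fun x => by simp
      F_mem := fun n j x hx => par_of_gr (M := N.baseChange ι) (N := N) ρ.toAddMonoidHom
        (fun j x hx => ρ_mem _ x hx) hx
      G_mem := fun n j x hx => par_of_gr (M := N) (N := N.baseChange ι) s.toAddMonoidHom
        (fun j x hx => bcMk_mem ι hx) hx
      h_mem := fun n j x hx => by simp
      h'_mem := fun n j x hx => by simp
      GF := fun x => by
        change s (ρ x) - x = (N.baseChange ι).d 0 + 0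
        rw [sρ, sub_self, map_zero, add_zero]
      FG := fun x => by
        change ρ (s x) - x = N.d 0 + 0
        rw [ρs, sub_self, map_zero, add_zero]
      pot := rfl }

/-! ### The combinatorics of forgetting inner vertices of paths and circles. -/

section Contraction
variable {V W : Type}

/-- There is an edge from `x` to `y`; edges are listed as pairs of their head and their tail. -/
def Step (E : List (V × V)) (x y : V) : Prop := (y, x) ∈ E

/-- The graph with edges `E₀` arises from the one with edges `E` by forgetting the vertices
outside the image of `g`, all of which lie in the interior of a path or of a circle. -/
structure Contracts (g : W → V) (E : List (V × V)) (E₀ : List (W × W)) : Prop where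
  heads : (E.map Prod.fst).Nodup
  tails : (E.map Prod.snd).Nodup
  nodup : E₀.Nodup
  head_mem : ∀ v ∉ Set.range g, ∃ a, (v, a) ∈ E
  tail_mem : ∀ v ∉ Set.range g, ∃ b, (b, v) ∈ E
  -- This excludes circles all of whose vertices are forgotten. On such a circle one would end with
  -- a loop at a forgotten vertex, which cannot be contracted any further.
  reach : ∀ v ∉ Set.range g, ∃ w, Relation.TransGen (Step E) (g w) v
  tail_of : ∀ a b, (b, g a) ∈ E → ∃ b', (b', a) ∈ E₀
  path : ∀ a b, (b, a) ∈ E₀ → Relation.TransGen (Step E) (g a) (g b)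
  -- Together with `path` this says that the next visible vertex after `g a` is `g b` and that no
  -- further one follows: an edge of `E₀` is an entire open path, or an entire circle with one
  -- visible vertex.
  unique : ∀ a b, (b, a) ∈ E₀ → ∀ w, Relation.TransGen (Step E) (g a) (g w) → w = b

namespace Contracts
variable {g : W → V} {E : List (V × V)} {E₀ : List (W × W)}

theorem perm {E' : List (V × V)} (h : Contracts g E E₀) (hE : E.Perm E') : Contracts g E' E₀ := by
  have e : Step E = Step E' := by ext x y; exact hE.mem_iff
  have e' : ∀ x, x ∈ E' ↔ x ∈ E := fun x => hE.mem_iff.symm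
  refine ⟨(hE.map _).nodup_iff.1 h.heads, (hE.map _).nodup_iff.1 h.tails, h.nodup, ?_, ?_, ?_, ?_,
    ?_, ?_⟩ <;> simp only [← e, e']
  exacts [h.head_mem, h.tail_mem, h.reach, h.tail_of, h.path, h.unique]

theorem head_unique (h : Contracts g E E₀) {x a b : V} (ha : (x, a) ∈ E) (hb : (x, b) ∈ E) :
    a = b :=
  congrArg Prod.snd (List.inj_on_of_nodup_map h.heads ha hb rfl)

theorem tail_unique (h : Contracts g E E₀) {x a b : V} (ha : (a, x) ∈ E) (hb : (b, x) ∈ E) :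
    a = b :=
  congrArg Prod.fst (List.inj_on_of_nodup_map h.tails ha hb rfl)

/-- If no vertex is forgotten, nothing changes. -/
theorem perm_of_surjective (h : Contracts g E E₀) (hg : Function.Injective g)
    (hs : ∀ v, v ∈ Set.range g) : E.Perm (E₀.map (Prod.map g g)) := by
  refine (List.perm_ext_iff_of_nodup (List.Nodup.of_map _ h.heads)
    (h.nodup.map (hg.prodMap hg))).2 ?_
  rintro ⟨b, a⟩
  obtain ⟨a, rfl⟩ := hs a
  obtain ⟨b, rfl⟩ := hs b
  have key : (b, a) ∈ E₀ ↔ (g b, g a) ∈ E := by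
    constructor
    · intro hab
      -- The first edge of the path ends at a visible vertex, since all are visible, and by
      -- uniqueness this is already `g b`.
      obtain ⟨c, hc, -⟩ := Relation.TransGen.head'_iff.1 (h.path a b hab)
      obtain ⟨c, rfl⟩ := hs c
      rwa [h.unique a b hab c (.single hc)] at hc
    · intro hab
      obtain ⟨b', hb'⟩ := h.tail_of a (g b) hab
      rwa [h.unique a b' hb' b (.single hab)]
  rw [← key, List.mem_map]
  constructor
  · exact fun hab => ⟨_, hab, rfl⟩
  · rintro ⟨⟨b', a'⟩, hab, e⟩
    obtain ⟨e1, e2⟩ := Prod.mk.inj e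
    rwa [← hg e1, ← hg e2]

/-- The two edges at a forgotten vertex. -/
theorem exists_perm (h : Contracts g E E₀) {v : V} (hv : v ∉ Set.range g) :
    ∃ a b E', a ≠ v ∧ b ≠ v ∧ E.Perm ((v, a) :: (b, v) :: E') := by
  obtain ⟨a, ha⟩ := h.head_mem v hv
  obtain ⟨b, hb⟩ := h.tail_mem v hv
  have hav : a ≠ v := by
    rintro rfl
    obtain ⟨w, hw⟩ := h.reach a hv
    -- With a loop at the forgotten vertex, this vertex would be its own only predecessor, so no
    -- path from a visible vertex could enter it, against `reach`.
    have : ∀ x, Relation.TransGen (Step E) (g w) x → x ≠ a := by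
      intro x hx
      induction hx with
      | single hx =>
        rintro rfl
        exact hv ⟨w, h.head_unique hx ha⟩
      | tail _ hx hy =>
        rintro rfl
        exact hy (h.head_unique hx ha)
    exact this a hw rfl
  have hbv : b ≠ v := by
    rintro rfl
    exact hav (h.head_unique ha hb)
  obtain ⟨E₁, h₁⟩ : ∃ E₁, E.Perm ((v, a) :: E₁) := by
    classical exact ⟨_, List.perm_cons_erase ha⟩
  have hb₁ : (b, v) ∈ E₁ := by
    rcases List.mem_cons.1 (h₁.mem_iff.1 hb) with e | e
    · exact absurd (Prod.mk.inj e).1 hbv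
    · exact e
  obtain ⟨E₂, h₂⟩ : ∃ E₂, E₁.Perm ((b, v) :: E₂) := by
    classical exact ⟨_, List.perm_cons_erase hb₁⟩
  exact ⟨a, b, E₂, hav, hbv, h₁.trans (h₂.cons _)⟩

/-- Forgetting a single vertex. -/
theorem contract {v : V} {a b : {x // x ≠ v}} {E' : List ({x // x ≠ v} × {x // x ≠ v})}
    {g' : W → {x // x ≠ v}}
    (h : Contracts (fun w => (g' w).1) ((v, a.1) :: (b.1, v) :: E'.map (Prod.map Subtype.val
      Subtype.val)) E₀) : Contracts g' ((b, a) :: E') E₀ := by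
  set E := (v, a.1) :: (b.1, v) :: E'.map (Prod.map Subtype.val Subtype.val) with hE
  have hinj : Function.Injective (Subtype.val : {x // x ≠ v} → V) := Subtype.val_injective
  have mem_iff : ∀ x y : {x // x ≠ v}, (x, y) ∈ E' ↔ (x.1, y.1) ∈ E := by
    intro x y
    simp only [hE, List.mem_cons, Prod.mk.injEq, x.2, y.2, false_and, and_false, false_or,
      List.mem_map, Prod.exists, Prod.map_apply]
    constructor
    · exact fun h => ⟨x, y, h, rfl, rfl⟩
    · rintro ⟨x', y', h, e1, e2⟩
      rwa [← hinj e1, ← hinj e2]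
  have ha : (v, a.1) ∈ E := by simp [hE]
  have hb : (b.1, v) ∈ E := by simp [hE]
  have h1 : (E.map Prod.fst).Nodup := h.heads
  have h2 : (E.map Prod.snd).Nodup := h.tails
  have to_step : ∀ x y, Relation.TransGen (Step ((b, a) :: E')) x y →
      Relation.TransGen (Step E) x.1 y.1 := by
    intro x y hxy
    have : ∀ x y, Step ((b, a) :: E') x y → Relation.TransGen (Step E) x.1 y.1 := by
      intro x y hxy
      rcases List.mem_cons.1 hxy with e | e
      · obtain ⟨rfl, rfl⟩ := Prod.mk.inj e
        exact .tail (.single ha) hb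
      · exact .single ((mem_iff _ _).1 e)
    induction hxy with
    | single hx => exact this _ _ hx
    | tail _ hx hy => exact hy.trans (this _ _ hx)
  -- Paths that stop at `v` have to be carried along in the induction: up to the predecessor `a` of
  -- `v` they exist in the contracted graph, and the next step away from `v` becomes the new edge.
  have of_step : ∀ (x : {x // x ≠ v}) (y : V), Relation.TransGen (Step E) x.1 y →
      (∀ hy : y ≠ v, Relation.TransGen (Step ((b, a) :: E')) x ⟨y, hy⟩) ∧
      (y = v → Relation.ReflTransGen (Step ((b, a) :: E')) x a) := by
    intro x y hxy
    induction hxy with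
    | single hx =>
      refine ⟨fun hy => .single (List.mem_cons_of_mem _ ((mem_iff _ _).2 hx)), ?_⟩
      rintro rfl
      have : x = a := hinj (h.head_unique hx ha)
      rw [this]
    | @tail y z _ hx hy =>
      constructor
      · intro hz
        by_cases hyv : y = v
        · subst hyv
          refine Relation.TransGen.tail' (hy.2 rfl) (List.mem_cons.2 (Or.inl ?_))
          rw [Prod.mk.injEq]
          exact ⟨hinj (h.tail_unique hx hb), rfl⟩
        · exact .tail (hy.1 hyv) (List.mem_cons_of_mem _ ((mem_iff ⟨z, hz⟩ ⟨y, hyv⟩).2 hx))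
      · rintro rfl
        have hya : y = a.1 := h.head_unique hx ha
        subst hya
        exact (hy.1 a.2).to_reflTransGen
  have nr : ∀ x : {x // x ≠ v}, x ∉ Set.range g' → x.1 ∉ Set.range fun w => (g' w).1 := by
    rintro x hx ⟨w, hw⟩
    exact hx ⟨w, hinj hw⟩
  refine ⟨?_, ?_, h.nodup, ?_, ?_, ?_, ?_, ?_, ?_⟩
  · rw [hE, List.map_cons, List.nodup_cons] at h1
    refine List.Nodup.of_map Subtype.val ?_
    have := h1.2
    simpa [List.map_map, Function.comp_def] using this
  · rw [hE, List.map_cons, List.map_cons, (List.Perm.swap _ _ _).nodup_iff, List.nodup_cons] at h2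
    refine List.Nodup.of_map Subtype.val ?_
    have := h2.2
    simpa [List.map_map, Function.comp_def] using this
  · intro x hx
    obtain ⟨c, hc⟩ := h.head_mem x.1 (nr x hx)
    by_cases hcv : c = v
    · subst hcv
      exact ⟨a, List.mem_cons.2 (Or.inl (Prod.ext (hinj (h.tail_unique hc hb)) rfl))⟩
    · exact ⟨⟨c, hcv⟩, List.mem_cons_of_mem _ ((mem_iff _ _).2 hc)⟩
  · intro x hx
    obtain ⟨c, hc⟩ := h.tail_mem x.1 (nr x hx)
    by_cases hcv : c = v
    · subst hcv
      exact ⟨b, List.mem_cons.2 (Or.inl (Prod.ext rfl (hinj (h.head_unique hc ha))))⟩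
    · exact ⟨⟨c, hcv⟩, List.mem_cons_of_mem _ ((mem_iff _ _).2 hc)⟩
  · intro x hx
    obtain ⟨w, hw⟩ := h.reach x.1 (nr x hx)
    exact ⟨w, (of_step _ _ hw).1 x.2⟩
  · intro x y hxy
    rcases List.mem_cons.1 hxy with e | e
    · refine h.tail_of x v ?_
      rw [(Prod.mk.inj e).2]
      exact ha
    · exact h.tail_of x y.1 ((mem_iff _ _).1 e)
  · exact fun x y hxy => (of_step _ _ (h.path x y hxy)).1 _
  · exact fun x y hxy w hw => h.unique x y hxy w (to_step _ _ hw)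

end Contracts
end Contraction

/-! ### Elimination of inner variables up to homotopy. -/

section Elimination
variable {k : Type u} [Field k] {p : Polynomial k} (χ : CrossingData p)

/-- The factors of a diagram with edges `E` and crossings `C`. -/
noncomputable def varFactors (k : Type u) [Field k] {V : Type} (L : List (Factor V)) :
    List (Factor (MvPolynomial V k)) :=
  L.map (Factor.map X)

theorem varFactors_rename {V V' : Type} (g : V → V') (L : List (Factor V)) :
    (varFactors k L).map (Factor.map (rename g : MvPolynomial V k →ₐ[k] MvPolynomial V' k)) =
      varFactors k (L.map (Factor.map g)) := by
  rw [varFactors, varFactors, List.map_map, List.map_map]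
  refine List.map_congr_left fun F _ => ?_
  simp only [Function.comp_apply, Factor.map_map]
  congr 1
  ext x : 1
  simp

theorem map_inl_append_inr {V V' : Type} (g : V → V') (E : List (V × V))
    (C : List (Bool × (Fin 4 → V))) :
    (E.map Sum.inl ++ C.map Sum.inr : List (Factor V)).map (Factor.map g) =
      (E.map (Prod.map g g)).map Sum.inl ++ (C.map (Prod.map id fun f => g ∘ f)).map Sum.inr := by
  simp [List.map_map, Function.comp_def, Factor.map]

/-- Only the two edges at `v` involve its variable; `L` comes from the ring without it. Division by
`t_v - t_a` removes the first edge, and setting `t_v = t_a` in the second one leaves an edge from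
`a` to `b`. The case `a = b`, in which a loop arises, is included. -/
theorem hEquiv_contract_edge {V : Type} {v : V} (a b : {x // x ≠ v})
    (L : List (Factor {x // x ≠ v})) :
    Nonempty (HEquiv (rename Subtype.val : MvPolynomial {x // x ≠ v} k →ₐ[k] _).toRingHom
      (factorsMF χ (varFactors k (Sum.inl (v, a.1) :: Sum.inl (b.1, v) ::
        L.map (Factor.map Subtype.val))))
      (factorsMF χ (varFactors k (Sum.inl (b, a) :: L)))) := by
  classical
  let c : MvPolynomial {x // x ≠ v} k := X a
  have hc : inclVar v c = X a.1 := rename_X _ _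
  have e1 : substVar v c (X b.1) = X b := substVar_X c b.2
  have e2 : substVar v c (X v) = c := substVar_X_self c
  have e3 : substVar v c (X b.1 - X v) = X b - X a := by rw [map_sub, e1, e2]
  have e4 : substVar v c (divDiff p (X b.1) (X v)) = divDiff p (X b) (X a) := by
    rw [map_divDiff, e1, e2]
  have h := HEquiv.eliminateBaseChange (ι := (inclVar v : _ →ₐ[k] MvPolynomial V k).toRingHom)
    (substVar v c).toRingHom (substVar_inclVar c) (τ := X v - inclVar v c)
    (y := divDiff p (X v) (X a.1)) (x' := X b.1 - X v) (y' := divDiff p (X b.1) (X v))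
    (divVar c) (divVar_inclVar_mul c)
    (by change substVar v c _ = 0; rw [map_sub, e2, substVar_inclVar, sub_self])
    (divVar_spec c) (divVar_mul c) (factorsMF χ (varFactors k L)) (by
      -- The potentials telescope: `p(t_v) - p(t_a)` and `p(t_b) - p(t_v)` add up to `p(t_b) -
      -- p(t_a)`, which does not contain `t_v`.
      change _ = inclVar v (substVar v c _ * substVar v c _)
      rw [← map_mul, hc, sub_mul_divDiff, sub_mul_divDiff, map_sub, map_sub,
        ← Polynomial.aeval_algHom_apply, ← Polynomial.aeval_algHom_apply,
        ← Polynomial.aeval_algHom_apply, ← Polynomial.aeval_algHom_apply, e1, e2, hc]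
      change _ = Polynomial.aeval (rename Subtype.val (X b)) p - _
      rw [rename_X]
      ring)
  rw [hc] at h
  have i1 : Isom (factorsMF χ (varFactors k (Sum.inl (v, a.1) :: Sum.inl (b.1, v) ::
      L.map (Factor.map Subtype.val)))) (kos (X v - X a.1) (divDiff p (X v) (X a.1))
        (kos (X b.1 - X v) (divDiff p (X b.1) (X v))
          ((factorsMF χ (varFactors k L)).baseChange (inclVar v).toRingHom))) := by
    refine ((Isom.refl _).tensor ((Isom.refl _).tensor ?_)).trans
      (((Isom.refl _).tensor (koszul_tensor_isom _ _ _)).trans (koszul_tensor_isom _ _ _))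
    refine ((baseChange_factorsMF χ (inclVar v) (varFactors k L)).trans (Isom.of_eq ?_)).symm
    rw [inclVar, varFactors_rename]
    rfl
  have i2 : Isom (kos (substVar v c (X b.1 - X v)) (substVar v c (divDiff p (X b.1) (X v)))
      (factorsMF χ (varFactors k L))) (factorsMF χ (varFactors k (Sum.inl (b, a) :: L))) := by
    rw [e3, e4]
    exact (factorsMF_cons_edge χ _ _ _).symm
  obtain ⟨i1⟩ := i1
  obtain ⟨i2⟩ := i2
  exact ⟨((HEquiv.ofGrIso i1).trans h).trans (HEquiv.ofGrIso i2)⟩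

/-- Induction on the number `n` of forgotten vertices: contracting one of them preserves the
hypothesis `Contracts`, and if none is left, then `g` is a bijection and the two lists of edges
agree up to order. -/
theorem hEquiv_of_contracts {W : Type} (E₀ : List (W × W)) (C₀ : List (Bool × (Fin 4 → W)))
    (n : ℕ) : ∀ (V : Type) [Finite V] (g : W → V) (_ : Function.Injective g) (E : List (V × V))
      (_ : Contracts g E E₀), (Set.range g)ᶜ.ncard = n →
      Nonempty (HEquiv (rename g : MvPolynomial W k →ₐ[k] MvPolynomial V k).toRingHom
        (factorsMF χ (varFactors k (E.map Sum.inl ++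
          (C₀.map (Prod.map id fun f => g ∘ f)).map Sum.inr)))
        (factorsMF χ (varFactors k (E₀.map Sum.inl ++ C₀.map Sum.inr)))) := by
  induction n with
  | zero =>
    intro V _ g hg E hE hn
    rw [Set.ncard_eq_zero, Set.compl_empty_iff] at hn
    have hs : Function.Surjective g := Set.range_eq_univ.1 hn
    have hp := hE.perm_of_surjective hg (fun v => hs v)
    let e : W ≃ V := Equiv.ofBijective g ⟨hg, hs⟩
    have i1 := factorsMF_perm χ (((hp.map Sum.inl).append_right
      ((C₀.map (Prod.map id fun f => g ∘ f)).map Sum.inr : List (Factor V))).map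
        (Factor.map (X (R := k))))
    have i2 := baseChange_factorsMF χ (rename g : MvPolynomial W k →ₐ[k] MvPolynomial V k)
      (varFactors k (E₀.map Sum.inl ++ C₀.map Sum.inr))
    rw [varFactors_rename, map_inl_append_inr] at i2
    obtain ⟨i⟩ := i1.trans i2.symm
    refine ⟨(HEquiv.ofGrIso i).trans (HEquiv.ofBaseChange (rename e.symm : MvPolynomial V k →ₐ[k]
      MvPolynomial W k).toRingHom ?_ ?_ _)⟩
    · intro s
      change rename e.symm (rename e s) = s
      rw [rename_rename, Equiv.symm_comp_self, rename_id_apply]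
    · intro s
      change rename e (rename e.symm s) = s
      rw [rename_rename, Equiv.self_comp_symm, rename_id_apply]
  | succ n ih =>
    intro V _ g hg E hE hn
    obtain ⟨v, hv⟩ : (Set.range g)ᶜ.Nonempty := by
      rw [← Set.ncard_pos, hn]; exact n.succ_pos
    obtain ⟨a, b, E₁, ha, hb, hp⟩ := hE.exists_perm hv
    have hE₁ := hE.perm hp
    have hgv : ∀ w, g w ≠ v := fun w hw => hv ⟨w, hw⟩
    -- Heads are not repeated and tails are not repeated, so `v` does not occur in the other edges,
    -- which therefore live on the remaining vertices.
    obtain ⟨E', rfl⟩ : ∃ E' : List ({x // x ≠ v} × {x // x ≠ v}),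
        E'.map (Prod.map Subtype.val Subtype.val) = E₁ := by
      rw [← Set.mem_range, Set.range_list_map]
      rintro ⟨x, y⟩ hxy
      have h1 := hE₁.heads
      have h2 := hE₁.tails
      simp only [List.map_cons, List.nodup_cons, List.mem_cons, not_or, List.mem_map, not_exists,
        not_and] at h1 h2
      exact ⟨(⟨x, fun e => h1.1.2 _ hxy e⟩, ⟨y, fun e => h2.2.1 _ hxy e⟩), rfl⟩
    let g' : W → {x // x ≠ v} := fun w => ⟨g w, hgv w⟩
    have hg' : Function.Injective g' := fun x y h => hg (congrArg Subtype.val h)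
    have hC := Contracts.contract (a := ⟨a, ha⟩) (b := ⟨b, hb⟩) (g' := g') hE₁
    have hn' : (Set.range g')ᶜ.ncard = n := by
      have : (Set.range g)ᶜ = insert v (Subtype.val '' (Set.range g')ᶜ) := by
        ext x
        simp only [Set.mem_compl_iff, Set.mem_range, Set.mem_insert_iff, Set.mem_image,
          Subtype.exists, exists_and_right, exists_eq_right, g', Subtype.mk.injEq]
        constructor
        · intro h
          by_cases hx : x = v
          · exact Or.inl hx
          · exact Or.inr ⟨hx, h⟩
        · rintro (rfl | ⟨_, h⟩)
          · exact hv
          · exact h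
      rw [this, Set.ncard_insert_of_notMem (by simp),
        Set.ncard_image_of_injective _ Subtype.val_injective] at hn
      omega
    obtain ⟨f⟩ := ih _ g' hg' _ hC hn'
    obtain ⟨f'⟩ := hEquiv_contract_edge χ (⟨a, ha⟩ : {x // x ≠ v}) ⟨b, hb⟩
      (E'.map Sum.inl ++ (C₀.map (Prod.map id fun f => g' ∘ f)).map Sum.inr)
    have i := factorsMF_perm χ (((hp.map Sum.inl).append_right
      ((C₀.map (Prod.map id fun f => g ∘ f)).map Sum.inr : List (Factor V))).map
        (Factor.map (X (R := k))))
    have e : ((((v, a) :: (b, v) :: E'.map (Prod.map Subtype.val Subtype.val)).map Sum.inl ++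
        (C₀.map (Prod.map id fun f => g ∘ f)).map Sum.inr) : List (Factor V)) =
        Sum.inl (v, a) :: Sum.inl (b, v) :: (E'.map Sum.inl ++ (C₀.map (Prod.map id
          fun f => g' ∘ f)).map Sum.inr : List (Factor {x // x ≠ v})).map
            (Factor.map Subtype.val) := by
      rw [map_inl_append_inr, List.map_map (f := Prod.map id fun f => g' ∘ f)]
      rfl
    rw [e] at i
    obtain ⟨i⟩ := i
    have h := ((HEquiv.ofGrIso i).trans f').trans f
    have eι : ((RingHom.id (MvPolynomial V k)).comp
        (rename Subtype.val : MvPolynomial {x // x ≠ v} k →ₐ[k] _).toRingHom).comp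
          (rename g' : MvPolynomial W k →ₐ[k] _).toRingHom =
        (rename g : MvPolynomial W k →ₐ[k] MvPolynomial V k).toRingHom := by
      rw [RingHom.id_comp]
      have : (rename Subtype.val : MvPolynomial {x // x ≠ v} k →ₐ[k] MvPolynomial V k).comp
          (rename g') = rename g := by
        ext x : 1
        simp [g']
      rw [← this]
      rfl
    rw [eι] at h
    exact ⟨h⟩

end Elimination
end KhR

namespace KhR
-- Paths in graphs where every vertex has at most one successor.
section Deterministic
variable {P : Type*} {R : P → P → Prop}

/-- From a closed point the only way forward leads around its circle, so every point that is reached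
lies on this circle. -/
theorem transGen_symm_of_closed (hout : ∀ a b c, R a b → R a c → b = c) {a b : P}
    (ha : Relation.TransGen R a a) (hab : Relation.TransGen R a b) : Relation.TransGen R b a := by
  have key : ∀ x y, Relation.TransGen R x a → R x y → Relation.TransGen R y a := by
    intro x y hx hxy
    obtain ⟨c, hc, hca⟩ := Relation.TransGen.head'_iff.1 hx
    rw [hout x y c hxy hc]
    exact Relation.TransGen.trans_right hca ha
  induction hab with
  | single h => exact key _ _ ha h
  | tail _ h ih => exact key _ _ ih h

/-- If no source leads to `x`, choose a predecessor for every point from which `x` can be reached.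
Successors are unique, so this choice is an injective self-map of a finite set, hence surjective. So
`x` is the predecessor of a point that leads back to `x`. -/
theorem exists_source_or_closed [Finite P] (hout : ∀ a b c, R a b → R a c → b = c) (x : P) :
    (∃ a, (∀ c, ¬ R c a) ∧ Relation.ReflTransGen R a x) ∨ Relation.TransGen R x x := by
  by_contra! h
  obtain ⟨h1, h2⟩ := h
  let S := {a // Relation.ReflTransGen R a x}
  have hp : ∀ a : S, ∃ c : S, R c.1 a.1 := fun a => by
    by_contra! hc
    exact h1 a.1 (fun c hca => hc ⟨c, .head hca a.2⟩ hca) a.2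
  choose p hp using hp
  have hinj : Function.Injective p := fun a b hab => by
    have h := hp a
    rw [hab] at h
    exact Subtype.ext (hout _ _ _ h (hp b))
  obtain ⟨y, hy⟩ := Finite.surjective_of_injective hinj ⟨x, .refl⟩
  have h := hp y
  rw [hy] at h
  exact h2 (Relation.TransGen.head' h y.2)

end Deterministic

/-! ### The glued diagram as a graph of arcs and edges. -/

section Pieces
variable {B₀ : Boundary} {m : ℕ} {B : Fin m → Boundary} (η : ArcDiagram B₀ B)
  (T : ∀ i, TangleDiagram (B i))

/-- The arcs and the edges of the pieces. -/
abbrev PieceIndex : Type := Fin η.arcs ⊕ Σ i, Fin (T i).edges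

/-- The tail of a piece. -/
def pieceTail : PieceIndex η T → GluePoint B₀ T
  | Sum.inl α => arcPoint T (η.tail α).1
  | Sum.inr e => Sum.inr ⟨e.1, ((T e.1).tail e.2).1⟩

/-- The head of a piece. -/
def pieceHead : PieceIndex η T → GluePoint B₀ T
  | Sum.inl α => arcPoint T (η.head α).1
  | Sum.inr e => Sum.inr ⟨e.1, ((T e.1).head e.2).1⟩

theorem piece_iff (a b : GluePoint B₀ T) :
    Piece η T a b ↔ ∃ e, pieceTail η T e = a ∧ pieceHead η T e = b := by
  constructor
  · rintro (⟨i, e, rfl, rfl⟩ | ⟨α, rfl, rfl⟩)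
    · exact ⟨Sum.inr ⟨i, e⟩, rfl, rfl⟩
    · exact ⟨Sum.inl α, rfl, rfl⟩
  · rintro ⟨α | ⟨i, e⟩, rfl, rfl⟩
    · exact Or.inr ⟨α, rfl, rfl⟩
    · exact Or.inl ⟨i, e, rfl, rfl⟩

theorem arcPoint_injective : Function.Injective (arcPoint (B₀ := B₀) T) := by
  rintro (a | ⟨i, a⟩) (b | ⟨j, b⟩) h
  · exact congrArg Sum.inl (Sum.inl.inj h)
  · simp [arcPoint] at h
  · simp [arcPoint] at h
  · simp only [arcPoint, Sum.map_inr, Sum.inr.injEq, Sigma.mk.injEq] at h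
    obtain ⟨rfl, h⟩ := h
    rw [Sum.inr.inj (eq_of_heq h)]

/-- The points from which a piece starts. -/
def IsTail (B₀ : Boundary) (T : ∀ i, TangleDiagram (B i)) : GluePoint B₀ T → Prop
  | Sum.inl b => B₀.pos b = false
  | Sum.inr ⟨_, Sum.inl x⟩ => ¬ 2 ≤ x.2.val
  | Sum.inr ⟨_, Sum.inr _⟩ => True

/-- The points at which a piece ends. -/
def IsHead (B₀ : Boundary) (T : ∀ i, TangleDiagram (B i)) : GluePoint B₀ T → Prop
  | Sum.inl b => B₀.pos b = true
  | Sum.inr ⟨_, Sum.inl x⟩ => 2 ≤ x.2.val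
  | Sum.inr ⟨_, Sum.inr _⟩ => True

/-- At a boundary point of a hole an edge of the inner tangle meets an arc. Exactly one of the two
starts there, and the sign of the point decides which; the other points belong to one piece only. -/
theorem isTail_iff (a : GluePoint B₀ T) : IsTail B₀ T a ↔ ∃ e, pieceTail η T e = a := by
  constructor
  · rcases a with b | ⟨i, x | b⟩
    · intro h
      exact ⟨Sum.inl (η.tail.symm ⟨Sum.inl b, h⟩), by simp [pieceTail, arcPoint]⟩
    · intro h
      exact ⟨Sum.inr ⟨i, (T i).tail.symm ⟨Sum.inl x, decide_eq_false h⟩⟩, by simp [pieceTail]⟩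
    · intro _
      cases h : (B i).pos b
      · exact ⟨Sum.inr ⟨i, (T i).tail.symm ⟨Sum.inr b, h⟩⟩, by simp [pieceTail]⟩
      · exact ⟨Sum.inl (η.tail.symm ⟨Sum.inr ⟨i, b⟩, by simp [arcInward, h]⟩),
          by simp [pieceTail, arcPoint]⟩
  · rintro ⟨α | ⟨i, e⟩, rfl⟩
    · rcases hα : η.tail α with ⟨b | ⟨i, b⟩, h⟩
      · change IsTail B₀ T (arcPoint T (η.tail α).1)
        rw [hα]
        exact h
      · change IsTail B₀ T (arcPoint T (η.tail α).1)
        rw [hα]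
        trivial
    · rcases hα : (T i).tail e with ⟨x | b, h⟩
      · change IsTail B₀ T (Sum.inr ⟨i, ((T i).tail e).1⟩)
        rw [hα]
        change ¬ 2 ≤ _
        simpa [Boundary.inward] using h
      · change IsTail B₀ T (Sum.inr ⟨i, ((T i).tail e).1⟩)
        rw [hα]
        trivial

theorem isHead_iff (a : GluePoint B₀ T) : IsHead B₀ T a ↔ ∃ e, pieceHead η T e = a := by
  constructor
  · rcases a with b | ⟨i, x | b⟩
    · intro h
      exact ⟨Sum.inl (η.head.symm ⟨Sum.inl b, h⟩), by simp [pieceHead, arcPoint]⟩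
    · intro h
      exact ⟨Sum.inr ⟨i, (T i).head.symm ⟨Sum.inl x, decide_eq_true h⟩⟩, by simp [pieceHead]⟩
    · intro _
      cases h : (B i).pos b
      · exact ⟨Sum.inl (η.head.symm ⟨Sum.inr ⟨i, b⟩, by simp [arcInward, h]⟩),
          by simp [pieceHead, arcPoint]⟩
      · exact ⟨Sum.inr ⟨i, (T i).head.symm ⟨Sum.inr b, h⟩⟩, by simp [pieceHead]⟩
  · rintro ⟨α | ⟨i, e⟩, rfl⟩
    · rcases hα : η.head α with ⟨b | ⟨i, b⟩, h⟩
      · change IsHead B₀ T (arcPoint T (η.head α).1)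
        rw [hα]
        exact h
      · change IsHead B₀ T (arcPoint T (η.head α).1)
        rw [hα]
        trivial
    · rcases hα : (T i).head e with ⟨x | b, h⟩
      · change IsHead B₀ T (Sum.inr ⟨i, ((T i).head e).1⟩)
        rw [hα]
        change 2 ≤ _
        simpa [Boundary.inward] using h
      · change IsHead B₀ T (Sum.inr ⟨i, ((T i).head e).1⟩)
        rw [hα]
        trivial

/-- An arc and an edge cannot start at the same point: at a boundary point of a hole they need
opposite signs, because `arcInward` negates the sign there. Two arcs, or two edges, are separated by
the bijections `tail`. -/
theorem pieceTail_injective : Function.Injective (pieceTail η T) := by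
  have key : ∀ α (e : Σ i, Fin (T i).edges),
      pieceTail η T (Sum.inl α) ≠ pieceTail η T (Sum.inr e) := by
    rintro α ⟨i, e⟩ h
    rcases hα : η.tail α with ⟨b | ⟨j, b⟩, hb⟩
    · simp [pieceTail, arcPoint, hα] at h
    · simp only [pieceTail, arcPoint, hα, Sum.map_inr, Sum.inr.injEq, Sigma.mk.injEq] at h
      obtain ⟨rfl, h⟩ := h
      have h1 := ((T j).tail e).2
      rw [← eq_of_heq h] at h1
      simp only [arcInward, Boundary.inward] at hb h1
      simp [h1] at hb
  rintro (α | e) (α' | e') h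
  · exact congrArg Sum.inl (η.tail.injective (Subtype.ext (arcPoint_injective T h)))
  · exact absurd h (key _ _)
  · exact absurd h.symm (key _ _)
  · obtain ⟨i, e⟩ := e
    obtain ⟨j, e'⟩ := e'
    simp only [pieceTail, Sum.inr.injEq, Sigma.mk.injEq] at h
    obtain ⟨rfl, h⟩ := h
    rw [(T i).tail.injective (Subtype.ext (eq_of_heq h))]

theorem pieceHead_injective : Function.Injective (pieceHead η T) := by
  have key : ∀ α (e : Σ i, Fin (T i).edges),
      pieceHead η T (Sum.inl α) ≠ pieceHead η T (Sum.inr e) := by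
    rintro α ⟨i, e⟩ h
    rcases hα : η.head α with ⟨b | ⟨j, b⟩, hb⟩
    · simp [pieceHead, arcPoint, hα] at h
    · simp only [pieceHead, arcPoint, hα, Sum.map_inr, Sum.inr.injEq, Sigma.mk.injEq] at h
      obtain ⟨rfl, h⟩ := h
      have h1 := ((T j).head e).2
      rw [← eq_of_heq h] at h1
      simp only [arcInward, Boundary.inward] at hb h1
      simp [h1] at hb
  rintro (α | e) (α' | e') h
  · exact congrArg Sum.inl (η.head.injective (Subtype.ext (arcPoint_injective T h)))
  · exact absurd h (key _ _)
  · exact absurd h.symm (key _ _)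
  · obtain ⟨i, e⟩ := e
    obtain ⟨j, e'⟩ := e'
    simp only [pieceHead, Sum.inr.injEq, Sigma.mk.injEq] at h
    obtain ⟨rfl, h⟩ := h
    rw [(T i).head.injective (Subtype.ext (eq_of_heq h))]

variable {η T}

theorem Piece.isTail {a b : GluePoint B₀ T} (h : Piece η T a b) : IsTail B₀ T a := by
  obtain ⟨e, h, -⟩ := (piece_iff η T a b).1 h
  exact (isTail_iff η T a).2 ⟨e, h⟩

theorem Piece.isHead {a b : GluePoint B₀ T} (h : Piece η T a b) : IsHead B₀ T b := by
  obtain ⟨e, -, h⟩ := (piece_iff η T a b).1 h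
  exact (isHead_iff η T b).2 ⟨e, h⟩

theorem IsTail.exists_piece {a : GluePoint B₀ T} (h : IsTail B₀ T a) : ∃ b, Piece η T a b := by
  obtain ⟨e, h⟩ := (isTail_iff η T a).1 h
  exact ⟨_, (piece_iff η T _ _).2 ⟨e, h, rfl⟩⟩

theorem IsHead.exists_piece {a : GluePoint B₀ T} (h : IsHead B₀ T a) : ∃ b, Piece η T b a := by
  obtain ⟨e, h⟩ := (isHead_iff η T a).1 h
  exact ⟨_, (piece_iff η T _ _).2 ⟨e, rfl, h⟩⟩

theorem Piece.head_unique (a b c : GluePoint B₀ T) (h : Piece η T a b) (h' : Piece η T a c) :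
    b = c := by
  obtain ⟨e, h1, h2⟩ := (piece_iff η T _ _).1 h
  obtain ⟨e', h3, h4⟩ := (piece_iff η T _ _).1 h'
  rw [← h2, ← h4, pieceTail_injective η T (h1.trans h3.symm)]

theorem isTail_of_transGen {a b : GluePoint B₀ T} (h : Relation.TransGen (Piece η T) a b) :
    IsTail B₀ T a := by
  obtain ⟨c, h, -⟩ := Relation.TransGen.head'_iff.1 h
  exact h.isTail

theorem isHead_of_transGen {a b : GluePoint B₀ T} (h : Relation.TransGen (Piece η T) a b) :
    IsHead B₀ T b := by
  obtain ⟨c, -, h⟩ := Relation.TransGen.tail'_iff.1 h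
  exact h.isHead

/-- Two points of a closed component are connected by a path. -/
theorem ClosedPoint.transGen_of_eq {a b : ClosedPoint η T}
    (h : Quot.mk (fun a b : ClosedPoint η T => Piece η T a.1 b.1) a = Quot.mk _ b) :
    Relation.TransGen (Piece η T) a.1 b.1 := by
  replace h := Quot.eqvGen_exact h
  induction h with
  | rel a b h => exact .single h
  | refl a => exact a.2
  | symm a b _ ih => exact transGen_symm_of_closed Piece.head_unique a.2 ih
  | trans a b c _ _ ih1 ih2 => exact ih1.trans ih2

theorem ClosedPoint.eq_of_transGen (a : ClosedPoint η T) {b : GluePoint B₀ T}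
    (h : Relation.TransGen (Piece η T) a.1 b) (hb : Relation.TransGen (Piece η T) b b) :
    Quot.mk (fun a b : ClosedPoint η T => Piece η T a.1 b.1) a = Quot.mk _ ⟨b, hb⟩ := by
  induction h with
  | single h => exact Quot.sound h
  | tail h1 h2 ih =>
    have h3 := transGen_symm_of_closed Piece.head_unique a.2 h1
    exact (ih (h3.trans h1)).trans (Quot.sound h2)

variable {U : TangleDiagram B₀} (F : Factorization η T U)

theorem Factorization.flag_injective : Function.Injective F.flag := by
  rintro (⟨x, h⟩ | b) (⟨x', h'⟩ | b') e
  · simp only [flag, gluedFlag, Sum.inr.injEq, Sigma.mk.injEq] at e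
    obtain ⟨e1, e2⟩ := e
    have : F.crossing x = F.crossing x' ∧ h = h' := by
      generalize F.crossing x = y at e1 e2 ⊢
      generalize F.crossing x' = y' at e1 e2 ⊢
      obtain ⟨i, y⟩ := y
      obtain ⟨j, y'⟩ := y'
      obtain rfl : i = j := e1
      have := eq_of_heq e2
      simp only [Sum.inl.injEq, Prod.mk.injEq] at this
      exact ⟨by rw [this.1], this.2⟩
    rw [F.crossing.injective this.1, this.2]
  · simp [flag, gluedFlag] at e
  · simp [flag, gluedFlag] at e
  · simp only [flag, gluedFlag, Sum.inl.injEq] at e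
    rw [e]

theorem Factorization.isTail_flag (φ : Flag U.crossings B₀.n) :
    IsTail B₀ T (F.flag φ) ↔ B₀.inward φ = false := by
  rcases φ with ⟨x, h⟩ | b
  · simp [flag, gluedFlag, IsTail, Boundary.inward]
  · rfl

theorem Factorization.isHead_flag (φ : Flag U.crossings B₀.n) :
    IsHead B₀ T (F.flag φ) ↔ B₀.inward φ = true := by
  rcases φ with ⟨x, h⟩ | b
  · simp [flag, gluedFlag, IsHead, Boundary.inward]
  · rfl

/-- The outer boundary points and the flags of the crossings all come from flags of `U`. Only
boundary points of holes are left, through which the strands pass. -/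
theorem Factorization.of_notMem_range {a : GluePoint B₀ T} (h : a ∉ Set.range F.flag) :
    IsTail B₀ T a ∧ IsHead B₀ T a := by
  rcases a with b | ⟨i, x | b⟩
  · exact absurd ⟨Sum.inr b, rfl⟩ h
  · refine absurd ⟨Sum.inl (F.crossing.symm ⟨i, x.1⟩, x.2), ?_⟩ h
    change (Sum.inr ⟨(F.crossing (F.crossing.symm ⟨i, x.1⟩)).1,
      Sum.inl ((F.crossing (F.crossing.symm ⟨i, x.1⟩)).2, x.2)⟩ : GluePoint B₀ T) = _
    rw [F.crossing.apply_symm_apply]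
  · exact ⟨trivial, trivial⟩

/-- This separates flags of `U` from hidden points and from points on closed components, where a
piece arrives and a piece leaves. -/
theorem Factorization.not_isTail_and_isHead (φ : Flag U.crossings B₀.n) :
    ¬ (IsTail B₀ T (F.flag φ) ∧ IsHead B₀ T (F.flag φ)) := by
  rw [F.isTail_flag, F.isHead_flag]
  rintro ⟨h1, h2⟩
  rw [h1] at h2
  exact Bool.false_ne_true h2

/-- The points of the glued diagram as variables. -/
def gluePointVar (B₀ : Boundary) (T : ∀ i, TangleDiagram (B i)) :
    GluePoint B₀ T → Fin B₀.n ⊕ Σ i, (T i).Var :=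
  Sum.map id fun x => ⟨x.1, Sum.inl x.2⟩

theorem gluePointVar_injective : Function.Injective (gluePointVar B₀ T) := by
  rintro (a | ⟨i, a⟩) (b | ⟨j, b⟩) h
  · exact congrArg Sum.inl (Sum.inl.inj h)
  · simp [gluePointVar] at h
  · simp [gluePointVar] at h
  · simp only [gluePointVar, Sum.map_inr, Sum.inr.injEq, Sigma.mk.injEq] at h
    obtain ⟨rfl, h⟩ := h
    rw [Sum.inl.inj (eq_of_heq h)]

theorem gluePointVar_surjective (hT : ∀ i, (T i).circles = 0) :
    Function.Surjective (gluePointVar B₀ T) := by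
  rintro (a | ⟨i, a | c⟩)
  · exact ⟨Sum.inl a, rfl⟩
  · exact ⟨Sum.inr ⟨i, a⟩, rfl⟩
  · exact absurd c.2 (by simp [hT i])

/-- The edges of the glued diagram, as pairs of the variables at head and tail. -/
noncomputable def pieceList (η : ArcDiagram B₀ B) (T : ∀ i, TangleDiagram (B i)) :
    List ((Fin B₀.n ⊕ Σ i, (T i).Var) × (Fin B₀.n ⊕ Σ i, (T i).Var)) :=
  (Finset.univ : Finset (PieceIndex η T)).toList.map fun e =>
    (gluePointVar B₀ T (pieceHead η T e), gluePointVar B₀ T (pieceTail η T e))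

theorem step_pieceList (a b : GluePoint B₀ T) :
    Step (pieceList η T) (gluePointVar B₀ T a) (gluePointVar B₀ T b) ↔ Piece η T a b := by
  rw [piece_iff, Step, pieceList, List.mem_map]
  constructor
  · rintro ⟨e, -, h⟩
    obtain ⟨h1, h2⟩ := Prod.mk.inj h
    exact ⟨e, gluePointVar_injective h2, gluePointVar_injective h1⟩
  · rintro ⟨e, rfl, rfl⟩
    exact ⟨e, by simp, rfl⟩

/-- As the `T i` have no marks on crossingless components, every variable belongs to a point, so a
path through variables is a path through points. -/
theorem transGen_pieceList (hT : ∀ i, (T i).circles = 0) (a b : GluePoint B₀ T) :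
    Relation.TransGen (Step (pieceList η T)) (gluePointVar B₀ T a) (gluePointVar B₀ T b) ↔
      Relation.TransGen (Piece η T) a b := by
  constructor
  · generalize hy : gluePointVar B₀ T b = y
    intro h
    induction h generalizing b with
    | single h => subst hy; exact .single ((step_pieceList _ _).1 h)
    | @tail c _ _ h ih =>
      subst hy
      obtain ⟨c, rfl⟩ := gluePointVar_surjective hT c
      exact .tail (ih c rfl) ((step_pieceList _ _).1 h)
  · intro h
    induction h with
    | single h => exact .single ((step_pieceList _ _).2 h)
    | tail _ h ih => exact .tail ih ((step_pieceList _ _).2 h)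

namespace TangleDiagram

/-- The edges and the crossingless closed components, as pairs of the variables at head and
tail. -/
def edgeList {B : Boundary} (T : TangleDiagram B) : List (T.Var × T.Var) :=
  List.ofFn (fun e => (Sum.inl (T.head e).1, Sum.inl (T.tail e).1)) ++
    List.ofFn fun c => (Sum.inr c, Sum.inr c)

/-- The crossings with the variables of their flags. -/
def crossingList {B : Boundary} (T : TangleDiagram B) : List (Bool × (Fin 4 → T.Var)) :=
  List.ofFn fun x => (T.positive x, fun h => Sum.inl (Sum.inl (x, h)))

theorem mem_edgeList {B : Boundary} (T : TangleDiagram B) (a b : T.Var) :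
    (b, a) ∈ T.edgeList ↔ (∃ e, a = Sum.inl (T.tail e).1 ∧ b = Sum.inl (T.head e).1) ∨
      ∃ c, a = Sum.inr c ∧ b = Sum.inr c := by
  simp only [edgeList, List.mem_append, List.mem_ofFn, Prod.mk.injEq]
  constructor
  · rintro (⟨e, rfl, rfl⟩ | ⟨c, rfl, rfl⟩)
    · exact Or.inl ⟨e, rfl, rfl⟩
    · exact Or.inr ⟨c, rfl, rfl⟩
  · rintro (⟨e, rfl, rfl⟩ | ⟨c, rfl, rfl⟩)
    · exact Or.inl ⟨e, rfl, rfl⟩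
    · exact Or.inr ⟨c, rfl, rfl⟩

theorem nodup_edgeList {B : Boundary} (T : TangleDiagram B) : T.edgeList.Nodup := by
  refine List.Nodup.append (List.nodup_ofFn.2 fun e e' h => ?_)
    (List.nodup_ofFn.2 fun c c' h => Sum.inr.inj (Prod.mk.inj h).1) ?_
  · exact T.head.injective (Subtype.ext (Sum.inl.inj (Prod.mk.inj h).1))
  · rintro x hx hy
    obtain ⟨e, rfl⟩ := List.mem_ofFn.1 hx
    obtain ⟨c, hc⟩ := List.mem_ofFn.1 hy
    simp at hc

end TangleDiagram

/-- The variables of the flags and the closed components of `U` can be identified with variables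
of the glued diagram, and the latter diagram contracts to `U`. -/
theorem Factorization.exists_contracts (hT : ∀ i, (T i).circles = 0) :
    ∃ g : U.Var → Fin B₀.n ⊕ Σ i, (T i).Var, Function.Injective g ∧
      (∀ φ, g (Sum.inl φ) = F.var φ) ∧ Contracts g (pieceList η T) U.edgeList := by
  have hc := F.circles
  rw [Finset.sum_eq_zero fun i _ => hT i, zero_add] at hc
  have : Finite (ClosedPoint η T) := inferInstance
  -- All crossingless components of `U` arise from the gluing. They are numbered through `e`, and
  -- the point `rep c` chosen on each of them plays the role of its mark.
  let e := Finite.equivFinOfCardEq hc.symm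
  choose rep hrep using fun c => Quot.exists_rep (e.symm c)
  have hrep' : ∀ c c', Relation.TransGen (Piece η T) (rep c).1 (rep c').1 → c = c' :=
    fun c c' h => e.symm.injective (by
      rw [← hrep, ← hrep]
      exact (rep c).eq_of_transGen h (rep c').2)
  let gp : U.Var → GluePoint B₀ T := Sum.elim F.flag fun c => (rep c).1
  -- A flag never coincides with some `rep c`, since a point of a closed component is both a tail
  -- and a head.
  have hgp : Function.Injective gp := by
    rintro (φ | c) (ψ | c') h
    · exact congrArg Sum.inl (F.flag_injective h)
    · have h' : F.flag φ = (rep c').1 := h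
      exact absurd ⟨h' ▸ isTail_of_transGen (rep c').2, h' ▸ isHead_of_transGen (rep c').2⟩
        (F.not_isTail_and_isHead φ)
    · have h' : F.flag ψ = (rep c).1 := h.symm
      exact absurd ⟨h' ▸ isTail_of_transGen (rep c).2, h' ▸ isHead_of_transGen (rep c).2⟩
        (F.not_isTail_and_isHead ψ)
    · have h' : (rep c).1 = (rep c').1 := h
      have h'' := (rep c').2
      nth_rw 1 [← h'] at h''
      exact congrArg Sum.inr (hrep' c c' h'')
  let v := gluePointVar B₀ T
  have hv : Function.Injective v := gluePointVar_injective
  have hs : ∀ x, ∃ a, v a = x := gluePointVar_surjective hT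
  have hr : ∀ a, v a ∉ Set.range (v ∘ gp) → a ∉ Set.range gp := by
    rintro _ h ⟨w, rfl⟩
    exact h ⟨w, rfl⟩
  have hr' : ∀ a, a ∉ Set.range gp → a ∉ Set.range F.flag := by
    rintro _ h ⟨φ, rfl⟩
    exact h ⟨Sum.inl φ, rfl⟩
  refine ⟨v ∘ gp, hv.comp hgp, fun φ => rfl, ?_⟩
  refine ⟨?_, ?_, U.nodup_edgeList, ?_, ?_, ?_, ?_, ?_, ?_⟩
  · rw [pieceList, List.map_map]
    exact (Finset.nodup_toList _).map (hv.comp (pieceHead_injective η T))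
  · rw [pieceList, List.map_map]
    exact (Finset.nodup_toList _).map (hv.comp (pieceTail_injective η T))
  · intro x hx
    obtain ⟨a, rfl⟩ := hs x
    obtain ⟨b, hb⟩ := (F.of_notMem_range (hr' a (hr a hx))).2.exists_piece
    exact ⟨v b, (step_pieceList _ _).2 hb⟩
  · intro x hx
    obtain ⟨a, rfl⟩ := hs x
    obtain ⟨b, hb⟩ := (F.of_notMem_range (hr' a (hr a hx))).1.exists_piece
    exact ⟨v b, (step_pieceList _ _).2 hb⟩
  · intro x hx
    obtain ⟨a, rfl⟩ := hs x
    have ha := hr a hx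
    -- Going backwards from a hidden point, one either arrives at a source, which cannot be hidden
    -- and so is a flag, or one moves around a closed component, which contains its representative.
    rcases exists_source_or_closed (Piece.head_unique (η := η) (T := T)) a with ⟨b, hb, hba⟩ | h
    · have hb' : b ∈ Set.range F.flag := by
        by_contra hb'
        obtain ⟨c, hc⟩ := (F.of_notMem_range hb').2.exists_piece
        exact hb c hc
      obtain ⟨φ, rfl⟩ := hb'
      refine ⟨Sum.inl φ, (transGen_pieceList hT _ _).2 ?_⟩
      rcases Relation.reflTransGen_iff_eq_or_transGen.1 hba with h | h
      · exact absurd ⟨Sum.inl φ, h.symm⟩ ha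
      · exact h
    · refine ⟨Sum.inr (e (Quot.mk _ ⟨a, h⟩)), (transGen_pieceList hT _ _).2 ?_⟩
      refine ClosedPoint.transGen_of_eq (b := ⟨a, h⟩) ?_
      rw [hrep, e.symm_apply_apply]
  · intro a b hab
    rcases a with φ | c
    · obtain ⟨b, rfl⟩ := hs b
      have h := ((step_pieceList (F.flag φ) b).1 hab).isTail
      rw [F.isTail_flag] at h
      exact ⟨_, (U.mem_edgeList _ _).2 (Or.inl ⟨U.tail.symm ⟨φ, h⟩, by simp, rfl⟩)⟩
    · exact ⟨_, (U.mem_edgeList _ _).2 (Or.inr ⟨c, rfl, rfl⟩)⟩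
  · intro a b hab
    refine (transGen_pieceList hT _ _).2 ?_
    rcases (U.mem_edgeList _ _).1 hab with ⟨e, rfl, rfl⟩ | ⟨c, rfl, rfl⟩
    · exact F.edge e
    · exact (rep c).2
  · intro a b hab w hw
    have hw := (transGen_pieceList hT _ _).1 hw
    rcases (U.mem_edgeList _ _).1 hab with ⟨e, rfl, rfl⟩ | ⟨c, rfl, rfl⟩
    · have hb : ¬ IsTail B₀ T (F.flag (U.head e).1) := by
        rw [F.isTail_flag, (U.head e).2]
        simp
      have hru : Relator.RightUnique (Piece η T) := fun a b c => Piece.head_unique a b c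
      -- Of two paths from the same point one continues the other. No piece leaves the head of an
      -- edge of `U`; and a visible point strictly between the ends would be a flag that is both
      -- head and tail, or a point of a closed component, from which the head of the edge would lie
      -- on a circle.
      rcases Relation.ReflTransGen.total_of_right_unique hru
        (F.edge e).to_reflTransGen hw.to_reflTransGen with h | h
      · rcases Relation.reflTransGen_iff_eq_or_transGen.1 h with h | h
        · exact hgp h
        · exact absurd (isTail_of_transGen h) hb
      · rcases Relation.reflTransGen_iff_eq_or_transGen.1 h with h | h
        · exact hgp h.symm
        · rcases w with ψ | c
          · exact absurd ⟨isTail_of_transGen h, isHead_of_transGen hw⟩ (F.not_isTail_and_isHead ψ)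
          · exact absurd (isTail_of_transGen
              (transGen_symm_of_closed Piece.head_unique (rep c).2 h)) hb
    · rcases w with ψ | c'
      · exact absurd ⟨isTail_of_transGen (transGen_symm_of_closed Piece.head_unique (rep c).2 hw),
          isHead_of_transGen hw⟩ (F.not_isTail_and_isHead ψ)
      · exact congrArg Sum.inr (hrep' c c' hw).symm

end Pieces
end KhR

namespace KhR
open TensorProduct MvPolynomial

/-! ### Rearranging lists indexed by finite types. -/

section Lists
variable {X : Type*}

theorem perm_univ_toList {I : Type*} [Fintype I] {l : List I} (h : l.Nodup) (h' : ∀ i, i ∈ l) :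
    l.Perm (Finset.univ : Finset I).toList :=
  (List.perm_ext_iff_of_nodup h (Finset.nodup_toList _)).2 fun i => by simp [h']

theorem ofFn_perm {J : Type*} [Fintype J] {c : ℕ} (e : Fin c ≃ J) (F : J → X) :
    (List.ofFn fun x => F (e x)).Perm ((Finset.univ : Finset J).toList.map F) := by
  have h : (List.ofFn fun x => F (e x)) = (List.ofFn e).map F := by
    rw [List.map_ofFn]; rfl
  rw [h]
  refine (perm_univ_toList (List.nodup_ofFn.2 e.injective) fun j => ?_).map F
  exact List.mem_ofFn.2 (e.surjective j)

theorem flatMap_ofFn_perm {m : ℕ} {n : Fin m → ℕ} (F : (Σ i, Fin (n i)) → X) :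
    ((List.finRange m).flatMap fun i => List.ofFn fun x => F ⟨i, x⟩).Perm
      ((Finset.univ : Finset (Σ i, Fin (n i))).toList.map F) := by
  have h : ((List.finRange m).flatMap fun i => List.ofFn fun x => F ⟨i, x⟩) =
      (List.sigma (List.finRange m) fun i => List.finRange (n i)).map F := by
    rw [List.sigma, List.map_flatMap]
    congr 1
    ext1 i
    rw [List.map_map, List.ofFn_eq_map]
    rfl
  rw [h]
  exact (perm_univ_toList ((List.nodup_finRange m).sigma fun i => List.nodup_finRange _)
    fun ⟨i, x⟩ => by simp).map F

theorem univ_sum_perm {I J : Type*} [Fintype I] [Fintype J] (F : I ⊕ J → X) :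
    ((Finset.univ : Finset I).toList.map (fun i => F (Sum.inl i)) ++
      (Finset.univ : Finset J).toList.map (fun i => F (Sum.inr i))).Perm
      ((Finset.univ : Finset (I ⊕ J)).toList.map F) := by
  have h : ((Finset.univ : Finset I).toList.map (fun i => F (Sum.inl i)) ++
      (Finset.univ : Finset J).toList.map (fun i => F (Sum.inr i))) =
      ((Finset.univ : Finset I).toList.map Sum.inl ++
        (Finset.univ : Finset J).toList.map Sum.inr).map F := by
    rw [List.map_append, List.map_map, List.map_map]; rfl
  rw [h]
  refine (perm_univ_toList (List.Nodup.append ((Finset.nodup_toList _).map Sum.inl_injective)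
    ((Finset.nodup_toList _).map Sum.inr_injective) ?_) ?_).map F
  · intro x hx hy
    simp only [List.mem_map] at hx hy
    obtain ⟨i, -, rfl⟩ := hx
    obtain ⟨j, -, h⟩ := hy
    cases h
  · rintro (i | j) <;> simp

end Lists

/-! ### Both complexes as tensor products of lists of factors. -/

section Isomorphisms
variable {k : Type u} [Field k] {p : Polynomial k} (χ : CrossingData p)

theorem rename_toRingHom {V V' : Type} (f : V → V') :
    (rename f : MvPolynomial V k →ₐ[k] MvPolynomial V' k).toRingHom =
      (aeval (R := k) fun x => (X (f x) : MvPolynomial V' k)).toRingHom :=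
  congrArg (fun h : MvPolynomial V k →ₐ[k] MvPolynomial V' k => h.toRingHom) (by
    ext x : 1
    simp)

namespace TangleDiagram
variable {B : Boundary} (T : TangleDiagram B)

/-- All factors of the complex of a diagram. -/
def factors : List (Factor T.Var) := T.edgeList.map Sum.inl ++ T.crossingList.map Sum.inr

theorem krComplex_isom : Isom (T.krComplex χ) (factorsMF χ (varFactors k T.factors)) := by
  have e : (varFactors k T.factors).map (factorMF χ) =
      (List.ofFn (T.edgeMF p) ++ List.ofFn (T.circleMF p)) ++ List.ofFn (T.crossingMF χ) := by
    simp only [varFactors, factors, edgeList, crossingList, List.map_append, List.map_ofFn]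
    refine congrArg₂ (· ++ ·) (congrArg₂ (· ++ ·) (congrArg List.ofFn (funext fun e => rfl))
      (congrArg List.ofFn (funext fun e => rfl))) (congrArg List.ofFn (funext fun x => ?_))
    exact congrArg (fun g => (χ.crossing (T.positive x)).baseChange g) (by
      rw [rename_toRingHom]; rfl)
  rw [factorsMF, e, krComplex, tensorFin_eq_tensorList, tensorFin_eq_tensorList,
    tensorFin_eq_tensorList]
  exact ((tensorList_append _ _).trans ((tensorList_append _ _).tensor (Isom.refl _))).symm

end TangleDiagram

variable {B₀ : Boundary} {m : ℕ} {B : Fin m → Boundary} (η : ArcDiagram B₀ B)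
  (T : ∀ i, TangleDiagram (B i))

/-- The variable of a glued diagram that belongs to a variable of one of the pieces. -/
abbrev pieceVar (B₀ : Boundary) (T : ∀ i, TangleDiagram (B i)) (i : Fin m) (y : (T i).Var) :
    Fin B₀.n ⊕ Σ i, (T i).Var := Sum.inr ⟨i, y⟩

/-- The factors of the arcs. -/
def arcList : List ((Fin B₀.n ⊕ Σ i, (T i).Var) × (Fin B₀.n ⊕ Σ i, (T i).Var)) :=
  List.ofFn fun α => (gluePointVar B₀ T (arcPoint T (η.head α).1),
    gluePointVar B₀ T (arcPoint T (η.tail α).1))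

/-- The factors of the pieces. -/
def holeFactors (B₀ : Boundary) (T : ∀ i, TangleDiagram (B i)) :
    List (Factor (Fin B₀.n ⊕ Σ i, (T i).Var)) :=
  (List.finRange m).flatMap fun i => (T i).factors.map (Factor.map (pieceVar B₀ T i))

theorem holes_isom : Isom (tensorFin m fun i => ((T i).kr χ).M.baseChange
      (rename (fun y => Sum.inr ⟨i, y⟩) : MvPolynomial ((T i).kr χ).Y k →ₐ[k]
        MvPolynomial (Fin B₀.n ⊕ Σ i, ((T i).kr χ).Y) k).toRingHom)
    (factorsMF χ (varFactors k (holeFactors B₀ T))) := by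
  have h : ∀ i, Isom (((T i).kr χ).M.baseChange
      (rename (fun y => Sum.inr ⟨i, y⟩) : MvPolynomial ((T i).kr χ).Y k →ₐ[k]
        MvPolynomial (Fin B₀.n ⊕ Σ i, ((T i).kr χ).Y) k).toRingHom)
      (factorsMF χ (varFactors k ((T i).factors.map (Factor.map (pieceVar B₀ T i))))) := fun i => by
    refine (((T i).krComplex_isom χ).baseChange _).trans ((baseChange_factorsMF χ _ _).trans
      (Isom.of_eq ?_))
    rw [← varFactors_rename]
  rw [tensorFin_eq_tensorList]
  refine (tensorList_forall₂ (l' := List.ofFn fun i => factorsMF χ (varFactors k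
    ((T i).factors.map (Factor.map (pieceVar B₀ T i))))) ?_).trans ?_
  · rw [List.ofFn_eq_map, List.ofFn_eq_map]
    exact List.forall₂_map_left_iff.2 (List.forall₂_map_right_iff.2
      (List.forall₂_same.2 fun i _ => h i))
  · have e : (varFactors k (holeFactors B₀ T)).map (factorMF χ) =
        (List.ofFn fun i => (varFactors k ((T i).factors.map (Factor.map
          (pieceVar B₀ T i)))).map (factorMF χ)).flatten := by
      rw [varFactors, holeFactors, List.map_flatMap, List.map_flatMap, List.ofFn_eq_map,
        List.flatMap_def]
      rfl
    rw [factorsMF, e]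
    refine Isom.trans (Isom.of_eq ?_) tensorList_flatten.symm
    rw [List.map_ofFn]
    rfl

theorem arcs_isom : Isom (tensorFin η.arcs (η.arcMF p fun i => ((T i).kr χ).inc))
    (factorsMF χ (varFactors k ((arcList η T).map Sum.inl))) := by
  rw [tensorFin_eq_tensorList, factorsMF]
  refine Isom.of_eq (congrArg tensorList ?_)
  simp only [varFactors, arcList, List.map_ofFn]
  refine congrArg List.ofFn (funext fun α => ?_)
  have e : ∀ x, ArcDiagram.var (B₀ := B₀) (fun i => ((T i).kr χ).Y) (fun i => ((T i).kr χ).inc) x =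
      gluePointVar B₀ T (arcPoint T x) := by
    rintro (b | b) <;> rfl
  rw [ArcDiagram.arcMF, e, e]
  rfl

/-- Each list contains every piece and every crossing once. The crossings of `U` are matched by
`F.crossing`, and `hT` removes the circle factors of the `T i`, which would not be pieces. -/
theorem factors_perm {U : TangleDiagram B₀} (F : Factorization η T U)
    (hT : ∀ i, (T i).circles = 0) {g : U.Var → Fin B₀.n ⊕ Σ i, (T i).Var}
    (hg : ∀ φ, g (Sum.inl φ) = F.var φ) :
    ((arcList η T).map Sum.inl ++ holeFactors B₀ T).Perm ((pieceList η T).map Sum.inl ++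
      (U.crossingList.map (Prod.map id fun f => g ∘ f)).map Sum.inr) := by
  let Fe : PieceIndex η T → Factor (Fin B₀.n ⊕ Σ i, (T i).Var) := fun e =>
    Sum.inl (gluePointVar B₀ T (pieceHead η T e), gluePointVar B₀ T (pieceTail η T e))
  let Fc : (Σ i, Fin (T i).crossings) → Factor (Fin B₀.n ⊕ Σ i, (T i).Var) := fun x =>
    Sum.inr ((T x.1).positive x.2, fun h => Sum.inr ⟨x.1, Sum.inl (Sum.inl (x.2, h))⟩)
  have e1 : (arcList η T).map Sum.inl = List.ofFn fun α => Fe (Sum.inl α) := by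
    rw [arcList, List.map_ofFn]; rfl
  have e2 : holeFactors B₀ T = (List.finRange m).flatMap fun i =>
      (List.ofFn fun e => Fe (Sum.inr ⟨i, e⟩)) ++ List.ofFn fun x => Fc ⟨i, x⟩ := by
    rw [holeFactors]
    congr 1
    ext1 i
    have : (List.ofFn fun c : Fin (T i).circles => ((Sum.inr c, Sum.inr c) :
        (T i).Var × (T i).Var)) = [] := List.eq_nil_of_length_eq_zero (by simp [hT i])
    simp only [TangleDiagram.factors, TangleDiagram.edgeList, TangleDiagram.crossingList, this,
      List.append_nil, List.map_append, List.map_ofFn]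
    rfl
  have e3 : (U.crossingList.map (Prod.map id fun f => g ∘ f)).map Sum.inr =
      List.ofFn fun x => Fc (F.crossing x) := by
    rw [TangleDiagram.crossingList, List.map_ofFn, List.map_ofFn]
    refine congrArg List.ofFn (funext fun x => congrArg Sum.inr (Prod.ext (F.positive x) ?_))
    exact funext fun h => hg _
  have e4 : (pieceList η T).map Sum.inl = (Finset.univ : Finset (PieceIndex η T)).toList.map Fe := by
    rw [pieceList, List.map_map]
    rfl
  rw [e1, e2, e3, e4]
  -- The factors are sorted hole by hole; this moves the edges of all holes in front of the
  -- crossings of all holes.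
  refine (((List.flatMap_append_perm _ _ _).symm).append_left _).trans ?_
  rw [← List.append_assoc]
  refine List.Perm.append ?_ ((flatMap_ofFn_perm Fc).trans (ofFn_perm F.crossing Fc).symm)
  exact ((ofFn_perm (Equiv.refl _) fun α => Fe (Sum.inl α)).append
    (flatMap_ofFn_perm fun e => Fe (Sum.inr e))).trans (univ_sum_perm Fe)

theorem exists_hEquiv {U : TangleDiagram B₀} (F : Factorization η T U)
    (hT : ∀ i, (T i).circles = 0) :
    ∃ g : U.Var → Fin B₀.n ⊕ Σ i, (T i).Var, (∀ φ, g (Sum.inl φ) = F.var φ) ∧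
      Nonempty (HEquiv (rename g : MvPolynomial U.Var k →ₐ[k] _).toRingHom
        (η.actComplex fun i => (T i).kr χ) (U.krComplex χ)) := by
  obtain ⟨g, hg, hgF, hc⟩ := F.exists_contracts hT
  refine ⟨g, hgF, ?_⟩
  obtain ⟨f⟩ := hEquiv_of_contracts χ U.edgeList U.crossingList _ _ g hg _ hc rfl
  have i1 : Isom (η.actComplex fun i => (T i).kr χ) (factorsMF χ (varFactors k
      ((pieceList η T).map Sum.inl ++
        (U.crossingList.map (Prod.map id fun f => g ∘ f)).map Sum.inr))) := by
    refine ((arcs_isom χ η T).tensor (holes_isom χ T)).trans ((factorsMF_append χ _ _).symm.trans ?_)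
    rw [varFactors, varFactors, ← List.map_append]
    exact factorsMF_perm χ ((factors_perm η T F hT hgF).map _)
  obtain ⟨i1⟩ := i1
  obtain ⟨i2⟩ := (U.krComplex_isom χ).symm
  have h := ((HEquiv.ofGrIso i1).trans f).trans (HEquiv.ofGrIso i2)
  rw [RingHom.id_comp, RingHom.comp_id] at h
  exact ⟨h⟩

end Isomorphisms

/-! ### Homotopy equivalences over the ring of the boundary variables. -/

section Restriction

theorem MFComplex.mem_par_restrict {R R₀ : Type u} [CommRing R] [CommRing R₀] {g : R₀ →+* R}
    {M : MFComplex R} {w : R₀} {hw : M.potential = g w} {n j : ℤ} {x : M.carrier} :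
    x ∈ (M.restrict g w hw).par n j ↔ x ∈ M.par n j := by
  constructor
  · exact par_of_gr (M := M.restrict g w hw) (N := M) (AddMonoidHom.id M.carrier)
      fun j x hx => hx
  · exact par_of_gr (M := M) (N := M.restrict g w hw) (AddMonoidHom.id M.carrier)
      fun j x hx => hx

variable {k : Type u} [Field k] {p : Polynomial k} {B : Boundary}

/-- A homotopy equivalence over the ring of all variables, regarded over the ring of the variables
of the boundary points. -/
theorem exists_isHomotopyEquiv {M N : BoundaryMF p B} (g : M.Y → N.Y)
    (hg : ∀ b, g (M.inc b) = N.inc b)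
    (h : HEquiv (rename g : MvPolynomial M.Y k →ₐ[k] MvPolynomial N.Y k).toRingHom N.M M.M) :
    ∃ f : M.overBoundary.carrier →ₗ[MvPolynomial (Fin B.n) k] N.overBoundary.carrier,
      IsHomotopyEquiv f ∧ ∀ y, f ∘ₗ M.mulVar y = N.mulVar (g y) ∘ₗ f := by
  have hgr : ∀ r : MvPolynomial (Fin B.n) k, (rename g : _ →ₐ[k] MvPolynomial N.Y k).toRingHom
      (rename M.inc r) = rename N.inc r := fun r => by
    change rename g (rename M.inc r) = _
    rw [rename_rename]
    congr 2
    exact funext hg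
  -- The equivalence `h` leads from the complex with more variables to the one with fewer. The map
  -- wanted here is its inverse `G`, and the two homotopies change places.
  let f : M.overBoundary.carrier →ₗ[MvPolynomial (Fin B.n) k] N.overBoundary.carrier :=
    { toFun := h.G
      map_add' := h.G.map_add
      map_smul' := fun r x => by
        have e := h.G_smul (rename M.inc r) x
        rw [hgr] at e
        exact e }
  let g' : N.overBoundary.carrier →ₗ[MvPolynomial (Fin B.n) k] M.overBoundary.carrier :=
    { toFun := h.F
      map_add' := h.F.map_add
      map_smul' := fun r x => by
        have e := h.F_smul (rename M.inc r) x
        rw [hgr] at e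
        exact e }
  let h₁ : M.overBoundary.carrier →ₗ[MvPolynomial (Fin B.n) k] M.overBoundary.carrier :=
    { toFun := h.h'
      map_add' := h.h'.map_add
      map_smul' := fun r x => h.h'_smul (rename M.inc r) x }
  let h₂ : N.overBoundary.carrier →ₗ[MvPolynomial (Fin B.n) k] N.overBoundary.carrier :=
    { toFun := h.h
      map_add' := h.h.map_add
      map_smul' := fun r x => by
        have e := h.h_smul (rename M.inc r) x
        rw [hgr] at e
        exact e }
  refine ⟨f, ⟨⟨LinearMap.ext h.G_d, LinearMap.ext h.G_del, fun n j x hx => ?_⟩, g',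
    ⟨LinearMap.ext h.F_d, LinearMap.ext h.F_del, fun n j x hx => ?_⟩,
    ⟨h₁, fun n j x hx => ?_, LinearMap.ext h.h'_del, LinearMap.ext h.FG⟩,
    ⟨h₂, fun n j x hx => ?_, LinearMap.ext h.h_del, LinearMap.ext h.GF⟩⟩, fun y => ?_⟩
  · exact (mem_par_restrict (hw := N.potential_eq)).2 (h.G_mem n j x (gr_le_par M.M n j hx))
  · exact (mem_par_restrict (hw := M.potential_eq)).2 (h.F_mem n j x (gr_le_par N.M n j hx))
  · exact (mem_par_restrict (hw := M.potential_eq)).2 (h.h'_mem n j x (gr_le_par M.M n j hx))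
  · exact (mem_par_restrict (hw := N.potential_eq)).2 (h.h_mem n j x (gr_le_par N.M n j hx))
  · refine LinearMap.ext fun x => (h.G_smul (X y) x).trans ?_
    rw [show (rename g : _ →ₐ[k] MvPolynomial N.Y k).toRingHom (X y) = X (g y) from rename_X g y]
    rfl

end Restriction
end KhR

/-! ### Exactness of `dp` in negative degrees, and Koszul factors of regular elements. -/

namespace KhR
open TensorProduct MvPolynomial
namespace MFComplex
variable {R : Type u} [CommRing R]

/-- The homology with respect to `dp` vanishes in negative degrees. -/
def Resolves (M : MFComplex R) : Prop :=
  ∀ i : ℤ × ℤ, i.2 < 0 → ∀ x ∈ M.gr i, M.dp x = 0 → ∃ z, M.dp z = x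

theorem Resolves.exists_mem {M : MFComplex R} (hM : M.Resolves) {i : ℤ × ℤ} (hi : i.2 < 0)
    {x : M.carrier} (hx : x ∈ M.gr i) (h : M.dp x = 0) :
    ∃ z ∈ M.gr (i.1, i.2 - 1), M.dp z = x := by
  obtain ⟨z, rfl⟩ := hM i hi x hx h
  refine exists_homogeneous_preimage M.internal M.internal M.dp (fun j => (j.1, j.2 + 1)) ?_
    M.dp_mem ?_
  · rintro ⟨a, b⟩ ⟨c, d⟩ h
    simpa using h
  · simpa using hx

theorem Resolves.of_isom {M N : MFComplex R} (h : Isom M N) (hN : N.Resolves) : M.Resolves := by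
  obtain ⟨f⟩ := h
  intro i hi x hx h0
  obtain ⟨z, hz⟩ := hN i hi (f.e x) (f.mem i x hx) (by rw [← f.dp, h0, map_zero])
  refine ⟨f.e.symm z, f.e.injective ?_⟩
  rw [f.dp, f.e.apply_symm_apply, hz]

theorem resolves_unit : (unit R).Resolves := fun i hi x hx _ => by
  have h : (unit R).gr i = ⊥ := if_neg (by rintro rfl; simp at hi)
  rw [h, Submodule.mem_bot] at hx
  exact ⟨0, by rw [map_zero, hx]⟩

/-- The cone of `x * x'` is built from the cones of `x` and `x'`: a cycle `(m, m')` gives the cycle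
`(m, x • m')` for `x'`, and a primitive `(a, b)` of the latter gives the cycle `(b, m')` for `x`.
The second entries do not matter, as they do not occur in `dp`. -/
theorem Resolves.kos_mul {x x' : R} {M : MFComplex R} {y y' : R} (y'' : R)
    (h : (kos x y M).Resolves) (h' : (kos x' y' M).Resolves) : (kos (x * x') y'' M).Resolves := by
  rintro ⟨n, j⟩ hi ⟨m, m'⟩ ⟨hm, hm'⟩ h0
  have e1 : M.dp m + (x * x') • m' = 0 := congrArg Prod.fst h0
  have e2 : -M.dp m' = 0 := congrArg Prod.snd h0
  obtain ⟨⟨a, b⟩, ⟨ha, hb⟩, hab⟩ := h'.exists_mem (i := (n, j)) (x := (m, x • m')) hi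
    ⟨hm, Submodule.smul_mem _ _ hm'⟩ (Prod.ext
      (show M.dp m + x' • x • m' = 0 by rw [smul_smul, mul_comm x', e1])
      (show -M.dp (x • m') = 0 by rw [map_smul, ← smul_neg, e2, smul_zero]))
  have e3 : M.dp a + x' • b = m := congrArg Prod.fst hab
  have e4 : -M.dp b = x • m' := congrArg Prod.snd hab
  -- The primitive was taken homogeneous in order that `(b, m')` has degree `(n, j)` again, so that
  -- exactness for `x` applies.
  have hb' : b ∈ M.gr (n, j) := by simpa using hb
  obtain ⟨⟨c, e⟩, hce⟩ := h (n, j) hi (b, m') ⟨hb', hm'⟩ (Prod.ext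
    (show M.dp b + x • m' = 0 by rw [← e4, add_neg_cancel]) e2)
  have e5 : M.dp c + x • e = b := congrArg Prod.fst hce
  have e6 : -M.dp e = m' := congrArg Prod.snd hce
  refine ⟨(a + x' • c, e), Prod.ext ?_ e6⟩
  change M.dp (a + x' • c) + (x * x') • e = m
  rw [← e3, ← e5, map_add, map_smul, smul_add, smul_smul, mul_comm x, add_assoc]

/-- Regular elements act injectively on flat modules. -/
theorem smul_eq_zero_of_flat {τ : R} (hτ : ∀ a, τ * a = 0 → a = 0) {M : Type u} [AddCommGroup M]
    [Module R M] [Module.Flat R M] {x : M} (h : τ • x = 0) : x = 0 := by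
  have hinj : Function.Injective (LinearMap.lsmul R R τ) :=
    (injective_iff_map_eq_zero _).2 fun a ha => hτ a ha
  have h1 := Module.Flat.rTensor_preserves_injective_linearMap (M := M) _ hinj
  have h2 : (LinearMap.lsmul R R τ).rTensor M (1 ⊗ₜ x) = 0 := by
    rw [LinearMap.rTensor_tmul, LinearMap.lsmul_apply, smul_tmul, h, tmul_zero]
  have h3 := (injective_iff_map_eq_zero _).1 h1 _ h2
  have h4 := congrArg (TensorProduct.lid R M) h3
  rwa [TensorProduct.lid_tmul, one_smul, map_zero] at h4

theorem bcMk_surjective {R' : Type u} [CommRing R'] {θ : R →+* R'} (hθ : Function.Surjective θ)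
    (M : MFComplex R) : Function.Surjective (bcMk θ M) := by
  let _ := θ.toAlgebra
  intro t
  change R' ⊗[R] M.carrier at t
  change ∃ x, (1 : R') ⊗ₜ[R] x = t
  induction t using TensorProduct.induction_on with
  | zero => exact ⟨0, tmul_zero _ _⟩
  | add a b ha hb =>
    obtain ⟨x, rfl⟩ := ha
    obtain ⟨y, rfl⟩ := hb
    exact ⟨x + y, tmul_add _ _ _⟩
  | tmul r x =>
    obtain ⟨s, rfl⟩ := hθ r
    refine ⟨s • x, ?_⟩
    rw [tmul_smul, smul_tmul']
    congr 1
    change θ s * 1 = θ s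
    rw [mul_one]

/-- Multiplication by `τ` followed by `θ` is exact on `R`. Tensoring with `M` is right exact, so the
kernel of `x ↦ 1 ⊗ x` is `τ M`. -/
theorem exists_smul_of_bcMk_eq_zero {R' : Type u} [CommRing R'] {θ : R →+* R'}
    (hθ : Function.Surjective θ) {τ : R} (hker : ∀ a, θ a = 0 → ∃ b, a = τ * b) (hτ : θ τ = 0)
    (M : MFComplex R) {x : M.carrier} (h : bcMk θ M x = 0) : ∃ z, τ • z = x := by
  let _ := θ.toAlgebra
  have hex : Function.Exact (LinearMap.lsmul R R τ) (Algebra.linearMap R R') := by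
    intro a
    constructor
    · intro ha
      obtain ⟨b, rfl⟩ := hker a ha
      exact ⟨b, rfl⟩
    · rintro ⟨b, rfl⟩
      change θ (τ * b) = 0
      rw [map_mul, hτ, zero_mul]
  have h1 := rTensor_exact M.carrier hex hθ
  have h2 : (Algebra.linearMap R R').rTensor M.carrier ((1 : R) ⊗ₜ x) = 0 := by
    rw [LinearMap.rTensor_tmul]
    change θ 1 ⊗ₜ[R] x = 0
    rw [map_one]
    exact h
  obtain ⟨t, ht⟩ := (h1 _).1 h2
  obtain ⟨z, rfl⟩ : ∃ z, (1 : R) ⊗ₜ[R] z = t :=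
    ⟨TensorProduct.lid R M.carrier t, (TensorProduct.lid R M.carrier).symm_apply_apply t⟩
  refine ⟨z, ?_⟩
  have h3 := congrArg (TensorProduct.lid R M.carrier) ht
  rwa [LinearMap.rTensor_tmul, TensorProduct.lid_tmul, TensorProduct.lid_tmul, one_smul,
    LinearMap.lsmul_apply, smul_eq_mul, mul_one] at h3

/-- The square of `dp + dm` is multiplication by a scalar and so has degree `0`, whereas its
component of degree `2` is the square of `dp`. -/
theorem dp_dp (M : MFComplex R) (x : M.carrier) : M.dp (M.dp x) = 0 := by
  refine LinearMap.congr_fun (f := M.dp ∘ₗ M.dp) (g := 0) (ext_homogeneous M.iSup_gr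
    fun i x hx => ?_) x
  have h1 : M.dp (M.dp x) + (M.dp (M.dm x) + M.dm (M.dp x)) + M.dm (M.dm x) =
      M.potential • x := by
    rw [← d_d, d_apply, d_apply, map_add, map_add]
    abel
  have e1 : (i.1, i.2 - 1 + 1) = i := by simp
  have e2 : (i.1, i.2 + 1 - 1) = i := by simp
  have h2 := M.dp_mem _ _ (M.dp_mem i x hx)
  have h3 : M.dp (M.dm x) + M.dm (M.dp x) ∈ M.gr i :=
    add_mem (e1 ▸ M.dp_mem _ _ (M.dm_mem i x hx)) (e2 ▸ M.dm_mem _ _ (M.dp_mem i x hx))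
  have h4 := M.dm_mem _ _ (M.dm_mem i x hx)
  have h5 := congrArg (fun y => comp M.gr M.internal y (i.1, i.2 + 1 + 1)) h1
  simp only [map_add, Finsupp.add_apply] at h5
  rw [← Finsupp.add_apply (comp M.gr M.internal (M.dp (M.dm x))), ← map_add,
    comp_of_mem M.internal h2, comp_of_mem M.internal h3, comp_of_mem M.internal h4,
    comp_of_mem M.internal (Submodule.smul_mem _ _ hx), Finsupp.single_eq_same,
    Finsupp.single_eq_of_ne (by intro h; simp [Prod.ext_iff] at h; omega),
    Finsupp.single_eq_of_ne (by intro h; simp [Prod.ext_iff] at h; omega), add_zero, add_zero,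
    Finsupp.single_eq_of_ne (by intro h; simp [Prod.ext_iff] at h; omega)] at h5
  exact h5

/-- A regular element may be divided out. -/
theorem Resolves.kos_of_baseChange {R' : Type u} [CommRing R'] {θ : R →+* R'}
    (hθ : Function.Surjective θ) {τ : R} (hker : ∀ a, θ a = 0 → ∃ b, a = τ * b) (hτ : θ τ = 0)
    (hreg : ∀ a, τ * a = 0 → a = 0) (y : R) {M : MFComplex R} [Module.Flat R M.carrier]
    (h : (M.baseChange θ).Resolves) : (kos τ y M).Resolves := by
  rintro ⟨n, j⟩ hi ⟨m, m'⟩ ⟨hm, hm'⟩ h0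
  have e1 : M.dp m + τ • m' = 0 := congrArg Prod.fst h0
  -- Modulo `τ` the element `m` is a cycle, so `m = dp w + τ v`. Applying `dp` to this shows that
  -- `τ` kills `dp v + m'`, which therefore vanishes because `M` is flat and `τ` regular.
  obtain ⟨z, hz⟩ := h (n, j) hi (bcMk θ M m) (bcMk_mem θ hm) (by
    refine (bcMk_dp θ M m).trans ?_
    rw [eq_neg_of_add_eq_zero_left e1, ← smul_neg, bcMk_smul, hτ, zero_smul])
  obtain ⟨w, rfl⟩ := bcMk_surjective hθ M z
  replace hz := (bcMk_dp θ M w).symm.trans hz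
  obtain ⟨v, hv⟩ := exists_smul_of_bcMk_eq_zero hθ hker hτ M (x := m - M.dp w) (by
    have := bcMk_add θ M (m - M.dp w) (M.dp w)
    rw [sub_add_cancel, hz] at this
    exact left_eq_add.1 (by rw [add_comm]; exact this))
  have e2 := dp_dp M w
  have e3 : M.dp v + m' = 0 := smul_eq_zero_of_flat hreg (by
    rw [smul_add, ← map_smul, hv, map_sub, e2, sub_zero, e1])
  exact ⟨(w, v), Prod.ext (show M.dp w + τ • v = m by rw [hv, add_sub_cancel])
    (show -M.dp v = m' from (eq_neg_of_add_eq_zero_right e3).symm)⟩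

/-- Linear maps that commute with `dp`, up to a shift of the homological degree. -/
structure ShiftHom (M N : MFComplex R) where
  f : M.carrier →ₗ[R] N.carrier
  c : ℤ
  mem : ∀ i, ∀ x ∈ M.gr i, f x ∈ N.gr (i.1 + c, i.2)
  dp : ∀ x, f (M.dp x) = N.dp (f x)

/-- The tensor product with an identity map. -/
noncomputable def ShiftHom.tensor {M N : MFComplex R} (φ : ShiftHom M N) (P : MFComplex R) :
    ShiftHom (tensor M P) (tensor N P) where
  f := φ.f.rTensor P.carrier
  c := φ.c
  mem i := map_mem_tensorGr _ <| by
    rintro a b rfl x hx y hy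
    refine tmul_mem_tensorGr ?_ (φ.mem a x hx) hy
    ext <;> simp [add_right_comm]
  dp := by
    refine LinearMap.congr_fun (f := φ.f.rTensor P.carrier ∘ₗ (MFComplex.tensor M P).dp)
      (g := (MFComplex.tensor N P).dp ∘ₗ φ.f.rTensor P.carrier) ?_
    refine tensor_ext fun a b x hx y hy => ?_
    have h1 := tensor_dp_tmul (N := P) hx y
    have h2 := tensor_dp_tmul (N := P) (φ.mem a x hx) y
    simp only [LinearMap.comp_apply, LinearMap.rTensor_tmul] at h1 h2 ⊢
    rw [h1, h2, map_add, map_zsmul, LinearMap.rTensor_tmul, LinearMap.rTensor_tmul, φ.dp]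

/-- Extension of scalars. -/
noncomputable def ShiftHom.baseChange {R' : Type u} [CommRing R'] (g : R →+* R')
    {M N : MFComplex R} (φ : ShiftHom M N) : ShiftHom (M.baseChange g) (N.baseChange g) where
  f := baseChangeMap g φ.f
  c := φ.c
  mem i t ht := by
    let _ := g.toAlgebra
    refine (Submodule.span_le.2 ?_ : baseChangeGr R' M i ≤
      (baseChangeGr R' N (i.1 + φ.c, i.2)).comap (φ.f.baseChange R')) ht
    rintro _ ⟨x, hx, rfl⟩
    exact Submodule.subset_span ⟨φ.f x, φ.mem i x hx, LinearMap.baseChange_tmul _ _ _⟩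
  dp t := by
    let _ := g.toAlgebra
    have h : φ.f ∘ₗ M.dp = N.dp ∘ₗ φ.f := LinearMap.ext φ.dp
    have h' := congrArg (LinearMap.baseChange R') h
    rw [LinearMap.baseChange_comp, LinearMap.baseChange_comp] at h'
    exact LinearMap.congr_fun h' t

/-- `K` is the direct sum of `M` and `N`, apart from the differential of the complex and the
grading by the homological degree. -/
structure Splits (K M N : MFComplex R) where
  i₁ : ShiftHom M K
  p₁ : ShiftHom K M
  i₂ : ShiftHom N K
  p₂ : ShiftHom K N
  sum : i₁.f ∘ₗ p₁.f + i₂.f ∘ₗ p₂.f = LinearMap.id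

noncomputable def Splits.tensor {K M N : MFComplex R} (s : Splits K M N) (P : MFComplex R) :
    Splits (tensor K P) (tensor M P) (tensor N P) where
  i₁ := s.i₁.tensor P
  p₁ := s.p₁.tensor P
  i₂ := s.i₂.tensor P
  p₂ := s.p₂.tensor P
  sum := by
    have h := congrArg (LinearMap.rTensor P.carrier) s.sum
    rwa [LinearMap.rTensor_add, LinearMap.rTensor_comp, LinearMap.rTensor_comp,
      LinearMap.rTensor_id] at h

noncomputable def Splits.baseChange {R' : Type u} [CommRing R'] (g : R →+* R')
    {K M N : MFComplex R} (s : Splits K M N) :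
    Splits (K.baseChange g) (M.baseChange g) (N.baseChange g) where
  i₁ := s.i₁.baseChange g
  p₁ := s.p₁.baseChange g
  i₂ := s.i₂.baseChange g
  p₂ := s.p₂.baseChange g
  sum := by
    let _ := g.toAlgebra
    have h := congrArg (LinearMap.baseChange R') s.sum
    rwa [LinearMap.baseChange_add, LinearMap.baseChange_comp, LinearMap.baseChange_comp,
      LinearMap.baseChange_id] at h

/-- Primitives of the two projections of `x` are combined by the inclusions. Since `Resolves`
involves neither `del` nor the homological degree, the differential of a crossing complex plays no
role in it. -/
theorem Splits.resolves {K M N : MFComplex R} (s : Splits K M N) (hM : M.Resolves)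
    (hN : N.Resolves) : K.Resolves := by
  intro i hi x hx h0
  obtain ⟨y, hy⟩ := hM (i.1 + s.p₁.c, i.2) hi (s.p₁.f x) (s.p₁.mem i x hx) (by rw [← s.p₁.dp, h0, map_zero])
  obtain ⟨z, hz⟩ := hN (i.1 + s.p₂.c, i.2) hi (s.p₂.f x) (s.p₂.mem i x hx) (by rw [← s.p₂.dp, h0, map_zero])
  refine ⟨s.i₁.f y + s.i₂.f z, ?_⟩
  rw [map_add, ← s.i₁.dp, ← s.i₂.dp, hy, hz]
  exact LinearMap.congr_fun s.sum x

/-- A two-term complex splits. -/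
def splitsTwoTerm (a : ℤ) (M N : MFComplex R) (hpot : M.potential = N.potential)
    (f : M.carrier →ₗ[R] N.carrier) (hf : ∀ i, ∀ x ∈ M.gr i, f x ∈ N.gr i)
    (hdp : f ∘ₗ M.dp = N.dp ∘ₗ f) (hdm : f ∘ₗ M.dm = N.dm ∘ₗ f)
    (hdel : f ∘ₗ M.del = N.del ∘ₗ f) : Splits (twoTerm a M N hpot f hf hdp hdm hdel) M N where
  i₁ :=
    { f := LinearMap.inl R M.carrier N.carrier
      c := a
      mem := fun i x hx => ⟨by simpa using hx, zero_mem _⟩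
      dp := fun x => Prod.ext rfl (map_zero N.dp).symm }
  p₁ :=
    { f := LinearMap.fst R M.carrier N.carrier
      c := -a
      mem := fun i x hx => hx.1
      dp := fun x => rfl }
  i₂ :=
    { f := LinearMap.inr R M.carrier N.carrier
      c := a + 1
      mem := fun i x hx => ⟨zero_mem _, by simpa using hx⟩
      dp := fun x => Prod.ext (map_zero M.dp).symm rfl }
  p₂ :=
    { f := LinearMap.snd R M.carrier N.carrier
      c := -(a + 1)
      mem := fun i x hx => hx.2
      dp := fun x => rfl }
  sum := LinearMap.ext fun x => Prod.ext (add_zero _) (zero_add _)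

theorem baseChange_kos {R' : Type u} [CommRing R'] (g : R →+* R') (x y : R) (M : MFComplex R) :
    Isom ((kos x y M).baseChange g) (kos (g x) (g y) (M.baseChange g)) :=
  ((koszul_tensor_isom x y M).symm.baseChange g).trans ((baseChange_tensor _ _ _).trans
    (((baseChange_koszul _ _ _).tensor (Isom.refl _)).trans (koszul_tensor_isom _ _ _)))

end MFComplex
end KhR

namespace KhR
open TensorProduct MvPolynomial

/-! ### Acyclic systems of factors. -/

section Layered
variable {V V' : Type}

/-- The outgoing variables of a factor. -/
def Factor.outputs : Factor V → List V
  | Sum.inl e => [e.1]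
  | Sum.inr c => [c.2 0, c.2 1]

/-- The incoming variables of a factor. -/
def Factor.inputs : Factor V → List V
  | Sum.inl e => [e.2]
  | Sum.inr c => [c.2 2, c.2 3]

theorem Factor.outputs_map (σ : V → V') (F : Factor V) : (F.map σ).outputs = F.outputs.map σ := by
  rcases F with F | F <;> rfl

theorem Factor.inputs_map (σ : V → V') (F : Factor V) : (F.map σ).inputs = F.inputs.map σ := by
  rcases F with F | F <;> rfl

/-- The factors of an acyclic diagram: the rank `ρ` increases along every factor, and no variable
is the output of two factors. -/
structure Layered (ρ : V → ℕ) (L : List (Factor V)) : Prop where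
  nodup : (L.flatMap Factor.outputs).Nodup
  lt : ∀ F ∈ L, ∀ a ∈ F.inputs, ∀ b ∈ F.outputs, ρ a < ρ b

theorem Layered.tail {ρ : V → ℕ} {F : Factor V} {L : List (Factor V)} (h : Layered ρ (F :: L)) :
    Layered ρ L :=
  ⟨by have := h.nodup; rw [List.flatMap_cons] at this; exact (List.nodup_append.1 this).2.1,
    fun G hG => h.lt G (List.mem_cons_of_mem _ hG)⟩

theorem Layered.notMem {ρ : V → ℕ} {F : Factor V} {L : List (Factor V)} (h : Layered ρ (F :: L))
    {a : V} (ha : a ∈ F.outputs) : a ∉ L.flatMap Factor.outputs := fun ha' => by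
  have := h.nodup
  rw [List.flatMap_cons, List.nodup_append] at this
  exact this.2.2 a ha a ha' rfl

/-- A variable that is not an output of `L` occurs there at most as an input. Replacing it by one of
smaller rank only makes inputs smaller, which preserves the inequalities. -/
theorem Layered.map {ρ : V → ℕ} {L : List (Factor V)} (h : Layered ρ L) (ρ' : V' → ℕ) (σ : V → V')
    (hinj : ∀ a ∈ L.flatMap Factor.outputs, ∀ b ∈ L.flatMap Factor.outputs, σ a = σ b → a = b)
    (hout : ∀ a ∈ L.flatMap Factor.outputs, ρ' (σ a) = ρ a) (hle : ∀ a, ρ' (σ a) ≤ ρ a) :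
    Layered ρ' (L.map (Factor.map σ)) := by
  have e : (L.map (Factor.map σ)).flatMap Factor.outputs = (L.flatMap Factor.outputs).map σ := by
    rw [List.flatMap_map, List.map_flatMap]
    congr 1
    ext1 F
    exact F.outputs_map σ
  refine ⟨?_, ?_⟩
  · rw [e]
    exact List.Nodup.map_on hinj h.nodup
  · intro F hF
    obtain ⟨G, hG, rfl⟩ := List.mem_map.1 hF
    rw [Factor.outputs_map, Factor.inputs_map]
    intro a ha b hb
    obtain ⟨a, ha', rfl⟩ := List.mem_map.1 ha
    obtain ⟨b, hb', rfl⟩ := List.mem_map.1 hb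
    rw [hout b (List.mem_flatMap.2 ⟨G, hG, hb'⟩)]
    exact (hle a).trans_lt (h.lt G hG a ha' b hb')

end Layered

/-! ### The complex of an acyclic diagram is a resolution. -/

section Resolution
variable {k : Type u} [Field k] {p : Polynomial k} (χ : CrossingData p)

instance flat_factorMF {R : Type u} [CommRing R] [Algebra k R] (F : Factor R) :
    Module.Flat R (factorMF χ F).carrier := by
  rcases F with F | ⟨s, v⟩
  · change Module.Flat R (R × R)
    infer_instance
  · let _ := (MvPolynomial.aeval (R := k) v).toRingHom.toAlgebra
    have h : Module.Flat (MvPolynomial (Fin 4) k) (χ.crossing s).carrier := by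
      let S := MvPolynomial (Fin 4) k
      cases s <;> change Module.Flat S (((S × S) ⊗[S] (S × S)) × ((S × S) ⊗[S] (S × S))) <;>
        infer_instance
    change Module.Flat R (R ⊗[MvPolynomial (Fin 4) k] (χ.crossing s).carrier)
    infer_instance

instance flat_factorsMF {R : Type u} [CommRing R] [Algebra k R] (L : List (Factor R)) :
    Module.Flat R (factorsMF χ L).carrier := by
  induction L with
  | nil =>
    change Module.Flat R R
    infer_instance
  | cons F L ih =>
    change Module.Flat R ((factorMF χ F).carrier ⊗[R] (factorsMF χ L).carrier)
    infer_instance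

theorem flat_of_isom {R : Type u} [CommRing R] {M N : MFComplex R} (h : Isom M N)
    [Module.Flat R N.carrier] : Module.Flat R M.carrier := by
  obtain ⟨f⟩ := h
  exact Module.Flat.of_linearEquiv f.e

/-- The element `v - c` is regular and generates the kernel of the substitution, so
`Resolves.kos_of_baseChange` applies. The opposite sign is admitted for the factor `-(t_1 - t_3)` of
a wide crossing. -/
theorem Resolves.of_substVar {V : Type} [DecidableEq V] {v : V}
    (c : MvPolynomial {x // x ≠ v} k) {x : MvPolynomial V k}
    (hx : x = X v - inclVar v c ∨ x = -(X v - inclVar v c)) (y : MvPolynomial V k)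
    {M : MFComplex (MvPolynomial V k)} [Module.Flat (MvPolynomial V k) M.carrier]
    (h : (M.baseChange (substVar v c).toRingHom).Resolves) : (kos x y M).Resolves := by
  have h0 : substVar v c (X v - inclVar v c) = 0 := by
    rw [map_sub, substVar_X_self, substVar_inclVar, sub_self]
  have hker : ∀ a, substVar v c a = 0 → ∃ b, a = (X v - inclVar v c) * b := fun a ha => by
    obtain ⟨b, hb⟩ := exists_substVar_add c a
    rw [ha, map_zero, zero_add] at hb
    exact ⟨b, hb.symm⟩
  have hne := X_sub_inclVar_ne_zero c
  refine Resolves.kos_of_baseChange (θ := (substVar v c).toRingHom)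
    (fun a => ⟨inclVar v a, substVar_inclVar c a⟩) (fun a ha => ?_) ?_ (fun a ha => ?_) y h
  · obtain ⟨b, rfl⟩ := hker a ha
    rcases hx with rfl | rfl
    · exact ⟨b, rfl⟩
    · exact ⟨-b, by ring⟩
  · change substVar v c x = 0
    rcases hx with rfl | rfl
    · exact h0
    · rw [map_neg, h0, neg_zero]
  · refine (mul_eq_zero.1 ha).resolve_left ?_
    rcases hx with rfl | rfl
    · exact hne
    · exact neg_ne_zero.2 hne

theorem varFactors_map {V V' : Type} (θ : MvPolynomial V k →ₐ[k] MvPolynomial V' k) (σ : V → V')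
    (h : ∀ x, θ (X x) = X (σ x)) (L : List (Factor V)) :
    (varFactors k L).map (Factor.map θ) = varFactors k (L.map (Factor.map σ)) := by
  rw [varFactors, varFactors, List.map_map, List.map_map]
  refine List.map_congr_left fun F _ => ?_
  simp only [Function.comp_apply, Factor.map_map]
  congr 1
  exact funext h

/-- Identification of the variable `v` with another one. -/
def replaceVar {V : Type} [DecidableEq V] (v : V) (a : {x // x ≠ v}) (x : V) : {x // x ≠ v} :=
  if h : x = v then a else ⟨x, h⟩

theorem replaceVar_self {V : Type} [DecidableEq V] (v : V) (a : {x // x ≠ v}) :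
    replaceVar v a v = a := dif_pos rfl

theorem replaceVar_of_ne {V : Type} [DecidableEq V] {v : V} (a : {x // x ≠ v}) {x : V}
    (h : x ≠ v) : replaceVar v a x = ⟨x, h⟩ := dif_neg h

theorem substVar_X_eq {V : Type} [DecidableEq V] (v : V) (a : {x // x ≠ v}) (x : V) :
    substVar v (X a : MvPolynomial {x // x ≠ v} k) (X x) = X (replaceVar v a x) := by
  by_cases h : x = v
  · subst h
    rw [substVar_X_self, replaceVar_self]
  · rw [substVar_X _ h, replaceVar_of_ne a h]

/-- Identification of the variable `i` with `a` and of the variable `j` with `b`. -/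
def replaceVars {V : Type} [DecidableEq V] (i : V) (j : {x // x ≠ i}) (a b : {x // x ≠ j})
    (x : V) : {x // x ≠ j} :=
  if h : x = i then a else replaceVar j b ⟨x, h⟩

/-- The first variable `i` has already been replaced by `c`. Identifying `j` with `b` turns `c` into
the variable `a`, so both substitutions together are a renaming of variables in `L`. -/
theorem resolves_two {V : Type} [DecidableEq V] {i : V} {j : {x // x ≠ i}} (a b : {x // x ≠ j})
    (c : MvPolynomial {x // x ≠ i} k) (hc : substVar j (X b) c = X a)
    {x : MvPolynomial {x // x ≠ i} k} (hx : x = X j - X b.1 ∨ x = -(X j - X b.1))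
    (y : MvPolynomial {x // x ≠ i} k) (L : List (Factor V))
    (h : (factorsMF χ (varFactors k (L.map (Factor.map (replaceVars i j a b))))).Resolves) :
    (kos x y ((factorsMF χ (varFactors k L)).baseChange (substVar i c).toRingHom)).Resolves := by
  have h1 := baseChange_factorsMF χ (substVar i c) (varFactors k L)
  have := flat_of_isom h1
  refine Resolves.of_substVar (X b) (by rwa [inclVar, rename_X]) y ?_
  refine Resolves.of_isom ((h1.baseChange _).trans ((baseChange_factorsMF χ _ _).trans
    (Isom.of_eq ?_))) h
  rw [← varFactors_map ((substVar j (X b)).comp (substVar i c)), List.map_map]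
  · congr 2
    ext1 F
    exact Factor.map_map _ _ F
  · intro x
    rw [AlgHom.comp_apply, replaceVars]
    split_ifs with hx
    · rw [hx, substVar_X_self, hc]
    · rw [substVar_X _ hx, substVar_X_eq]

theorem baseChange_tensor_koszul {S R : Type u} [CommRing S] [CommRing R] (g : S →+* R)
    (x y x' y' : S) (M : MFComplex R) :
    Isom (tensor ((tensor (koszul x y) (koszul x' y')).baseChange g) M)
      (kos (g x) (g y) (kos (g x') (g y') M)) :=
  (((baseChange_tensor _ _ _).trans ((baseChange_koszul _ _ _).tensor
    (baseChange_koszul _ _ _))).tensor (Isom.refl M)).trans ((tensor_assoc _ _ _).trans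
      (((Isom.refl _).tensor (koszul_tensor_isom _ _ _)).trans (koszul_tensor_isom _ _ _)))

theorem CrossingData.del_comm {y y' : Fin 2 → MvPolynomial (Fin 4) k}
    (f : (wide y).carrier →ₗ[MvPolynomial (Fin 4) k] (smooth y').carrier) :
    f ∘ₗ (wide y).del = (smooth y').del ∘ₗ f := by simp [wide_del, smooth_del]

theorem CrossingData.del_comm' {y y' : Fin 2 → MvPolynomial (Fin 4) k}
    (f : (smooth y).carrier →ₗ[MvPolynomial (Fin 4) k] (wide y').carrier) :
    f ∘ₗ (smooth y).del = (wide y').del ∘ₗ f := by simp [wide_del, smooth_del]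

/-- The complex of a positive crossing splits. -/
noncomputable def CrossingData.splitsTrue :
    Splits (χ.crossing true) (wide χ.y₁) (smooth χ.y₂) :=
  splitsTwoTerm (-1) (wide χ.y₁) (smooth χ.y₂) (χ.potential₁.trans χ.potential₂.symm)
      χ.pos χ.pos_mem χ.pos_dp χ.pos_dm (CrossingData.del_comm _)

/-- The complex of a negative crossing splits. -/
noncomputable def CrossingData.splitsFalse :
    Splits (χ.crossing false) (smooth χ.y₂) (wide χ.y₁) :=
  splitsTwoTerm 0 (smooth χ.y₂) (wide χ.y₁) (χ.potential₂.trans χ.potential₁.symm)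
      χ.neg χ.neg_mem χ.neg_dp χ.neg_dm (CrossingData.del_comm' _)

/-- The complex of an acyclic diagram is a resolution. -/
theorem resolves_of_layered (n : ℕ) : ∀ (V : Type) (ρ : V → ℕ) (L : List (Factor V)),
    L.length = n → Layered ρ L → (factorsMF χ (varFactors k L)).Resolves := by
  classical
  induction n with
  | zero =>
    intro V ρ L hL h
    rw [List.length_eq_zero_iff] at hL
    subst hL
    exact resolves_unit
  | succ n ih =>
    rintro V ρ (_ | ⟨⟨h, t⟩ | ⟨s, v⟩, L⟩) hL hρ
    · simp at hL
    · have hlt : ρ t < ρ h := hρ.lt _ List.mem_cons_self t (by simp [Factor.inputs]) h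
        (by simp [Factor.outputs])
      have hth : t ≠ h := by rintro rfl; exact lt_irrefl _ hlt
      have hout : ∀ a ∈ L.flatMap Factor.outputs, a ≠ h := by
        rintro a ha rfl
        exact hρ.notMem (by simp [Factor.outputs]) ha
      let t' : {x // x ≠ h} := ⟨t, hth⟩
      refine Resolves.of_isom (factorsMF_cons_edge χ _ _ _) ?_
      -- The head `h` of the edge is no output of `L`, so it may be identified with the tail, which
      -- has smaller rank; `L` stays layered.
      refine Resolves.of_substVar (X t') (by rw [inclVar, rename_X]; exact Or.inl rfl) _ ?_
      refine Resolves.of_isom ((baseChange_factorsMF χ _ _).trans (Isom.of_eq ?_))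
        (ih _ (fun x => ρ x.1) (L.map (Factor.map (replaceVar h t'))) (by simpa using hL)
          (hρ.tail.map _ _ ?_ ?_ ?_))
      · exact congrArg (factorsMF χ) (varFactors_map _ _ (substVar_X_eq h t') L)
      · intro a ha b hb hab
        rw [replaceVar_of_ne _ (hout a ha), replaceVar_of_ne _ (hout b hb)] at hab
        exact congrArg Subtype.val hab
      · intro a ha
        rw [replaceVar_of_ne _ (hout a ha)]
      · intro a
        by_cases ha : a = h
        · subst ha
          rw [replaceVar_self]
          exact hlt.le
        · rw [replaceVar_of_ne _ ha]
    · have hlt : ∀ a ∈ [v 2, v 3], ∀ b ∈ [v 0, v 1], ρ a < ρ b := hρ.lt _ List.mem_cons_self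
      have h20 := hlt (v 2) (by simp) (v 0) (by simp)
      have h21 := hlt (v 2) (by simp) (v 1) (by simp)
      have h30 := hlt (v 3) (by simp) (v 0) (by simp)
      have h31 := hlt (v 3) (by simp) (v 1) (by simp)
      have h10 : v 1 ≠ v 0 := by
        have := hρ.nodup
        rw [List.flatMap_cons, List.nodup_append] at this
        have h1 : [v 0, v 1].Nodup := this.1
        simp only [List.nodup_cons, List.mem_singleton] at h1
        exact fun e => h1.1 e.symm
      have hne : ∀ {a b : V}, ρ a < ρ b → a ≠ b := by rintro a _ h rfl; exact lt_irrefl _ h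
      have hout0 : ∀ a ∈ L.flatMap Factor.outputs, a ≠ v 0 := by
        rintro a ha rfl
        exact hρ.notMem (by simp [Factor.outputs]) ha
      have hout1 : ∀ a ∈ L.flatMap Factor.outputs, a ≠ v 1 := by
        rintro a ha rfl
        exact hρ.notMem (by simp [Factor.outputs]) ha
      let j : {x // x ≠ v 0} := ⟨v 1, h10⟩
      let k' : {x // x ≠ v 0} := ⟨v 2, hne h20⟩
      let l' : {x // x ≠ v 0} := ⟨v 3, hne h30⟩
      have hk : k' ≠ j := fun e => hne h21 (congrArg Subtype.val e)
      have hl : l' ≠ j := fun e => hne h31 (congrArg Subtype.val e)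
      -- The two outputs of the crossing are not outputs of `L`. Replacing them by variables of at
      -- most the same rank keeps `L` layered, and the induction hypothesis applies to the shorter
      -- list.
      have key : ∀ a b : {x // x ≠ j}, ρ a.1.1 ≤ ρ (v 0) → ρ b.1.1 ≤ ρ (v 1) →
          (factorsMF χ (varFactors k (L.map (Factor.map (replaceVars (v 0) j a b))))).Resolves := by
        intro a b ha hb
        have e : ∀ x (h0 : x ≠ v 0) (h1 : x ≠ v 1), replaceVars (v 0) j a b x =
            ⟨⟨x, h0⟩, fun e => h1 (congrArg Subtype.val e)⟩ := fun x h0 h1 => by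
          rw [replaceVars, dif_neg h0, replaceVar_of_ne]
        refine ih _ (fun x => ρ x.1.1) _ (by simpa using hL) (hρ.tail.map _ _ ?_ ?_ ?_)
        · intro x hx y hy hxy
          rw [e x (hout0 x hx) (hout1 x hx), e y (hout0 y hy) (hout1 y hy)] at hxy
          exact congrArg (fun z => z.1.1) hxy
        · intro x hx
          rw [e x (hout0 x hx) (hout1 x hx)]
        · intro x
          by_cases h0 : x = v 0
          · rw [replaceVars, dif_pos h0, h0]
            exact ha
          · by_cases h1 : x = v 1
            · subst h1
              rw [replaceVars, dif_neg h0, replaceVar_self]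
              exact hb
            · rw [e x h0 h1]
      have hflat : ∀ x y : MvPolynomial V k, Module.Flat (MvPolynomial V k)
          (kos x y (factorsMF χ (varFactors k L))).carrier := fun x y => by
        have : Module.Flat (MvPolynomial V k) (tensor (koszul x y)
            (factorsMF χ (varFactors k L))).carrier := by
          have := flat_factorsMF χ (varFactors k L)
          change Module.Flat (MvPolynomial V k) ((MvPolynomial V k × MvPolynomial V k)
            ⊗[MvPolynomial V k] (factorsMF χ (varFactors k L)).carrier)
          infer_instance
        exact flat_of_isom (koszul_tensor_isom _ _ _).symm
      have e1 : inclVar (v 0) (X k' : MvPolynomial _ k) = X (v 2) := rename_X _ _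
      have e2 : inclVar (v 0) (X l' : MvPolynomial _ k) = X (v 3) := rename_X _ _
      have e3 : inclVar (v 0) (X j : MvPolynomial _ k) = X (v 1) := rename_X _ _
      -- The entries `t_0 - t_3` and `t_1 - t_2` identify each output with one input.
      have hsmooth : (tensor ((smooth χ.y₂).baseChange (MvPolynomial.aeval (R := k)
          (fun h => (X (v h) : MvPolynomial V k))).toRingHom)
          (factorsMF χ (varFactors k L))).Resolves := by
        refine Resolves.of_isom (baseChange_tensor_koszul _ _ _ _ _ _) ?_
        have := hflat
        refine Resolves.of_substVar (X l') (Or.inl ?_) _ ?_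
        · rw [e2]
          simp
        · refine Resolves.of_isom (baseChange_kos _ _ _ _) (resolves_two χ ⟨l', hl⟩ ⟨k', hk⟩ _ ?_
            (Or.inl ?_) _ L (key _ _ h30.le h21.le))
          · exact substVar_X _ hl
          · change substVar (v 0) _ (aeval _ (X 1 - X 2)) = _
            rw [map_sub, aeval_X, aeval_X, map_sub, substVar_X _ h10, substVar_X _ (hne h20)]
      -- The linear entry is solved for `t_0 = t_2 + t_3 - t_1`. Then `t_0 t_1 - t_2 t_3` is the
      -- product of `t_1 - t_2` and `-(t_1 - t_3)`, and these two factors identify the outputs with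
      -- the inputs in the two possible ways.
      have hwide : (tensor ((wide χ.y₁).baseChange (MvPolynomial.aeval (R := k)
          (fun h => (X (v h) : MvPolynomial V k))).toRingHom)
          (factorsMF χ (varFactors k L))).Resolves := by
        refine Resolves.of_isom (baseChange_tensor_koszul _ _ _ _ _ _) ?_
        have := hflat
        refine Resolves.of_substVar (X k' + X l' - X j) (Or.inl ?_) _ ?_
        · rw [map_sub (inclVar (v 0)), map_add (inclVar (v 0)), e1, e2, e3]
          change aeval _ (X 0 + X 1 - X 2 - X 3) = _
          simp only [map_sub, map_add, aeval_X]
          ring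
        · refine Resolves.of_isom (baseChange_kos _ _ _ _) ?_
          have e4 : (substVar (v 0) (X k' + X l' - X j : MvPolynomial _ k)).toRingHom
              ((aeval (R := k) fun h => (X (v h) : MvPolynomial V k)).toRingHom
                (X 0 * X 1 - X 2 * X 3)) = (X j - X k') * -(X j - X l') := by
            change substVar (v 0) _ (aeval _ (X 0 * X 1 - X 2 * X 3)) = _
            simp only [map_sub, map_mul, aeval_X]
            rw [substVar_X_self, substVar_X _ h10, substVar_X _ (hne h20), substVar_X _ (hne h30)]
            ring
          rw [e4]
          -- The second entries of the two auxiliary Koszul factors are arbitrary, since only `dp`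
          -- is concerned.
          refine Resolves.kos_mul (y := 0) (y' := 0) _ (resolves_two χ ⟨l', hl⟩ ⟨k', hk⟩ _ ?_
            (Or.inl rfl) _ L (key _ _ h30.le h21.le)) (resolves_two χ ⟨k', hk⟩ ⟨l', hl⟩ _ ?_
            (Or.inr rfl) _ L (key _ _ h20.le h31.le))
          · rw [map_sub, map_add, substVar_X_self, substVar_X _ hk, substVar_X _ hl]
            ring
          · rw [map_sub, map_add, substVar_X_self, substVar_X _ hk, substVar_X _ hl]
            ring
      cases s
      · exact ((χ.splitsFalse.baseChange _).tensor _).resolves hsmooth hwide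
      · exact ((χ.splitsTrue.baseChange _).tensor _).resolves hwide hsmooth

end Resolution

/-! ### Ranking the flags of an acyclic diagram. -/

section Acyclic
variable {B : Boundary}

namespace TangleDiagram
variable (T : TangleDiagram B)

/-- The number of vertices from which a given vertex can be reached. -/
noncomputable def depth (v : Fin T.crossings ⊕ Fin B.n) : ℕ :=
  {w | Relation.TransGen T.Adj w v}.ncard

/-- Whatever reaches `v` also reaches `w`; in addition `v` reaches `w`, but by acyclicity it does
not reach itself. -/
theorem depth_lt (hT : T.Acyclic) {v w : Fin T.crossings ⊕ Fin B.n} (h : T.Adj v w) :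
    T.depth v < T.depth w := by
  refine Set.ncard_lt_ncard ⟨fun x hx => Relation.TransGen.tail hx h, fun hle => ?_⟩ (Set.toFinite _)
  exact hT.1 v (hle (show Relation.TransGen T.Adj v w from .single h))

/-- A function on the flags which increases along the edges and at the crossings. -/
noncomputable def flagRank (φ : Flag T.crossings B.n) : ℕ :=
  2 * T.depth (vertex φ) + if B.inward φ then 0 else 1

/-- Along an edge the depth grows by at least one, so its double grows by at least two, which
outweighs the additional `1` of the outgoing flag. That `1` is what separates inputs from outputs at
a crossing. -/
theorem flagRank_edge (hT : T.Acyclic) (e : Fin T.edges) :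
    T.flagRank (T.tail e).1 < T.flagRank (T.head e).1 := by
  have := T.depth_lt hT (⟨e, rfl, rfl⟩ : T.Adj (vertex (T.tail e).1) (vertex (T.head e).1))
  rw [flagRank, flagRank, (T.tail e).2, (T.head e).2]
  simp only [Bool.false_eq_true, if_false, if_true]
  omega

theorem flagRank_crossing (x : Fin T.crossings) {a b : Fin 4} (ha : 2 ≤ a.val) (hb : ¬ 2 ≤ b.val) :
    T.flagRank (Sum.inl (x, a)) < T.flagRank (Sum.inl (x, b)) := by
  have h1 : B.inward (c := T.crossings) (Sum.inl (x, a)) = true := decide_eq_true ha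
  have h2 : B.inward (c := T.crossings) (Sum.inl (x, b)) = false := decide_eq_false hb
  rw [flagRank, flagRank, h1, h2]
  simp [vertex]

/-- The rank of the variables. -/
noncomputable def varRank : T.Var → ℕ := Sum.elim T.flagRank fun _ => 0

/-- The output of an edge is an incoming flag, that of a crossing an outgoing one; edges have
distinct heads and crossings distinct flags, so no variable is an output twice. Crossingless
components, whose input equals their output, are absent by hypothesis. -/
theorem layered (hT : T.Acyclic) : Layered T.varRank T.factors := by
  have hc : (List.ofFn fun c : Fin T.circles => ((Sum.inr c, Sum.inr c) : T.Var × T.Var)) = [] :=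
    List.eq_nil_of_length_eq_zero (by simp [hT.2])
  have hL : T.factors = List.ofFn (fun e => Sum.inl (Sum.inl (T.head e).1, Sum.inl (T.tail e).1)) ++
      List.ofFn fun x => Sum.inr (T.positive x, fun h => Sum.inl (Sum.inl (x, h))) := by
    rw [factors, edgeList, crossingList, hc, List.append_nil, List.map_ofFn, List.map_ofFn]
    rfl
  rw [hL]
  constructor
  · rw [List.nodup_flatMap]
    constructor
    · intro F hF
      rcases List.mem_append.1 hF with hF | hF
      · obtain ⟨e, rfl⟩ := List.mem_ofFn.1 hF
        simp [Factor.outputs]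
      · obtain ⟨x, rfl⟩ := List.mem_ofFn.1 hF
        simp [Factor.outputs]
    · rw [List.pairwise_append]
      refine ⟨?_, ?_, ?_⟩
      · rw [List.pairwise_ofFn]
        intro e e' hee
        simp only [Function.onFun, Factor.outputs, List.disjoint_singleton, List.mem_singleton]
        intro h
        exact hee.ne' (T.head.injective (Subtype.ext (Sum.inl.inj h)))
      · rw [List.pairwise_ofFn]
        intro x x' hxx a ha hb
        simp only [Factor.outputs, List.mem_cons, List.not_mem_nil, or_false] at ha hb
        rcases ha with rfl | rfl <;> rcases hb with h | h <;>
          simp only [Sum.inl.injEq, Prod.mk.injEq] at h <;> exact hxx.ne h.1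
      · intro F hF G hG a ha hb
        obtain ⟨e, rfl⟩ := List.mem_ofFn.1 hF
        obtain ⟨x, rfl⟩ := List.mem_ofFn.1 hG
        simp only [Factor.outputs, List.mem_cons, List.not_mem_nil, or_false] at ha hb
        subst ha
        have h1 := (T.head e).2
        rcases hb with h | h <;> rw [Sum.inl.inj h] at h1 <;> simp [Boundary.inward] at h1
  · intro F hF
    rcases List.mem_append.1 hF with hF | hF
    · obtain ⟨e, rfl⟩ := List.mem_ofFn.1 hF
      simp only [Factor.outputs, Factor.inputs, List.mem_singleton]
      rintro _ rfl _ rfl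
      exact T.flagRank_edge hT e
    · obtain ⟨x, rfl⟩ := List.mem_ofFn.1 hF
      simp only [Factor.outputs, Factor.inputs, List.mem_cons, List.not_mem_nil, or_false]
      rintro _ (rfl | rfl) _ (rfl | rfl) <;> exact T.flagRank_crossing x (by decide) (by decide)

end TangleDiagram

variable {k : Type u} [Field k] {p : Polynomial k} (χ : CrossingData p)
variable {B₀ : Boundary} {m : ℕ} {B : Fin m → Boundary} (T : ∀ i, TangleDiagram (B i))

/-- The tangles in different holes have disjoint sets of variables, so their ranks can be used side
by side. The arcs are not among these factors, and thus cycles which run through arcs do no harm. -/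
theorem layered_holeFactors (hT : ∀ i, (T i).Acyclic) :
    Layered (Sum.elim (fun _ => 0) fun x => (T x.1).varRank x.2) (holeFactors B₀ T) := by
  have h := fun i => ((T i).layered (hT i)).map (V' := Fin B₀.n ⊕ Σ i, (T i).Var)
    (Sum.elim (fun _ => 0) fun x => (T x.1).varRank x.2) (pieceVar B₀ T i) (by simp)
    (fun _ _ => rfl) (fun _ => le_rfl)
  rw [holeFactors]
  constructor
  · rw [List.flatMap_assoc, List.nodup_flatMap]
    refine ⟨fun i _ => (h i).nodup, ?_⟩
    refine (List.nodup_finRange m).imp fun {i j} hij a ha hb => hij ?_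
    have key : ∀ i, a ∈ ((T i).factors.map (Factor.map (pieceVar B₀ T i))).flatMap Factor.outputs →
        ∃ y, pieceVar B₀ T i y = a := by
      intro i ha
      obtain ⟨F, hF, ha⟩ := List.mem_flatMap.1 ha
      obtain ⟨G, -, rfl⟩ := List.mem_map.1 hF
      rw [Factor.outputs_map] at ha
      obtain ⟨y, -, rfl⟩ := List.mem_map.1 ha
      exact ⟨y, rfl⟩
    obtain ⟨y, hy⟩ := key i ha
    obtain ⟨z, hz⟩ := key j hb
    exact congrArg Sigma.fst (Sum.inr.inj (hy.trans hz.symm))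
  · intro F hF
    obtain ⟨i, -, hF⟩ := List.mem_flatMap.1 hF
    exact (h i).lt F hF

/-- The tensor product of the complexes of acyclic diagrams is a resolution. -/
theorem resolves_holes (hT : ∀ i, (T i).Acyclic) :
    (tensorFin m fun i => ((T i).kr χ).M.baseChange
      (rename (fun y => Sum.inr ⟨i, y⟩) : MvPolynomial ((T i).kr χ).Y k →ₐ[k]
        MvPolynomial (Fin B₀.n ⊕ Σ i, ((T i).kr χ).Y) k).toRingHom).Resolves :=
  Resolves.of_isom (holes_isom χ T)
    (resolves_of_layered χ _ _ _ _ rfl (layered_holeFactors T hT))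

end Acyclic
end KhR

/-! ### Compatibility of the naive projection with tensor products and extension of scalars. -/

namespace KhR
open TensorProduct MvPolynomial
namespace MFComplex
variable {R : Type u} [CommRing R]

/-- Linear maps that preserve the bigrading and commute with all differentials. -/
structure GrHom {M N : MFComplex R} (f : M.carrier →ₗ[R] N.carrier) : Prop where
  mem : ∀ i, ∀ x ∈ M.gr i, f x ∈ N.gr i
  dp : f ∘ₗ M.dp = N.dp ∘ₗ f
  dm : f ∘ₗ M.dm = N.dm ∘ₗ f
  del : f ∘ₗ M.del = N.del ∘ₗ f

namespace GrHom

theorem id (M : MFComplex R) : GrHom (LinearMap.id : M.carrier →ₗ[R] M.carrier) :=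
  ⟨fun _ _ h => h, rfl, rfl, rfl⟩

theorem sign_comm {M N : MFComplex R} {f : M.carrier →ₗ[R] N.carrier} (hf : GrHom f)
    (s : ℤ × ℤ → ℤ) : f ∘ₗ M.sign s = N.sign s ∘ₗ f :=
  ext_homogeneous M.iSup_gr fun i x hx => by
    rw [LinearMap.comp_apply, LinearMap.comp_apply, sign_of_mem M s hx,
      sign_of_mem N s (hf.mem i x hx), map_zsmul]

theorem tensor {M M' N N' : MFComplex R} {f : M.carrier →ₗ[R] M'.carrier}
    {g : N.carrier →ₗ[R] N'.carrier} (hf : GrHom f) (hg : GrHom g) :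
    GrHom (M := tensor M N) (N := tensor M' N') (TensorProduct.map f g) where
  mem i := map_mem_tensorGr _ <| by
    rintro a b rfl x hx y hy
    exact tmul_mem_tensorGr rfl (hf.mem a x hx) (hg.mem b y hy)
  dp := by
    have h := hf.sign_comm Prod.snd
    change TensorProduct.map f g ∘ₗ (TensorProduct.map M.dp LinearMap.id +
      TensorProduct.map (M.sign Prod.snd) N.dp) = (TensorProduct.map M'.dp LinearMap.id +
      TensorProduct.map (M'.sign Prod.snd) N'.dp) ∘ₗ TensorProduct.map f g
    simp only [LinearMap.comp_add, LinearMap.add_comp, ← TensorProduct.map_comp, hf.dp, hg.dp, h,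
      LinearMap.comp_id, LinearMap.id_comp]
  dm := by
    have h := hf.sign_comm Prod.snd
    change TensorProduct.map f g ∘ₗ (TensorProduct.map M.dm LinearMap.id +
      TensorProduct.map (M.sign Prod.snd) N.dm) = (TensorProduct.map M'.dm LinearMap.id +
      TensorProduct.map (M'.sign Prod.snd) N'.dm) ∘ₗ TensorProduct.map f g
    simp only [LinearMap.comp_add, LinearMap.add_comp, ← TensorProduct.map_comp, hf.dm, hg.dm, h,
      LinearMap.comp_id, LinearMap.id_comp]
  del := by
    have h := hf.sign_comm Prod.fst
    change TensorProduct.map f g ∘ₗ (TensorProduct.map M.del LinearMap.id +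
      TensorProduct.map (M.sign Prod.fst) N.del) = (TensorProduct.map M'.del LinearMap.id +
      TensorProduct.map (M'.sign Prod.fst) N'.del) ∘ₗ TensorProduct.map f g
    simp only [LinearMap.comp_add, LinearMap.add_comp, ← TensorProduct.map_comp, hf.del, hg.del, h,
      LinearMap.comp_id, LinearMap.id_comp]

theorem baseChange {R' : Type u} [CommRing R'] (g : R →+* R') {M N : MFComplex R}
    {f : M.carrier →ₗ[R] N.carrier} (hf : GrHom f) : GrHom (baseChangeMap g f) := by
  let _ := g.toAlgebra
  have key : ∀ {u : M.carrier →ₗ[R] M.carrier} {v : N.carrier →ₗ[R] N.carrier},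
      f ∘ₗ u = v ∘ₗ f → f.baseChange R' ∘ₗ u.baseChange R' = v.baseChange R' ∘ₗ f.baseChange R' :=
    fun h => by rw [← LinearMap.baseChange_comp, h, LinearMap.baseChange_comp]
  refine ⟨fun i t ht => ?_, key hf.dp, key hf.dm, key hf.del⟩
  refine (Submodule.span_le.2 ?_ : baseChangeGr R' M i ≤
    (baseChangeGr R' N i).comap (f.baseChange R')) ht
  rintro _ ⟨x, hx, rfl⟩
  exact Submodule.subset_span ⟨f x, hf.mem i x hx, LinearMap.baseChange_tmul _ _ _⟩

theorem tensorFin : ∀ {m : ℕ} {M N : Fin m → MFComplex R}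
    {f : ∀ i, (M i).carrier →ₗ[R] (N i).carrier}, (∀ i, GrHom (f i)) → GrHom (tensorFinMap m f)
  | 0, _, _, _, _ => GrHom.id _
  | _ + 1, _, _, _, h => (h 0).tensor (GrHom.tensorFin fun i => h i.succ)

theorem naiveMk (M : MFComplex R) (hM : IsNonpos M) : GrHom (N := M.naive hM) M.naiveMk where
  mem i x hx := by
    change M.naiveMk x ∈ naiveGr M i
    rw [naiveGr]
    split_ifs with hi
    · exact Submodule.mem_map_of_mem hx
    · rw [M.naiveMk_eq_zero (M.mem_naiveSub_of_ne hi hx)]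
      exact zero_mem _
  dp := LinearMap.ext fun x => M.naiveMk_eq_zero (M.dp_mem_naiveSub x)
  dm := ext_homogeneous M.iSup_gr fun i x hx => by
    -- `dm` can reach degree `0` only from degree `1`, where `M` vanishes.
    by_cases hi : i.2 = 1
    · rw [hM i (by omega), Submodule.mem_bot] at hx
      rw [hx, map_zero, map_zero]
    · exact M.naiveMk_eq_zero (M.mem_naiveSub_of_ne (by simp; omega) (M.dm_mem i x hx))
  del := LinearMap.ext fun x => rfl

theorem restrict {R₀ : Type u} [CommRing R₀] {g : R₀ →+* R} {M N : MFComplex R} {w : R₀}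
    (hM : M.potential = g w) (hN : N.potential = g w) {f : M.carrier →ₗ[R] N.carrier}
    (hf : GrHom f) : GrHom (restrictMap g hM hN f) where
  mem := hf.mem
  dp := LinearMap.ext fun x => LinearMap.congr_fun hf.dp x
  dm := LinearMap.ext fun x => LinearMap.congr_fun hf.dm x
  del := LinearMap.ext fun x => LinearMap.congr_fun hf.del x

theorem isMor {M N : MFComplex R} {f : M.carrier →ₗ[R] N.carrier} (hf : GrHom f) : IsMor f where
  d_comm := by rw [d, d, LinearMap.comp_add, LinearMap.add_comp, hf.dp, hf.dm]
  del_comm := hf.del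
  mem n j x hx := N.gr_le_par n j (hf.mem _ x hx)

end GrHom

/-- Surjective maps with the same kernel as the projection onto the naive complex. -/
structure IsNaiveProj (M : MFComplex R) {N : Type*} [AddCommGroup N] [Module R N]
    (f : M.carrier →ₗ[R] N) : Prop where
  surjective : Function.Surjective f
  ker_eq : LinearMap.ker f = M.naiveSub

theorem isNaiveProj_naiveMk (M : MFComplex R) : IsNaiveProj M M.naiveMk :=
  ⟨M.naiveSub.mkQ_surjective, M.naiveSub.ker_mkQ⟩

theorem isNaiveProj_unit : IsNaiveProj (unit R) (LinearMap.id : R →ₗ[R] R) := by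
  refine ⟨Function.surjective_id, ?_⟩
  rw [LinearMap.ker_id, eq_comm, eq_bot_iff]
  refine (unit R).naiveSub_le (fun i hi x hx => ?_) fun x => zero_mem _
  have h : (unit R).gr i = ⊥ := if_neg (by rintro rfl; exact hi rfl)
  rwa [h] at hx

/-- In nonpositive degrees a tensor has degree `0` only if both of its factors have. The essential
case is `dp z ⊗ y` with `y` of degree `0`: then `dp y = 0`, and the element equals `dp (z ⊗ y)`. -/
theorem tmul_mem_naiveSub_left {M N : MFComplex R} (hM : IsNonpos M) (hN : IsNonpos N)
    {x : M.carrier} (hx : x ∈ M.naiveSub) (y : N.carrier) :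
    (x ⊗ₜ[R] y : M.carrier ⊗[R] N.carrier) ∈ (tensor M N).naiveSub := by
  have hdp : ∀ z : M.carrier, (M.dp z ⊗ₜ[R] y : M.carrier ⊗[R] N.carrier) ∈
      (tensor M N).naiveSub := by
    intro z
    have h : (tensor M N).naiveSub.mkQ ∘ₗ TensorProduct.map M.dp LinearMap.id = 0 := by
      refine tensor_ext fun a b z hz y hy => (Submodule.Quotient.mk_eq_zero _).2 ?_
      rw [TensorProduct.map_tmul, LinearMap.id_apply]
      by_cases hb : b.2 = 0
      · have hy0 : N.dp y = 0 := by
          have := N.dp_mem b y hy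
          rwa [hN _ (by simp [hb]), Submodule.mem_bot] at this
        have := tensor_dp_tmul (N := N) hz y
        rw [hy0, tmul_zero, smul_zero, add_zero] at this
        exact this ▸ dp_mem_naiveSub _ _
      · by_cases ha : 0 < a.2 + 1
        · have := M.dp_mem a z hz
          rw [hM _ ha, Submodule.mem_bot] at this
          rw [this, zero_tmul]
          exact zero_mem _
        · by_cases hb' : 0 < b.2
          · rw [hN b hb', Submodule.mem_bot] at hy
            rw [hy, tmul_zero]
            exact zero_mem _
          · refine mem_naiveSub_of_ne (tensor M N) (i := (a.1, a.2 + 1) + b) ?_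
              (tmul_mem_tensorGr rfl (M.dp_mem a z hz) hy)
            simp only [Prod.snd_add]
            omega
    exact (Submodule.Quotient.mk_eq_zero _).1 (LinearMap.congr_fun h (z ⊗ₜ[R] y))
  have h : M.naiveSub ≤ (tensor M N).naiveSub.comap ((TensorProduct.mk R M.carrier N.carrier).flip y) := by
    refine M.naiveSub_le (fun a ha x hx => ?_) hdp
    have hy : y ∈ ⨆ i, N.gr i := by rw [N.iSup_gr]; trivial
    refine (iSup_le fun b y hy => ?_ : (⨆ i, N.gr i) ≤
      (tensor M N).naiveSub.comap (TensorProduct.mk R M.carrier N.carrier x)) hy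
    change (x ⊗ₜ[R] y : M.carrier ⊗[R] N.carrier) ∈ (tensor M N).naiveSub
    by_cases ha' : 0 < a.2
    · rw [hM a ha', Submodule.mem_bot] at hx
      rw [hx, zero_tmul]
      exact zero_mem _
    · by_cases hb' : 0 < b.2
      · rw [hN b hb', Submodule.mem_bot] at hy
        rw [hy, tmul_zero]
        exact zero_mem _
      · refine mem_naiveSub_of_ne (tensor M N) (i := a + b) ?_ (tmul_mem_tensorGr rfl hx hy)
        simp only [Prod.snd_add]
        omega
  exact h hx

theorem tmul_mem_naiveSub_right {M N : MFComplex R} (hM : IsNonpos M) (hN : IsNonpos N)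
    (x : M.carrier) {y : N.carrier} (hy : y ∈ N.naiveSub) :
    (x ⊗ₜ[R] y : M.carrier ⊗[R] N.carrier) ∈ (tensor M N).naiveSub := by
  have hx : x ∈ ⨆ i, M.gr i := by rw [M.iSup_gr]; trivial
  refine (iSup_le fun a x hx => ?_ : (⨆ i, M.gr i) ≤ (tensor M N).naiveSub.comap
    ((TensorProduct.mk R M.carrier N.carrier).flip y)) hx
  change (x ⊗ₜ[R] y : M.carrier ⊗[R] N.carrier) ∈ (tensor M N).naiveSub
  by_cases ha : a.2 = 0
  · have h : N.naiveSub ≤ (tensor M N).naiveSub.comap (TensorProduct.mk R M.carrier N.carrier x) := by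
      refine N.naiveSub_le (fun b hb y hy => ?_) fun y => ?_
      · exact mem_naiveSub_of_ne (tensor M N) (i := a + b) (by simpa [ha] using hb)
          (tmul_mem_tensorGr rfl hx hy)
      · have hx0 : M.dp x = 0 := by
          have := M.dp_mem a x hx
          rwa [hM _ (by simp [ha]), Submodule.mem_bot] at this
        have := tensor_dp_tmul (N := N) hx y
        rw [hx0, zero_tmul, zero_add, ha, show eps 0 = 1 from rfl, one_smul] at this
        exact (congrArg (· ∈ (tensor M N).naiveSub) this).mp (dp_mem_naiveSub (tensor M N) _)
    exact h hy
  · exact tmul_mem_naiveSub_left hM hN (M.mem_naiveSub_of_ne ha hx) y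

/-- By right exactness the kernel of `f ⊗ g` is spanned by tensors with one factor in a kernel, and
these lie in `naiveSub` of the tensor product. So for complexes in nonpositive degrees `H^0`
commutes with tensor products, without any flatness. -/
theorem IsNaiveProj.tensor {M N : MFComplex R} {M' N' : Type u} [AddCommGroup M'] [Module R M']
    [AddCommGroup N'] [Module R N'] {f : M.carrier →ₗ[R] M'} {g : N.carrier →ₗ[R] N'}
    (hM : IsNonpos M) (hN : IsNonpos N) (hf : IsNaiveProj M f) (hg : IsNaiveProj N g) :
    IsNaiveProj (tensor M N) (TensorProduct.map f g) := by
  refine ⟨TensorProduct.map_surjective hf.surjective hg.surjective, le_antisymm ?_ ?_⟩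
  · change LinearMap.ker (TensorProduct.map f g) ≤ _
    rw [TensorProduct.map_ker (LinearMap.exact_subtype_ker_map f) hf.surjective
      (LinearMap.exact_subtype_ker_map g) hg.surjective]
    refine sup_le ?_ ?_
    · rintro _ ⟨t, rfl⟩
      induction t using TensorProduct.induction_on with
      | zero => rw [map_zero]; exact zero_mem _
      | add a b ha hb => rw [map_add]; exact add_mem ha hb
      | tmul x y => exact tmul_mem_naiveSub_right hM hN x (hg.ker_eq ▸ y.2)
    · rintro _ ⟨t, rfl⟩
      induction t using TensorProduct.induction_on with
      | zero => rw [map_zero]; exact zero_mem _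
      | add a b ha hb => rw [map_add]; exact add_mem ha hb
      | tmul x y => exact tmul_mem_naiveSub_left hM hN (hf.ker_eq ▸ x.2) y
  · have hf0 : ∀ x ∈ M.naiveSub, f x = 0 := fun x hx => LinearMap.mem_ker.1 (hf.ker_eq ▸ hx)
    have hg0 : ∀ y ∈ N.naiveSub, g y = 0 := fun y hy => LinearMap.mem_ker.1 (hg.ker_eq ▸ hy)
    refine naiveSub_le _ (fun i hi t ht => ?_) fun t => ?_
    · refine (Submodule.span_le.2 ?_ : tensorGr M N i ≤ LinearMap.ker (TensorProduct.map f g)) ht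
      rintro _ ⟨a, b, rfl, x, hx, y, hy, rfl⟩
      change TensorProduct.map f g _ = 0
      rw [TensorProduct.map_tmul]
      by_cases ha : a.2 = 0
      · rw [hg0 y (N.mem_naiveSub_of_ne (by simpa [ha] using hi) hy), tmul_zero]
      · rw [hf0 x (M.mem_naiveSub_of_ne ha hx), zero_tmul]
    · have hf1 : f ∘ₗ M.dp = 0 := LinearMap.ext fun x => hf0 _ (M.dp_mem_naiveSub x)
      have hg1 : g ∘ₗ N.dp = 0 := LinearMap.ext fun x => hg0 _ (N.dp_mem_naiveSub x)
      have h : TensorProduct.map f g ∘ₗ (TensorProduct.map M.dp LinearMap.id +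
          TensorProduct.map M.sgn N.dp) = 0 := by
        rw [LinearMap.comp_add, ← TensorProduct.map_comp, ← TensorProduct.map_comp, hf1, hg1,
          TensorProduct.map_zero_left, TensorProduct.map_zero_right, add_zero]
      exact LinearMap.congr_fun h t

theorem IsNaiveProj.tensorFin : ∀ {m : ℕ} {M N : Fin m → MFComplex R}
    {f : ∀ i, (M i).carrier →ₗ[R] (N i).carrier}, (∀ i, IsNonpos (M i)) →
    (∀ i, IsNaiveProj (M i) (f i)) → IsNaiveProj (tensorFin m M) (tensorFinMap m f)
  | 0, _, _, _, _, _ => isNaiveProj_unit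
  | _ + 1, _, _, _, hM, h => (h 0).tensor (hM 0) (IsNonpos.tensorFin fun i => hM i.succ)
      (IsNaiveProj.tensorFin (fun i => hM i.succ) fun i => h i.succ)

/-- Right exactness again: the kernel after extension of scalars is generated by the elements `1 ⊗
x` with `x` in the old kernel. -/
theorem IsNaiveProj.baseChange {R' : Type u} [CommRing R'] (g : R →+* R') {M N : MFComplex R}
    {f : M.carrier →ₗ[R] N.carrier} (hf : IsNaiveProj M f) :
    IsNaiveProj (M.baseChange g) (baseChangeMap g f) := by
  let _ := g.toAlgebra
  refine ⟨LinearMap.lTensor_surjective R' hf.surjective, le_antisymm (fun t ht => ?_) ?_⟩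
  · have key : ∀ x ∈ M.naiveSub, ((1 : R') ⊗ₜ[R] x : R' ⊗[R] M.carrier) ∈
        (M.baseChange g).naiveSub := by
      refine M.naiveSub_le (N := ((M.baseChange g).naiveSub.restrictScalars R).comap
        (TensorProduct.mk R R' M.carrier 1)) (fun i hi x hx => ?_) fun x => ?_
      · exact mem_naiveSub_of_ne (M.baseChange g) hi (bcMk_mem g hx)
      · exact dp_mem_naiveSub (M.baseChange g) (bcMk g M x)
    obtain ⟨t, rfl⟩ := (lTensor_exact R' (LinearMap.exact_subtype_ker_map f) hf.surjective t).1 ht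
    clear ht
    induction t using TensorProduct.induction_on with
    | zero => rw [map_zero]; exact zero_mem _
    | add a b ha hb => rw [map_add]; exact add_mem ha hb
    | tmul r x =>
      have := Submodule.smul_mem _ r (key x.1 (hf.ker_eq ▸ x.2))
      rwa [smul_tmul', smul_eq_mul, mul_one] at this
  · refine naiveSub_le _ (fun i hi t ht => ?_) fun t => ?_
    · refine (Submodule.span_le.2 ?_ : baseChangeGr R' M i ≤ LinearMap.ker (f.baseChange R')) ht
      rintro _ ⟨x, hx, rfl⟩
      have := M.mem_naiveSub_of_ne hi hx
      rw [← hf.ker_eq] at this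
      change f.baseChange R' _ = 0
      rw [LinearMap.baseChange_tmul, LinearMap.mem_ker.1 this, tmul_zero]
    · have h : f ∘ₗ M.dp = 0 := LinearMap.ext fun x => by
        have := M.dp_mem_naiveSub x
        rw [← hf.ker_eq] at this
        exact this
      have h' : f.baseChange R' ∘ₗ M.dp.baseChange R' = 0 := by
        rw [← LinearMap.baseChange_comp, h, LinearMap.baseChange_zero]
      exact LinearMap.congr_fun h' t

end MFComplex
end KhR

/-! ### Boundedness, and the projections onto single degrees. -/

namespace KhR
open TensorProduct MvPolynomial
namespace MFComplex
variable {R : Type u} [CommRing R]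

/-- All components of sufficiently negative degree vanish. -/
def IsBounded (M : MFComplex R) : Prop := ∃ N : ℕ, ∀ i : ℤ × ℤ, i.2 < -N → M.gr i = ⊥

theorem isBounded_unit : (unit R).IsBounded :=
  ⟨0, fun i hi => if_neg (by rintro rfl; simp at hi)⟩

theorem isBounded_koszul (x y : R) : (koszul x y).IsBounded := ⟨1, fun i hi => by
  refine eq_bot_iff.2 ?_
  rintro ⟨a, b⟩ ⟨h1, h2⟩
  have ha : a = 0 := h1 (by rintro rfl; simp at hi)
  have hb : b = 0 := h2 (by rintro rfl; simp at hi)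
  subst ha hb
  rfl⟩

theorem IsBounded.tensor {M N : MFComplex R} (hM : M.IsBounded) (hN : N.IsBounded) :
    (tensor M N).IsBounded := by
  obtain ⟨m, hM⟩ := hM
  obtain ⟨n, hN⟩ := hN
  refine ⟨m + n, fun i hi => eq_bot_iff.2 (Submodule.span_le.2 ?_)⟩
  rintro _ ⟨a, b, rfl, x, hx, y, hy, rfl⟩
  by_cases ha : a.2 < -m
  · rw [hM a ha, Submodule.mem_bot] at hx
    rw [hx, zero_tmul]
    exact zero_mem _
  · have hb : b.2 < -n := by
      simp only [Prod.snd_add] at hi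
      push_cast at hi
      omega
    rw [hN b hb, Submodule.mem_bot] at hy
    rw [hy, tmul_zero]
    exact zero_mem _

theorem IsBounded.tensorFin : ∀ {m : ℕ} {M : Fin m → MFComplex R}, (∀ i, (M i).IsBounded) →
    (tensorFin m M).IsBounded
  | 0, _, _ => isBounded_unit
  | _ + 1, _, h => (h 0).tensor (IsBounded.tensorFin fun i => h i.succ)

theorem IsBounded.twoTerm {a : ℤ} {M N : MFComplex R} {hpot : M.potential = N.potential}
    {f : M.carrier →ₗ[R] N.carrier} {hf : ∀ i, ∀ x ∈ M.gr i, f x ∈ N.gr i}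
    {hdp : f ∘ₗ M.dp = N.dp ∘ₗ f} {hdm : f ∘ₗ M.dm = N.dm ∘ₗ f}
    {hdel : f ∘ₗ M.del = N.del ∘ₗ f} (hM : M.IsBounded) (hN : N.IsBounded) :
    (twoTerm a M N hpot f hf hdp hdm hdel).IsBounded := by
  obtain ⟨m, hM⟩ := hM
  obtain ⟨n, hN⟩ := hN
  refine ⟨m + n, fun i hi => ?_⟩
  push_cast at hi
  change (M.gr (i.1 - a, i.2)).prod (N.gr (i.1 - (a + 1), i.2)) = ⊥
  rw [hM (i.1 - a, i.2) (by dsimp only; omega), hN (i.1 - (a + 1), i.2) (by dsimp only; omega),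
    Submodule.prod_bot]

theorem IsBounded.baseChange {R' : Type u} [CommRing R'] (g : R →+* R') {M : MFComplex R}
    (hM : M.IsBounded) : (baseChange g M).IsBounded := by
  obtain ⟨m, hM⟩ := hM
  refine ⟨m, fun i hi => ?_⟩
  let _ := g.toAlgebra
  refine eq_bot_iff.2 (Submodule.span_le.2 ?_)
  rintro _ ⟨x, hx, rfl⟩
  rw [hM i hi, Submodule.mem_bot] at hx
  rw [hx, tmul_zero]
  exact zero_mem _

/-- The projection onto the part of degree `c` for the grading of the matrix factorizations. -/
noncomputable def degProj (M : MFComplex R) (c : ℤ) : M.carrier →ₗ[R] M.carrier :=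
  Finsupp.lsum R (fun i : ℤ × ℤ => if i.2 = c then LinearMap.id else 0) ∘ₗ comp M.gr M.internal

section DegProj
variable (M : MFComplex R)

theorem degProj_of_mem (c : ℤ) {i : ℤ × ℤ} {x : M.carrier} (hx : x ∈ M.gr i) :
    M.degProj c x = if i.2 = c then x else 0 := by
  rw [degProj, LinearMap.comp_apply, comp_of_mem M.internal hx, Finsupp.lsum_single]
  split_ifs <;> rfl

theorem degProj_comp (a b : ℤ) : M.degProj a ∘ₗ M.degProj b = if a = b then M.degProj a else 0 :=
  ext_homogeneous M.iSup_gr fun i x hx => by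
    rw [LinearMap.comp_apply, degProj_of_mem M b hx]
    by_cases hb : i.2 = b
    · subst hb
      by_cases ha : i.2 = a
      · subst ha
        simp
      · rw [if_pos rfl, degProj_of_mem M a hx, if_neg ha, if_neg (Ne.symm ha), LinearMap.zero_apply]
    · by_cases ha : a = b
      · subst ha
        rw [if_neg hb, map_zero, if_pos rfl, degProj_of_mem M a hx, if_neg hb]
      · rw [if_neg hb, map_zero, if_neg ha, LinearMap.zero_apply]

theorem degProj_dp (c : ℤ) : M.degProj (c + 1) ∘ₗ M.dp = M.dp ∘ₗ M.degProj c :=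
  ext_homogeneous M.iSup_gr fun i x hx => by
    rw [LinearMap.comp_apply, LinearMap.comp_apply, degProj_of_mem M _ hx,
      degProj_of_mem M _ (M.dp_mem i x hx)]
    simp only [add_left_inj]
    split_ifs <;> simp

theorem degProj_dm (c : ℤ) : M.degProj (c - 1) ∘ₗ M.dm = M.dm ∘ₗ M.degProj c :=
  ext_homogeneous M.iSup_gr fun i x hx => by
    rw [LinearMap.comp_apply, LinearMap.comp_apply, degProj_of_mem M _ hx,
      degProj_of_mem M _ (M.dm_mem i x hx)]
    simp only [sub_left_inj]
    split_ifs <;> simp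

theorem sum_degProj (h0 : M.IsNonpos) {N : ℕ} (hN : ∀ i : ℤ × ℤ, i.2 < -N → M.gr i = ⊥) :
    ∑ c ∈ Finset.Icc (-N : ℤ) 0, M.degProj c = LinearMap.id :=
  ext_homogeneous M.iSup_gr fun i x hx => by
    rw [LinearMap.sum_apply, Finset.sum_congr rfl fun c _ => degProj_of_mem M c hx,
      Finset.sum_ite_eq, LinearMap.id_apply]
    split_ifs with h
    · rfl
    · rw [Finset.mem_Icc, not_and_or, not_le, not_le] at h
      rcases h with h | h
      · rw [hN i h, Submodule.mem_bot] at hx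
        exact hx.symm
      · rw [h0 i h, Submodule.mem_bot] at hx
        exact hx.symm

theorem comp_dp (x : M.carrier) (i : ℤ × ℤ) :
    comp M.gr M.internal (M.dp x) (i.1, i.2 + 1) = M.dp (comp M.gr M.internal x i) := by
  have : (Finsupp.lapply (i.1, i.2 + 1) ∘ₗ comp M.gr M.internal) ∘ₗ M.dp =
      M.dp ∘ₗ Finsupp.lapply i ∘ₗ comp M.gr M.internal :=
    ext_homogeneous M.iSup_gr fun j y hy => by
      simp only [LinearMap.comp_apply, Finsupp.lapply_apply, comp_of_mem M.internal hy,
        comp_of_mem M.internal (M.dp_mem j y hy), Finsupp.single_apply]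
      by_cases h : j = i
      · subst h
        simp
      · rw [if_neg h, if_neg, map_zero]
        rintro h'
        simp only [Prod.mk.injEq, add_left_inj] at h'
        exact h (Prod.ext h'.1 h'.2)
  exact LinearMap.congr_fun this x

theorem comp_degProj (c : ℤ) (x : M.carrier) (i : ℤ × ℤ) :
    comp M.gr M.internal (M.degProj c x) i = if i.2 = c then comp M.gr M.internal x i else 0 := by
  have : (Finsupp.lapply i ∘ₗ comp M.gr M.internal) ∘ₗ M.degProj c =
      if i.2 = c then Finsupp.lapply i ∘ₗ comp M.gr M.internal else 0 :=
    ext_homogeneous M.iSup_gr fun j y hy => by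
      rw [LinearMap.comp_apply, degProj_of_mem M c hy]
      by_cases h : j = i
      · subst h
        split_ifs <;> simp
      · split_ifs <;> simp [comp_of_mem M.internal hy, h]
  have := LinearMap.congr_fun this x
  split_ifs at this ⊢ <;> exact this

variable {M}

/-- `degProj c` does not fix the homological degree, so the element is a finite sum over homological
degrees; a homogeneous primitive is taken for each summand. -/
theorem Resolves.exists_degProj (hM : M.Resolves) {c : ℤ} (hc : c < 0) {x : M.carrier}
    (h : M.dp (M.degProj c x) = 0) : ∃ z, M.degProj c x = M.dp (M.degProj (c - 1) z) := by
  set y := M.degProj c x with hy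
  have h1 : ∀ i, ∃ z, comp M.gr M.internal y i = M.dp (M.degProj (c - 1) z) := by
    intro i
    by_cases hi : i.2 = c
    · obtain ⟨z, hz, hz'⟩ := hM.exists_mem (hi ▸ hc) (comp_apply_mem M.internal i y)
        (by rw [← comp_dp, h, map_zero, Finsupp.zero_apply])
      exact ⟨z, by rw [degProj_of_mem M _ hz, if_pos (by simp [hi]), hz']⟩
    · exact ⟨0, by rw [hy, comp_degProj, if_neg hi, map_zero, map_zero]⟩
  choose z hz using h1
  refine ⟨∑ i ∈ (comp M.gr M.internal y).support, z i, ?_⟩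
  rw [map_sum, map_sum, ← Finset.sum_congr rfl fun i _ => hz i]
  exact (eq_sum_comp M.internal y).symm

/-- This presents `naiveSub` as the sum of the images of the two endomorphisms `1 - degProj 0` and
`dp ∘ degProj (-1)`. In this form the statement survives tensoring with flat modules. -/
theorem mem_naiveSub_iff (x : M.carrier) : x ∈ M.naiveSub ↔
    ∃ w z, x = (w - M.degProj 0 w) + M.dp (M.degProj (-1) z) := by
  constructor
  · have h : M.naiveSub ≤ LinearMap.range (LinearMap.id - M.degProj 0) ⊔
        LinearMap.range (M.dp ∘ₗ M.degProj (-1)) := by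
      refine M.naiveSub_le (fun i hi x hx => Submodule.mem_sup_left ⟨x, ?_⟩) fun x => ?_
      · simp [degProj_of_mem M 0 hx, hi]
      · have h1 := LinearMap.congr_fun (M.degProj_dp (-1)) x
        refine Submodule.mem_sup.2 ⟨M.dp x - M.degProj 0 (M.dp x), ⟨M.dp x, rfl⟩,
          M.dp (M.degProj (-1) x), ⟨x, rfl⟩, ?_⟩
        rw [show (0 : ℤ) = -1 + 1 from rfl]
        rw [← LinearMap.comp_apply M.dp, ← h1, LinearMap.comp_apply, sub_add_cancel]
    intro hx
    obtain ⟨_, ⟨w, rfl⟩, _, ⟨z, rfl⟩, rfl⟩ := Submodule.mem_sup.1 (h hx)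
    exact ⟨w, z, rfl⟩
  · rintro ⟨w, z, rfl⟩
    refine add_mem ?_ (M.dp_mem_naiveSub _)
    have : M.naiveMk ∘ₗ (LinearMap.id - M.degProj 0) = 0 :=
      ext_homogeneous M.iSup_gr fun i x hx => by
        rw [LinearMap.comp_apply, LinearMap.sub_apply, LinearMap.id_apply, degProj_of_mem M _ hx,
          LinearMap.zero_apply]
        split_ifs with hi
        · rw [sub_self, map_zero]
        · rw [sub_zero, M.naiveMk_eq_zero (M.mem_naiveSub_of_ne hi hx)]
    exact (Submodule.Quotient.mk_eq_zero _).1 (LinearMap.congr_fun this w)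

end DegProj
end MFComplex
end KhR

namespace KhR
open TensorProduct MvPolynomial

/-! ### Removing a cycle degree by degree. -/

section Filtration
variable {S P : Type*} [CommRing S] [AddCommGroup P] [Module S P]

/-- A differential `Tp + Tm + E` whose part `Tp` of degree `1` is exact in negative degrees. -/
theorem exists_primitive {Tp Tm E : P →ₗ[S] P} {pr : ℤ → P →ₗ[S] P} {N : ℕ}
    (hTp : ∀ c x, pr (c + 1) (Tp x) = Tp (pr c x)) (hTm : ∀ c x, pr (c - 1) (Tm x) = Tm (pr c x))
    (hE : ∀ c x, pr c (E x) = E (pr c x)) (hpr : ∀ a b x, pr a (pr b x) = if a = b then pr a x else 0)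
    (hsum : ∀ x, ∑ c ∈ Finset.Icc (-N : ℤ) 0, pr c x = x)
    (hex : ∀ c < 0, ∀ x, Tp (pr c x) = 0 → ∃ y, pr c x = Tp (pr (c - 1) y))
    (hsq : ∀ x, (Tp + Tm + E) ((Tp + Tm + E) x) = 0) {w b : P}
    (h : (Tp + Tm + E) (w - pr 0 w + Tp (pr (-1) b)) = 0) :
    ∃ y, pr 0 y = 0 ∧ (Tp + Tm + E) y = w - pr 0 w + Tp (pr (-1) b) := by
  have hTp' : ∀ c x, pr c (Tp x) = Tp (pr (c - 1) x) := fun c x => by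
    rw [← hTp, sub_add_cancel]
  have hTm' : ∀ c x, pr c (Tm x) = Tm (pr (c + 1) x) := fun c x => by
    rw [← hTm, add_sub_cancel_right]
  have hD : ∀ c x, pr c ((Tp + Tm + E) x) = Tp (pr (c - 1) x) + Tm (pr (c + 1) x) + E (pr c x) :=
    fun c x => by
      rw [LinearMap.add_apply, LinearMap.add_apply, map_add, map_add, hTp', hTm', hE]
  have hpos : ∀ c, 0 < c → ∀ x, pr c x = 0 := fun c hc x => by
    rw [← hsum x, map_sum]
    refine Finset.sum_eq_zero fun a ha => ?_
    rw [hpr, if_neg]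
    rintro rfl
    exact absurd (Finset.mem_Icc.1 ha).2 (not_le.2 hc)
  -- The induction is on the number of degrees in which `x` may have components, counted from the
  -- lowest one, `-N`. The condition `pr 0 y = 0` is carried along so that the primitive stays in
  -- the kernel of the projection.
  have key : ∀ n ≤ N, ∀ x, (Tp + Tm + E) x = 0 → (∀ a : ℤ, (n : ℤ) - N ≤ a → pr a x = 0) →
      ∃ y, pr 0 y = 0 ∧ (Tp + Tm + E) y = x := by
    intro n
    induction n with
    | zero =>
      intro _ x _ hx
      refine ⟨0, map_zero _, ?_⟩
      rw [map_zero, ← hsum x]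
      refine (Finset.sum_eq_zero fun a ha => hx a ?_).symm
      have := (Finset.mem_Icc.1 ha).1
      simpa using this
    | succ n ih =>
      intro hn x hx hx'
      push_cast at hx'
      have hc : (n : ℤ) - N < 0 := by omega
      -- In the degree above the top component of `x`, only `Tp` of this component contributes to
      -- the differential of `x`.
      have h1 : Tp (pr ((n : ℤ) - N) x) = 0 := by
        have h2 := hD ((n : ℤ) - N + 1) x
        rwa [hx, map_zero, hx' ((n : ℤ) - N + 1) (by omega),
          hx' ((n : ℤ) - N + 1 + 1) (by omega), map_zero, map_zero, add_zero, add_zero,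
          add_sub_cancel_right, eq_comm] at h2
      obtain ⟨y, hy⟩ := hex _ hc _ h1
      -- The subtracted boundary has top component `Tp (pr (n - N - 1) y)`, which cancels that of
      -- `x`; its other components lie in lower degrees.
      obtain ⟨z, hz, hz'⟩ := ih (by omega) (x - (Tp + Tm + E) (pr ((n : ℤ) - N - 1) y))
        (by rw [map_sub, hx, hsq, sub_zero]) (fun a ha => by
          rw [map_sub, hD, hpr, hpr, hpr, if_neg (show a + 1 ≠ (n : ℤ) - N - 1 by omega),
            if_neg (show a ≠ (n : ℤ) - N - 1 by omega), map_zero, map_zero, add_zero, add_zero]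
          by_cases hac : a = (n : ℤ) - N
          · rw [hac, if_pos rfl, ← hy, sub_self]
          · rw [if_neg (by omega), map_zero, sub_zero, hx' a (by omega)])
      refine ⟨z + pr ((n : ℤ) - N - 1) y, ?_, ?_⟩
      · rw [map_add, hz, hpr, if_neg (by omega), add_zero]
      · rw [map_add, hz', sub_add_cancel]
  -- The component of degree `0` is `Tp (pr (-1) b)`; subtracting the boundary of `pr (-1) b`
  -- removes it and leaves a cycle in negative degrees.
  obtain ⟨y, hy, hy'⟩ := key N le_rfl (w - pr 0 w + Tp (pr (-1) b) - (Tp + Tm + E) (pr (-1) b))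
    (by rw [map_sub, h, hsq, sub_zero]) (fun a ha => by
      rcases eq_or_lt_of_le (show 0 ≤ a by omega) with rfl | ha'
      · rw [map_sub, map_add, map_sub, hpr, if_pos rfl, sub_self, zero_add, hTp', hD, hpr, hpr, hpr,
          if_pos (show (0 : ℤ) - 1 = -1 from rfl), if_neg (show (0 : ℤ) + 1 ≠ -1 by omega),
          if_neg (show (0 : ℤ) ≠ -1 by omega), map_zero, map_zero, add_zero, add_zero, sub_self]
      · exact hpos a ha' _)
  refine ⟨y + pr (-1) b, ?_, ?_⟩
  · rw [map_add, hy, hpr, if_neg (by omega), add_zero]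
  · rw [map_add, hy', sub_add_cancel]

end Filtration

/-! ### Bijectivity on homology in terms of elements. -/

section HomologyMap
variable {R : Type u} [CommRing R] {M N : Type u} [AddCommGroup M] [Module R M] [AddCommGroup N]
  [Module R N] {d : M →ₗ[R] M} {d' : N →ₗ[R] N}

theorem Homology.mk_eq_zero {x : LinearMap.ker d} : Homology.mk d x = 0 ↔ ∃ y, d y = x :=
  Submodule.Quotient.mk_eq_zero _

theorem Homology.map_mk {f : M →ₗ[R] N} (h : f ∘ₗ d = d' ∘ₗ f) (x : LinearMap.ker d) :
    Homology.map f h (Homology.mk d x) =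
      Homology.mk d' ⟨f x, mem_ker_of_comm h x.1 x.2⟩ := rfl

theorem Homology.map_bijective_iff {f : M →ₗ[R] N} (h : f ∘ₗ d = d' ∘ₗ f) :
    Function.Bijective (Homology.map f h) ↔
      (∀ x, d x = 0 → (∃ y, d' y = f x) → ∃ y, d y = x) ∧
        ∀ x, d' x = 0 → ∃ y z, d y = 0 ∧ f y + d' z = x := by
  refine and_congr ?_ ?_
  · rw [injective_iff_map_eq_zero]
    constructor
    · intro H x hx hy
      exact Homology.mk_eq_zero.1 (H (Homology.mk d ⟨x, hx⟩) (Homology.mk_eq_zero.2 hy))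
    · intro H t ht
      obtain ⟨⟨x, hx⟩, rfl⟩ := Submodule.mkQ_surjective _ t
      exact Homology.mk_eq_zero.2 (H x hx (Homology.mk_eq_zero.1 ht))
  · constructor
    · intro H x hx
      obtain ⟨t, ht⟩ := H (Homology.mk d' ⟨x, hx⟩)
      obtain ⟨⟨y, hy⟩, rfl⟩ := Submodule.mkQ_surjective _ t
      rw [← sub_eq_zero, Homology.map_mk, ← map_sub, Homology.mk_eq_zero] at ht
      obtain ⟨z, hz⟩ := ht
      refine ⟨y, -z, hy, ?_⟩
      rw [map_neg, hz]
      change f y + -(f y - x) = x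
      abel
    · intro H t
      obtain ⟨⟨x, hx⟩, rfl⟩ := Submodule.mkQ_surjective _ t
      obtain ⟨y, z, hy, hz⟩ := H x hx
      refine ⟨Homology.mk d ⟨y, hy⟩, ?_⟩
      rw [Homology.map_mk, ← sub_eq_zero]
      change _ - Homology.mk d' _ = 0
      rw [← map_sub, Homology.mk_eq_zero]
      refine ⟨-z, ?_⟩
      change _ = f y - x
      rw [← hz, map_neg]
      abel

/-- A surjective chain map with acyclic kernel induces an isomorphism on homology. -/
theorem Homology.map_bijective_of_surjective {f : M →ₗ[R] N} (h : f ∘ₗ d = d' ∘ₗ f)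
    (hd : ∀ x, d (d x) = 0) (hf : Function.Surjective f)
    (hker : ∀ x, f x = 0 → d x = 0 → ∃ y, f y = 0 ∧ d y = x) :
    Function.Bijective (Homology.map f h) := by
  have h' : ∀ x, f (d x) = d' (f x) := fun x => LinearMap.congr_fun h x
  refine (Homology.map_bijective_iff h).2 ⟨fun x hx => ?_, fun x hx => ?_⟩
  · rintro ⟨y, hy⟩
    obtain ⟨y, rfl⟩ := hf y
    obtain ⟨z, -, hz⟩ := hker (x - d y) (by rw [map_sub, h', hy, sub_self])
      (by rw [map_sub, hx, hd, sub_zero])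
    exact ⟨z + y, by rw [map_add, hz, sub_add_cancel]⟩
  · obtain ⟨x, rfl⟩ := hf x
    obtain ⟨z, hz, hz'⟩ := hker (d x) (by rw [h', hx]) (hd x)
    exact ⟨x - z, 0, by rw [map_sub, hz', sub_self], by rw [map_sub, hz, sub_zero, map_zero, add_zero]⟩

end HomologyMap

namespace MFComplex

/-! ### The total differential on a tensor product, and exactness under flat tensor products. -/

section NearIso
variable {R : Type u} [CommRing R]

/-- The squares contribute the two potentials, which cancel. The mixed terms cancel because `sgn`
anticommutes with `M.d`. -/
theorem dTensor_dTensor (M : MFComplex R) (D : MF R) (h : D.potential = -M.potential)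
    (t : M.carrier ⊗[R] D.carrier) : M.dTensor D (M.dTensor D t) = 0 := by
  have hM : M.d ∘ₗ M.d = M.potential • LinearMap.id := M.sq
  have hD : D.d ∘ₗ D.d = D.potential • LinearMap.id := D.sq
  have hs : M.sgn ∘ₗ M.d = -(M.d ∘ₗ M.sgn) := by
    simp only [d, LinearMap.comp_add, LinearMap.add_comp, sgn_dp, sgn_dm]; abel
  have hss : M.sgn ∘ₗ M.sgn = LinearMap.id := M.sign_sign _
  have : M.dTensor D ∘ₗ M.dTensor D = 0 := by
    simp only [dTensor, LinearMap.comp_add, LinearMap.add_comp, ← TensorProduct.map_comp, hM, hD,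
      hs, hss, h, LinearMap.comp_id, LinearMap.id_comp]
    refine TensorProduct.ext' fun x y => ?_
    simp [TensorProduct.neg_tmul, TensorProduct.smul_tmul', TensorProduct.tmul_neg,
      TensorProduct.tmul_smul]
  exact LinearMap.congr_fun this t

/-- The kernel of `h` is the sum of the images of `f` and `g`. -/
def JointlyExact {M N P Q : Type u} [AddCommGroup M] [AddCommGroup N] [AddCommGroup P]
    [AddCommGroup Q] [Module R M] [Module R N] [Module R P] [Module R Q] (f : M →ₗ[R] P)
    (g : N →ₗ[R] P) (h : P →ₗ[R] Q) : Prop := ∀ x, h x = 0 ↔ ∃ y z, f y + g z = x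

section JointlyExact
variable {M N P Q : Type u} [AddCommGroup M] [AddCommGroup N] [AddCommGroup P]
  [AddCommGroup Q] [Module R M] [Module R N] [Module R P] [Module R Q] {f : M →ₗ[R] P}
  {g : N →ₗ[R] P} {h : P →ₗ[R] Q}

theorem jointlyExact_iff : JointlyExact f g h ↔ Function.Exact (f.coprod g) h :=
  forall_congr' fun _ => iff_congr Iff.rfl
    ⟨fun ⟨y, z, e⟩ => ⟨(y, z), e⟩, fun ⟨y, e⟩ => ⟨y.1, y.2, e⟩⟩

/-- Joint exactness is exactness of `M × N → P → Q`, which a flat module preserves. -/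
theorem JointlyExact.lTensor (H : JointlyExact f g h) (Z : Type u) [AddCommGroup Z] [Module R Z]
    [Module.Flat R Z] : JointlyExact (f.lTensor Z) (g.lTensor Z) (h.lTensor Z) := by
  intro t
  have e := Module.Flat.lTensor_exact Z (jointlyExact_iff.1 H)
  have e' : f.coprod g = f ∘ₗ LinearMap.fst R M N + g ∘ₗ LinearMap.snd R M N := by
    ext <;> simp
  constructor
  · intro ht
    obtain ⟨y, rfl⟩ := (e t).1 ht
    rw [e', LinearMap.lTensor_add, LinearMap.lTensor_comp, LinearMap.lTensor_comp]
    exact ⟨_, _, rfl⟩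
  · rintro ⟨y, z, rfl⟩
    have h1 : h ∘ₗ f = 0 := LinearMap.ext fun x => (H _).2 ⟨x, 0, by rw [map_zero, add_zero]⟩
    have h2 : h ∘ₗ g = 0 := LinearMap.ext fun x => (H _).2 ⟨0, x, by rw [map_zero, zero_add]⟩
    rw [map_add, ← LinearMap.comp_apply, ← LinearMap.lTensor_comp, h1, ← LinearMap.comp_apply,
      ← LinearMap.lTensor_comp, h2, LinearMap.lTensor_zero, LinearMap.lTensor_zero,
      LinearMap.zero_apply, LinearMap.zero_apply, add_zero]

theorem JointlyExact.rTensor (H : JointlyExact f g h) (Z : Type u) [AddCommGroup Z] [Module R Z]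
    [Module.Flat R Z] : JointlyExact (f.rTensor Z) (g.rTensor Z) (h.rTensor Z) := by
  intro t
  have e := H.lTensor Z (TensorProduct.comm R P Z t)
  have hc : ∀ {A B : Type u} [AddCommGroup A] [AddCommGroup B] [Module R A] [Module R B]
      (u : A →ₗ[R] B) (x : A ⊗[R] Z), u.lTensor Z (TensorProduct.comm R A Z x) =
        TensorProduct.comm R B Z (u.rTensor Z x) := fun u x => by
    induction x using TensorProduct.induction_on with
    | zero => simp
    | add a b ha hb => simp only [map_add, ha, hb]
    | tmul a b => simp
  rw [hc, LinearEquiv.map_eq_zero_iff] at e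
  rw [e]
  constructor
  · rintro ⟨y, z, hyz⟩
    obtain ⟨y, rfl⟩ := (TensorProduct.comm R M Z).surjective y
    obtain ⟨z, rfl⟩ := (TensorProduct.comm R N Z).surjective z
    refine ⟨y, z, (TensorProduct.comm R P Z).injective ?_⟩
    rw [map_add, ← hc, ← hc, hyz]
  · rintro ⟨y, z, rfl⟩
    exact ⟨TensorProduct.comm R M Z y, TensorProduct.comm R N Z z, by rw [map_add, ← hc, ← hc]⟩

end JointlyExact
end NearIso
end MFComplex
end KhR

namespace KhR
open TensorProduct MvPolynomial
namespace MFComplex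

/-! ### The projection of a bounded resolution onto its naive complex is a near-isomorphism. -/

section Scalars
variable {A S : Type u} [CommRing A] [CommRing S] (θ : S →+* A)

/-- Endomorphisms of a module over `A` act on the tensor product over `S` with `D`. -/
noncomputable def scalarMap {M : MFComplex A} {w : S} (hM : M.potential = θ w) (D : MF S) :
    Module.End A M.carrier →+* Module.End S ((M.restrict θ w hM).carrier ⊗[S] D.carrier) where
  toFun u := (restrictMap θ hM hM u).rTensor D.carrier
  map_one' := LinearMap.rTensor_id _ _
  map_mul' u v := LinearMap.rTensor_comp D.carrier (restrictMap θ hM hM u) (restrictMap θ hM hM v)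
  map_zero' := LinearMap.rTensor_zero _
  map_add' u v := LinearMap.rTensor_add D.carrier (restrictMap θ hM hM u) (restrictMap θ hM hM v)

theorem degProj_mem (M : MFComplex A) (c : ℤ) {i : ℤ × ℤ} {x : M.carrier} (hx : x ∈ M.gr i) :
    M.degProj c x ∈ M.gr i := by
  rw [degProj_of_mem M c hx]
  split_ifs
  · exact hx
  · exact zero_mem _

/-- The tensor product with a flat factorization of the projection of a resolution onto its naive
complex is a near-isomorphism. -/
theorem nearIso_of_resolves {Z X X' : MFComplex A} [Module.Flat A Z.carrier]
    {π : X.carrier →ₗ[A] X'.carrier} (hπ : GrHom π) (hp : IsNaiveProj X π) (hX : X.Resolves)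
    (h0 : X.IsNonpos) (hb : X.IsBounded) {w : S} (hM : (tensor Z X).potential = θ w)
    (hN : (tensor Z X').potential = θ w) :
    NearIso (restrictMap θ (M := tensor Z X) (N := tensor Z X') hM hN
      (TensorProduct.map LinearMap.id π)) := by
  refine ⟨(GrHom.restrict hM hN ((GrHom.id Z).tensor hπ)).isMor, fun D hD hpot => ?_⟩
  obtain ⟨N, hN'⟩ := hb
  let _ : Module S ((tensor Z X).restrict θ w hM).carrier := ((tensor Z X).restrict θ w hM).module
  let _ : Module S ((tensor Z X').restrict θ w hN).carrier := ((tensor Z X').restrict θ w hN).module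
  -- The tensor products with `Z` and with `D` are taken over different rings. Since `Ψ` is a ring
  -- homomorphism and `tm` is multiplicative, identities between endomorphisms of `X` pass to the
  -- final module.
  let Ψ := scalarMap θ hM D
  let tm : Module.End A Z.carrier → Module.End A X.carrier → Module.End A (tensor Z X).carrier :=
    fun u v => TensorProduct.map u v
  have tm_mul : ∀ u v u' v', tm u v * tm u' v' = tm (u * u') (v * v') := fun u v u' v' =>
    (TensorProduct.map_comp u v u' v').symm
  have tm_sub : ∀ u v v', tm u (v - v') = tm u v - tm u v' := fun u v v' =>
    map_sub (TensorProduct.mapBilinear (RingHom.id A) _ _ _ _ u) v v'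
  have tm_sum : ∀ u (s : Finset ℤ) (v : ℤ → Module.End A X.carrier),
      tm u (∑ c ∈ s, v c) = ∑ c ∈ s, tm u (v c) := fun u s v =>
    map_sum (TensorProduct.mapBilinear (RingHom.id A) _ _ _ _ u) v s
  have tm_one : tm 1 1 = 1 := TensorProduct.map_id
  have tm_zero : ∀ u, tm u 0 = 0 := fun u => TensorProduct.map_zero_right _
  have hss : (Z.sgn * Z.sgn : Module.End A Z.carrier) = 1 := Z.sign_sign _
  let dP : ℤ → Module.End A X.carrier := X.degProj
  let dp : Module.End A X.carrier := X.dp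
  let dm : Module.End A X.carrier := X.dm
  have hdp : ∀ c, dP (c + 1) * dp = dp * dP c := X.degProj_dp
  have hdm : ∀ c, dP (c - 1) * dm = dm * dP c := X.degProj_dm
  have hdP : ∀ a b, dP a * dP b = if a = b then dP a else 0 := X.degProj_comp
  -- The differential of `X` acts with the sign of `Z`. The involution `σ` converts between `Z.sgn ⊗
  -- v` and `1 ⊗ v`, so exactness can be proved without this sign.
  let σ := Ψ (tm Z.sgn 1)
  let pr : ℤ → Module.End S (((tensor Z X).restrict θ w hM).carrier ⊗[S] D.carrier) := fun c => Ψ (tm 1 (dP c))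
  -- The total differential is decomposed according to its effect on the degree in `X`: `Tp` raises
  -- it, `Tm` lowers it, and `E`, which comes from `Z` and `D`, preserves it.
  let Tp := Ψ (tm Z.sgn dp)
  let Tm := Ψ (tm Z.sgn dm)
  let E₂ : Module.End S (((tensor Z X).restrict θ w hM).carrier ⊗[S] D.carrier) :=
    TensorProduct.map ((tensor Z X).restrict θ w hM).sgn D.d
  let E := Ψ (tm Z.d 1) + E₂
  have hσ : ∀ v t, Ψ (tm Z.sgn v) t = Ψ (tm 1 v) (σ t) := fun v t => by
    rw [← Module.End.mul_apply, ← map_mul, tm_mul, one_mul, mul_one]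
  have hσ' : ∀ v t, Ψ (tm 1 v) t = Ψ (tm Z.sgn v) (σ t) := fun v t => by
    rw [← Module.End.mul_apply, ← map_mul, tm_mul, hss, mul_one]
  have hσ₀ : ∀ v t, Ψ (tm Z.sgn v) t = σ (Ψ (tm 1 v) t) := fun v t => by
    rw [← Module.End.mul_apply, ← map_mul, tm_mul, one_mul, mul_one]
  have hσσ : ∀ t, σ (σ t) = t := fun t => by
    rw [← Module.End.mul_apply, ← map_mul, tm_mul, hss, one_mul, tm_one, map_one,
      Module.End.one_apply]
  have hD' : ((tensor Z X).restrict θ w hM).dTensor D = Tp + Tm + E := by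
    have h1 : ((tensor Z X).restrict θ w hM).d = restrictMap θ hM hM (tm Z.sgn dp + tm Z.sgn dm + tm Z.d 1) := by
      refine LinearMap.ext fun t => ?_
      refine LinearMap.congr_fun (f := (tm Z.dp 1 + tm Z.sgn dp) + (tm Z.dm 1 + tm Z.sgn dm))
        (g := tm Z.sgn dp + tm Z.sgn dm + tm Z.d 1) ?_ t
      have h2 : tm Z.d 1 = tm Z.dp 1 + tm Z.dm 1 := TensorProduct.map_add_left _ _ _
      rw [h2]
      abel
    rw [dTensor, h1]
    change Ψ (tm Z.sgn dp + tm Z.sgn dm + tm Z.d 1) + E₂ = _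
    rw [map_add, map_add, add_assoc _ _ E₂]
  have hE₂ : ∀ c t, pr c (E₂ t) = E₂ (pr c t) := fun c t => by
    have h1 : restrictMap θ hM hM (tm 1 (dP c)) ∘ₗ ((tensor Z X).restrict θ w hM).sgn =
        ((tensor Z X).restrict θ w hM).sgn ∘ₗ restrictMap θ hM hM (tm 1 (dP c)) := by
      refine ext_homogeneous ((tensor Z X).restrict θ w hM).iSup_gr fun i x hx => ?_
      have h2 : restrictMap θ hM hM (tm 1 (dP c)) x ∈ ((tensor Z X).restrict θ w hM).gr i := by
        refine map_mem_tensorGr (M := Z) (N := X) (M' := Z) (N' := X) (i := i) (j := i)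
          (tm 1 (dP c)) ?_ x hx
        rintro a b rfl x hx y hy
        exact tmul_mem_tensorGr rfl hx (degProj_mem X c hy)
      rw [LinearMap.comp_apply, LinearMap.comp_apply, sgn, sign_of_mem _ _ hx, sign_of_mem _ _ h2,
        map_zsmul]
    refine LinearMap.congr_fun (f := pr c ∘ₗ E₂) (g := E₂ ∘ₗ pr c) ?_ t
    change TensorProduct.map _ _ ∘ₗ TensorProduct.map _ _ =
      TensorProduct.map _ _ ∘ₗ TensorProduct.map _ _
    rw [← TensorProduct.map_comp, ← TensorProduct.map_comp, h1, LinearMap.id_comp,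
      LinearMap.comp_id]
  -- Here flatness enters: that of `Z` over `A`, and that of `D` over `S`, which follows from
  -- projectivity.
  have hex : ∀ {u v w : Module.End A X.carrier}, JointlyExact u v w →
      JointlyExact (Ψ (tm 1 u)) (Ψ (tm 1 v)) (Ψ (tm 1 w)) := fun {u v w} h => by
    have h1 : JointlyExact (restrictMap θ hM hM (tm 1 u)) (restrictMap θ hM hM (tm 1 v))
      (restrictMap θ hM hM (tm 1 w)) := h.lTensor Z.carrier
    exact h1.rTensor D.carrier
  have hexπ : JointlyExact (Ψ (tm 1 (1 - dP 0))) (Ψ (tm 1 (dp * dP (-1))))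
      ((restrictMap θ (M := tensor Z X) (N := tensor Z X') hM hN
        (TensorProduct.map LinearMap.id π)).rTensor D.carrier) := by
    have h : JointlyExact (1 - dP 0) (dp * dP (-1)) π := fun x => by
      rw [← LinearMap.mem_ker, hp.ker_eq, mem_naiveSub_iff]
      exact exists_congr fun y => exists_congr fun z => eq_comm
    have h1 : JointlyExact (restrictMap θ hM hM (tm 1 (1 - dP 0)))
      (restrictMap θ hM hM (tm 1 (dp * dP (-1)))) (restrictMap θ (M := tensor Z X)
        (N := tensor Z X') hM hN (TensorProduct.map LinearMap.id π)) := h.lTensor Z.carrier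
    exact h1.rTensor D.carrier
  have hsub : ∀ t, Ψ (tm 1 (1 - dP 0)) t = t - pr 0 t := fun t => by
    rw [tm_sub, map_sub, tm_one, map_one, LinearMap.sub_apply, Module.End.one_apply]
  have hmulP : ∀ c t, Ψ (tm 1 (dp * dP c)) t = Tp (pr c (σ t)) := fun c t => by
    rw [hσ' _ t, ← Module.End.mul_apply Tp, ← map_mul, tm_mul, mul_one]
  have hsq : ∀ t, (Tp + Tm + E) ((Tp + Tm + E) t) = 0 := fun t => by
    rw [← hD']
    exact dTensor_dTensor _ D hpot t
  have h1 : ∀ c x, pr (c + 1) (Tp x) = Tp (pr c x) := fun c x => by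
    rw [← Module.End.mul_apply, ← Module.End.mul_apply, ← map_mul, ← map_mul, tm_mul, tm_mul, hdp,
      one_mul, mul_one]
  have h2 : ∀ c x, pr (c - 1) (Tm x) = Tm (pr c x) := fun c x => by
    rw [← Module.End.mul_apply, ← Module.End.mul_apply, ← map_mul, ← map_mul, tm_mul, tm_mul, hdm,
      one_mul, mul_one]
  have h3 : ∀ c x, pr c (E x) = E (pr c x) := fun c x => by
    rw [LinearMap.add_apply, LinearMap.add_apply, map_add, hE₂, ← Module.End.mul_apply,
      ← map_mul, ← Module.End.mul_apply (Ψ (tm Z.d 1)), ← map_mul, tm_mul, tm_mul, one_mul,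
      mul_one, one_mul, mul_one]
  have h4 : ∀ a b x, pr a (pr b x) = if a = b then pr a x else 0 := fun a b x => by
    rw [← Module.End.mul_apply, ← map_mul, tm_mul, one_mul, hdP]
    split_ifs
    · rfl
    · rw [tm_zero, map_zero, LinearMap.zero_apply]
  have h5 : ∀ x, ∑ c ∈ Finset.Icc (-N : ℤ) 0, pr c x = x := fun x => by
    have h : ∑ c ∈ Finset.Icc (-N : ℤ) 0, dP c = 1 := X.sum_degProj h0 hN'
    rw [← LinearMap.sum_apply, ← map_sum, ← tm_sum, h, tm_one, map_one, Module.End.one_apply]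
  have h6 : ∀ c < 0, ∀ x, Tp (pr c x) = 0 → ∃ y, pr c x = Tp (pr (c - 1) y) := fun c hc x hx => by
    -- Exactness of `X` in degree `c`, written with endomorphisms of all of `X`: the components
    -- outside degree `c` lie in the kernel as well and are accounted for by `1 - dP c`.
    have h : JointlyExact (dp * dP (c - 1)) (1 - dP c) (dp * dP c) := fun x => by
      have hi : dP c * dP c = dP c := by rw [hdP, if_pos rfl]
      have hz : dp * dp = 0 := LinearMap.ext (dp_dp X)
      constructor
      · intro hx
        obtain ⟨y, hy⟩ := hX.exists_degProj hc (x := x) hx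
        refine ⟨y, x, ?_⟩
        change X.dp (X.degProj (c - 1) y) + (x - X.degProj c x) = x
        rw [← hy, add_sub_cancel]
      · rintro ⟨y, z, rfl⟩
        have e1 : dp * dP c * (dp * dP (c - 1)) = 0 := by
          rw [← hdp, mul_assoc, ← mul_assoc dp, hz, zero_mul, mul_zero]
        have e2 : dp * dP c * (1 - dP c) = 0 := by
          rw [mul_sub, mul_one, mul_assoc, hi, sub_self]
        rw [map_add, ← Module.End.mul_apply, e1, ← Module.End.mul_apply, e2, LinearMap.zero_apply,
          LinearMap.zero_apply, add_zero]
    have hx' : Ψ (tm 1 (dp * dP c)) x = 0 := by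
      rw [← hσσ (Ψ _ x), ← hσ₀, ← mul_one Z.sgn, ← tm_mul, map_mul, Module.End.mul_apply]
      exact (congrArg σ hx).trans (map_zero σ)
    obtain ⟨y, z, rfl⟩ := (hex h x).1 hx'
    refine ⟨σ y, ?_⟩
    have e1 : dP c * (dp * dP (c - 1)) = dp * dP (c - 1) := by
      have := hdp (c - 1)
      rw [sub_add_cancel] at this
      rw [← mul_assoc, this, mul_assoc, hdP, if_pos rfl]
    have e2 : dP c * (1 - dP c) = 0 := by rw [mul_sub, mul_one, hdP, if_pos rfl, sub_self]
    rw [← hmulP, map_add, ← Module.End.mul_apply, ← map_mul, tm_mul, one_mul, e1,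
      ← Module.End.mul_apply, ← map_mul, tm_mul, e2, tm_zero, map_zero, LinearMap.zero_apply,
      add_zero]
  refine Homology.map_bijective_of_surjective _ (fun t => dTensor_dTensor _ D hpot t) ?_ ?_
  · refine LinearMap.rTensor_surjective D.carrier
      (g := restrictMap θ (M := tensor Z X) (N := tensor Z X') hM hN
        (TensorProduct.map LinearMap.id π)) ?_
    exact TensorProduct.map_surjective Function.surjective_id hp.surjective
  · intro t ht hdt
    -- An element of the kernel has its part of degree `0` in the image of `Tp`, which is the form
    -- that `exists_primitive` requires.
    obtain ⟨v, b, rfl⟩ := (hexπ t).1 ht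
    rw [hsub, hmulP] at *
    change ((tensor Z X).restrict θ w hM).dTensor D _ = 0 at hdt
    rw [hD'] at hdt
    obtain ⟨y, hy, hy'⟩ := exists_primitive h1 h2 h3 h4 h5 h6 hsq hdt
    refine ⟨y, (hexπ y).2 ⟨y, 0, ?_⟩, ?_⟩
    · rw [hsub, hy, sub_zero, map_zero, add_zero]
    · change ((tensor Z X).restrict θ w hM).dTensor D y = _
      rw [hD', hy']

end Scalars
end MFComplex
end KhR

/-! ### Properties of near-isomorphisms, and total homology for zero potential. -/

namespace KhR
open TensorProduct MvPolynomial
namespace MFComplex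
variable {S : Type u} [CommRing S]

theorem sgn_of_mem_par {M : MFComplex S} {n j : ℤ} {x : M.carrier} (hx : x ∈ M.par n j) :
    M.sgn x = eps j • x := by
  refine (iSup_le fun l y hy => ?_ : M.par n j ≤
    LinearMap.eqLocus M.sgn (eps j • LinearMap.id)) hx
  change M.sign _ y = _
  rw [sign_of_mem M _ hy, Int.negOnePow_add, Int.negOnePow_two_mul, mul_one]
  rfl

/-- Odd maps anticommute with the sign of the grading. -/
theorem sgn_odd {M : MFComplex S} {h : M.carrier →ₗ[S] M.carrier}
    (hh : ∀ n j, ∀ x ∈ M.gr (n, j), h x ∈ M.par n (j + 1)) : h ∘ₗ M.sgn = -(M.sgn ∘ₗ h) :=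
  ext_homogeneous M.iSup_gr fun i x hx => by
    rw [LinearMap.neg_apply, LinearMap.comp_apply, LinearMap.comp_apply,
      sgn_of_mem_par (hh i.1 i.2 x hx), sgn_of_mem_par (M.gr_le_par i.1 i.2 hx), map_zsmul, eps_add,
      eps_one, mul_neg, mul_one, neg_smul, neg_neg]

/-- Homotopies extend to the tensor product with a matrix factorization. -/
theorem homotopy_dTensor {M : MFComplex S} {u h : M.carrier →ₗ[S] M.carrier}
    (hh : ∀ n j, ∀ x ∈ M.gr (n, j), h x ∈ M.par n (j + 1))
    (H : u - LinearMap.id = M.d ∘ₗ h + h ∘ₗ M.d) (D : MF S) (t : M.carrier ⊗[S] D.carrier) :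
    u.rTensor D.carrier t - t = M.dTensor D (h.rTensor D.carrier t) +
      h.rTensor D.carrier (M.dTensor D t) := by
  have h1 := congrArg (LinearMap.rTensor D.carrier) H
  rw [LinearMap.rTensor_sub, LinearMap.rTensor_add, LinearMap.rTensor_id] at h1
  have h2 : M.dTensor D ∘ₗ h.rTensor D.carrier + h.rTensor D.carrier ∘ₗ M.dTensor D =
      (M.d ∘ₗ h).rTensor D.carrier + (h ∘ₗ M.d).rTensor D.carrier := by
    simp only [dTensor, LinearMap.rTensor, LinearMap.comp_add, LinearMap.add_comp,
      ← TensorProduct.map_comp, sgn_odd hh, LinearMap.comp_id, LinearMap.id_comp]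
    have : TensorProduct.map (-(M.sgn ∘ₗ h)) D.d = -TensorProduct.map (M.sgn ∘ₗ h) D.d :=
      TensorProduct.ext' fun x y => by simp [neg_tmul]
    rw [this]
    abel
  exact LinearMap.congr_fun (h1.trans h2.symm) t

/-- An odd homotopy anticommutes with the sign in front of the differential of `D`, so it remains a
homotopy after tensoring with `D`, and the homotopy inverse induces the inverse on homology. -/
theorem nearIso_of_isHomotopyEquiv {M N : MFComplex S} {f : M.carrier →ₗ[S] N.carrier}
    (hf : IsHomotopyEquiv f) : NearIso f := by
  obtain ⟨hf, g, hg, ⟨h, hh, -, H⟩, h', hh', -, H'⟩ := hf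
  refine ⟨hf, fun D _ _ => (Homology.map_bijective_iff _).2 ⟨fun x hx => ?_, fun x hx => ?_⟩⟩
  · rintro ⟨y, hy⟩
    have h1 := homotopy_dTensor hh H D x
    rw [hx, map_zero, add_zero, LinearMap.rTensor_comp, LinearMap.comp_apply, ← hy,
      ← LinearMap.comp_apply, hg.dTensor_comm, LinearMap.comp_apply] at h1
    exact ⟨g.rTensor D.carrier y - h.rTensor D.carrier x, by rw [map_sub, ← h1, sub_sub_cancel]⟩
  · have h1 := homotopy_dTensor hh' H' D x
    rw [hx, map_zero, add_zero, LinearMap.rTensor_comp, LinearMap.comp_apply] at h1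
    refine ⟨g.rTensor D.carrier x, -h'.rTensor D.carrier x, ?_, ?_⟩
    · rw [← LinearMap.comp_apply, ← hg.dTensor_comm, LinearMap.comp_apply, hx, map_zero]
    · rw [map_neg, ← h1]
      abel

theorem IsMor.comp {M N P : MFComplex S} {g : N.carrier →ₗ[S] P.carrier}
    {f : M.carrier →ₗ[S] N.carrier} (hg : IsMor g) (hf : IsMor f) : IsMor (g ∘ₗ f) where
  d_comm := by rw [LinearMap.comp_assoc, hf.d_comm, ← LinearMap.comp_assoc, hg.d_comm]; rfl
  del_comm := by rw [LinearMap.comp_assoc, hf.del_comm, ← LinearMap.comp_assoc, hg.del_comm]; rfl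
  mem n j x hx := by
    have := par_induction (M := N) (N := P) g.toAddMonoidHom 0
      (fun j x hx => by rw [add_zero]; exact hg.mem n j x hx) (hf.mem n j x hx)
    rwa [add_zero] at this

theorem NearIso.comp {M N P : MFComplex S} {g : N.carrier →ₗ[S] P.carrier}
    {f : M.carrier →ₗ[S] N.carrier} (hg : NearIso g) (hf : NearIso f)
    (h : M.potential = N.potential) : NearIso (g ∘ₗ f) := by
  obtain ⟨hf, hf'⟩ := hf
  obtain ⟨hg, hg'⟩ := hg
  refine ⟨hg.comp hf, fun D hD hpot => ?_⟩
  convert (hg' D hD (h ▸ hpot)).comp (hf' D hD hpot) using 1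
  funext t
  obtain ⟨x, rfl⟩ := Submodule.mkQ_surjective _ t
  rw [Function.comp_apply, Homology.map_mk, Homology.map_mk, Homology.map_mk]
  congr 2
  exact LinearMap.rTensor_comp_apply _ _ _ _

/-- The base ring as a matrix factorization with potential `0`. -/
noncomputable def unitMF (S : Type u) [CommRing S] : MF S where
  carrier := S
  gr j := if j = 0 then ⊤ else ⊥
  internal := by
    refine isInternal_of_comp ?_ (Finsupp.lsingle 0) fun j x hx => ?_
    · exact eq_top_iff.2 (le_iSup_of_le 0 (by rw [if_pos rfl]))
    · split_ifs at hx with h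
      · rw [h, Finsupp.lsingle_apply]
      · rw [Submodule.mem_bot] at hx
        rw [hx, map_zero, Finsupp.single_zero]
  potential := 0
  dp := 0
  dm := 0
  dp_mem := fun _ _ _ => zero_mem _
  dm_mem := fun _ _ _ => zero_mem _
  sq := by rw [add_zero, LinearMap.comp_zero, zero_smul]

/-- For potential `0`, near-isomorphisms induce isomorphisms on total homology. -/
theorem NearIso.bijective_homology {M N : MFComplex S} {f : M.carrier →ₗ[S] N.carrier}
    (hf : NearIso f) (h0 : M.potential = 0) (hf' : IsMor f) :
    Function.Bijective (Homology.map f hf'.d_comm) := by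
  obtain ⟨hf, H⟩ := hf
  have h1 := H (unitMF S) (inferInstanceAs (Module.Projective S S)) (by rw [h0, neg_zero]; rfl)
  -- Through the generator `u`, the map `x ↦ x ⊗ u` identifies a complex with its tensor product
  -- with the unit factorization, including the total differentials.
  obtain ⟨u, hu⟩ : ∃ u : (unitMF S).carrier, u = (1 : S) := ⟨(1 : S), rfl⟩
  have hd : ∀ (P : MFComplex S) (x : P.carrier),
      P.dTensor (unitMF S) (x ⊗ₜ[S] u) = P.d x ⊗ₜ[S] u := fun P x => by
    have h : (unitMF S).d u = 0 := add_zero (0 : S)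
    rw [dTensor, LinearMap.add_apply, map_tmul, map_tmul, h, tmul_zero, add_zero,
      LinearMap.id_apply]
  have hs : ∀ (P : MFComplex S) (t : P.carrier ⊗[S] (unitMF S).carrier),
      ∃ x : P.carrier, x ⊗ₜ[S] u = t := fun P t => hu ▸
    ⟨TensorProduct.rid S P.carrier t, (TensorProduct.rid S P.carrier).symm_apply_apply t⟩
  have hi : ∀ (P : MFComplex S) {x y : P.carrier}, x ⊗ₜ[S] u = y ⊗ₜ[S] u → x = y := by
    subst hu
    exact fun P x y h => (TensorProduct.rid S P.carrier).symm.injective h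
  obtain ⟨h2, h3⟩ := (Homology.map_bijective_iff _).1 h1
  refine (Homology.map_bijective_iff _).2 ⟨fun x hx => ?_, fun x hx => ?_⟩
  · rintro ⟨y, hy⟩
    obtain ⟨t, ht⟩ := h2 (x ⊗ₜ[S] u) (by rw [hd, hx, zero_tmul])
      ⟨y ⊗ₜ[S] u, by rw [hd, hy]; rfl⟩
    obtain ⟨z, rfl⟩ := hs M t
    rw [hd] at ht
    exact ⟨z, hi M ht⟩
  · obtain ⟨s, t, hs', ht⟩ := h3 (x ⊗ₜ[S] u) (by rw [hd, hx, zero_tmul])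
    obtain ⟨y, rfl⟩ := hs M s
    obtain ⟨z, rfl⟩ := hs N t
    rw [hd] at hs' ht
    refine ⟨y, z, hi M (hs'.trans (zero_tmul _ _).symm), hi N ?_⟩
    rw [add_tmul]
    exact ht

/-- The projection onto the part of homological degree `n` and of the parity of `j`. -/
noncomputable def parProj (M : MFComplex S) (n j : ℤ) : M.carrier →ₗ[S] M.carrier :=
  Finsupp.lsum S (fun i : ℤ × ℤ => if i.1 = n ∧ Even (i.2 - j) then LinearMap.id else 0) ∘ₗ
    comp M.gr M.internal

theorem parProj_of_mem_par {M : MFComplex S} {n j a b : ℤ} {x : M.carrier} (hx : x ∈ M.par a b) :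
    M.parProj n j x = if a = n ∧ Even (b - j) then x else 0 := by
  refine (iSup_le fun l y hy => ?_ : M.par a b ≤ LinearMap.eqLocus (M.parProj n j)
    (if a = n ∧ Even (b - j) then LinearMap.id else 0)) hx |>.trans ?_
  · change M.parProj n j y = _
    rw [parProj, LinearMap.comp_apply, comp_of_mem M.internal hy, Finsupp.lsum_single]
    have : Even (b + 2 * l - j) ↔ Even (b - j) := by
      rw [add_sub_right_comm, Int.even_add]
      simp
    simp only [this]
  · split_ifs <;> rfl

theorem parProj_mem (M : MFComplex S) (n j : ℤ) (x : M.carrier) : M.parProj n j x ∈ M.par n j := by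
  have hx : x ∈ ⨆ i, M.gr i := by rw [M.iSup_gr]; trivial
  refine (iSup_le fun i x hx => ?_ : (⨆ i, M.gr i) ≤ (M.par n j).comap (M.parProj n j)) hx
  have h := M.gr_le_par i.1 i.2 hx
  rw [Submodule.mem_comap, parProj_of_mem_par h]
  split_ifs with hi
  · obtain ⟨h1, l, h2⟩ := hi
    rw [← h1]
    rwa [show i.2 = j + 2 * l by omega, par_add_two_mul] at h
  · exact zero_mem _

theorem parProj_comm {M N : MFComplex S} {f : M.carrier →ₗ[S] N.carrier} (c : ℤ)
    (hf : ∀ n j, ∀ x ∈ M.gr (n, j), f x ∈ N.par n (j + c)) (n j : ℤ) (x : M.carrier) :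
    N.parProj n (j + c) (f x) = f (M.parProj n j x) := by
  refine LinearMap.congr_fun (f := N.parProj n (j + c) ∘ₗ f) (g := f ∘ₗ M.parProj n j)
    (ext_homogeneous M.iSup_gr fun i x hx => ?_) x
  rw [LinearMap.comp_apply, LinearMap.comp_apply, parProj_of_mem_par (hf i.1 i.2 x hx),
    parProj_of_mem_par (M.gr_le_par i.1 i.2 hx), add_sub_add_right_eq_sub]
  split_ifs
  · rfl
  · rw [map_zero]

/-- Morphisms that induce a bijection on total homology induce an isomorphism of complexes. -/
theorem IsMor.exists_htIso {M N : MFComplex S} {f : M.carrier →ₗ[S] N.carrier} (hf : IsMor f)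
    (h : Function.Bijective (Homology.map f hf.d_comm)) :
    ∃ Φ : HtIso M N, Φ.equiv.toLinearMap = Homology.map f hf.d_comm := by
  have hmem : ∀ n j x, x ∈ M.par n j → f x ∈ N.par n j := fun n j x hx => by
    have := par_induction (M := M) (N := N) f.toAddMonoidHom 0
      (fun j x hx => by rw [add_zero]; exact hf.mem n j x hx) hx
    rwa [add_zero] at this
  have hpM : ∀ n j x, M.parProj n (j + 1) (M.d x) = M.d (M.parProj n j x) :=
    parProj_comm 1 fun n j x hx => M.d_mem_par (M.gr_le_par n j hx)
  have hpN : ∀ n j x, N.parProj n (j + 1) (N.d x) = N.d (N.parProj n j x) :=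
    parProj_comm 1 fun n j x hx => N.d_mem_par (N.gr_le_par n j hx)
  have hpf : ∀ n j x, N.parProj n j (f x) = f (M.parProj n j x) := fun n j x => by
    have := parProj_comm (f := f) 0 (fun n j x hx => by rw [add_zero]; exact hf.mem n j x hx) n j x
    rwa [add_zero] at this
  refine ⟨⟨LinearEquiv.ofBijective _ h, fun t => ?_, fun n j => le_antisymm ?_ ?_⟩, rfl⟩
  · obtain ⟨x, rfl⟩ := Submodule.mkQ_surjective _ t
    change Homology.map f hf.d_comm (Homology.map M.del M.del_d (Homology.mk _ x)) =
      Homology.map N.del N.del_d (Homology.map f hf.d_comm (Homology.mk _ x))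
    rw [Homology.map_mk, Homology.map_mk, Homology.map_mk, Homology.map_mk]
    congr 2
    exact LinearMap.congr_fun hf.del_comm x
  · rintro _ ⟨_, ⟨⟨x, hx⟩, hx', rfl⟩, rfl⟩
    exact ⟨⟨f x, mem_ker_of_comm hf.d_comm x hx⟩, hmem n j x hx', rfl⟩
  · rintro _ ⟨⟨x, hx⟩, hx', rfl⟩
    obtain ⟨y, z, hy, hyz⟩ := ((Homology.map_bijective_iff _).1 h).2 x hx
    have hy' : M.parProj n j y ∈ LinearMap.ker M.d := by
      rw [LinearMap.mem_ker, ← hpM, hy, map_zero]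
    refine ⟨Homology.mk M.d ⟨M.parProj n j y, hy'⟩, ⟨⟨_, hy'⟩, M.parProj_mem n j y, rfl⟩, ?_⟩
    change Homology.map f hf.d_comm (Homology.mk _ _) = _
    rw [Homology.map_mk, ← sub_eq_zero, ← map_sub, Homology.mk_eq_zero]
    -- Projecting `f y + d z = x` to parity `j` replaces `y` by a homogeneous cycle. As `d` is odd,
    -- the boundary term then comes from the component of `z` of parity `j - 1`.
    refine ⟨-N.parProj n (j - 1) z, ?_⟩
    change _ = f (M.parProj n j y) - x
    have h1 := congrArg (N.parProj n j) hyz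
    have h2 : N.parProj n j x = x := (parProj_of_mem_par hx').trans (if_pos ⟨rfl, by simp⟩)
    have h3 := hpN n (j - 1) z
    rw [sub_add_cancel] at h3
    rw [map_add, hpf, h3, h2] at h1
    rw [map_neg, ← h1]
    abel

end MFComplex

/-! ### The near-isomorphism for the action of an arc diagram. -/

section ActProj
variable {k : Type u} [Field k] {p : Polynomial k} (χ : CrossingData p)
variable {B₀ : Boundary} {m : ℕ} {B : Fin m → Boundary} (η : ArcDiagram B₀ B)
  (T : ∀ i, TangleDiagram (B i))

theorem CrossingData.crossing_isBounded (s : Bool) : (χ.crossing s).IsBounded := by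
  have h1 : (wide χ.y₁).IsBounded :=
    (isBounded_koszul (X 0 + X 1 - X 2 - X 3) (χ.y₁ 0)).tensor
      (isBounded_koszul (X 0 * X 1 - X 2 * X 3) (χ.y₁ 1))
  have h2 : (smooth χ.y₂).IsBounded :=
    (isBounded_koszul (X 0 - X 3) (χ.y₂ 0)).tensor (isBounded_koszul (X 1 - X 2) (χ.y₂ 1))
  cases s
  · exact IsBounded.twoTerm (hpot := χ.potential₂.trans χ.potential₁.symm) (hf := χ.neg_mem)
      (hdp := χ.neg_dp) (hdm := χ.neg_dm) (hdel := by simp [wide_del, smooth_del]) h2 h1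
  · exact IsBounded.twoTerm (hpot := χ.potential₁.trans χ.potential₂.symm) (hf := χ.pos_mem)
      (hdp := χ.pos_dp) (hdm := χ.pos_dm) (hdel := by simp [wide_del, smooth_del]) h1 h2

theorem TangleDiagram.krComplex_isBounded {B : Boundary} (T : TangleDiagram B) :
    (T.krComplex χ).IsBounded :=
  ((IsBounded.tensorFin fun _ => isBounded_koszul _ _).tensor
    (IsBounded.tensorFin fun _ => isBounded_koszul _ _)).tensor
    (IsBounded.tensorFin fun _ => (χ.crossing_isBounded _).baseChange _)

/-- The projection from the action on complexes of acyclic diagrams to the action on their naive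
complexes is a near-isomorphism. -/
theorem nearIso_actProj (hT : ∀ i, (T i).Acyclic) :
    NearIso (η.actProj (fun i => (T i).kr χ) fun i => (T i).krComplex_nonpos χ) := by
  -- Of the arcs only flatness is needed; they are the factor `Z` of `nearIso_of_resolves` and need
  -- not be part of a resolution.
  have := flat_of_isom (arcs_isom χ η T)
  have hN := fun i => (T i).krComplex_nonpos χ
  have h1 := GrHom.tensorFin fun i => (GrHom.naiveMk _ (hN i)).baseChange
    (rename (fun y => Sum.inr ⟨i, y⟩) : MvPolynomial ((T i).kr χ).Y k →ₐ[k]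
        MvPolynomial (Fin B₀.n ⊕ Σ i, ((T i).kr χ).Y) k).toRingHom
  have h2 := IsNaiveProj.tensorFin (fun i => (hN i).baseChange
    (rename (fun y => Sum.inr ⟨i, y⟩) : MvPolynomial ((T i).kr χ).Y k →ₐ[k]
        MvPolynomial (Fin B₀.n ⊕ Σ i, ((T i).kr χ).Y) k).toRingHom)
    fun i => IsNaiveProj.baseChange _ (N := ((T i).krComplex χ).naive (hN i)) (isNaiveProj_naiveMk _)
  have h3 := IsNonpos.tensorFin fun i => (hN i).baseChange
    (rename (fun y => Sum.inr ⟨i, y⟩) : MvPolynomial ((T i).kr χ).Y k →ₐ[k]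
        MvPolynomial (Fin B₀.n ⊕ Σ i, ((T i).kr χ).Y) k).toRingHom
  have h4 := IsBounded.tensorFin fun i => ((T i).krComplex_isBounded χ).baseChange
    (rename (fun y => Sum.inr ⟨i, y⟩) : MvPolynomial ((T i).kr χ).Y k →ₐ[k]
        MvPolynomial (Fin B₀.n ⊕ Σ i, ((T i).kr χ).Y) k).toRingHom
  exact nearIso_of_resolves (rename Sum.inl : MvPolynomial (Fin B₀.n) k →ₐ[k]
    MvPolynomial (Fin B₀.n ⊕ Σ i, ((T i).kr χ).Y) k).toRingHom h1 h2 (resolves_holes χ T hT) h3 h4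
    (η.act fun i => (T i).kr χ).potential_eq
    (η.act fun i => ((T i).kr χ).naive (hN i)).potential_eq

end ActProj
end KhR

theorem corollary2p6 {k : Type u} [Field k] (p : Polynomial k) (hp : p.eval 0 = 0)
    (χ : CrossingData p) {B₀ : Boundary} {m : ℕ} {B : Fin m → Boundary} (η : ArcDiagram B₀ B)
    (T : ∀ i, TangleDiagram (B i)) (hT : ∀ i, (T i).Acyclic) (U : TangleDiagram B₀)
    (F : Factorization η T U) :
    ∃ f : (U.kr χ).overBoundary.carrier →ₗ[MvPolynomial (Fin B₀.n) k]
        (η.act fun i => (T i).kr χ).overBoundary.carrier,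
      IsHomotopyEquiv f ∧
      (∀ φ, f ∘ₗ (U.kr χ).mulVar (Sum.inl φ) =
        (η.act fun i => (T i).kr χ).mulVar (F.var φ) ∘ₗ f) ∧
      NearIso (η.actProj (fun i => (T i).kr χ) fun i => (T i).krComplex_nonpos χ) ∧
      NearIso ((η.actProj (fun i => (T i).kr χ) fun i => (T i).krComplex_nonpos χ) ∘ₗ f) ∧
      (B₀.n = 0 →
        ∃ (hf : IsMor ((η.actProj (fun i => (T i).kr χ) fun i => (T i).krComplex_nonpos χ) ∘ₗ f))
          (Φ : HtIso (U.kr χ).overBoundary (η.act fun i => (T i).naiveKR χ).overBoundary),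
          Φ.equiv.toLinearMap = Homology.map _ hf.d_comm) := by
  obtain ⟨g, hgF, ⟨h⟩⟩ := exists_hEquiv χ η T F fun i => (hT i).2
  obtain ⟨f, hf, hvar⟩ := exists_isHomotopyEquiv (M := U.kr χ) (N := η.act fun i => (T i).kr χ) g
    (fun b => hgF (Sum.inr b)) h
  have h1 := nearIso_actProj χ η T hT
  have h2 := h1.comp (nearIso_of_isHomotopyEquiv hf) rfl
  refine ⟨f, hf, fun φ => by rw [hvar, hgF], h1, h2, fun hn => ⟨h2.1, ?_⟩⟩
  -- Without end points the potential is an empty sum, so total homology makes sense and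
  -- near-isomorphisms can be tested on the unit factorization.
  refine h2.1.exists_htIso (h2.bijective_homology ?_ h2.1)
  have : IsEmpty (Fin B₀.n) := hn ▸ Fin.isEmpty
  change B₀.potential p = 0
  rw [Boundary.potential, Finset.univ_eq_empty, Finset.sum_empty]
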